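/- **Notation.** For a square-free integer $d$ put $D=d$ if $d\equiv1\pmod 4$ and $D=4d$ if $d\equiv 2,3\pmod 4$. Let $\chi_d=\left(\frac{D}{\cdot}\right)$ be the Kronecker symbol and $L(s,\chi_d)$ its analytically continued Dirichlet $L$-function (so $L(s,\chi_1)=\zeta(s)$). The numbers $D$ with $d\ne1$ are the fundamental discriminants, and $\chi_D:=\left(\frac{D}{\cdot}\right)$. Let $m\ge1$. For each sign $\pm$ and $\nu=1,2,3$ let $$Z^\pm_\nu(s_1,\dots,s_m,w)=\sum_{\substack{d\ \text{square-free},\ \pm d>0\\ d\equiv\nu\,(4)}}\frac{L(s_1,\chi_d)\cdots L(s_m,\chi_d)}{|d|^{w}},\qquad Z^\pm=Z_1^\pm+4^{-w}\left(Z_2^\pm+Z_3^\pm\right),$$ which converges absolutely for $\Re s_i>1$, $\Re w>1$, and let $$\widehat{Z^\pm}=\prod_{i=1}^m\pi^{-\frac{s_i+a}2}\,\Gamma\!\left(\tfrac{s_i+a}2\right)\cdot Z^\pm,\qquad a=0\text{ for }+,\quad a=1\text{ for }-.$$ **Conjecture$(m)$.** (i) There is an open convex set $B\subset\mathbb R^{m+1}$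 containing $(\frac12,\dots,\frac12,1)$ and $\{\sigma_1,\dots,\sigma_m>1,\ \omega>1\}$ such that both functions $\widehat{Z^\pm}$ continue meromorphically from $\{\Re s_i>1,\ \Re w>1\}$ to the tube domain $\{z\in\mathbb C^{m+1}:\Re z\in B\}$. (ii) Near the point $(\frac12,\dots,\frac12,1)$ both continuations have the same polar divisor, and it consists of the $2^m$ hyperplanes $$H_\epsilon:\quad \epsilon_1s_1+\cdots+\epsilon_ms_m+w-\frac{\epsilon_1+\cdots+\epsilon_m+2}2=0,\qquad \epsilon\in\{0,1\}^m,$$ that is, it equals $\sum_\epsilon k_\epsilon H_\epsilon$ with integers $k_\epsilon\ge1$. (iii) The functions $Z^\pm(\frac12,\dots,\frac12,w)$, given by the above series for $\Re w$ sufficiently large, continue holomorphically to $\Re w>1$, and these continuations extend continuously to $\{\Re w\ge1,\ w\neq1\}$. **Theorem.** Let $m\ge 2$ be even. If Conjecture$(m)$ holds, then, as $x\to\infty$, $$\sum_{|D|\le x}L\left(\tfrac12,\chi_D\right)^m\ \sim\ \frac6{\pi^2}\,a_m\prod_{\ell=1}^m\frac{\ell!}{(2\ell)!}\cdot x(\log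 x)^{m(m+1)/2},$$ where $D$ runs over the fundamental discriminants (of both signs) and $$a_m=\prod_p\frac{\left(1-\frac1p\right)^{\frac{m(m+1)}2}}{1+\frac1p}\left(\frac{\left(1-\frac1{\sqrt p}\right)^{-m}+\left(1+\frac1{\sqrt p}\right)^{-m}}2+\frac1p\right).$$ -/

import Mathlib

open Filter Topology Asymptotics

/-- The Kronecker symbol `(D / n)` for `n ≥ 0`: `(D / 2) = 0, 1, -1` according as `D` is even,
`D ≡ ±1`, `D ≡ ±3` modulo `8`, it is the Jacobi symbol for odd `n`, it is completely
multiplicative in `n ≥ 1`, and `(D / 0)` is `1` for `D = ±1` and `0` otherwise. -/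
def kronecker (D : ℤ) (n : ℕ) : ℤ :=
  if n = 0 then (if D.natAbs = 1 then 1 else 0)
  else ZMod.χ₈ (D : ZMod 8) ^ (n.factorization 2) * jacobiSym D (n / 2 ^ n.factorization 2)

/-- The discriminant of `ℚ(√d)`, for `d` square-free (and `1` for `d = 1`). -/
def quadDisc (d : ℤ) : ℤ := if d % 4 = 1 then d else 4 * d

/-- Fundamental discriminants, that is, the discriminants of quadratic fields
(so `1` is excluded). -/
def IsFundamentalDiscriminant (D : ℤ) : Prop :=
  D ≠ 1 ∧ ∃ d : ℤ, Squarefree d ∧ D = quadDisc d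

noncomputable section

/-- The (analytically continued) Dirichlet `L`-function `L(s, χ)` of `χ = (D / ·)`, for `D = 1` or
`D` a fundamental discriminant, so that `χ` is a Dirichlet character modulo `|D|`. It is the
Riemann zeta function for `D = 1`. The value at `D = 0` is a dummy. -/
def quadL (D : ℤ) (s : ℂ) : ℂ :=
  if h : D = 0 then 0
  else
    haveI : NeZero D.natAbs := ⟨Int.natAbs_ne_zero.mpr h⟩
    ZMod.LFunction (fun a : ZMod D.natAbs => (kronecker D a.val : ℂ)) s

/-- The sum of `L(s₁, χ_d) ⋯ L(s_m, χ_d) |d|^{-w}` over the square-free `d ≡ ν (mod 4)` whose sign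
is `σ`. -/
def momentSeriesPart {m : ℕ} (σ : ℤˣ) (ν : ℤ) (s : Fin m → ℂ) (w : ℂ) : ℂ :=
  ∑' d : {d : ℤ // Squarefree d ∧ d % 4 = ν ∧ 0 < (σ : ℤ) * d},
    (∏ i, quadL (quadDisc d) (s i)) / ((d : ℤ).natAbs : ℂ) ^ w

/-- The multiple Dirichlet series `Z⁺` (for `σ = 1`) and `Z⁻` (for `σ = -1`). -/
def momentSeries {m : ℕ} (σ : ℤˣ) (s : Fin m → ℂ) (w : ℂ) : ℂ :=
  momentSeriesPart σ 1 s w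
    + (4 : ℂ) ^ (-w) * (momentSeriesPart σ 2 s w + momentSeriesPart σ 3 s w)

/-- The gamma-completed series: `Z^±` times the product of the
`π ^ (-(sᵢ + a) / 2) * Γ ((sᵢ + a) / 2)`, where `a = 0` for the sign `+` and `a = 1` for `-`.
(`Complex.Gammaℝ s` is `π ^ (-s / 2) * Γ (s / 2)`.) -/
def completedSeries {m : ℕ} (σ : ℤˣ) (s : Fin m → ℂ) (w : ℂ) : ℂ :=
  (∏ i, Complex.Gammaℝ (s i + if σ = 1 then 0 else 1)) * momentSeries σ s w

/-- The tube over the base `B`: all complex points whose real part lies in `B`. -/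
def tube {m : ℕ} (B : Set ((Fin m → ℝ) × ℝ)) : Set ((Fin m → ℂ) × ℂ) :=
  {z | ((fun i => (z.1 i).re, z.2.re) : (Fin m → ℝ) × ℝ) ∈ B}

/-- Meromorphic functions of several variables: near every point of `Ω`, `F` is a quotient of two
holomorphic functions, the denominator not being identically zero. As usual, the values of `F`
on the zeros of the denominator are irrelevant. -/
def IsMeromorphicOn {E : Type*} [NormedAddCommGroup E] [NormedSpace ℂ E]
    (F : E → ℂ) (Ω : Set E) : Prop :=
  ∀ z₀ ∈ Ω, ∃ f g : E → ℂ, AnalyticAt ℂ f z₀ ∧ AnalyticAt ℂ g z₀ ∧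
    (∃ᶠ z in 𝓝 z₀, g z ≠ 0) ∧ ∀ᶠ z in 𝓝 z₀, g z ≠ 0 → F z = f z / g z

/-- Near `z₀`, the polar divisor of `F` is the sum of the hyperplanes `hᵢ = 0` with multiplicities
`kᵢ`: there `F = f / ∏ hᵢ ^ kᵢ` with `f` holomorphic and, for each `i`, not identically zero on
the part of the hyperplane `hᵢ = 0` near `z₀`. -/
def HasPolarDivisorAt {E ι : Type*} [NormedAddCommGroup E] [NormedSpace ℂ E] [Fintype ι]
    (F : E → ℂ) (h : ι → E → ℂ) (k : ι → ℕ) (z₀ : E) : Prop :=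
  ∃ f : E → ℂ, AnalyticAt ℂ f z₀ ∧
    (∀ᶠ z in 𝓝 z₀, (∀ i, h i z ≠ 0) → F z = f z / ∏ i, h i z ^ k i) ∧
    ∀ i, ∃ᶠ z in 𝓝 z₀, h i z = 0 ∧ f z ≠ 0

/-- The linear form `ε₁ s₁ + ⋯ + ε_m s_m + w - (ε₁ + ⋯ + ε_m + 2) / 2`, with `εᵢ ∈ {0, 1}`. -/
def polarForm {m : ℕ} (ε : Fin m → Fin 2) (z : (Fin m → ℂ) × ℂ) : ℂ :=
  ∑ i, ((ε i : ℕ) : ℂ) * z.1 i + z.2 - (∑ i, ((ε i : ℕ) : ℂ) + 2) / 2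

/-- The conjecture on the two completed series in `m + 1` variables. They continue
meromorphically from the region `Re sᵢ > 1`, `Re w > 1` of absolute convergence to a (convex) tube
domain containing this region and the point `(1/2, …, 1/2, 1)`; the polar divisors of both have
the same part through this point, consisting of the `2 ^ m` hyperplanes `polarForm ε = 0`; and
`Z^±(1/2, …, 1/2, w)`, the continuation from a right half-plane of the series specialized at
`sᵢ = 1/2`, is holomorphic for `Re w > 1`, with `w = 1` as its only singularity
on `Re w = 1`. -/
def PolarDivisorConjecture (m : ℕ) : Prop :=
  ∃ (B : Set ((Fin m → ℝ) × ℝ)) (k : (Fin m → Fin 2) → ℕ) (F : ℤˣ → (Fin m → ℂ) × ℂ → ℂ),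
    IsOpen B ∧ Convex ℝ B ∧ ((fun _ => 1 / 2, 1) : (Fin m → ℝ) × ℝ) ∈ B ∧
    {x : (Fin m → ℝ) × ℝ | (∀ i, 1 < x.1 i) ∧ 1 < x.2} ⊆ B ∧
    (∀ ε, 1 ≤ k ε) ∧
    ∀ σ : ℤˣ,
      IsMeromorphicOn (F σ) (tube B) ∧
      (∀ (s : Fin m → ℂ) (w : ℂ), (∀ i, 1 < (s i).re) → 1 < w.re →
        F σ (s, w) = completedSeries σ s w) ∧
      HasPolarDivisorAt (F σ) polarForm k ((fun _ => 1 / 2, 1) : (Fin m → ℂ) × ℂ) ∧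
      ∃ Z : ℂ → ℂ,
        DifferentiableOn ℂ Z {w | 1 < w.re} ∧
        ContinuousOn Z {w | 1 ≤ w.re ∧ w ≠ 1} ∧
        ∃ c : ℝ, ∀ w : ℂ, c < w.re → Z w = momentSeries σ (fun _ : Fin m => 1 / 2) w

/-- The constant `a_m`, an absolutely convergent product over the primes. -/
def arithmeticFactor (m : ℕ) : ℝ :=
  ∏' p : Nat.Primes, (1 - 1 / (p : ℝ)) ^ (m * (m + 1) / 2) / (1 + 1 / (p : ℝ)) *
    ((((1 - 1 / √(p : ℝ)) ^ m)⁻¹ + ((1 + 1 / √(p : ℝ)) ^ m)⁻¹) / 2 + 1 / (p : ℝ))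

open Classical in
/-- The sum of `L(1/2, χ_D) ^ m` over the fundamental discriminants `D` with `|D| ≤ x`. -/
def quadMoment (m : ℕ) (x : ℝ) : ℂ :=
  ∑ D ∈ Finset.Icc (-⌊x⌋) ⌊x⌋ with IsFundamentalDiscriminant D, quadL D (1 / 2) ^ m

end

/-!
Let `Ẑ` be one of the two completed series, `M = m (m + 1) / 2`, and let `w = 1` be the hyperplane
`ε = 0`. The functional equations of the `L (s, χ_D)`, which have no signs because quadratic Gauss
sums are known exactly (`exists_isSelfDual_kronecker`, `quadL_one_sub`), give `2 ^ m` reflections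
`s_i ↦ 1 - s_i`, `w ↦ w + s_i - 1 / 2` under which `Ẑ` is invariant
(`completedSeries_reflection`), and which permute the `2 ^ m` polar hyperplanes through the centre
`(1/2, …, 1/2, 1)` simply transitively (`polarForm_reflection`).

For `Re s_i > 1` the pole at `w = 1` is simple. Its residue is an average of Kronecker symbols
`(D / N)`, to which only squares `N` contribute (`tendsto_kronecker_mean`), and it is the product of
`3 / π ^ 2`, the gamma factors, the `ζ(s_i + s_j)` for `i ≤ j`, and an Euler product that
converges beyond the centre, with value `arithmeticFactor m` there
(`tsum_tupleCoeff_squareWeight`, `eulerProd_half`). An identity theorem on the hyperplane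
(`IsMeromorphicOn.subset_closure_tendsto`) carries this to the centre. By the reflections all
multiplicities are therefore one, and all residues are known (`IsContinuation.exists_residues`).

On the line `s = (1/2, …, 1/2)` all hyperplanes meet at `w = 1`, but the pole has only the order
`M + 1`. This follows from the residues, whose denominators `∏ (s_i + s_j - 1)`, reflected, have
degree `M`: by divided differences they determine the low Taylor coefficients of the numerator of
`Ẑ` at the centre (`IsContinuation.exists_numerator`). The leading coefficient is a sum over signs
which a determinant evaluates to `M! ∏ ℓ! / (2 ℓ)!` (`sum_signs_eq`). The restriction to that line
is the continuation in one variable (`IsContinuation.numerator_eq`).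

For even `m` the coefficients `L (1/2, χ_D) ^ m` are nonnegative, the central values being real.
Landau's theorem (`LSeriesSummable_of_differentiableOn`) and a Tauberian theorem
(`tendsto_sum_div_of_pole`) then turn the pole into the asymptotic formula.
-/

/-! ### Holomorphic functions of several variables -/

section SeveralVariables

variable {E : Type*} [NormedAddCommGroup E] [NormedSpace ℂ E]

/-- Continuous functions on `U` that are holomorphic along every complex line. For an open `U` in a
finite-dimensional space these are the holomorphic functions; the definition is in a form that is
convenient to check for series and products, and it suffices for the identity theorem. -/
structure LineHol (f : E → ℂ) (U : Set E) : Prop where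
  cont : ContinuousOn f U
  hol : ∀ a b : E, DifferentiableOn ℂ (fun z : ℂ => f (a + z • b)) {z | a + z • b ∈ U}

omit [NormedSpace ℂ E] in
theorem isOpen_line_preimage [NormedSpace ℂ E] {U : Set E} (hU : IsOpen U) (a b : E) :
    IsOpen {z : ℂ | a + z • b ∈ U} :=
  hU.preimage (by fun_prop : Continuous fun z : ℂ => a + z • b)

theorem DifferentiableOn.lineHol {f : E → ℂ} {U : Set E} (hf : DifferentiableOn ℂ f U) :
    LineHol f U where
  cont := hf.continuousOn
  hol a b := hf.comp (s := {z : ℂ | a + z • b ∈ U}) (by fun_prop) (fun _ hz => hz)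

namespace LineHol

variable {f g : E → ℂ} {U V : Set E}

theorem mono (hf : LineHol f U) (h : V ⊆ U) : LineHol f V :=
  ⟨hf.cont.mono h, fun a b => (hf.hol a b).mono fun _ hz => h hz⟩

theorem mul (hf : LineHol f U) (hg : LineHol g U) : LineHol (fun x => f x * g x) U :=
  ⟨hf.cont.mul hg.cont, fun a b => (hf.hol a b).mul (hg.hol a b)⟩

theorem sub (hf : LineHol f U) (hg : LineHol g U) : LineHol (fun x => f x - g x) U :=
  ⟨hf.cont.sub hg.cont, fun a b => (hf.hol a b).sub (hg.hol a b)⟩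

theorem prod {ι : Type*} {s : Finset ι} {f : ι → E → ℂ} (hf : ∀ i ∈ s, LineHol (f i) U) :
    LineHol (fun x => ∏ i ∈ s, f i x) U :=
  ⟨continuousOn_finsetProd _ fun i hi => (hf i hi).cont,
    fun a b => DifferentiableOn.fun_finsetProd fun i hi => (hf i hi).hol a b⟩

/-- The identity theorem, on convex sets. -/
theorem eqOn_zero (hf : LineHol f U) (hU : IsOpen U) (hUc : Convex ℝ U) (hV : IsOpen V)
    (hVU : (V ∩ U).Nonempty) (h0 : ∀ x ∈ V ∩ U, f x = 0) : ∀ y ∈ U, f y = 0 := by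
  intro y hy
  obtain ⟨x, hxV, hxU⟩ := hVU
  set S : Set ℂ := {z | x + z • (y - x) ∈ U} with hS
  have hSo : IsOpen S := isOpen_line_preimage hU x (y - x)
  have hSc : Convex ℝ S := by
    intro z hz w hw a b ha hb hab
    have := hUc hz hw ha hb hab
    simp only [hS, Set.mem_ofPred_eq] at *
    convert this using 1
    obtain rfl : b = 1 - a := by linarith
    simp only [← Complex.coe_smul]
    push_cast
    module
  have hhol := (hf.hol x (y - x)).analyticOnNhd hSo
  have hev : (fun z : ℂ => f (x + z • (y - x))) =ᶠ[𝓝 0] 0 := by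
    have hc : Continuous fun z : ℂ => x + z • (y - x) := by fun_prop
    have : ∀ᶠ z : ℂ in 𝓝 0, x + z • (y - x) ∈ V ∩ U :=
      hc.continuousAt.eventually_mem (by simpa using (hV.inter hU).mem_nhds ⟨hxV, hxU⟩)
    filter_upwards [this] with z hz using h0 _ hz
  have h0S : (0 : ℂ) ∈ S := by simpa [hS] using hxU
  have h1S : (1 : ℂ) ∈ S := by simpa [hS] using hy
  have := hhol.eqOn_zero_of_preconnected_of_eventuallyEq_zero hSc.isPreconnected h0S hev h1S
  simpa using this

theorem subset_closure_ne_zero (hf : LineHol f U) (hU : IsOpen U) (hUc : Convex ℝ U)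
    (hne : ∃ x ∈ U, f x ≠ 0) : U ⊆ closure (U ∩ {x | f x ≠ 0}) := by
  intro x hx
  rw [mem_closure_iff]
  intro V hV hxV
  by_contra hcon
  rw [Set.not_nonempty_iff_eq_empty] at hcon
  obtain ⟨y, hy, hy0⟩ := hne
  refine hy0 (hf.eqOn_zero hU hUc hV ⟨x, hxV, hx⟩ (fun z hz => ?_) y hy)
  by_contra hz0
  exact (Set.eq_empty_iff_forall_notMem.mp hcon z) ⟨hz.1, hz.2, hz0⟩

theorem isOpen_ne_zero (hf : LineHol f U) (hU : IsOpen U) : IsOpen (U ∩ {x | f x ≠ 0}) :=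
  hf.cont.isOpen_inter_preimage hU isOpen_ne

end LineHol

theorem subset_closure_inter_of_isOpen {X : Type*} [TopologicalSpace X] {U A B : Set X}
    (hU : IsOpen U) (hA : IsOpen A) (hUA : U ⊆ closure A) (hUB : U ⊆ closure B) :
    U ⊆ closure (A ∩ B) := by
  intro x hx
  rw [mem_closure_iff]
  intro V hV hxV
  obtain ⟨y, hyV, hyA⟩ := mem_closure_iff.mp (hUA hx) (V ∩ U) (hV.inter hU) ⟨hxV, hx⟩
  obtain ⟨z, hzV, hzB⟩ := mem_closure_iff.mp (hUB hyV.2) (V ∩ U ∩ A) ((hV.inter hU).inter hA)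
    ⟨hyV, hyA⟩
  exact ⟨z, hzV.1.1, hzV.2, hzB⟩

/-- If, locally in the preconnected set `K`, the open set `O` is either empty or dense, and it meets
`K`, then it is dense in `K`. -/
theorem IsPreconnected.subset_closure_of_locally {X : Type*} [TopologicalSpace X] {K O : Set X}
    (hK : IsPreconnected K) (hO : IsOpen O) (hne : (K ∩ O).Nonempty)
    (hloc : ∀ x ∈ K, ∃ U, IsOpen U ∧ x ∈ U ∧ ((O ∩ U).Nonempty → U ⊆ closure O)) :
    K ⊆ closure O := by
  refine (hK.subset_of_closure_inter_subset (u := interior (closure O)) isOpen_interior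
    (hne.mono fun x hx => ⟨hx.1, hO.subset_interior_closure hx.2⟩) ?_).trans interior_subset
  rintro x ⟨hx, hxK⟩
  obtain ⟨U, hU, hxU, h⟩ := hloc x hxK
  have hx' : x ∈ closure O := closure_minimal interior_subset isClosed_closure hx
  obtain ⟨y, hyU, hyO⟩ := mem_closure_iff.mp hx' U hU hxU
  exact mem_interior.mpr ⟨U, h ⟨y, hyO, hyU⟩, hU, hxU⟩

theorem IsMeromorphicOn.exists_ball {F : E → ℂ} {Ω : Set E} (hF : IsMeromorphicOn F Ω) {z₀ : E}
    (hz₀ : z₀ ∈ Ω) : ∃ f g : E → ℂ, ∃ ρ > 0, AnalyticOnNhd ℂ f (Metric.ball z₀ ρ) ∧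
      AnalyticOnNhd ℂ g (Metric.ball z₀ ρ) ∧ (∃ z ∈ Metric.ball z₀ ρ, g z ≠ 0) ∧
      ∀ z ∈ Metric.ball z₀ ρ, g z ≠ 0 → F z = f z / g z := by
  obtain ⟨f, g, hf, hg, hne, heq⟩ := hF z₀ hz₀
  have := (hf.eventually_analyticAt.and hg.eventually_analyticAt).and heq
  obtain ⟨ρ, hρ, h⟩ := Metric.eventually_nhds_iff_ball.mp this
  refine ⟨f, g, ρ, hρ, fun z hz => (h z hz).1.1, fun z hz => (h z hz).1.2, ?_,
    fun z hz => (h z hz).2⟩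
  obtain ⟨z, hz, hzb⟩ := (hne.and_eventually (Metric.ball_mem_nhds z₀ hρ)).exists
  exact ⟨z, hzb, hz⟩

theorem AnalyticOnNhd.lineHol {f : E → ℂ} {U : Set E} (hf : AnalyticOnNhd ℂ f U) : LineHol f U :=
  hf.differentiableOn.lineHol

/-- The identity theorem for a meromorphic function and a quotient of holomorphic functions. -/
theorem IsMeromorphicOn.subset_closure_eq {F r₁ r₂ : E → ℂ} {Ω S : Set E}
    (hF : IsMeromorphicOn F Ω) (hΩ : IsOpen Ω) (hΩc : Convex ℝ Ω) (h₁ : LineHol r₁ Ω)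
    (h₂ : LineHol r₂ Ω) (hS : IsOpen S) (hSΩ : (Ω ∩ S).Nonempty)
    (heq : ∀ z ∈ S, r₂ z * F z = r₁ z) :
    Ω ⊆ closure (interior {z | r₂ z * F z = r₁ z}) := by
  have hSi : S ⊆ interior {z | r₂ z * F z = r₁ z} := interior_maximal heq hS
  refine hΩc.isPreconnected.subset_closure_of_locally isOpen_interior
    (hSΩ.mono (Set.inter_subset_inter_right _ hSi)) fun z₀ hz₀ => ?_
  obtain ⟨f, g, ρ, hρ, hf, hg, hne, hfg⟩ := hF.exists_ball hz₀
  obtain ⟨ρ', hρ', hsub⟩ := Metric.isOpen_iff.mp hΩ z₀ hz₀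
  set U := Metric.ball z₀ (min ρ ρ')
  have hUρ : U ⊆ Metric.ball z₀ ρ := Metric.ball_subset_ball (min_le_left _ _)
  have hUΩ : U ⊆ Ω := (Metric.ball_subset_ball (min_le_right _ _)).trans hsub
  have hgd := hg.lineHol.subset_closure_ne_zero Metric.isOpen_ball (convex_ball _ _) hne
  have hgo := hg.lineHol.isOpen_ne_zero Metric.isOpen_ball
  refine ⟨U, Metric.isOpen_ball, Metric.mem_ball_self (by positivity), fun hmeet => ?_⟩
  have hdiff : LineHol (fun z => r₂ z * f z - r₁ z * g z) U :=
    ((h₂.mono hUΩ).mul (hf.lineHol.mono hUρ)).sub ((h₁.mono hUΩ).mul (hg.lineHol.mono hUρ))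
  -- the relation holds where the denominator does not vanish, on an open set
  obtain ⟨y, hyO, hyU⟩ := hmeet
  obtain ⟨y', hy'1, hy'2⟩ := mem_closure_iff.mp (hgd (hUρ hyU)) _
    (isOpen_interior.inter Metric.isOpen_ball) ⟨hyO, hyU⟩
  have hzero := hdiff.eqOn_zero Metric.isOpen_ball (convex_ball _ _)
    ((isOpen_interior (s := {z | r₂ z * F z = r₁ z})).inter hgo) ⟨y', ⟨hy'1.1, hy'2⟩, hy'1.2⟩ (by
      rintro z ⟨⟨hz1, hz2, hz3⟩, -⟩
      have h1 : r₂ z * F z = r₁ z :=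
        interior_subset (s := {z | r₂ z * F z = r₁ z}) hz1
      rw [hfg z hz2 hz3] at h1
      rw [← h1]
      field_simp [show g z ≠ 0 from hz3]
      ring)
  intro z hz
  have hgU : IsOpen (U ∩ (Metric.ball z₀ ρ ∩ {x | g x ≠ 0})) := Metric.isOpen_ball.inter hgo
  refine closure_mono (interior_maximal ?_ hgU)
    (subset_closure_inter_of_isOpen Metric.isOpen_ball Metric.isOpen_ball subset_closure
      (hUρ.trans hgd) hz)
  rintro x ⟨hxU, hxρ, hx0⟩
  have := hzero x hxU
  have hx0' : g x ≠ 0 := hx0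
  simp only [Set.mem_ofPred_eq, hfg x hxρ hx0]
  field_simp
  linear_combination this

/-- The identity theorem for meromorphic functions. -/
theorem IsMeromorphicOn.subset_closure_eq' {F G : E → ℂ} {Ω S : Set E}
    (hF : IsMeromorphicOn F Ω) (hG : IsMeromorphicOn G Ω) (hΩc : Convex ℝ Ω)
    (hS : IsOpen S) (hSΩ : (Ω ∩ S).Nonempty) (heq : ∀ z ∈ S, F z = G z) :
    Ω ⊆ closure (interior {z | F z = G z}) := by
  refine hΩc.isPreconnected.subset_closure_of_locally isOpen_interior
    (hSΩ.mono (Set.inter_subset_inter_right _ (interior_maximal heq hS))) fun z₀ hz₀ => ?_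
  obtain ⟨f, g, ρ, hρ, hf, hg, hne, hfg⟩ := hF.exists_ball hz₀
  obtain ⟨f', g', ρ', hρ', hf', hg', hne', hfg'⟩ := hG.exists_ball hz₀
  have hgd := hg.lineHol.subset_closure_ne_zero Metric.isOpen_ball (convex_ball _ _) hne
  have hgd' := hg'.lineHol.subset_closure_ne_zero Metric.isOpen_ball (convex_ball _ _) hne'
  have hgo := hg.lineHol.isOpen_ne_zero Metric.isOpen_ball
  have hgo' := hg'.lineHol.isOpen_ne_zero Metric.isOpen_ball
  set U := Metric.ball z₀ (min ρ ρ')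
  have hUρ : U ⊆ Metric.ball z₀ ρ := Metric.ball_subset_ball (min_le_left _ _)
  have hUρ' : U ⊆ Metric.ball z₀ ρ' := Metric.ball_subset_ball (min_le_right _ _)
  have hd2 : U ⊆ closure ((Metric.ball z₀ ρ ∩ {x | g x ≠ 0}) ∩
      (Metric.ball z₀ ρ' ∩ {x | g' x ≠ 0})) :=
    subset_closure_inter_of_isOpen Metric.isOpen_ball hgo (hUρ.trans hgd) (hUρ'.trans hgd')
  have hdo := hgo.inter hgo'
  refine ⟨U, Metric.isOpen_ball, Metric.mem_ball_self (by positivity), fun hmeet => ?_⟩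
  have hdiff : LineHol (fun z => f z * g' z - f' z * g z) U :=
    ((hf.lineHol.mono hUρ).mul (hg'.lineHol.mono hUρ')).sub
      ((hf'.lineHol.mono hUρ').mul (hg.lineHol.mono hUρ))
  obtain ⟨y, hyO, hyU⟩ := hmeet
  obtain ⟨y', hy'1, hy'2⟩ := mem_closure_iff.mp (hd2 hyU) _
    (isOpen_interior.inter Metric.isOpen_ball) ⟨hyO, hyU⟩
  have hzero := hdiff.eqOn_zero Metric.isOpen_ball (convex_ball _ _)
    ((isOpen_interior (s := {z | F z = G z})).inter hdo) ⟨y', ⟨hy'1.1, hy'2⟩, hy'1.2⟩ (by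
      rintro z ⟨⟨hz1, ⟨hz2, hz3⟩, ⟨hz4, hz5⟩⟩, -⟩
      have h1 : F z = G z := interior_subset (s := {z | F z = G z}) hz1
      rw [hfg z hz2 hz3, hfg' z hz4 hz5, div_eq_div_iff hz3 hz5] at h1
      linear_combination h1)
  intro z hz
  refine closure_mono (interior_maximal ?_ (Metric.isOpen_ball.inter hdo))
    (subset_closure_inter_of_isOpen Metric.isOpen_ball Metric.isOpen_ball subset_closure hd2 hz)
  rintro x ⟨hxU, ⟨hxρ, hx0⟩, hxρ', hx0'⟩
  have := hzero x hxU
  simp only [Set.mem_ofPred_eq, hfg x hxρ hx0, hfg' x hxρ' hx0', div_eq_div_iff hx0 hx0']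
  linear_combination this

end SeveralVariables

/-! ### Limits of meromorphic functions along hyperplanes -/

section Propagation

/-- The order of vanishing and the leading coefficient, in terms of derivatives. -/
theorem AnalyticAt.tendsto_div_pow {φ : ℂ → ℂ} {τ₀ : ℂ} (hφ : AnalyticAt ℂ φ τ₀) {j : ℕ}
    (h0 : ∀ n < j, iteratedDeriv n φ τ₀ = 0) :
    Tendsto (fun τ => φ τ / (τ - τ₀) ^ j) (𝓝[≠] τ₀) (𝓝 (iteratedDeriv j φ τ₀ / j.factorial)) := by
  have hps := hφ.hasFPowerSeriesAt
  have hO := hps.isBigO_sub_partialSum_pow (j + 1)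
  have hpart : ∀ y : ℂ, (FormalMultilinearSeries.ofScalars ℂ
      (fun n => iteratedDeriv n φ τ₀ / (n.factorial : ℂ))).partialSum (j + 1) y =
      y ^ j * (iteratedDeriv j φ τ₀ / j.factorial) := by
    intro y
    rw [FormalMultilinearSeries.partialSum, Finset.sum_eq_single j]
    · simp [FormalMultilinearSeries.ofScalars, mul_comm]
    · intro n hn hnj
      have : n < j := by simp at hn; omega
      simp [FormalMultilinearSeries.ofScalars, h0 n this]
    · simp
  simp only [hpart] at hO
  have hO' : (fun y : ℂ => φ (τ₀ + y) / y ^ j - iteratedDeriv j φ τ₀ / j.factorial)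
      =O[𝓝[≠] 0] fun y => ‖y‖ := by
    have h2 := (IsBigO.mono (l := 𝓝[≠] 0) hO nhdsWithin_le_nhds).mul
      (isBigO_refl (fun y : ℂ => (y ^ j)⁻¹) (𝓝[≠] 0)).norm_right
    refine (h2.congr' (f₂ := fun y : ℂ => φ (τ₀ + y) / y ^ j -
      iteratedDeriv j φ τ₀ / j.factorial) ?_ EventuallyEq.rfl).trans ?_
    · filter_upwards [self_mem_nhdsWithin] with y hy
      have hy : y ≠ 0 := hy
      field_simp
    refine IsBigO.of_bound 1 ?_
    filter_upwards [self_mem_nhdsWithin] with y hy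
    have hy : y ≠ 0 := hy
    have hy' : ‖y‖ ≠ 0 := norm_ne_zero_iff.mpr hy
    simp only [norm_mul, norm_pow, norm_inv, norm_norm, one_mul]
    rw [pow_succ']
    field_simp
    exact le_rfl
  have hlim : Tendsto (fun y : ℂ => φ (τ₀ + y) / y ^ j) (𝓝[≠] 0)
      (𝓝 (iteratedDeriv j φ τ₀ / j.factorial)) := by
    rw [← tendsto_sub_nhds_zero_iff]
    refine hO'.trans_tendsto ?_
    exact (tendsto_norm_zero.mono_left nhdsWithin_le_nhds)
  have hsub : Tendsto (fun τ : ℂ => τ - τ₀) (𝓝[≠] τ₀) (𝓝[≠] 0) := by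
    refine tendsto_nhdsWithin_iff.mpr ⟨?_, ?_⟩
    · have : Tendsto (fun τ : ℂ => τ - τ₀) (𝓝 τ₀) (𝓝 (τ₀ - τ₀)) :=
        (continuous_sub_right τ₀).tendsto τ₀
      rw [sub_self] at this
      exact this.mono_left nhdsWithin_le_nhds
    · filter_upwards [self_mem_nhdsWithin] with τ hτ
      exact sub_ne_zero.mpr hτ
  simpa [Function.comp_def] using hlim.comp hsub

/-- If the quotient of `φ` by `(τ - τ₀) ^ j` has a finite limit along some filter, then `φ` vanishes
to order `j` at `τ₀`. -/
theorem AnalyticAt.iteratedDeriv_eq_zero_of_tendsto {φ : ℂ → ℂ} {τ₀ : ℂ} (hφ : AnalyticAt ℂ φ τ₀)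
    {j : ℕ} {l : Filter ℂ} [l.NeBot] (hl : l ≤ 𝓝[≠] τ₀) {c : ℂ}
    (h : Tendsto (fun τ => φ τ / (τ - τ₀) ^ j) l (𝓝 c)) : ∀ n < j, iteratedDeriv n φ τ₀ = 0 := by
  by_contra! hcon
  obtain ⟨hn, hn0⟩ := Nat.find_spec hcon
  set n := Nat.find hcon
  have hmin : ∀ k < n, iteratedDeriv k φ τ₀ = 0 := by
    intro k hk
    by_contra hk0
    exact Nat.find_min hcon hk ⟨hk.trans hn, hk0⟩
  have h1 := (hφ.tendsto_div_pow hmin).mono_left hl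
  have hsub : Tendsto (fun τ : ℂ => (τ - τ₀) ^ (j - n)) l (𝓝 0) := by
    have : Tendsto (fun τ : ℂ => (τ - τ₀) ^ (j - n)) (𝓝 τ₀) (𝓝 ((τ₀ - τ₀) ^ (j - n))) :=
      ((continuous_sub_right τ₀).pow _).tendsto τ₀
    rw [sub_self, zero_pow (by omega)] at this
    exact this.mono_left (hl.trans nhdsWithin_le_nhds)
  have h2 : Tendsto (fun τ => φ τ / (τ - τ₀) ^ n) l (𝓝 (c * 0)) := by
    refine (h.mul hsub).congr' ?_
    have : ∀ᶠ τ in l, τ ≠ τ₀ := hl self_mem_nhdsWithin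
    filter_upwards [this] with τ hτ
    have hτ' : τ - τ₀ ≠ 0 := sub_ne_zero.mpr hτ
    have : (τ - τ₀) ^ j = (τ - τ₀) ^ (j - n) * (τ - τ₀) ^ n := by
      rw [← pow_add]; congr 1; omega
    rw [this]
    field_simp
  have h3 := tendsto_nhds_unique h1 h2
  rw [mul_zero, div_eq_zero_iff] at h3
  exact h3.elim hn0 (by exact_mod_cast n.factorial_ne_zero)

variable {E : Type*} [NormedAddCommGroup E] [NormedSpace ℂ E]

/-- The partial derivative in the last variable. -/
noncomputable def lastDeriv (f : E × ℂ → ℂ) (z : E × ℂ) : ℂ := fderiv ℂ f z (0, 1)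

theorem AnalyticOnNhd.lastDeriv {f : E × ℂ → ℂ} {U : Set (E × ℂ)} (hf : AnalyticOnNhd ℂ f U) :
    AnalyticOnNhd ℂ (lastDeriv f) U := fun z hz =>
  ((ContinuousLinearMap.apply ℂ ℂ ((0, 1) : E × ℂ)).analyticAt _).comp (hf z hz).fderiv

theorem AnalyticOnNhd.iterate_lastDeriv {f : E × ℂ → ℂ} {U : Set (E × ℂ)}
    (hf : AnalyticOnNhd ℂ f U) (n : ℕ) : AnalyticOnNhd ℂ (_root_.lastDeriv^[n] f) U := by
  induction n generalizing f with
  | zero => exact hf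
  | succ n ih => exact ih hf.lastDeriv

theorem iteratedDeriv_slice {f : E × ℂ → ℂ} {U : Set (E × ℂ)} (hU : IsOpen U)
    (hf : AnalyticOnNhd ℂ f U) (n : ℕ) (s : E) (τ : ℂ) (h : (s, τ) ∈ U) :
    iteratedDeriv n (fun τ => f (s, τ)) τ = lastDeriv^[n] f (s, τ) := by
  induction n generalizing f with
  | zero => simp
  | succ n ih =>
    rw [iteratedDeriv_succ', Function.iterate_succ_apply, ← ih hf.lastDeriv]
    refine Filter.EventuallyEq.iteratedDeriv_eq n ?_
    have hc : ContinuousAt (fun τ : ℂ => (s, τ)) τ := by fun_prop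
    filter_upwards [hc.eventually_mem (hU.mem_nhds h)] with t ht
    have h1 := (hf _ ht).differentiableAt.hasFDerivAt.comp_hasDerivAt t
      ((hasDerivAt_const t s).prodMk (hasDerivAt_id t))
    exact h1.deriv

/-- Propagation of a limit along the hyperplane `τ = τ₀`: suppose that `F` is meromorphic near all
points `(s, τ₀)` with `s ∈ K`. If `r₂(s) F(s, τ)` tends to `r₁(s)` as `τ` tends to `τ₀` in some way,
for `s` in an open part of `K`, then the same holds, without restriction on `τ`, for generic `s`
in `K`. -/
theorem IsMeromorphicOn.subset_closure_tendsto {F : E × ℂ → ℂ} {K S : Set E} {τ₀ : ℂ}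
    {r₁ r₂ : E → ℂ} (hF : IsMeromorphicOn F (K ×ˢ {τ₀})) (hK : IsOpen K) (hKc : Convex ℝ K)
    (h₁ : LineHol r₁ K) (h₂ : LineHol r₂ K) (h₂ne : ∃ s ∈ K, r₂ s ≠ 0)
    (hS : IsOpen S) (hSK : (K ∩ S).Nonempty)
    (hlim : ∀ s ∈ S, ∃ l : Filter ℂ, l.NeBot ∧ l ≤ 𝓝[≠] τ₀ ∧
      Tendsto (fun τ => r₂ s * F (s, τ)) l (𝓝 (r₁ s))) :
    K ⊆ closure (interior {s | Tendsto (fun τ => r₂ s * F (s, τ)) (𝓝[≠] τ₀) (𝓝 (r₁ s))}) := by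
  classical
  set W : Set E := {s | ∃ l : Filter ℂ, l.NeBot ∧ l ≤ 𝓝[≠] τ₀ ∧
      Tendsto (fun τ => r₂ s * F (s, τ)) l (𝓝 (r₁ s))} with hW
  set L : Set E := {s | Tendsto (fun τ => r₂ s * F (s, τ)) (𝓝[≠] τ₀) (𝓝 (r₁ s))} with hL
  have hLW : L ⊆ W := fun s hs => ⟨_, inferInstance, le_rfl, hs⟩
  have key : ∀ s₀ ∈ K, ∃ U, IsOpen U ∧ s₀ ∈ U ∧
      ((interior W ∩ U).Nonempty → U ⊆ closure (interior L)) := by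
    intro s₀ hs₀
    obtain ⟨f, g, ρ₁, hρ₁, hf', hg', hne', hfg'⟩ :=
      hF.exists_ball (z₀ := (s₀, τ₀)) ⟨hs₀, rfl⟩
    obtain ⟨ρ₂, hρ₂, hsub⟩ := Metric.isOpen_iff.mp hK s₀ hs₀
    set ρ := min ρ₁ ρ₂ with hρdef
    have hρ : 0 < ρ := by positivity
    have hBρ : Metric.ball ((s₀, τ₀) : E × ℂ) ρ ⊆ Metric.ball (s₀, τ₀) ρ₁ :=
      Metric.ball_subset_ball (min_le_left _ _)
    have hf := hf'.mono hBρ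
    have hg := hg'.mono hBρ
    have hfg := fun z hz => hfg' z (hBρ hz)
    have hne : ∃ z ∈ Metric.ball ((s₀, τ₀) : E × ℂ) ρ, g z ≠ 0 := by
      by_contra! hcon
      obtain ⟨z, hz, hz0⟩ := hne'
      refine hz0 (hg'.lineHol.eqOn_zero Metric.isOpen_ball (convex_ball _ _)
        (Metric.isOpen_ball (x := ((s₀, τ₀) : E × ℂ)) (ε := ρ))
        ⟨(s₀, τ₀), Metric.mem_ball_self hρ, Metric.mem_ball_self hρ₁⟩
        (fun x hx => hcon x hx.1) z hz)
    rw [← ball_prod_same] at hf hg hfg hne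
    set U := Metric.ball s₀ ρ with hU
    set D := Metric.ball τ₀ ρ with hD
    have hUK : U ⊆ K := (Metric.ball_subset_ball (min_le_right _ _)).trans hsub
    have hUD : IsOpen (U ×ˢ D) := Metric.isOpen_ball.prod Metric.isOpen_ball
    have hτD : τ₀ ∈ D := Metric.mem_ball_self hρ
    -- The Taylor coefficients of `f` and `g` in the last variable are holomorphic in `s`. Let `j`
    -- be the least order for which that of `g` is not identically zero. Then a finite limit of `F`
    -- is the quotient of the coefficients of order `j`.
    have hcoef : ∀ {φ : E × ℂ → ℂ}, AnalyticOnNhd ℂ φ (U ×ˢ D) → ∀ n,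
        LineHol (fun s => lastDeriv^[n] φ (s, τ₀)) U := by
      intro φ hφ n
      refine AnalyticOnNhd.lineHol fun s hs => ?_
      exact AnalyticAt.comp (f := fun s : E => (s, τ₀))
        (hφ.iterate_lastDeriv n (s, τ₀) ⟨hs, hτD⟩) (analyticAt_id.prod analyticAt_const)
    have hslice : ∀ {φ : E × ℂ → ℂ}, AnalyticOnNhd ℂ φ (U ×ˢ D) → ∀ s ∈ U, ∀ τ ∈ D,
        AnalyticAt ℂ (fun τ => φ (s, τ)) τ := fun hφ s hs τ hτ =>
      AnalyticAt.comp (f := fun τ : ℂ => (s, τ)) (hφ (s, τ) ⟨hs, hτ⟩)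
        (analyticAt_const.prod analyticAt_id)
    have hex : ∃ n, ∃ s ∈ U, lastDeriv^[n] g (s, τ₀) ≠ 0 := by
      by_contra! hcon
      obtain ⟨⟨s, τ⟩, ⟨hs, hτ⟩, hz⟩ := hne
      refine hz ?_
      have hsl : AnalyticOnNhd ℂ (fun τ => g (s, τ)) D := fun τ hτ => hslice hg s hs τ hτ
      refine hsl.eqOn_zero_of_preconnected_of_eventuallyEq_zero
        (convex_ball _ _).isPreconnected hτD ?_ hτ
      refine (hsl τ₀ hτD).hasFPowerSeriesAt.eventually_hasSum_sub.mono fun y hy => ?_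
      simp only [iteratedDeriv_slice hUD hg _ s τ₀ ⟨hs, hτD⟩, hcon _ s hs,
        FormalMultilinearSeries.ofScalars, zero_div] at hy
      simpa using hy.unique (by simp)
    set j := Nat.find hex with hj
    have hgj : ∃ s ∈ U, lastDeriv^[j] g (s, τ₀) ≠ 0 := Nat.find_spec hex
    have hglt : ∀ n < j, ∀ s ∈ U, lastDeriv^[n] g (s, τ₀) = 0 := by
      intro n hn
      by_contra! hcon
      exact Nat.find_min hex hn hcon
    have hgd := (hcoef hg j).subset_closure_ne_zero Metric.isOpen_ball (convex_ball _ _) hgj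
    have hgo := (hcoef hg j).isOpen_ne_zero Metric.isOpen_ball
    refine ⟨U, Metric.isOpen_ball, Metric.mem_ball_self hρ, fun hmeet => ?_⟩
    have hglim : ∀ s ∈ U, Tendsto (fun τ => g (s, τ) / (τ - τ₀) ^ j) (𝓝[≠] τ₀)
        (𝓝 (lastDeriv^[j] g (s, τ₀) / j.factorial)) := by
      intro s hs
      rw [← iteratedDeriv_slice hUD hg _ s τ₀ ⟨hs, hτD⟩]
      refine (hslice hg s hs τ₀ hτD).tendsto_div_pow fun n hn => ?_
      rw [iteratedDeriv_slice hUD hg _ s τ₀ ⟨hs, hτD⟩, hglt n hn s hs]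
    have hjf : (j.factorial : ℂ) ≠ 0 := by exact_mod_cast j.factorial_ne_zero
    have hgne : ∀ s ∈ U, lastDeriv^[j] g (s, τ₀) ≠ 0 → ∀ᶠ τ in 𝓝[≠] τ₀,
        F (s, τ) = f (s, τ) / g (s, τ) ∧ g (s, τ) ≠ 0 := by
      intro s hs h0
      have h1 := (hglim s hs).eventually_ne (div_ne_zero h0 hjf)
      have h2 : ∀ᶠ τ in 𝓝[≠] τ₀, τ ∈ D :=
        nhdsWithin_le_nhds (Metric.isOpen_ball.mem_nhds hτD)
      filter_upwards [h1, h2] with τ hτ1 hτ2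
      have : g (s, τ) ≠ 0 := fun h => hτ1 (by rw [h, zero_div])
      exact ⟨hfg (s, τ) ⟨hs, hτ2⟩ this, this⟩
    -- on this open set the limit is known and no denominator vanishes; the identity theorem extends the
    -- relation to `U`
    have hr2o := h₂.isOpen_ne_zero hK
    have hr2d : U ⊆ closure (K ∩ {s | r₂ s ≠ 0}) :=
      hUK.trans (h₂.subset_closure_ne_zero hK hKc h₂ne)
    have hd2 := subset_closure_inter_of_isOpen Metric.isOpen_ball hgo hgd hr2d
    set V := interior W ∩ ((U ∩ {s | lastDeriv^[j] g (s, τ₀) ≠ 0}) ∩ (K ∩ {s | r₂ s ≠ 0}))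
      with hV
    have hVo : IsOpen V := isOpen_interior.inter (hgo.inter hr2o)
    have hVne : (V ∩ U).Nonempty := by
      obtain ⟨y, hyW, hyU⟩ := hmeet
      obtain ⟨y', hy'1, hy'2⟩ := mem_closure_iff.mp (hd2 hyU) _
        (isOpen_interior.inter Metric.isOpen_ball) ⟨hyW, hyU⟩
      exact ⟨y', ⟨hy'1.1, hy'2⟩, hy'1.2⟩
    have hflim : ∀ s ∈ V ∩ U, ∃ l : Filter ℂ, l.NeBot ∧ l ≤ 𝓝[≠] τ₀ ∧
        Tendsto (fun τ => f (s, τ) / (τ - τ₀) ^ j) l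
          (𝓝 (r₁ s / r₂ s * (lastDeriv^[j] g (s, τ₀) / j.factorial))) := by
      rintro s ⟨⟨hsW, ⟨-, hsg⟩, ⟨-, hsr⟩⟩, hsU⟩
      obtain ⟨l, hl, hl', hlt⟩ := interior_subset hsW
      refine ⟨l, hl, hl', ?_⟩
      have hsr : r₂ s ≠ 0 := hsr
      refine ((hlt.div_const (r₂ s)).mul ((hglim s hsU).mono_left hl')).congr' ?_
      filter_upwards [hl' (hgne s hsU hsg)] with τ hτ
      rw [hτ.1]
      have := hτ.2
      field_simp
    have hflt : ∀ n < j, ∀ s ∈ U, lastDeriv^[n] f (s, τ₀) = 0 := by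
      intro n hn
      refine (hcoef hf n).eqOn_zero Metric.isOpen_ball (convex_ball _ _) hVo hVne fun s hs => ?_
      obtain ⟨l, hl, hl', hlt⟩ := hflim s hs
      have := (hslice hf s hs.2 τ₀ hτD).iteratedDeriv_eq_zero_of_tendsto hl' hlt n hn
      rwa [iteratedDeriv_slice hUD hf _ s τ₀ ⟨hs.2, hτD⟩] at this
    have hfj : ∀ s ∈ U, Tendsto (fun τ => f (s, τ) / (τ - τ₀) ^ j) (𝓝[≠] τ₀)
        (𝓝 (lastDeriv^[j] f (s, τ₀) / j.factorial)) := by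
      intro s hs
      rw [← iteratedDeriv_slice hUD hf _ s τ₀ ⟨hs, hτD⟩]
      refine (hslice hf s hs τ₀ hτD).tendsto_div_pow fun n hn => ?_
      rw [iteratedDeriv_slice hUD hf _ s τ₀ ⟨hs, hτD⟩, hflt n hn s hs]
    have hrel : ∀ s ∈ U, r₂ s * lastDeriv^[j] f (s, τ₀) - r₁ s * lastDeriv^[j] g (s, τ₀) = 0 := by
      refine (((h₂.mono hUK).mul (hcoef hf j)).sub ((h₁.mono hUK).mul (hcoef hg j))).eqOn_zero
        Metric.isOpen_ball (convex_ball _ _) hVo hVne fun s hs => ?_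
      obtain ⟨l, hl, hl', hlt⟩ := hflim s hs
      have h := tendsto_nhds_unique hlt ((hfj s hs.2).mono_left hl')
      have hsr : r₂ s ≠ 0 := hs.1.2.2.2
      field_simp at h
      linear_combination -h
    refine hgd.trans (closure_mono (interior_maximal ?_ hgo))
    rintro s ⟨hs, hsg⟩
    have hsg : lastDeriv^[j] g (s, τ₀) ≠ 0 := hsg
    have h := ((hfj s hs).div (hglim s hs) (div_ne_zero hsg hjf)).const_mul (r₂ s)
    have hval : r₂ s * (lastDeriv^[j] f (s, τ₀) / j.factorial /
        (lastDeriv^[j] g (s, τ₀) / j.factorial)) = r₁ s := by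
      field_simp
      linear_combination hrel s hs
    rw [hval] at h
    refine h.congr' ?_
    filter_upwards [hgne s hs hsg, self_mem_nhdsWithin] with τ hτ hτ0
    have hτ' : τ - τ₀ ≠ 0 := sub_ne_zero.mpr hτ0
    have := hτ.2
    simp only [Pi.div_apply]
    rw [hτ.1]
    field_simp
  have hSW : S ⊆ interior W := interior_maximal hlim hS
  have hKW : K ⊆ closure (interior W) :=
    hKc.isPreconnected.subset_closure_of_locally isOpen_interior
      (hSK.mono (Set.inter_subset_inter_right _ hSW)) fun s hs => by
        obtain ⟨U, hU, hsU, h⟩ := key s hs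
        exact ⟨U, hU, hsU, fun hne => (h hne).trans (closure_mono (interior_mono hLW))⟩
  intro s hs
  obtain ⟨U, hU, hsU, h⟩ := key s hs
  obtain ⟨y, hyU, hyW⟩ := mem_closure_iff.mp (hKW hs) U hU hsU
  exact h ⟨y, hyW, hyU⟩ hsU

end Propagation

/-! ### A Tauberian theorem -/

section Landau

/-- Landau's theorem: if a Dirichlet series with nonnegative coefficients continues holomorphically
to `Re w > 1`, then it converges there, and it represents its continuation. -/
theorem LSeriesSummable_of_differentiableOn {a : ℕ → ℝ} (ha : ∀ n, 0 ≤ a n) {Z : ℂ → ℂ}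
    (hZ : DifferentiableOn ℂ Z {w | 1 < w.re}) {c : ℝ}
    (hs : ∀ w : ℂ, c < w.re → LSeriesSummable (fun n => (a n : ℂ)) w)
    (hc : ∀ w : ℂ, c < w.re → LSeries (fun n => (a n : ℂ)) w = Z w) {w : ℂ} (hw : 1 < w.re) :
    LSeriesSummable (fun n => (a n : ℂ)) w ∧ LSeries (fun n => (a n : ℂ)) w = Z w := by
  set f : ℕ → ℂ := fun n => (a n : ℂ) with hf
  have hopen : IsOpen {w : ℂ | 1 < w.re} := isOpen_lt continuous_const Complex.continuous_re
  have hAn : AnalyticOnNhd ℂ Z {w | 1 < w.re} := hZ.analyticOnNhd hopen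
  have habs0 : LSeries.abscissaOfAbsConv f ≤ c :=
    LSeries.abscissaOfAbsConv_le_of_forall_lt_LSeriesSummable fun y hy => hs y (by simpa using hy)
  have hreal : ∀ x : ℝ, 1 < x → LSeriesSummable f x := by
    intro x hx
    set b : ℝ := max c x + 1 with hb
    have hcb : c < b := by rw [hb]; linarith [le_max_left c x]
    have hxb : x < b := by rw [hb]; linarith [le_max_right c x]
    have hballs : Metric.ball (b : ℂ) (b - 1) ⊆ {w : ℂ | 1 < w.re} := by
      intro z hz
      have h1 : |(z - b).re| < b - 1 := (Complex.abs_re_le_norm _).trans_lt (by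
        simpa [dist_eq_norm] using hz)
      have := (abs_lt.mp h1).1
      simp at this ⊢
      linarith
    have hxball : (x : ℂ) ∈ Metric.ball (b : ℂ) (b - 1) := by
      rw [Metric.mem_ball, dist_eq_norm, ← Complex.ofReal_sub, Complex.norm_real, Real.norm_eq_abs,
        abs_of_neg (by linarith)]
      linarith
    have htaylor := Complex.hasSum_taylorSeries_on_ball (hZ.mono hballs) hxball
    have hbabs : LSeries.abscissaOfAbsConv f < ((b : ℂ).re : EReal) :=
      habs0.trans_lt (by simpa using hcb)
    have hev : Z =ᶠ[𝓝 (b : ℂ)] LSeries f := by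
      have : ∀ᶠ z : ℂ in 𝓝 (b : ℂ), c < z.re :=
        Complex.continuous_re.continuousAt.eventually (lt_mem_nhds (by simpa using hcb))
      filter_upwards [this] with z hz using (hc z hz).symm
    have hpow : ∀ (n k : ℕ), (LSeries.logMul^[n] f) k = (Real.log k) ^ n * a k := by
      intro n k
      induction n with
      | zero => simp [hf]
      | succ n ih =>
        rw [Function.iterate_succ_apply', LSeries.logMul, ih, ← Complex.natCast_log]
        push_cast
        ring
    -- the real terms of the double series
    set T : ℕ → ℕ → ℝ := fun n k => if k = 0 then 0 else
      (n.factorial : ℝ)⁻¹ * ((b - x) * Real.log k) ^ n * (a k * (k : ℝ) ^ (-b)) with hT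
    have hT0 : ∀ n k, 0 ≤ T n k := by
      intro n k
      simp only [hT]
      split_ifs with hk
      · exact le_rfl
      · have : 0 ≤ Real.log k := Real.log_natCast_nonneg k
        have := ha k
        have : 0 ≤ b - x := by linarith
        positivity
    have hTn : ∀ n, HasSum (fun k => (T n k : ℂ))
        ((n.factorial : ℂ)⁻¹ • ((x : ℂ) - b) ^ n • iteratedDeriv n Z b) := by
      intro n
      rw [hev.iteratedDeriv_eq n, LSeries_iteratedDeriv n hbabs]
      have hsum : LSeriesSummable (LSeries.logMul^[n] f) (b : ℂ) :=
        LSeriesSummable_of_abscissaOfAbsConv_lt_re (by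
          rwa [LSeries.absicssaOfAbsConv_logPowMul])
      have := hsum.hasSum.mul_left ((n.factorial : ℂ)⁻¹ * ((b : ℂ) - x) ^ n)
      have e1 : (fun k => (T n k : ℂ)) = fun k => (n.factorial : ℂ)⁻¹ * ((b : ℂ) - x) ^ n *
          LSeries.term (LSeries.logMul^[n] f) (b : ℂ) k := by
        funext k
        simp only [hT, LSeries.term]
        split_ifs with hk
        · simp
        · have hk0 : (k : ℂ) ≠ 0 := by exact_mod_cast hk
          rw [hpow, Complex.ofReal_mul, Complex.ofReal_mul, Complex.ofReal_mul,
            Complex.ofReal_cpow (Nat.cast_nonneg k)]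
          push_cast
          rw [Complex.cpow_neg, mul_pow]
          ring
      have e2 : (n.factorial : ℂ)⁻¹ • ((x : ℂ) - b) ^ n •
          ((-1) ^ n * LSeries (LSeries.logMul^[n] f) b) = (n.factorial : ℂ)⁻¹ * ((b : ℂ) - x) ^ n *
          ∑' k, LSeries.term (LSeries.logMul^[n] f) (b : ℂ) k := by
        simp only [smul_eq_mul, LSeries]
        have : ((x : ℂ) - b) ^ n = (-1) ^ n * ((b : ℂ) - x) ^ n := by
          rw [← mul_pow]; ring
        rw [this]
        have h1 : ((-1 : ℂ) ^ n) * (-1) ^ n = 1 := by rw [← mul_pow]; simp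
        linear_combination ((n.factorial : ℂ)⁻¹ * ((b : ℂ) - x) ^ n *
          ∑' k, LSeries.term (LSeries.logMul^[n] f) (b : ℂ) k) * h1
      rw [e1, e2]
      exact this
    have hTr : ∀ n, HasSum (fun k => T n k)
        ((n.factorial : ℂ)⁻¹ • ((x : ℂ) - b) ^ n • iteratedDeriv n Z b).re := fun n => by
      simpa using Complex.hasSum_re (hTn n)
    have htr : HasSum (fun n => ∑' k, T n k) (Z x).re := by
      have := Complex.hasSum_re htaylor
      convert this using 1
      funext n
      exact (hTr n).tsum_eq
    have hexp : ∀ k : ℕ, HasSum (fun n => T n k)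
        (if k = 0 then 0 else a k * (k : ℝ) ^ (-x)) := by
      intro k
      by_cases hk : k = 0
      · simp [hT, hk]
      · have hk0 : (0 : ℝ) < k := by exact_mod_cast Nat.pos_of_ne_zero hk
        have := (NormedSpace.expSeries_div_hasSum_exp ((b - x) * Real.log k)).mul_right
          (a k * (k : ℝ) ^ (-b))
        rw [← Real.exp_eq_exp_ℝ] at this
        have e1 : (fun n => T n k) = fun n => ((b - x) * Real.log k) ^ n / n.factorial *
            (a k * (k : ℝ) ^ (-b)) := by
          funext n
          simp only [hT, hk, if_false]
          ring
        have e2 : (if k = 0 then 0 else a k * (k : ℝ) ^ (-x)) =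
            Real.exp ((b - x) * Real.log k) * (a k * (k : ℝ) ^ (-b)) := by
          rw [if_neg hk, Real.rpow_def_of_pos hk0, Real.rpow_def_of_pos hk0, mul_left_comm,
            ← Real.exp_add]
          ring_nf
        rw [e1, e2]
        exact this
    have hsummable : Summable (fun k : ℕ => if k = 0 then 0 else a k * (k : ℝ) ^ (-x)) := by
      refine summable_of_sum_le (c := (Z x).re) (fun k => ?_) (fun s => ?_)
      · split_ifs
        · exact le_rfl
        · have := ha k; positivity
      · have h1 := hasSum_sum (fun k (_ : k ∈ s) => hexp k)
        refine hasSum_le (fun n => ?_) h1 htr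
        exact (hTr n).summable.sum_le_tsum s (fun k _ => hT0 n k)
    rw [LSeriesSummable, ← summable_norm_iff]
    refine hsummable.congr fun k => ?_
    rw [LSeries.norm_term_eq]
    split_ifs with hk
    · rfl
    · simp [hf, abs_of_nonneg (ha k), Real.rpow_neg, div_eq_mul_inv]
  have habs : LSeries.abscissaOfAbsConv f ≤ (1 : ℝ) :=
    LSeries.abscissaOfAbsConv_le_of_forall_lt_LSeriesSummable fun y hy => hreal y hy
  have hLan : AnalyticOnNhd ℂ (LSeries f) {w | 1 < w.re} := fun z hz =>
    LSeries_analyticOnNhd f z (habs.trans_lt (EReal.coe_lt_coe_iff.mpr hz))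
  refine ⟨LSeriesSummable_of_abscissaOfAbsConv_lt_re (habs.trans_lt (EReal.coe_lt_coe_iff.mpr hw)), ?_⟩
  have hconv : IsPreconnected {w : ℂ | 1 < w.re} := (convex_halfSpace_re_gt 1).isPreconnected
  refine hLan.eqOn_of_preconnected_of_eventuallyEq hAn hconv
    (z₀ := ((max c 1 + 1 : ℝ) : ℂ)) ?_ ?_ hw
  · have := le_max_right c 1
    simp only [Set.mem_ofPred_eq, Complex.ofReal_re]
    linarith
  · have : ∀ᶠ z : ℂ in 𝓝 ((max c 1 + 1 : ℝ) : ℂ), c < z.re :=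
      Complex.continuous_re.continuousAt.eventually (lt_mem_nhds (by
        simp only [Complex.ofReal_re]
        linarith [le_max_left c 1]))
    filter_upwards [this] with z hz using hc z hz

end Landau

section Kernel

open MeasureTheory Complex FourierTransform Real in
/-- A nonnegative kernel of rapid decay with continuous and compactly supported Fourier
transform: the square of the Fourier transform of an even bump function. -/
theorem exists_fourier_kernel :
    ∃ (k : ℝ → ℂ) (K : ℝ → ℝ), Continuous k ∧ HasCompactSupport k ∧ Continuous K ∧
      (∀ v, 0 ≤ K v) ∧ (∀ v, (K v : ℂ) = ∫ y, 𝐞 (-(y * v)) • k y) ∧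
      (∀ n : ℕ, Integrable fun v => (1 + |v|) ^ n * K v) ∧ 0 < ∫ v, K v := by
  let b : ContDiffBump (0 : ℝ) := ⟨1, 2, one_pos, one_lt_two⟩
  have hfc : Continuous fun x : ℝ => (b x : ℂ) := continuous_ofReal.comp b.continuous
  have hfs : HasCompactSupport fun x : ℝ => (b x : ℂ) :=
    b.hasCompactSupport.comp_left (g := fun x : ℝ => (x : ℂ)) ofReal_zero
  have hfd : ContDiff ℝ (⊤ : ℕ∞) fun x : ℝ => (b x : ℂ) := ofRealCLM.contDiff.comp b.contDiff
  set f : SchwartzMap ℝ ℂ := hfs.toSchwartzMap hfd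
  set g : SchwartzMap ℝ ℂ := 𝓕 f
  have hgf : ∀ v, g v = 𝓕 (fun x : ℝ => (b x : ℂ)) v := fun v => rfl
  have hgre : ∀ v, ((g v).re : ℂ) = g v := by
    intro v
    rw [← conj_eq_iff_re, hgf, Real.fourier_real_eq_integral_exp_smul, ← integral_conj,
      ← integral_neg_eq_self]
    refine integral_congr_ae (Eventually.of_forall fun x => ?_)
    have e : (starRingEnd ℂ) (((-2 * π * -x * v : ℝ) : ℂ) * I) =
        ((-2 * π * x * v : ℝ) : ℂ) * I := by
      rw [map_mul, conj_ofReal, conj_I]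
      push_cast
      ring
    simp only
    rw [smul_eq_mul, smul_eq_mul, map_mul, conj_ofReal, ← exp_conj, e, b.neg]
  set k₀ : ℝ → ℂ := convolution (fun x : ℝ => (b x : ℂ)) (fun x : ℝ => (b x : ℂ))
    (ContinuousLinearMap.mul ℂ ℂ) volume with hk₀
  have hfi : Integrable fun x : ℝ => (b x : ℂ) := hfc.integrable_of_hasCompactSupport hfs
  have hk₀c : Continuous k₀ :=
    hfs.continuous_convolution_right _ hfi.locallyIntegrable hfc
  have hk₀s : HasCompactSupport k₀ := hfs.convolution _ hfs
  set K₀ : ℝ → ℝ := fun v => (g v).re ^ 2 with hK₀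
  have hK₀c : Continuous K₀ := (continuous_re.comp g.continuous).pow 2
  have hK₀n : ∀ v, 0 ≤ K₀ v := fun v => sq_nonneg _
  have hK₀k : ∀ v, (K₀ v : ℂ) = ∫ y, 𝐞 (-(y * v)) • k₀ y := by
    intro v
    have := Real.fourier_mul_convolution_eq hfi hfi v
    rw [Real.fourier_real_eq] at this
    rw [hk₀, this, hK₀]
    push_cast
    rw [hgre, hgf, sq]
  obtain ⟨C, hC⟩ := g.decay 0 0
  have hgC : ∀ v, ‖g v‖ ≤ C := by simpa using hC.2
  have hgi : ∀ n : ℕ, Integrable fun v => (1 + |v|) ^ n * ‖g v‖ := by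
    intro n
    have h1 := (g.integrable_pow_mul volume 0).add (g.integrable_pow_mul volume n)
    refine (h1.const_mul (2 ^ (n - 1))).mono'
      ((by fun_prop : Continuous fun v : ℝ => (1 + |v|) ^ n * ‖g v‖).aestronglyMeasurable)
      (Eventually.of_forall fun v => ?_)
    have h2 := add_pow_le (zero_le_one (α := ℝ)) (abs_nonneg v) n
    simp only [Pi.add_apply, pow_zero, one_mul, Real.norm_eq_abs] at *
    rw [abs_of_nonneg (by positivity)]
    calc (1 + |v|) ^ n * ‖g v‖ ≤ 2 ^ (n - 1) * (1 ^ n + |v| ^ n) * ‖g v‖ := by gcongr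
      _ = _ := by ring
  have hK₀i : ∀ n : ℕ, Integrable fun v => (1 + |v|) ^ n * K₀ v := by
    intro n
    refine ((hgi n).const_mul C).mono'
      ((by fun_prop : Continuous fun v : ℝ => (1 + |v|) ^ n * K₀ v).aestronglyMeasurable)
      (Eventually.of_forall fun v => ?_)
    have := hK₀n v
    rw [Real.norm_eq_abs, abs_of_nonneg (by positivity)]
    have h1 : K₀ v ≤ C * ‖g v‖ := by
      calc K₀ v = |(g v).re| * |(g v).re| := by rw [hK₀, ← sq, sq_abs]
        _ ≤ ‖g v‖ * ‖g v‖ := by gcongr <;> exact abs_re_le_norm _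
        _ ≤ C * ‖g v‖ := by gcongr; exact hgC v
    calc (1 + |v|) ^ n * K₀ v ≤ (1 + |v|) ^ n * (C * ‖g v‖) := by gcongr
      _ = _ := by ring
  have hK₀i0 : Integrable K₀ := by simpa using hK₀i 0
  have hκ0 : 0 < ∫ v, K₀ v := by
    refine integral_pos_of_integrable_nonneg_nonzero hK₀c hK₀i0 hK₀n (x := 0) ?_
    have : g 0 = ((∫ x, b x : ℝ) : ℂ) := by
      rw [hgf, Real.fourier_real_eq_integral_exp_smul, ← integral_complex_ofReal]
      simp
    simp only [hK₀, this, ofReal_re]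
    have := b.integral_pos (μ := volume)
    positivity
  exact ⟨k₀, K₀, hk₀c, hk₀s, hK₀c, hK₀n, hK₀k, hK₀i, hκ0⟩

open MeasureTheory Complex FourierTransform Real in
/-- Nonnegative kernels of integral `1`, of rapid decay, concentrated near `0`, and with
continuous and compactly supported Fourier transform. -/
theorem exists_concentrated_kernel (N : ℕ) {δ η : ℝ} (hδ : 0 < δ) (hη : 0 < η) :
    ∃ (k : ℝ → ℂ) (K : ℝ → ℝ), Continuous k ∧ HasCompactSupport k ∧ Continuous K ∧
      (∀ v, 0 ≤ K v) ∧ (∀ v, (K v : ℂ) = ∫ y, 𝐞 (-(y * v)) • k y) ∧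
      (∀ n : ℕ, Integrable fun v => (1 + |v|) ^ n * K v) ∧ ∫ v, K v = 1 ∧
      ∫ v, Set.indicator {v | δ < |v|} (fun v => (1 + |v|) ^ N * K v) v ≤ η := by
  obtain ⟨k₀, K₀, hk₀c, hk₀s, hK₀c, hK₀n, hK₀k, hK₀i, hκ0⟩ := exists_fourier_kernel
  set κ := ∫ v, K₀ v with hκ
  -- The kernel is `x ↦ κ⁻¹ l K₀ (l x)`, whose mass outside `[-δ, δ]` tends to `0` as `l → ∞`.
  have htail : Tendsto (fun l : ℝ => κ⁻¹ * ∫ x, Set.indicator {x | l * δ < |x|}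
      (fun x => (1 + |x|) ^ N * K₀ x) x) atTop (𝓝 0) := by
    have h0 : Tendsto (fun l : ℝ => ∫ x, Set.indicator {x | l * δ < |x|}
        (fun x => (1 + |x|) ^ N * K₀ x) x) atTop (𝓝 (∫ _x : ℝ, (0 : ℝ))) := by
      refine tendsto_integral_filter_of_dominated_convergence
        (fun x => (1 + |x|) ^ N * K₀ x) ?_ ?_ (hK₀i N) ?_
      · refine Eventually.of_forall fun l => ?_
        exact (hK₀i N).aestronglyMeasurable.indicator
          (measurableSet_lt measurable_const continuous_abs.measurable)
      · refine Eventually.of_forall fun l => Eventually.of_forall fun x => ?_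
        refine (norm_indicator_le_norm_self _ _).trans ?_
        have := hK₀n x
        rw [Real.norm_eq_abs, abs_of_nonneg (by positivity)]
      · refine Eventually.of_forall fun x => ?_
        refine tendsto_const_nhds.congr' ?_
        filter_upwards [eventually_ge_atTop (|x| / δ)] with l hl
        rw [Set.indicator_of_notMem]
        simp only [Set.mem_ofPred_eq, not_lt]
        rwa [div_le_iff₀ hδ] at hl
    simpa using h0.const_mul κ⁻¹
  obtain ⟨l, hl1, hl⟩ := ((eventually_ge_atTop (1 : ℝ)).and (htail.eventually_le_const hη)).exists
  have hl0 : 0 < l := by linarith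
  refine ⟨fun y => (κ⁻¹ : ℂ) * k₀ (y / l), fun v => κ⁻¹ * (l * K₀ (l * v)), ?_, ?_, ?_, ?_, ?_, ?_,
    ?_, ?_⟩
  · fun_prop
  · have : HasCompactSupport fun y => k₀ (l⁻¹ • y) := hk₀s.comp_smul (inv_ne_zero hl0.ne')
    have e : (fun y => (κ⁻¹ : ℂ) * k₀ (y / l)) =
        (fun _ => (κ⁻¹ : ℂ)) * fun y => k₀ (l⁻¹ • y) := by
      funext y
      simp [div_eq_inv_mul]
    rw [e]
    exact this.mul_left
  · fun_prop
  · intro v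
    have := hK₀n (l * v)
    positivity
  · intro v
    have h1 := Measure.integral_comp_div (fun y => 𝐞 (-(y * (l * v))) • ((κ⁻¹ : ℂ) * k₀ y)) l
    have h2 : ∀ y : ℝ, y / l * (l * v) = y * v := fun y => by field_simp
    simp only [h2] at h1
    rw [h1, abs_of_pos hl0]
    push_cast
    rw [hK₀k, ← integral_const_mul]
    simp only [Circle.smul_def, smul_eq_mul, real_smul]
    rw [← integral_const_mul, ← integral_const_mul]
    congr 1
    funext y
    ring
  · intro n
    have h1 := ((hK₀i n).comp_mul_left' hl0.ne').const_mul (κ⁻¹ * l)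
    refine h1.mono' ((by fun_prop : Continuous fun v : ℝ =>
      (1 + |v|) ^ n * (κ⁻¹ * (l * K₀ (l * v)))).aestronglyMeasurable)
      (Eventually.of_forall fun v => ?_)
    have := hK₀n (l * v)
    rw [Real.norm_eq_abs, abs_of_nonneg (by positivity), abs_mul, abs_of_pos hl0]
    have h3 : |v| ≤ l * |v| := le_mul_of_one_le_left (abs_nonneg v) hl1
    calc (1 + |v|) ^ n * (κ⁻¹ * (l * K₀ (l * v)))
        ≤ (1 + l * |v|) ^ n * (κ⁻¹ * (l * K₀ (l * v))) := by gcongr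
      _ = _ := by ring
  · rw [integral_const_mul, integral_const_mul, Measure.integral_comp_mul_left, abs_of_pos
      (inv_pos.mpr hl0), smul_eq_mul, ← hκ]
    field_simp
  · refine le_trans ?_ hl
    have h1 := Measure.integral_comp_mul_left (fun x => Set.indicator {x | l * δ < |x|}
      (fun x => (1 + |x|) ^ N * K₀ x) x) l
    rw [abs_of_pos (inv_pos.mpr hl0), smul_eq_mul] at h1
    have h2 : ∫ x, Set.indicator {x | l * δ < |x|} (fun x => (1 + |x|) ^ N * K₀ x) x =
        ∫ x, l * Set.indicator {x | l * δ < |x|} (fun x => (1 + |x|) ^ N * K₀ x) (l * x) := by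
      rw [integral_const_mul, h1]
      field_simp
    rw [h2, ← integral_const_mul]
    have hI : Integrable (fun x => Set.indicator {x | l * δ < |x|}
        (fun x => (1 + |x|) ^ N * K₀ x) x) :=
      (hK₀i N).indicator (measurableSet_lt measurable_const continuous_abs.measurable)
    refine integral_mono_of_nonneg (Eventually.of_forall fun v => ?_)
      (((hI.comp_mul_left' hl0.ne').const_mul l).const_mul κ⁻¹) (Eventually.of_forall fun v => ?_)
    · refine Set.indicator_nonneg (fun v _ => ?_) v
      have := hK₀n (l * v)
      positivity
    · simp only [Set.indicator_apply, Set.mem_ofPred_eq, abs_mul, abs_of_pos hl0,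
        mul_lt_mul_iff_right₀ hl0]
      split_ifs with hv
      · have h3 : |v| ≤ l * |v| := le_mul_of_one_le_left (abs_nonneg v) hl1
        have := hK₀n (l * v)
        calc (1 + |v|) ^ N * (κ⁻¹ * (l * K₀ (l * v)))
            ≤ (1 + l * |v|) ^ N * (κ⁻¹ * (l * K₀ (l * v))) := by gcongr
          _ = _ := by ring
      · simp

end Kernel

section TauberianCore

open MeasureTheory Complex FourierTransform Real Set

theorem integrableOn_mul_exp_of_le {f : ℝ → ℂ} {C : ℝ} {N : ℕ}
    (hf : AEStronglyMeasurable f (volume.restrict (Ioi 0)))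
    (hb : ∀ t, 0 < t → ‖f t‖ ≤ C * (1 + t) ^ N) {z : ℂ} (hz : 0 < z.re) :
    IntegrableOn (fun t : ℝ => f t * cexp (-(z * t))) (Ioi 0) := by
  have h1 : IntegrableOn (fun t : ℝ => C * (N.factorial * (2 / z.re) ^ N * Real.exp (z.re / 2)) *
      Real.exp (-(z.re / 2) * t)) (Ioi 0) :=
    (integrableOn_exp_mul_Ioi (by linarith : -(z.re / 2) < 0) 0).const_mul _
  refine h1.mono' (hf.mul (by fun_prop : Continuous fun t : ℝ =>
    cexp (-(z * t))).aestronglyMeasurable) ?_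
  filter_upwards [ae_restrict_mem measurableSet_Ioi] with t ht
  have ht : 0 < t := ht
  have hC : 0 ≤ C := by
    have := (norm_nonneg _).trans (hb t ht)
    by_contra hC
    have h2 : 0 < (1 + t) ^ N := by positivity
    nlinarith
  rw [norm_mul, norm_exp]
  have h2 : (-(z * (t : ℂ))).re = -(z.re * t) := by simp
  rw [h2]
  have h3 := Real.pow_div_factorial_le_exp (z.re / 2 * (1 + t)) (by positivity) N
  rw [div_le_iff₀ (by positivity), mul_pow] at h3
  have h4 : (1 + t) ^ N ≤ N.factorial * (2 / z.re) ^ N * Real.exp (z.re / 2 * (1 + t)) := by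
    have h5 : (2 / z.re) ^ N * (z.re / 2) ^ N = 1 := by
      rw [← mul_pow]
      have : 2 / z.re * (z.re / 2) = 1 := by field_simp
      rw [this, one_pow]
    calc (1 + t) ^ N = (2 / z.re) ^ N * ((z.re / 2) ^ N * (1 + t) ^ N) := by
          rw [← mul_assoc, h5, one_mul]
      _ ≤ (2 / z.re) ^ N * (Real.exp (z.re / 2 * (1 + t)) * N.factorial) := by gcongr
      _ = _ := by ring
  calc ‖f t‖ * Real.exp (-(z.re * t))
      ≤ C * (N.factorial * (2 / z.re) ^ N * Real.exp (z.re / 2 * (1 + t))) *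
        Real.exp (-(z.re * t)) := by
          gcongr
          exact (hb t ht).trans (by gcongr)
    _ = C * (N.factorial * (2 / z.re) ^ N) *
        (Real.exp (z.re / 2 * (1 + t)) * Real.exp (-(z.re * t))) := by ring
    _ = C * (N.factorial * (2 / z.re) ^ N) *
        (Real.exp (z.re / 2) * Real.exp (-(z.re / 2) * t)) := by
          rw [← Real.exp_add, ← Real.exp_add]
          ring_nf
    _ = _ := by ring

theorem one_add_abs_le_mul (u v : ℝ) : 1 + |u - v| ≤ (1 + |u|) * (1 + |v|) := by
  have := abs_sub u v
  nlinarith [abs_nonneg u, abs_nonneg v]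

/-- The Riemann–Lebesgue step: if the Laplace transform of `Q` extends continuously to the closed
half-plane, then the averages of `Q` against translates of the kernel tend to zero. -/
theorem tendsto_integral_mul_kernel {Q : ℝ → ℂ} {C : ℝ} {N : ℕ} (hQ : Measurable Q)
    (hb : ∀ t, 0 < t → ‖Q t‖ ≤ C * (1 + t) ^ N) {G : ℂ → ℂ} (hG : ContinuousOn G {z | 0 ≤ z.re})
    (hlap : ∀ z : ℂ, 0 < z.re → ∫ t in Ioi (0 : ℝ), Q t * cexp (-(z * t)) = G z)
    {k : ℝ → ℂ} {K : ℝ → ℝ} (hk : Continuous k) (hks : HasCompactSupport k) (hK : Continuous K)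
    (hK0 : ∀ v, 0 ≤ K v) (hKk : ∀ v, (K v : ℂ) = ∫ y, 𝐞 (-(y * v)) • k y)
    (hKi : ∀ n : ℕ, Integrable fun v => (1 + |v|) ^ n * K v) :
    Tendsto (fun u : ℝ => ∫ t in Ioi (0 : ℝ), Q t * K (u - t)) atTop (𝓝 0) := by
  set g : ℝ → ℝ → ℂ := fun ε y => k y * G (ε - 2 * π * I * y) with hg
  have hki : Integrable k := hk.integrable_of_hasCompactSupport hks
  have hre : ∀ ε y : ℝ, ((ε : ℂ) - 2 * π * I * y).re = ε := by intro ε y; simp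
  have hfub : ∀ ε : ℝ, 0 < ε → ∀ u : ℝ, ∫ t in Ioi (0 : ℝ), Q t * cexp (-(ε * t)) * K (u - t) =
      ∫ y, 𝐞 (-(y * u)) • g ε y := by
    intro ε hε u
    have h1 : IntegrableOn (fun t : ℝ => Q t * cexp (-((ε : ℂ) * t))) (Ioi 0) :=
      integrableOn_mul_exp_of_le hQ.aestronglyMeasurable hb (by simpa using hε)
    have h2 := Integrable.mul_prod h1 hki
    have h3 : Integrable (fun p : ℝ × ℝ => 𝐞 (-(p.2 * (u - p.1))) •
        (Q p.1 * cexp (-((ε : ℂ) * p.1)) * k p.2)) ((volume.restrict (Ioi 0)).prod volume) := by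
      refine h2.norm.mono' ?_ (Eventually.of_forall fun p => by
        rw [Circle.smul_def, norm_smul, Circle.norm_coe, one_mul])
      have hc : Continuous fun p : ℝ × ℝ => ((𝐞 (-(p.2 * (u - p.1))) : Circle) : ℂ) :=
        continuous_subtype_val.comp (Real.continuous_fourierChar.comp (by fun_prop))
      exact hc.aestronglyMeasurable.mul h2.aestronglyMeasurable
    calc ∫ t in Ioi (0 : ℝ), Q t * cexp (-(ε * t)) * K (u - t)
        = ∫ t in Ioi (0 : ℝ), ∫ y, 𝐞 (-(y * (u - t))) •
            (Q t * cexp (-((ε : ℂ) * t)) * k y) := by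
          congr 1
          funext t
          rw [hKk, ← integral_const_mul]
          congr 1
          funext y
          simp only [Circle.smul_def, smul_eq_mul]
          ring
      _ = ∫ y, ∫ t in Ioi (0 : ℝ), 𝐞 (-(y * (u - t))) •
            (Q t * cexp (-((ε : ℂ) * t)) * k y) := integral_integral_swap h3
      _ = _ := by
          congr 1
          funext y
          simp only [hg]
          rw [← hlap _ (by rw [hre]; exact hε), ← integral_const_mul]
          simp only [Circle.smul_def, smul_eq_mul]
          rw [← integral_const_mul]
          congr 1
          funext t
          have : ((𝐞 (-(y * (u - t))) : Circle) : ℂ) * cexp (-((ε : ℂ) * t)) =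
              ((𝐞 (-(y * u)) : Circle) : ℂ) * cexp (-((ε - 2 * π * I * y) * t)) := by
            rw [Real.fourierChar_apply, Real.fourierChar_apply, ← Complex.exp_add,
              ← Complex.exp_add]
            congr 1
            push_cast
            ring
          linear_combination (Q t * k y) * this
  set ε : ℕ → ℝ := fun n => 1 / ((n : ℝ) + 1) with hε
  have hε0 : ∀ n, 0 < ε n := fun n => by positivity
  have hε1 : ∀ n, ε n ≤ 1 := fun n => by
    rw [hε]; simp only; rw [div_le_one (by positivity)]; linarith [(Nat.cast_nonneg n : (0:ℝ) ≤ n)]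
  have hεt : Tendsto ε atTop (𝓝 0) := tendsto_one_div_add_atTop_nhds_zero_nat
  -- the limit `ε → 0` on both sides
  have hgc : ∀ y, ContinuousOn (fun e : ℝ => g e y) (Ici 0) := by
    intro y
    refine continuousOn_const.mul (hG.comp (by fun_prop) fun e he => ?_)
    simpa [hre] using he
  obtain ⟨D, hD⟩ : ∃ D, ∀ e ∈ Icc (0 : ℝ) 1, ∀ y, ‖g e y‖ ≤ D := by
    have hcomp : IsCompact (Icc (0 : ℝ) 1 ×ˢ tsupport k) := isCompact_Icc.prod hks
    have hcont : ContinuousOn (fun p : ℝ × ℝ => g p.1 p.2) (Icc (0 : ℝ) 1 ×ˢ tsupport k) := by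
      refine (by fun_prop : Continuous fun p : ℝ × ℝ => k p.2).continuousOn.mul
        (hG.comp (by fun_prop) fun p hp => ?_)
      simpa [hre] using hp.1.1
    obtain ⟨D, hD⟩ := hcomp.exists_bound_of_continuousOn hcont
    refine ⟨max D 0, fun e he y => ?_⟩
    by_cases hy : y ∈ tsupport k
    · exact (hD (e, y) ⟨he, hy⟩).trans (le_max_left _ _)
    · simp [hg, image_eq_zero_of_notMem_tsupport hy]
  have hlim : ∀ u : ℝ, ∫ t in Ioi (0 : ℝ), Q t * K (u - t) = ∫ y, 𝐞 (-(y * u)) • g 0 y := by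
    intro u
    have hl : Tendsto (fun n => ∫ t in Ioi (0 : ℝ), Q t * cexp (-(ε n * t)) * K (u - t)) atTop
        (𝓝 (∫ t in Ioi (0 : ℝ), Q t * K (u - t))) := by
      refine tendsto_integral_of_dominated_convergence
        (fun t => C * (1 + |u|) ^ N * ((1 + |u - t|) ^ N * K (u - t))) (fun n => ?_) ?_
        (fun n => ?_) ?_
      · have : Measurable fun t : ℝ => Q t * cexp (-(ε n * t)) * K (u - t) := by fun_prop
        exact this.aestronglyMeasurable
      · exact (((hKi N).comp_sub_left u).const_mul _).integrableOn
      · filter_upwards [ae_restrict_mem measurableSet_Ioi] with t ht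
        have ht : 0 < t := ht
        have h1 : ‖cexp (-((ε n : ℂ) * t))‖ ≤ 1 := by
          rw [norm_exp]
          have : (-((ε n : ℂ) * t)).re = -(ε n * t) := by simp
          rw [this]
          exact Real.exp_le_one_iff.mpr (by have := mul_pos (hε0 n) ht; linarith)
        have h2 : (1 + t) ≤ (1 + |u|) * (1 + |u - t|) := by
          have := one_add_abs_le_mul u (u - t)
          rwa [sub_sub_cancel, abs_of_pos ht] at this
        have hC : 0 ≤ C := by
          have := (norm_nonneg _).trans (hb t ht)
          by_contra hC
          have h2 : 0 < (1 + t) ^ N := by positivity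
          nlinarith
        rw [norm_mul, norm_mul, norm_real, Real.norm_eq_abs, abs_of_nonneg (hK0 _)]
        calc ‖Q t‖ * ‖cexp (-((ε n : ℂ) * t))‖ * K (u - t)
            ≤ (C * ((1 + |u|) * (1 + |u - t|)) ^ N) * 1 * K (u - t) := by
              gcongr
              · exact hK0 _
              · exact (hb t ht).trans (by gcongr)
          _ = _ := by rw [mul_pow]; ring
      · refine Eventually.of_forall fun t => ?_
        have : Tendsto (fun n => cexp (-((ε n : ℂ) * t))) atTop (𝓝 (cexp (-(((0 : ℝ) : ℂ) * t)))) :=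
          (by fun_prop : Continuous fun e : ℝ => cexp (-((e : ℂ) * t))).continuousAt.tendsto.comp hεt
        simpa using (this.const_mul (Q t)).mul_const (K (u - t) : ℂ)
    have hr : Tendsto (fun n => ∫ y, 𝐞 (-(y * u)) • g (ε n) y) atTop
        (𝓝 (∫ y, 𝐞 (-(y * u)) • g 0 y)) := by
      have hci : Integrable (indicator (tsupport k) fun _ => D) :=
        (integrable_indicator_iff (isClosed_tsupport k).measurableSet).mpr
          (integrableOn_const (hks.isCompact.measure_lt_top.ne))
      refine tendsto_integral_of_dominated_convergence _ (fun n => ?_) hci (fun n => ?_) ?_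
      · have hc1 : Continuous fun y => g (ε n) y := by
          refine hk.mul (hG.comp_continuous (by fun_prop) fun y => ?_)
          simpa [hre] using (hε0 n).le
        exact ((continuous_subtype_val.comp (Real.continuous_fourierChar.comp (by fun_prop :
          Continuous fun y : ℝ => -(y * u)))).mul hc1).aestronglyMeasurable
      · refine Eventually.of_forall fun y => ?_
        by_cases hy : y ∈ tsupport k
        · rw [indicator_of_mem hy]
          rw [Circle.smul_def, norm_smul, Circle.norm_coe, one_mul]
          exact hD (ε n) ⟨(hε0 n).le, hε1 n⟩ y
        · rw [indicator_of_notMem hy]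
          simp [hg, image_eq_zero_of_notMem_tsupport hy]
      · refine Eventually.of_forall fun y => ?_
        have h1 : Tendsto ε atTop (𝓝[Ici 0] 0) :=
          tendsto_nhdsWithin_iff.mpr ⟨hεt, Eventually.of_forall fun n => (hε0 n).le⟩
        exact (((hgc y) 0 (by simp)).tendsto.comp h1).const_smul _
    exact tendsto_nhds_unique hl (hr.congr fun n => (hfub _ (hε0 n) u).symm)
  simp only [hlim]
  exact (Real.tendsto_integral_exp_smul_cocompact (g 0)).comp
    (tendsto_id.mono_right atTop_le_cocompact)

theorem integral_Ioi_eq_integral_indicator {f : ℝ → ℂ} (K : ℝ → ℝ) (u : ℝ) :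
    ∫ t in Ioi (0 : ℝ), f t * K (u - t) = ∫ v, (Ioi (0 : ℝ)).indicator f (u - v) * K v := by
  rw [← integral_indicator measurableSet_Ioi,
    ← integral_sub_left_eq_self (fun v => (Ioi (0 : ℝ)).indicator f (u - v) * K v) volume u]
  congr 1
  funext t
  simp only [sub_sub_cancel, indicator_apply]
  split_ifs <;> simp

theorem tendsto_sub_pow_div_pow (v : ℝ) {j M : ℕ} (hj : j ≤ M) :
    Tendsto (fun u : ℝ => (u - v) ^ j / u ^ M) atTop (𝓝 (if j = M then 1 else 0)) := by
  have h1 : Tendsto (fun u : ℝ => (u - v) / u) atTop (𝓝 1) := by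
    have : Tendsto (fun u : ℝ => 1 - v / u) atTop (𝓝 (1 - 0)) :=
      tendsto_const_nhds.sub (tendsto_const_nhds.div_atTop tendsto_id)
    rw [sub_zero] at this
    refine this.congr' ?_
    filter_upwards [eventually_gt_atTop 0] with u hu
    field_simp
  have h2 : Tendsto (fun u : ℝ => (u ^ (M - j))⁻¹) atTop (𝓝 (if j = M then 1 else 0)) := by
    split_ifs with h
    · simp [h]
    · exact tendsto_inv_atTop_zero.comp (tendsto_pow_atTop (by omega))
  have h3 := (h1.pow j).mul h2
  rw [one_pow, one_mul] at h3
  refine h3.congr' ?_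
  filter_upwards [eventually_gt_atTop 0] with u hu
  have : u ^ M = u ^ j * u ^ (M - j) := by rw [← pow_add]; congr 1; omega
  rw [this, div_pow]
  field_simp

/-- The average of a polynomial of degree `M` about `u` has the same leading term as the polynomial
at `u`. -/
theorem tendsto_integral_polynomial_mul_kernel {M : ℕ} (c : ℕ → ℂ) {K : ℝ → ℝ}
    (hK : Continuous K) (hK0 : ∀ v, 0 ≤ K v) (hK1 : ∫ v, K v = 1)
    (hKi : ∀ n : ℕ, Integrable fun v => (1 + |v|) ^ n * K v) :
    Tendsto (fun u : ℝ => (∫ t in Ioi (0 : ℝ), (∑ j ∈ Finset.range (M + 1), c j * (t : ℂ) ^ j) *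
      K (u - t)) / (u : ℂ) ^ M) atTop (𝓝 (c M)) := by
  have hfin : ∀ t : ℝ, ‖∑ j ∈ Finset.range (M + 1), c j * (t : ℂ) ^ j‖ ≤
      (∑ j ∈ Finset.range (M + 1), ‖c j‖) * (1 + |t|) ^ M := by
    intro t
    rw [Finset.sum_mul]
    refine (norm_sum_le _ _).trans (Finset.sum_le_sum fun j hj => ?_)
    rw [norm_mul, norm_pow, norm_real, Real.norm_eq_abs]
    have h1 : |t| ^ j ≤ (1 + |t|) ^ j := by gcongr; linarith
    have h2 : (1 + |t|) ^ j ≤ (1 + |t|) ^ M :=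
      pow_le_pow_right₀ (by linarith [abs_nonneg t]) (by simp at hj; omega)
    gcongr
    exact h1.trans h2
  set S := ∑ j ∈ Finset.range (M + 1), ‖c j‖
  have hS : 0 ≤ S := Finset.sum_nonneg fun _ _ => norm_nonneg _
  have hmain : Tendsto (fun u : ℝ => ∫ v, (Ioi (0 : ℝ)).indicator
      (fun t : ℝ => ∑ j ∈ Finset.range (M + 1), c j * (t : ℂ) ^ j) (u - v) * K v / (u : ℂ) ^ M)
      atTop (𝓝 (∫ v, c M * K v)) := by
    refine tendsto_integral_filter_of_dominated_convergence
      (fun v => S * 2 ^ M * ((1 + |v|) ^ M * K v)) ?_ ?_ ((hKi M).const_mul _) ?_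
    · refine Eventually.of_forall fun u => ?_
      have h1 : Measurable ((Ioi (0 : ℝ)).indicator
          (fun t : ℝ => ∑ j ∈ Finset.range (M + 1), c j * (t : ℂ) ^ j)) :=
        (by fun_prop : Continuous fun t : ℝ => ∑ j ∈ Finset.range (M + 1),
          c j * (t : ℂ) ^ j).measurable.indicator measurableSet_Ioi
      exact (((h1.comp (measurable_const.sub measurable_id)).mul
        (measurable_ofReal.comp hK.measurable)).div_const _).aestronglyMeasurable
    · filter_upwards [eventually_ge_atTop 1] with u hu
      refine Eventually.of_forall fun v => ?_
      rw [norm_div, norm_mul, norm_pow, norm_real, norm_real, Real.norm_eq_abs, Real.norm_eq_abs,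
        abs_of_nonneg (hK0 v), abs_of_nonneg (by linarith : 0 ≤ u), div_le_iff₀ (by positivity)]
      have h1 := (norm_indicator_le_norm_self (s := Ioi (0 : ℝ))
        (fun t : ℝ => ∑ j ∈ Finset.range (M + 1), c j * (t : ℂ) ^ j) (u - v)).trans (hfin (u - v))
      have h2 := one_add_abs_le_mul u v
      rw [abs_of_nonneg (by linarith : 0 ≤ u)] at h2
      have h3 : 1 + |u - v| ≤ 2 * u * (1 + |v|) := h2.trans (by gcongr; linarith)
      calc _ ≤ S * (2 * u * (1 + |v|)) ^ M * K v := by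
            gcongr
            · exact hK0 v
            · exact h1.trans (by gcongr)
        _ = _ := by rw [mul_pow, mul_pow]; ring
    · refine Eventually.of_forall fun v => ?_
      have h1 : Tendsto (fun u : ℝ => ∑ j ∈ Finset.range (M + 1),
          c j * (((u - v) ^ j / u ^ M : ℝ) : ℂ)) atTop
          (𝓝 (∑ j ∈ Finset.range (M + 1), c j * ((if j = M then 1 else 0 : ℝ) : ℂ))) := by
        refine tendsto_finsetSum _ fun j hj => Tendsto.const_mul _ ?_
        exact (continuous_ofReal.tendsto _).comp
          (tendsto_sub_pow_div_pow v (by simp at hj; omega))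
      have h2 : ∑ j ∈ Finset.range (M + 1), c j * ((if j = M then 1 else 0 : ℝ) : ℂ) = c M := by
        rw [Finset.sum_eq_single M] <;> simp +contextual
      rw [h2] at h1
      refine (h1.mul_const (K v : ℂ)).congr' ?_
      filter_upwards [eventually_gt_atTop v] with u hu
      rw [indicator_of_mem (by simpa using hu), mul_div_right_comm, Finset.sum_div]
      congr 1
      refine Finset.sum_congr rfl fun j _ => ?_
      push_cast
      ring
  rw [integral_const_mul, integral_complex_ofReal, hK1, ofReal_one, mul_one] at hmain
  refine hmain.congr fun u => ?_
  rw [integral_Ioi_eq_integral_indicator, ← integral_div]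

/-- A Tauberian theorem of Wiener–Ikehara type for Laplace transforms with a multiple pole at the
origin. With `B t = e ^ (-t) A t` and `P` the polynomial whose Laplace transform is the polar part,
the averages of `B - P` against a kernel with compactly supported Fourier transform tend to `0`, so
that those of `B` are asymptotic to `γ u ^ M`. The monotonicity of `A` turns the averages into `B`
itself. -/
theorem tendsto_div_pow_of_laplace {A : ℝ → ℝ} (hA : Monotone A) (hA0 : ∀ t, 0 ≤ A t) {M N : ℕ}
    {C : ℝ} (hb : ∀ t, 0 < t → Real.exp (-t) * A t ≤ C * (1 + t) ^ N) {G : ℂ → ℂ}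
    (hG : ContinuousOn G {z | 0 ≤ z.re}) {c : ℕ → ℂ} {γ : ℝ} (hγ : c M = γ * M.factorial)
    (hlap : ∀ z : ℂ, 0 < z.re → ∫ t in Ioi (0 : ℝ), ((Real.exp (-t) * A t : ℝ) : ℂ) *
      cexp (-(z * t)) = (∑ j ∈ Finset.range (M + 1), c j / z ^ (j + 1)) + G z) :
    Tendsto (fun u => Real.exp (-u) * A u / u ^ M) atTop (𝓝 γ) := by
  set B : ℝ → ℝ := fun t => Real.exp (-t) * A t with hB
  have hB0 : ∀ t, 0 ≤ B t := fun t => mul_nonneg (Real.exp_pos _).le (hA0 t)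
  have hBm : Measurable B := by
    have := hA.measurable
    fun_prop
  set P : ℝ → ℂ := fun t => ∑ j ∈ Finset.range (M + 1), c j / j.factorial * (t : ℂ) ^ j with hP
  have hPb : ∀ t, 0 < t → ‖P t‖ ≤ (∑ j ∈ Finset.range (M + 1), ‖c j‖) * (1 + t) ^ M := by
    intro t ht
    rw [hP, Finset.sum_mul]
    refine (norm_sum_le _ _).trans (Finset.sum_le_sum fun j hj => ?_)
    rw [norm_mul, norm_pow, norm_real, Real.norm_eq_abs, abs_of_pos ht, norm_div, Complex.norm_natCast]
    have h1 : t ^ j ≤ (1 + t) ^ j := by gcongr; linarith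
    have h2 : (1 + t) ^ j ≤ (1 + t) ^ M :=
      pow_le_pow_right₀ (by linarith) (by simp at hj; omega)
    have h3 : ‖c j‖ / (j.factorial : ℝ) ≤ ‖c j‖ :=
      div_le_self (norm_nonneg _) (by exact_mod_cast j.factorial_pos)
    gcongr
    exact h1.trans h2
  have hcomb : ∀ t, 0 < t → ‖(B t : ℂ) - P t‖ ≤
      (|C| + ∑ j ∈ Finset.range (M + 1), ‖c j‖) * (1 + t) ^ (max N M) := by
    intro t ht
    refine (norm_sub_le _ _).trans ?_
    rw [norm_real, Real.norm_eq_abs, abs_of_nonneg (hB0 t), add_mul]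
    have h1 : (1 : ℝ) ≤ 1 + t := by linarith
    have hS : 0 ≤ ∑ j ∈ Finset.range (M + 1), ‖c j‖ := Finset.sum_nonneg fun _ _ => norm_nonneg _
    refine add_le_add ((hb t ht).trans ?_) ((hPb t ht).trans ?_)
    · calc C * (1 + t) ^ N ≤ |C| * (1 + t) ^ N := by gcongr; exact le_abs_self C
        _ ≤ _ := by gcongr; exact le_max_left _ _
    · gcongr
      exact le_max_right _ _
  have hlapQ : ∀ z : ℂ, 0 < z.re →
      ∫ t in Ioi (0 : ℝ), ((B t : ℂ) - P t) * cexp (-(z * t)) = G z := by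
    intro z hz
    have hz0 : z ≠ 0 := by rintro rfl; simp at hz
    have hi1 : IntegrableOn (fun t : ℝ => (B t : ℂ) * cexp (-(z * t))) (Ioi 0) :=
      integrableOn_mul_exp_of_le (by fun_prop) (C := C) (N := N) (fun t ht => by
        rw [norm_real, Real.norm_eq_abs, abs_of_nonneg (hB0 t)]; exact hb t ht) hz
    have hij : ∀ j : ℕ, IntegrableOn (fun t : ℝ => (t : ℂ) ^ j * cexp (-(z * t))) (Ioi 0) :=
      fun j => integrableOn_mul_exp_of_le (C := 1) (N := j) (by fun_prop) (fun t ht => by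
        rw [norm_pow, norm_real, Real.norm_eq_abs, abs_of_pos ht, one_mul]
        gcongr
        linarith) hz
    have hval : ∀ j : ℕ, ∫ t in Ioi (0 : ℝ), (t : ℂ) ^ j * cexp (-(z * t)) =
        j.factorial / z ^ (j + 1) := by
      intro j
      induction j with
      | zero =>
        have := integral_exp_mul_complex_Ioi (a := -z) (by simpa using hz) 0
        simpa [neg_mul] using this
      | succ j ih =>
        have hd : ∀ t ∈ Ioi (0 : ℝ), HasDerivAt (fun t : ℝ => (t : ℂ) ^ (j + 1) * cexp (-(z * t)))
            (((j + 1 : ℕ) : ℂ) * ((t : ℂ) ^ j * cexp (-(z * t))) -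
              z * ((t : ℂ) ^ (j + 1) * cexp (-(z * t)))) t := by
          intro t _
          have h1 : HasDerivAt (fun w : ℂ => w ^ (j + 1) * cexp (-(z * w)))
              (((j + 1 : ℕ) : ℂ) * ((t : ℂ) ^ j * cexp (-(z * t))) -
              z * ((t : ℂ) ^ (j + 1) * cexp (-(z * t)))) (t : ℂ) := by
            have h2 := (hasDerivAt_pow (j + 1) (t : ℂ)).mul
              (((hasDerivAt_id (t : ℂ)).const_mul z).neg.cexp)
            refine h2.congr_deriv ?_
            simp only [id, add_tsub_cancel_right, Pi.neg_apply]
            ring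
          exact h1.comp_ofReal
        have hint := ((hij j).const_mul ((j + 1 : ℕ) : ℂ)).sub ((hij (j + 1)).const_mul z)
        have hz1 := integral_Ioi_of_hasDerivAt_of_tendsto (by fun_prop) hd hint
          (tendsto_zero_of_hasDerivAt_of_integrableOn_Ioi hd hint (hij (j + 1)))
        rw [integral_sub ((hij j).const_mul _) ((hij (j + 1)).const_mul _), integral_const_mul,
          integral_const_mul, ih] at hz1
        simp only [ofReal_zero, ne_eq, Nat.succ_ne_zero, not_false_eq_true, zero_pow, zero_mul,
          sub_zero] at hz1
        rw [Nat.factorial_succ, eq_div_iff (pow_ne_zero _ hz0)]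
        have h3 : z ^ (j + 1) ≠ 0 := pow_ne_zero _ hz0
        field_simp at hz1
        push_cast at hz1 ⊢
        linear_combination -hz1
    have hiP : IntegrableOn (fun t : ℝ => P t * cexp (-(z * t))) (Ioi 0) :=
      integrableOn_mul_exp_of_le (by fun_prop) hPb hz
    have hPval : ∫ t in Ioi (0 : ℝ), P t * cexp (-(z * t)) =
        ∑ j ∈ Finset.range (M + 1), c j / z ^ (j + 1) := by
      simp only [hP, Finset.sum_mul, mul_assoc]
      rw [integral_finsetSum _ fun j _ => (hij j).const_mul _]
      refine Finset.sum_congr rfl fun j _ => ?_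
      rw [integral_const_mul, hval]
      have : (j.factorial : ℂ) ≠ 0 := by exact_mod_cast j.factorial_ne_zero
      field_simp
    simp only [sub_mul]
    rw [integral_sub hi1 hiP, hPval, hlap z hz]
    ring
  -- the averages of `B`: by the Riemann–Lebesgue step those of `B - P` are `o(1)`, and those of `P`
  -- are asymptotic to `γ u ^ M`
  have hJ : ∀ {k : ℝ → ℂ} {K : ℝ → ℝ}, Continuous k → HasCompactSupport k → Continuous K →
      (∀ v, 0 ≤ K v) → (∀ v, (K v : ℂ) = ∫ y, 𝐞 (-(y * v)) • k y) →
      (∀ n : ℕ, Integrable fun v => (1 + |v|) ^ n * K v) → ∫ v, K v = 1 →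
      (∀ u, Integrable fun v => (Ioi (0 : ℝ)).indicator B (u - v) * K v) ∧
      Tendsto (fun u : ℝ => (∫ v, (Ioi (0 : ℝ)).indicator B (u - v) * K v) / u ^ M) atTop
        (𝓝 γ) := by
    intro k K hk hks hK hK0 hKk hKi hK1
    have hBi : ∀ u, Integrable fun v => (Ioi (0 : ℝ)).indicator B (u - v) * K v := by
      intro u
      refine ((hKi N).const_mul (|C| * (1 + |u|) ^ N)).mono' ?_ (Eventually.of_forall fun v => ?_)
      · exact (((hBm.indicator measurableSet_Ioi).comp (measurable_const.sub measurable_id)).mul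
          hK.measurable).aestronglyMeasurable
      · have h0 : 0 ≤ (Ioi (0 : ℝ)).indicator B (u - v) := indicator_nonneg (fun t _ => hB0 t) _
        have hKv := hK0 v
        rw [Real.norm_eq_abs, abs_of_nonneg (mul_nonneg h0 hKv)]
        have : (Ioi (0 : ℝ)).indicator B (u - v) ≤ |C| * ((1 + |u|) * (1 + |v|)) ^ N := by
          rw [indicator_apply]
          split_ifs with h
          · have h' : 0 < u - v := h
            have h2 := one_add_abs_le_mul u v
            rw [abs_of_pos h'] at h2
            calc B (u - v) ≤ C * (1 + (u - v)) ^ N := hb _ h'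
              _ ≤ |C| * (1 + (u - v)) ^ N := by gcongr; exact le_abs_self C
              _ ≤ _ := by gcongr
          · positivity
        calc _ ≤ |C| * ((1 + |u|) * (1 + |v|)) ^ N * K v := by gcongr
          _ = _ := by rw [mul_pow]; ring
    refine ⟨hBi, ?_⟩
    have h1 := tendsto_integral_mul_kernel (Q := fun t => (B t : ℂ) - P t) (by fun_prop) hcomb hG
      hlapQ hk hks hK hK0 hKk hKi
    have h2 := tendsto_integral_polynomial_mul_kernel (M := M) (fun j => c j / j.factorial) hK hK0
      hK1 hKi
    have h3 : Tendsto (fun u : ℝ => ((u : ℂ) ^ M)⁻¹ * ∫ t in Ioi (0 : ℝ),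
        ((B t : ℂ) - P t) * K (u - t)) atTop (𝓝 0) := by
      rw [tendsto_zero_iff_norm_tendsto_zero]
      refine squeeze_zero' (Eventually.of_forall fun u => norm_nonneg _) ?_
        (tendsto_zero_iff_norm_tendsto_zero.mp h1)
      filter_upwards [eventually_ge_atTop 1] with u hu
      rw [norm_mul, norm_inv, norm_pow, norm_real, Real.norm_eq_abs, abs_of_nonneg (by linarith)]
      exact mul_le_of_le_one_left (norm_nonneg _) (inv_le_one_of_one_le₀ (one_le_pow₀ hu))
    have h4 := h3.add h2
    have hMf : (M.factorial : ℂ) ≠ 0 := by exact_mod_cast M.factorial_ne_zero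
    rw [zero_add, hγ, mul_div_assoc, div_self hMf, mul_one] at h4
    have h5 := (continuous_re.tendsto _).comp h4
    rw [ofReal_re] at h5
    refine h5.congr fun u => ?_
    have e1 : ∫ t in Ioi (0 : ℝ), ((B t : ℂ) - P t) * K (u - t) =
        (∫ t in Ioi (0 : ℝ), (B t : ℂ) * K (u - t)) - ∫ t in Ioi (0 : ℝ), P t * K (u - t) := by
      have hiB : IntegrableOn (fun t : ℝ => (B t : ℂ) * K (u - t)) (Ioi 0) := by
        rw [← integrable_indicator_iff measurableSet_Ioi]
        refine ((hBi u).comp_sub_left u).ofReal.congr (Eventually.of_forall fun t => ?_)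
        simp only [sub_sub_cancel, indicator_apply]
        split_ifs <;> simp
      have hiP : IntegrableOn (fun t : ℝ => P t * K (u - t)) (Ioi 0) := by
        refine (((hKi M).comp_sub_left u).const_mul
          ((∑ j ∈ Finset.range (M + 1), ‖c j‖) * (1 + |u|) ^ M)).integrableOn.mono'
          (by fun_prop) ?_
        filter_upwards [ae_restrict_mem measurableSet_Ioi] with t ht
        have ht : 0 < t := ht
        have h2 : (1 + t) ≤ (1 + |u|) * (1 + |u - t|) := by
          have := one_add_abs_le_mul u (u - t)
          rwa [sub_sub_cancel, abs_of_pos ht] at this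
        have hS : 0 ≤ ∑ j ∈ Finset.range (M + 1), ‖c j‖ :=
          Finset.sum_nonneg fun _ _ => norm_nonneg _
        rw [norm_mul, norm_real, Real.norm_eq_abs, abs_of_nonneg (hK0 _)]
        calc ‖P t‖ * K (u - t) ≤ (∑ j ∈ Finset.range (M + 1), ‖c j‖) *
              ((1 + |u|) * (1 + |u - t|)) ^ M * K (u - t) := by
              gcongr
              · exact hK0 _
              · exact (hPb t ht).trans (by gcongr)
          _ = _ := by rw [mul_pow]; ring
      rw [← integral_sub hiB hiP]
      simp only [sub_mul]
    have e2 : ∫ t in Ioi (0 : ℝ), (B t : ℂ) * K (u - t) =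
        ((∫ v, (Ioi (0 : ℝ)).indicator B (u - v) * K v : ℝ) : ℂ) := by
      rw [integral_Ioi_eq_integral_indicator (f := fun t => (B t : ℂ)), ← integral_complex_ofReal]
      congr 1
      funext v
      simp only [indicator_apply]
      split_ifs <;> simp
    simp only [Function.comp_apply]
    rw [e1, e2, ← ofReal_pow, inv_mul_eq_div, sub_div]
    rw [show (fun t : ℝ => P t * (K (u - t) : ℂ)) = fun t : ℝ => (∑ j ∈ Finset.range (M + 1),
      c j / j.factorial * (t : ℂ) ^ j) * (K (u - t) : ℂ) from rfl, sub_add_cancel, ← ofReal_div,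
      ofReal_re]
  -- As `A` is monotone, `B` decreases by at most a factor `e ^ (2 δ)` on an interval of length `2
  -- δ`. For a kernel concentrated on `|v| ≤ δ` this compares `B` with its averages `J` on both
  -- sides; the upper bound for `J` needs an a priori bound for `B`, to control the tail of the
  -- kernel.
  have hup : ∀ δ > 0, ∀ η > 0, ∃ J : ℝ → ℝ, Tendsto (fun u => J u / u ^ M) atTop (𝓝 γ) ∧
      (∀ u > 0, B u * (Real.exp (-(2 * δ)) * (1 - η)) ≤ J (u + δ)) ∧
      ∀ C₁, (∀ t > 0, B t ≤ C₁ * (1 + t) ^ M) → ∀ u > 0,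
        J u ≤ B (u + δ) * Real.exp (2 * δ) + C₁ * (1 + u) ^ M * η := by
    intro δ hδ η hη
    obtain ⟨k, K, hk, hks, hK, hK0, hKk, hKi, hK1, hKη⟩ := exists_concentrated_kernel M hδ hη
    obtain ⟨hBi, hJt⟩ := hJ hk hks hK hK0 hKk hKi hK1
    have hK1i : Integrable K := by simpa using hKi 0
    have htail : Integrable (indicator {v | δ < |v|} (fun v => (1 + |v|) ^ M * K v)) :=
      (hKi M).indicator (measurableSet_lt measurable_const continuous_abs.measurable)
    refine ⟨fun u => ∫ v, (Ioi (0 : ℝ)).indicator B (u - v) * K v, hJt, fun u hu => ?_,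
      fun C₁ hC₁ u hu => ?_⟩
    · calc B u * (Real.exp (-(2 * δ)) * (1 - η))
          ≤ B u * (Real.exp (-(2 * δ)) * (1 - ∫ v, indicator {v | δ < |v|}
              (fun v => (1 + |v|) ^ M * K v) v)) := by
            have := hB0 u
            gcongr
        _ = ∫ v, B u * (Real.exp (-(2 * δ)) * (K v - indicator {v | δ < |v|}
              (fun v => (1 + |v|) ^ M * K v) v)) := by
            rw [integral_const_mul, integral_const_mul, integral_sub hK1i htail, hK1]
        _ ≤ _ := by
            refine integral_mono (((hK1i.sub htail).const_mul _).const_mul _) (hBi (u + δ))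
              fun v => ?_
            have hKv := hK0 v
            have h0 : 0 ≤ (Ioi (0 : ℝ)).indicator B (u + δ - v) :=
              indicator_nonneg (fun t _ => hB0 t) _
            by_cases hv : δ < |v|
            · rw [indicator_of_mem (by simpa using hv)]
              refine le_trans ?_ (mul_nonneg h0 hKv)
              have h1 : K v ≤ (1 + |v|) ^ M * K v :=
                le_mul_of_one_le_left hKv (one_le_pow₀ (by linarith [abs_nonneg v]))
              exact mul_nonpos_of_nonneg_of_nonpos (hB0 u)
                (mul_nonpos_of_nonneg_of_nonpos (Real.exp_pos _).le (by linarith))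
            · rw [indicator_of_notMem (by simpa using hv), sub_zero, ← mul_assoc]
              have hv' := abs_le.mp (not_lt.mp hv)
              have hpos : u + δ - v ∈ Ioi (0 : ℝ) := by
                simp only [mem_Ioi]; linarith [hv'.2]
              simp only [indicator_of_mem hpos]
              gcongr
              simp only [hB]
              have h1 : A u ≤ A (u + δ - v) := hA (by linarith [hv'.2])
              have h2 : Real.exp (-u) * Real.exp (-(2 * δ)) ≤ Real.exp (-(u + δ - v)) := by
                rw [← Real.exp_add]
                exact Real.exp_le_exp.mpr (by linarith [hv'.1])
              calc Real.exp (-u) * A u * Real.exp (-(2 * δ))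
                  = Real.exp (-u) * Real.exp (-(2 * δ)) * A u := by ring
                _ ≤ _ := mul_le_mul h2 h1 (hA0 u) (Real.exp_pos _).le
    · have hC₁0 : 0 ≤ C₁ := by
        have h1 := (hB0 u).trans (hC₁ u hu)
        by_contra hC
        have h2 : 0 < (1 + u) ^ M := by positivity
        nlinarith
      calc ∫ v, (Ioi (0 : ℝ)).indicator B (u - v) * K v
          ≤ ∫ v, (B (u + δ) * Real.exp (2 * δ) * K v + C₁ * (1 + u) ^ M *
              indicator {v | δ < |v|} (fun v => (1 + |v|) ^ M * K v) v) := by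
            refine integral_mono (hBi u) ((hK1i.const_mul _).add (htail.const_mul _)) fun v => ?_
            have hKv := hK0 v
            simp only
            by_cases hv : δ < |v|
            · rw [indicator_of_mem (s := {v | δ < |v|}) (by simpa using hv)]
              have h1 : (Ioi (0 : ℝ)).indicator B (u - v) ≤ C₁ * ((1 + u) * (1 + |v|)) ^ M := by
                rw [indicator_apply]
                split_ifs with h
                · have h' : 0 < u - v := h
                  have h2 := one_add_abs_le_mul u v
                  rw [abs_of_pos h', abs_of_pos hu] at h2
                  exact (hC₁ _ h').trans (by gcongr)
                · positivity
              have h3 : 0 ≤ B (u + δ) * Real.exp (2 * δ) * K v :=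
                mul_nonneg (mul_nonneg (hB0 _) (Real.exp_pos _).le) hKv
              have h4 : (Ioi (0 : ℝ)).indicator B (u - v) * K v ≤
                  C₁ * ((1 + u) * (1 + |v|)) ^ M * K v := by gcongr
              rw [mul_pow] at h4
              linarith
            · rw [indicator_of_notMem (s := {v | δ < |v|}) (by simpa using hv), mul_zero, add_zero]
              have hv' := abs_le.mp (not_lt.mp hv)
              gcongr
              rw [indicator_apply]
              split_ifs with h
              · simp only [hB]
                have h1 : A (u - v) ≤ A (u + δ) := hA (by linarith [hv'.1])
                have h2 : Real.exp (-(u - v)) ≤ Real.exp (-(u + δ)) * Real.exp (2 * δ) := by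
                  rw [← Real.exp_add]
                  exact Real.exp_le_exp.mpr (by linarith [hv'.2])
                calc _ ≤ Real.exp (-(u + δ)) * Real.exp (2 * δ) * A (u + δ) :=
                      mul_le_mul h2 h1 (hA0 _) (by positivity)
                  _ = _ := by ring
              · exact mul_nonneg (hB0 _) (Real.exp_pos _).le
        _ = B (u + δ) * Real.exp (2 * δ) + C₁ * (1 + u) ^ M *
              ∫ v, indicator {v | δ < |v|} (fun v => (1 + |v|) ^ M * K v) v := by
            rw [integral_add (hK1i.const_mul _) (htail.const_mul _), integral_const_mul,
              integral_const_mul, hK1, mul_one]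
        _ ≤ _ := by gcongr
  have hshift : ∀ (J : ℝ → ℝ) (d : ℝ), Tendsto (fun u => J u / u ^ M) atTop (𝓝 γ) →
      Tendsto (fun u => J (u + d) / u ^ M) atTop (𝓝 γ) := by
    intro J d h
    have h1 := h.comp (tendsto_atTop_add_const_right atTop d tendsto_id)
    have h2 := tendsto_sub_pow_div_pow (-d) (le_refl M)
    simp only [if_true, sub_neg_eq_add] at h2
    have h3 := h1.mul h2
    rw [mul_one] at h3
    refine h3.congr' ?_
    filter_upwards [eventually_gt_atTop (-d)] with u hu
    have : u + d ≠ 0 := by linarith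
    simp only [Function.comp_apply, id]
    field_simp
  have hγ0 : 0 ≤ γ := by
    obtain ⟨J, hJ1, hJ2, -⟩ := hup 1 one_pos 1 one_pos
    refine ge_of_tendsto (hshift J 1 hJ1) ?_
    filter_upwards [eventually_gt_atTop 0] with u hu
    have := hJ2 u hu
    simp only [sub_self, mul_zero] at this
    positivity
  -- the a priori bound: the lower bound for `J` needs none, and with `δ = 1`, `η = 1 / 2` it gives `B
  -- = O((1 + t) ^ M)`
  obtain ⟨C₁, hC₁⟩ : ∃ C₁, ∀ t > 0, B t ≤ C₁ * (1 + t) ^ M := by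
    obtain ⟨J, hJ1, hJ2, -⟩ := hup 1 one_pos (1 / 2) (by norm_num)
    have h1 := (hshift J 1 hJ1).eventually_lt_const (lt_add_one γ)
    obtain ⟨u₀, hu₀⟩ := eventually_atTop.mp (h1.and (eventually_ge_atTop 1))
    have hu₀1 : 1 ≤ u₀ := (hu₀ u₀ le_rfl).2
    have hA00 := hA0 u₀
    refine ⟨max (A u₀) ((γ + 1) * (2 * Real.exp 2)), fun t ht => ?_⟩
    have ht1 : 1 ≤ (1 + t) ^ M := one_le_pow₀ (by linarith)
    rcases le_total t u₀ with h | h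
    · calc B t ≤ 1 * A u₀ := by
            exact mul_le_mul (Real.exp_le_one_iff.mpr (by linarith)) (hA h) (hA0 t) zero_le_one
        _ ≤ max (A u₀) ((γ + 1) * (2 * Real.exp 2)) * 1 := by
            rw [one_mul, mul_one]; exact le_max_left _ _
        _ ≤ _ := by gcongr
    · have h2 := (hu₀ t h).1
      have h3 := hJ2 t ht
      rw [div_lt_iff₀ (by positivity)] at h2
      have h4 : B t * (Real.exp (-(2 * 1)) * (1 - 1 / 2)) ≤ (γ + 1) * t ^ M := h3.trans h2.le
      have h5 : Real.exp (-(2 * 1)) * (2 * Real.exp 2) = 2 := by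
        have : Real.exp (-(2 * 1)) * Real.exp 2 = 1 := by rw [← Real.exp_add]; norm_num
        linear_combination 2 * this
      calc B t = B t * (Real.exp (-(2 * 1)) * (1 - 1 / 2)) * (2 * Real.exp 2) := by
            linear_combination (-(1 / 2) * B t) * h5
        _ ≤ (γ + 1) * t ^ M * (2 * Real.exp 2) := by gcongr
        _ = (γ + 1) * (2 * Real.exp 2) * t ^ M := by ring
        _ ≤ max (A u₀) ((γ + 1) * (2 * Real.exp 2)) * (1 + t) ^ M := by
            gcongr
            · exact le_max_right _ _
            · linarith
  -- both comparisons with `δ = η = e`, where `e → 0`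
  have hseq : Tendsto (fun n : ℕ => 1 / ((n : ℝ) + 1)) atTop (𝓝 0) :=
    tendsto_one_div_add_atTop_nhds_zero_nat
  refine tendsto_order.mpr ⟨fun a ha => ?_, fun a ha => ?_⟩
  · have hl : Tendsto (fun e : ℝ => (γ - C₁ * 2 ^ M * e - e) * Real.exp (-(2 * e))) (𝓝 0)
        (𝓝 ((γ - C₁ * 2 ^ M * 0 - 0) * Real.exp (-(2 * 0)))) :=
      (by fun_prop : Continuous fun e : ℝ =>
        (γ - C₁ * 2 ^ M * e - e) * Real.exp (-(2 * e))).tendsto 0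
    simp only [mul_zero, sub_zero, neg_zero, Real.exp_zero, mul_one] at hl
    obtain ⟨n, hn⟩ := ((hl.comp hseq).eventually_const_lt ha).exists
    simp only [Function.comp_apply] at hn
    set e : ℝ := 1 / ((n : ℝ) + 1)
    have he : 0 < e := by positivity
    obtain ⟨J, hJ1, -, hJ3⟩ := hup e he e he
    have h1 := (hshift J (-e) hJ1).eventually_const_lt (sub_lt_self γ he)
    filter_upwards [h1, eventually_gt_atTop (1 + e)] with u hu1 hu2
    have hu0 : 0 < u := by linarith
    have h2 := hJ3 C₁ hC₁ (u + -e) (by linarith)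
    rw [neg_add_cancel_right] at h2
    rw [lt_div_iff₀ (by positivity)] at hu1
    refine hn.trans_le ?_
    change _ ≤ B u / u ^ M
    rw [le_div_iff₀ (by positivity)]
    have hC₁0 : 0 ≤ C₁ := by
      have h1 := (hB0 1).trans (hC₁ 1 one_pos)
      by_contra hC
      have h2 : (0 : ℝ) < (1 + 1) ^ M := by positivity
      nlinarith
    have h3 : C₁ * (1 + (u + -e)) ^ M * e ≤ C₁ * 2 ^ M * e * u ^ M := by
      calc C₁ * (1 + (u + -e)) ^ M * e ≤ C₁ * (2 * u) ^ M * e := by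
            gcongr
            · linarith
            · linarith
        _ = _ := by rw [mul_pow]; ring
    have h4 : (γ - C₁ * 2 ^ M * e - e) * u ^ M ≤ B u * Real.exp (2 * e) := by
      nlinarith
    calc (γ - C₁ * 2 ^ M * e - e) * Real.exp (-(2 * e)) * u ^ M
        = (γ - C₁ * 2 ^ M * e - e) * u ^ M * Real.exp (-(2 * e)) := by ring
      _ ≤ B u * Real.exp (2 * e) * Real.exp (-(2 * e)) := by gcongr
      _ = B u := by rw [mul_assoc, ← Real.exp_add]; simp
  · have hl : Tendsto (fun e : ℝ => (γ + e) * (Real.exp (2 * e) / (1 - e))) (𝓝 0)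
        (𝓝 ((γ + 0) * (Real.exp (2 * 0) / (1 - 0)))) := by
      refine Tendsto.mul (Continuous.tendsto (by fun_prop) 0) (Tendsto.div ?_
        (Continuous.tendsto (by fun_prop) 0) (by norm_num))
      exact (by fun_prop : Continuous fun e : ℝ => Real.exp (2 * e)).tendsto 0
    simp only [mul_zero, sub_zero, Real.exp_zero, add_zero, div_one, mul_one] at hl
    obtain ⟨n, hn, hn1⟩ := (((hl.comp hseq).eventually_lt_const ha).and
      (hseq.eventually_lt_const one_pos)).exists
    simp only [Function.comp_apply] at hn
    set e : ℝ := 1 / ((n : ℝ) + 1)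
    have he : 0 < e := by positivity
    obtain ⟨J, hJ1, hJ2, -⟩ := hup e he e he
    have h1 := (hshift J e hJ1).eventually_lt_const (lt_add_of_pos_right γ he)
    filter_upwards [h1, eventually_gt_atTop 0] with u hu1 hu2
    refine lt_of_le_of_lt ?_ hn
    change B u / u ^ M ≤ _
    have h2 := hJ2 u hu2
    rw [div_lt_iff₀ (by positivity)] at hu1
    rw [div_le_iff₀ (by positivity)]
    have h3 : B u * (Real.exp (-(2 * e)) * (1 - e)) ≤ (γ + e) * u ^ M := h2.trans hu1.le
    calc B u = B u * (Real.exp (-(2 * e)) * (1 - e)) * (Real.exp (2 * e) / (1 - e)) := by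
          have : Real.exp (-(2 * e)) * Real.exp (2 * e) = 1 := by rw [← Real.exp_add]; simp
          field_simp
          linear_combination (-B u) * this
      _ ≤ (γ + e) * u ^ M * (Real.exp (2 * e) / (1 - e)) := by gcongr
      _ = _ := by ring

end TauberianCore

section TauberianDirichlet

/-- Taylor's formula of order `n` with a remainder analytic at the centre. -/
theorem AnalyticAt.exists_taylor {h : ℂ → ℂ} {w₀ : ℂ} (hh : AnalyticAt ℂ h w₀) (n : ℕ) :
    ∃ (d : ℕ → ℂ) (ψ : ℂ → ℂ), AnalyticAt ℂ ψ w₀ ∧ (0 < n → d 0 = h w₀) ∧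
      ∀ w, h w = (∑ j ∈ Finset.range n, d j * (w - w₀) ^ j) + (w - w₀) ^ n * ψ w := by
  induction n with
  | zero => exact ⟨0, h, hh, by simp, by simp⟩
  | succ n ih =>
    obtain ⟨d, ψ, hψ, hd, heq⟩ := ih
    refine ⟨Function.update d n (ψ w₀), dslope ψ w₀, ?_, fun _ => ?_, fun w => ?_⟩
    · obtain ⟨p, hp⟩ := hψ
      exact hp.has_fpower_series_dslope_fslope.analyticAt
    · rcases Nat.eq_zero_or_pos n with rfl | hn
      · have := heq w₀
        simpa using this.symm
      · rw [Function.update_of_ne hn.ne, hd hn]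
    · rw [Finset.sum_range_succ, Function.update_self, heq w]
      have h1 : ∑ j ∈ Finset.range n, Function.update d n (ψ w₀) j * (w - w₀) ^ j =
          ∑ j ∈ Finset.range n, d j * (w - w₀) ^ j :=
        Finset.sum_congr rfl fun j hj => by
          rw [Function.update_of_ne (Finset.mem_range.mp hj).ne]
      have h2 := sub_smul_dslope ψ w₀ w
      rw [smul_eq_mul] at h2
      rw [h1, pow_succ]
      linear_combination (-(w - w₀) ^ n) * h2

variable {a : ℕ → ℝ}

theorem LSeries_ofReal_eq {r : ℝ} (hr : r ≠ 0) :
    LSeries (fun n => (a n : ℂ)) r = ((∑' k : ℕ, a k * (k : ℝ) ^ (-r) : ℝ) : ℂ) := by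
  rw [LSeries, Complex.ofReal_tsum]
  congr 1
  funext k
  by_cases hk : k = 0
  · simp [hk, Real.zero_rpow (neg_ne_zero.mpr hr)]
  · rw [LSeries.term_of_ne_zero hk, Complex.ofReal_mul, Complex.ofReal_cpow (Nat.cast_nonneg k),
      Complex.ofReal_neg, Complex.cpow_neg, Complex.ofReal_natCast, div_eq_mul_inv]

theorem LSeriesSummable.summable_ofReal (ha : ∀ n, 0 ≤ a n) {r : ℝ} (hr : r ≠ 0)
    (hs : LSeriesSummable (fun n => (a n : ℂ)) r) :
    Summable fun k : ℕ => a k * (k : ℝ) ^ (-r) := by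
  refine hs.norm.congr fun k => ?_
  rw [LSeries.norm_term_eq]
  split_ifs with hk
  · simp [hk, Real.zero_rpow (neg_ne_zero.mpr hr)]
  · simp [abs_of_nonneg (ha k), Real.rpow_neg, div_eq_mul_inv]

theorem sum_Icc_le_rpow_mul_tsum (ha : ∀ n, 0 ≤ a n) {r : ℝ} (hr : 0 < r)
    (hs : Summable fun k : ℕ => a k * (k : ℝ) ^ (-r)) {T : ℝ} (hT : 0 ≤ T) :
    ∑ k ∈ Finset.Icc 1 ⌊T⌋₊, a k ≤ T ^ r * ∑' k : ℕ, a k * (k : ℝ) ^ (-r) := by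
  calc ∑ k ∈ Finset.Icc 1 ⌊T⌋₊, a k ≤ ∑ k ∈ Finset.Icc 1 ⌊T⌋₊, T ^ r * (a k * (k : ℝ) ^ (-r)) := by
        refine Finset.sum_le_sum fun k hk => ?_
        obtain ⟨hk1, hk2⟩ := Finset.mem_Icc.mp hk
        have hk0 : (0 : ℝ) < k := by exact_mod_cast hk1
        have hkT : (k : ℝ) ≤ T := (Nat.le_floor_iff hT).mp hk2
        have h1 : (k : ℝ) ^ r ≤ T ^ r := Real.rpow_le_rpow hk0.le hkT hr.le
        have h2 : (k : ℝ) ^ r * (k : ℝ) ^ (-r) = 1 := by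
          rw [← Real.rpow_add hk0]; simp
        have h3 : 0 ≤ (k : ℝ) ^ (-r) := by positivity
        calc a k = (k : ℝ) ^ r * (a k * (k : ℝ) ^ (-r)) := by linear_combination (-a k) * h2
          _ ≤ _ := mul_le_mul_of_nonneg_right h1 (mul_nonneg (ha k) h3)
    _ = T ^ r * ∑ k ∈ Finset.Icc 1 ⌊T⌋₊, a k * (k : ℝ) ^ (-r) := by rw [Finset.mul_sum]
    _ ≤ _ := by
        gcongr
        exact hs.sum_le_tsum _ fun k _ => mul_nonneg (ha k) (by positivity)

open Complex MeasureTheory Set in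
/-- The Laplace transform of `e ^ (-t) ∑_{k ≤ e ^ t} a k`: summation by parts, in the variable `t =
log x`. -/
theorem integral_exp_neg_mul_sum (ha : ∀ n, 0 ≤ a n)
    (hs : ∀ w : ℂ, 1 < w.re → LSeriesSummable (fun n => (a n : ℂ)) w) {z : ℂ} (hz : 0 < z.re) :
    ∫ t in Ioi (0 : ℝ), ((Real.exp (-t) * ∑ k ∈ Finset.Icc 1 ⌊Real.exp t⌋₊, a k : ℝ) : ℂ) *
      cexp (-(z * t)) = LSeries (fun n => (a n : ℂ)) (1 + z) / (1 + z) := by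
  have h1z : (1 : ℂ) + z ≠ 0 := fun h => by
    have := congrArg Complex.re h
    simp at this
    linarith
  set r : ℝ := 1 + z.re / 2 with hr
  have hr1 : 1 < r := by rw [hr]; linarith
  have hO : (fun n : ℕ => ∑ k ∈ Finset.Icc 1 n, a k) =O[atTop] fun n => (n : ℝ) ^ r := by
    have hsr := (hs (r : ℂ) (by simpa using hr1)).summable_ofReal ha (by linarith)
    refine IsBigO.of_bound (∑' k : ℕ, a k * (k : ℝ) ^ (-r)) (Eventually.of_forall fun n => ?_)
    have := sum_Icc_le_rpow_mul_tsum ha (by linarith) hsr (Nat.cast_nonneg n)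
    rw [Nat.floor_natCast] at this
    rw [Real.norm_eq_abs, Real.norm_eq_abs, abs_of_nonneg (Finset.sum_nonneg fun k _ => ha k),
      abs_of_nonneg (by positivity), mul_comm]
    exact this
  have hmain := LSeries_eq_mul_integral_of_nonneg a (by linarith : 0 ≤ r) (s := 1 + z)
    (by rw [hr]; simp; linarith) hO ha
  rw [hmain, mul_div_cancel_left₀ _ h1z]
  have hexp := integral_comp_exp_Ioi (fun t : ℝ => (∑ k ∈ Finset.Icc 1 ⌊t⌋₊, (a k : ℂ)) *
    (t : ℂ) ^ (-(1 + z + 1))) 0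
  rw [Real.exp_zero] at hexp
  rw [← hexp]
  congr 1
  funext t
  have h2 : ((Real.exp t : ℝ) : ℂ) ^ (-(1 + z + 1)) = cexp (-(1 + z + 1) * t) := by
    rw [cpow_def_of_ne_zero (by exact_mod_cast (Real.exp_pos t).ne'), ← ofReal_log
      (Real.exp_pos t).le, Real.log_exp, mul_comm]
  rw [h2, real_smul]
  push_cast
  have h3 : cexp t * cexp (-(1 + z + 1) * t) = cexp (-t) * cexp (-(z * t)) := by
    rw [← Complex.exp_add, ← Complex.exp_add]
    ring_nf
  linear_combination -(∑ k ∈ Finset.Icc 1 ⌊Real.exp t⌋₊, (a k : ℂ)) * h3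

open Set in
/-- A Tauberian theorem for Dirichlet series with nonnegative coefficients: if the series continues
continuously to `Re w = 1` except for a pole of order `M + 1` at `w = 1`, then the sum of its
coefficients up to `x` is asymptotic to a multiple of `x (log x) ^ M`. -/
theorem tendsto_sum_div_of_pole (ha : ∀ n, 0 ≤ a n)
    (hs : ∀ w : ℂ, 1 < w.re → LSeriesSummable (fun n => (a n : ℂ)) w) {Z : ℂ → ℂ}
    (hZ : ∀ w : ℂ, 1 < w.re → LSeries (fun n => (a n : ℂ)) w = Z w)
    (hcont : ContinuousOn Z {w | 1 ≤ w.re ∧ w ≠ 1}) {φ : ℂ → ℂ} (hφ : AnalyticAt ℂ φ 1) {M : ℕ}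
    (hpole : ∀ᶠ w in 𝓝 (1 : ℂ), 1 < w.re → Z w = φ w / (w - 1) ^ (M + 1)) {γ : ℝ}
    (hγ : φ 1 = γ * M.factorial) :
    Tendsto (fun x : ℝ => (∑ k ∈ Finset.Icc 1 ⌊x⌋₊, a k) / (x * Real.log x ^ M)) atTop (𝓝 γ) := by
  obtain ⟨d, ψ, hψ, hd, htay⟩ := (hφ.div analyticAt_id one_ne_zero).exists_taylor (M + 1)
  simp only [Pi.div_apply, id] at htay
  have hd0 : d 0 = φ 1 := by simpa using hd (Nat.succ_pos M)
  set c : ℕ → ℂ := fun j => d (M - j) with hc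
  -- the polar part of the Laplace transform
  have hpolar : ∀ z : ℂ, z ≠ 0 → 1 + z ≠ 0 → φ (1 + z) / z ^ (M + 1) / (1 + z) =
      (∑ j ∈ Finset.range (M + 1), c j / z ^ (j + 1)) + ψ (1 + z) := by
    intro z hz hz1
    have h1 := htay (1 + z)
    rw [add_sub_cancel_left] at h1
    have h2 : (∑ j ∈ Finset.range (M + 1), c j / z ^ (j + 1)) * z ^ (M + 1) =
        ∑ j ∈ Finset.range (M + 1), d j * z ^ j := by
      rw [← Finset.sum_range_reflect (fun j => d j * z ^ j), Finset.sum_mul]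
      refine Finset.sum_congr rfl fun j hj => ?_
      have hj' : j ≤ M := by simp at hj; omega
      have e1 : M + 1 - 1 - j = M - j := by omega
      have e2 : z ^ (M + 1) = z ^ (M - j) * z ^ (j + 1) := by
        rw [← pow_add]
        congr 1
        omega
      have h3 : z ^ (j + 1) ≠ 0 := pow_ne_zero _ hz
      rw [e1, e2, hc, div_mul_eq_mul_div, div_eq_iff h3, mul_assoc]
    have hzM : z ^ (M + 1) ≠ 0 := pow_ne_zero _ hz
    rw [div_right_comm, div_eq_iff hzM, h1, add_mul, h2]
    ring
  have hpole' : ∀ᶠ w in 𝓝 (1 : ℂ), 1 ≤ w.re ∧ w ≠ 1 → Z w = φ w / (w - 1) ^ (M + 1) := by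
    have hev := hpole.eventually_nhds.and hφ.eventually_analyticAt
    filter_upwards [hev] with w hw hw1
    have hne : (w - 1) ^ (M + 1) ≠ 0 := pow_ne_zero _ (sub_ne_zero.mpr hw1.2)
    have hl : Tendsto (fun n : ℕ => w + ((1 / ((n : ℝ) + 1) : ℝ) : ℂ)) atTop (𝓝 w) := by
      have := (Complex.continuous_ofReal.tendsto 0).comp
        (tendsto_one_div_add_atTop_nhds_zero_nat (𝕜 := ℝ))
      simpa using this.const_add w
    have hre : ∀ n : ℕ, 1 < (w + ((1 / ((n : ℝ) + 1) : ℝ) : ℂ)).re := fun n => by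
      have : 0 < 1 / ((n : ℝ) + 1) := by positivity
      rw [Complex.add_re, Complex.ofReal_re]
      linarith [hw1.1]
    have hin : Tendsto (fun n : ℕ => w + ((1 / ((n : ℝ) + 1) : ℝ) : ℂ)) atTop
        (𝓝[{w | 1 ≤ w.re ∧ w ≠ 1}] w) :=
      tendsto_nhdsWithin_iff.mpr ⟨hl, Eventually.of_forall fun n => ⟨(hre n).le, fun h => by
        have := hre n
        rw [h] at this
        simp at this⟩⟩
    have h1 := (hcont w hw1).tendsto.comp hin
    have h2 : Tendsto (fun w => φ w / (w - 1) ^ (M + 1)) (𝓝 w) (𝓝 (φ w / (w - 1) ^ (M + 1))) :=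
      hw.2.continuousAt.div (by fun_prop) hne
    refine tendsto_nhds_unique h1 ((h2.comp hl).congr' ?_)
    filter_upwards [hl.eventually hw.1] with n hn
    exact (hn (hre n)).symm
  set G : ℂ → ℂ := fun z => if z = 0 then ψ 1 else
    Z (1 + z) / (1 + z) - ∑ j ∈ Finset.range (M + 1), c j / z ^ (j + 1) with hG
  have h1z : ∀ z : ℂ, 0 ≤ z.re → 1 + z ≠ 0 := fun z hz h => by
    have := congrArg Complex.re h
    simp at this
    linarith
  have hGc : ContinuousOn G {z | 0 ≤ z.re} := by
    intro z hz
    have hz' : 0 ≤ z.re := hz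
    by_cases h0 : z = 0
    · subst h0
      have hψc : Tendsto (fun z : ℂ => ψ (1 + z)) (𝓝 0) (𝓝 (ψ 1)) := by
        have h1 : Tendsto (fun z : ℂ => 1 + z) (𝓝 0) (𝓝 1) := by
          simpa using (continuous_const_add (1 : ℂ)).tendsto 0
        exact hψ.continuousAt.tendsto.comp h1
      have hG0 : G 0 = ψ 1 := by simp [hG]
      rw [ContinuousWithinAt, hG0]
      refine (hψc.mono_left nhdsWithin_le_nhds).congr' ?_
      have h1 : Tendsto (fun z : ℂ => 1 + z) (𝓝 0) (𝓝 1) := by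
        simpa using (continuous_const_add (1 : ℂ)).tendsto 0
      filter_upwards [nhdsWithin_le_nhds (h1.eventually hpole'), self_mem_nhdsWithin] with z hz1 hz2
      by_cases h0 : z = 0
      · simp [hG, h0]
      · have hz2' : 0 ≤ z.re := hz2
        simp only [hG, if_neg h0]
        rw [hz1 ⟨by simpa using hz2', by simpa using h0⟩, add_sub_cancel_left,
          hpolar z h0 (h1z z hz2')]
        ring
    · have h1 : ContinuousWithinAt (fun z => Z (1 + z) / (1 + z) -
          ∑ j ∈ Finset.range (M + 1), c j / z ^ (j + 1)) ({z | 0 ≤ z.re} ∩ {0}ᶜ) z := by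
        refine ContinuousWithinAt.sub (ContinuousWithinAt.div ?_ (by fun_prop) (h1z z hz')) ?_
        · refine (hcont (1 + z) ⟨by simpa using hz', by simpa using h0⟩).comp (by fun_prop) ?_
          rintro y ⟨hy1, hy2⟩
          have hy1' : 0 ≤ y.re := hy1
          exact ⟨by simpa using hy1', by simpa using hy2⟩
        · refine (tendsto_finsetSum _ fun j _ => ?_)
          exact ContinuousWithinAt.div (by fun_prop) (by fun_prop) (pow_ne_zero _ h0)
      have h2 : ContinuousWithinAt G ({z | 0 ≤ z.re} ∩ {0}ᶜ) z :=
        h1.congr (fun y hy => by simp only [hG, if_neg (show y ≠ 0 from hy.2)])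
          (by simp only [hG, if_neg h0])
      exact (continuousWithinAt_inter (isOpen_compl_singleton.mem_nhds h0)).mp h2
  set A : ℝ → ℝ := fun t => ∑ k ∈ Finset.Icc 1 ⌊Real.exp t⌋₊, a k with hA
  have hAm : Monotone A := by
    intro t t' htt
    refine Finset.sum_le_sum_of_subset_of_nonneg (Finset.Icc_subset_Icc_right
      (Nat.floor_le_floor (Real.exp_le_exp.mpr htt))) fun k _ _ => ha k
  have hA0 : ∀ t, 0 ≤ A t := fun t => Finset.sum_nonneg fun k _ => ha k
  have hlap : ∀ z : ℂ, 0 < z.re → ∫ t in Ioi (0 : ℝ), ((Real.exp (-t) * A t : ℝ) : ℂ) *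
      Complex.exp (-(z * t)) = (∑ j ∈ Finset.range (M + 1), c j / z ^ (j + 1)) + G z := by
    intro z hz
    have h0 : z ≠ 0 := by rintro rfl; simp at hz
    rw [hA, integral_exp_neg_mul_sum ha hs hz, hZ _ (by simpa using hz)]
    simp only [hG, if_neg h0]
    ring
  -- the partial sums up to `e ^ t` are at most `e ^ (t (1 + x))` times the series at `1 + x`; as the
  -- series is `O(x ^ (-M - 1))`, the choice `x = 1 / (1 + t)` gives a polynomial bound
  set R : ℝ → ℝ := fun r => ∑' k : ℕ, a k * (k : ℝ) ^ (-r) with hR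
  have hRs : ∀ r : ℝ, 1 < r → Summable fun k : ℕ => a k * (k : ℝ) ^ (-r) := fun r hr =>
    (hs (r : ℂ) (by simpa using hr)).summable_ofReal ha (by linarith)
  have hR0 : ∀ r, 0 ≤ R r := fun r => tsum_nonneg fun k => mul_nonneg (ha k) (by positivity)
  obtain ⟨C, hC⟩ : ∃ C, ∀ x : ℝ, 0 < x → x ≤ 1 → R (1 + x) * x ^ (M + 1) ≤ C := by
    have hl : Tendsto (fun x : ℝ => 1 + (x : ℂ)) (𝓝 0) (𝓝 1) := by
      simpa using (by fun_prop : Continuous fun x : ℝ => 1 + (x : ℂ)).tendsto 0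
    have hb : ∀ᶠ w in 𝓝 (1 : ℂ), ‖φ w‖ < ‖φ 1‖ + 1 :=
      hφ.continuousAt.norm.eventually_lt_const (lt_add_one _)
    obtain ⟨e, he, hev⟩ := Metric.eventually_nhds_iff.mp (hl.eventually (hpole.and hb))
    refine ⟨max (‖φ 1‖ + 1) (R (1 + e / 2)), fun x hx0 hx1 => ?_⟩
    rcases lt_or_ge x e with hxe | hxe
    · obtain ⟨h1, h2⟩ := hev (show dist x 0 < e by simpa [abs_of_pos hx0] using hxe)
      have h3 := h1 (by simpa using hx0)
      have h4 : ((R (1 + x) : ℝ) : ℂ) = φ (1 + x) / (x : ℂ) ^ (M + 1) := by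
        rw [add_sub_cancel_left] at h3
        rw [← h3, ← hZ _ (by simpa using hx0), hR, ← LSeries_ofReal_eq (by linarith)]
        push_cast
        rfl
      have h5 : ‖((R (1 + x) : ℝ) : ℂ)‖ = ‖φ (1 + x)‖ / x ^ (M + 1) := by
        rw [h4, norm_div, norm_pow, Complex.norm_real, Real.norm_eq_abs, abs_of_pos hx0]
      rw [Complex.norm_real, Real.norm_eq_abs, abs_of_nonneg (hR0 _)] at h5
      rw [h5, div_mul_cancel₀ _ (by positivity)]
      exact h2.le.trans (le_max_left _ _)
    · have h1 : R (1 + x) ≤ R (1 + e / 2) := by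
        refine (hRs _ (by linarith)).tsum_le_tsum (fun k => ?_) (hRs _ (by linarith))
        rcases Nat.eq_zero_or_pos k with rfl | hk
        · rw [Nat.cast_zero, Real.zero_rpow (by linarith), Real.zero_rpow (by linarith)]
        · exact mul_le_mul_of_nonneg_left (Real.rpow_le_rpow_of_exponent_le
            (by exact_mod_cast hk) (by linarith)) (ha k)
      calc R (1 + x) * x ^ (M + 1) ≤ R (1 + e / 2) * 1 := by
            gcongr
            · exact hR0 _
            · exact pow_le_one₀ hx0.le hx1
        _ ≤ _ := by rw [mul_one]; exact le_max_right _ _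
  have hC0 : 0 ≤ C := le_trans (mul_nonneg (hR0 _) (by norm_num)) (hC 1 one_pos le_rfl)
  have hb : ∀ t, 0 < t → Real.exp (-t) * A t ≤ Real.exp 1 * C * (1 + t) ^ (M + 1) := by
    intro t ht
    set x : ℝ := 1 / (1 + t) with hx
    have hx0 : 0 < x := by positivity
    have hx1 : x ≤ 1 := by rw [hx, div_le_one (by positivity)]; linarith
    have h1 := sum_Icc_le_rpow_mul_tsum ha (by linarith : 0 < 1 + x) (hRs _ (by linarith))
      (Real.exp_pos t).le
    have h2 := hC x hx0 hx1
    have h3 : R (1 + x) ≤ C * (1 + t) ^ (M + 1) := by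
      have : x ^ (M + 1) * (1 + t) ^ (M + 1) = 1 := by
        rw [← mul_pow, hx, one_div, inv_mul_cancel₀ (by positivity), one_pow]
      calc R (1 + x) = R (1 + x) * x ^ (M + 1) * (1 + t) ^ (M + 1) := by
            rw [mul_assoc, this, mul_one]
        _ ≤ _ := by gcongr
    have h4 : Real.exp (-t) * Real.exp t ^ (1 + x) ≤ Real.exp 1 := by
      rw [← Real.exp_mul, ← Real.exp_add]
      refine Real.exp_le_exp.mpr ?_
      have : t * x ≤ 1 := by rw [hx, mul_one_div, div_le_one (by positivity)]; linarith
      linarith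
    calc Real.exp (-t) * A t ≤ Real.exp (-t) * (Real.exp t ^ (1 + x) * R (1 + x)) := by gcongr
      _ = Real.exp (-t) * Real.exp t ^ (1 + x) * R (1 + x) := by ring
      _ ≤ Real.exp 1 * (C * (1 + t) ^ (M + 1)) := mul_le_mul h4 h3 (hR0 _) (Real.exp_pos _).le
      _ = _ := by ring
  have hcM : c M = γ * M.factorial := by simp only [hc, Nat.sub_self]; rw [hd0, hγ]
  have hfin := tendsto_div_pow_of_laplace hAm hA0 hb hGc hcM hlap
  refine (hfin.comp Real.tendsto_log_atTop).congr' ?_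
  filter_upwards [eventually_gt_atTop 1] with x hx
  have hx0 : 0 < x := by linarith
  simp only [Function.comp_apply, hA, Real.exp_log hx0, Real.exp_neg]
  have := Real.log_pos hx
  field_simp

end TauberianDirichlet

/-! ### The leading constant -/

section LeadingConstant

open Matrix

/-- The sign `±1` attached to `e ∈ {0, 1}`. -/
def fsgn (e : Fin 2) : ℂ := if e = 1 then -1 else 1

lemma fsgn_mul_self (e : Fin 2) : fsgn e * fsgn e = 1 := by
  unfold fsgn; split_ifs <;> norm_num

lemma fsgn_eq (e : Fin 2) : fsgn e = 1 - 2 * ((e : ℕ) : ℂ) := by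
  fin_cases e <;> norm_num [fsgn]

/-- If an exponential polynomial vanishes to order `M` at `0`, its leading coefficient there is the
`M`-th moment of the exponents. -/
theorem sum_mul_pow_eq_of_tendsto {ι : Type*} [Fintype ι] (c μ : ι → ℂ) (M : ℕ) (L : ℂ)
    (h : Tendsto (fun x : ℂ => (∑ i, c i * Complex.exp (x * μ i)) / x ^ M) (𝓝[≠] 0) (𝓝 L)) :
    ∑ i, c i * μ i ^ M = M.factorial * L := by
  set S : ℂ → ℂ := fun x => ∑ i, c i * Complex.exp (x * μ i) with hS
  have hder : ∀ n, iteratedDeriv n S = fun x => ∑ i, c i * μ i ^ n * Complex.exp (x * μ i) := by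
    intro n
    induction n with
    | zero => simp [hS]
    | succ n ih =>
      rw [iteratedDeriv_succ, ih]
      funext x
      have : HasDerivAt (fun x => ∑ i, c i * μ i ^ n * Complex.exp (x * μ i))
          (∑ i, c i * μ i ^ n * (Complex.exp (x * μ i) * (1 * μ i))) x :=
        HasDerivAt.fun_sum fun i _ => (((hasDerivAt_id x).mul_const (μ i)).cexp).const_mul _
      rw [this.deriv]
      exact Finset.sum_congr rfl fun i _ => by ring
  have hA : AnalyticAt ℂ S 0 := by
    have : Differentiable ℂ S := by fun_prop
    exact this.analyticAt 0
  have h' : Tendsto (fun x : ℂ => S x / (x - 0) ^ M) (𝓝[≠] 0) (𝓝 L) := by simpa using h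
  have h1 := hA.tendsto_div_pow (hA.iteratedDeriv_eq_zero_of_tendsto le_rfl h')
  have h2 := tendsto_nhds_unique h' h1
  rw [h2, hder]
  simp only [zero_mul, Complex.exp_zero, mul_one]
  rw [mul_div_cancel₀ _ (by exact_mod_cast Nat.factorial_ne_zero M)]

lemma sum_range_two_mul_eq (g : ℕ → ℂ) (h : ∀ l, g (2 * l) = 0) (m : ℕ) :
    ∑ p ∈ Finset.range (2 * m), g p = ∑ l ∈ Finset.range m, g (2 * l + 1) := by
  induction m with
  | zero => simp
  | succ m ih =>
    rw [Finset.sum_range_succ, ← ih, show 2 * (m + 1) = 2 * m + 1 + 1 by ring,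
      Finset.sum_range_succ, Finset.sum_range_succ, h, add_zero]

/-- The odd function `y ^ j (e ^ y - (-1) ^ j e ^ (-y))`. -/
noncomputable def oddExp (j : ℕ) (y : ℂ) : ℂ :=
  y ^ j * (Complex.exp y - (-1) ^ j * Complex.exp (-y))

/-- The coefficient of `y ^ (2 l + 1)` in `oddExp j`. -/
noncomputable def oddExpCoeff (l j : ℕ) : ℂ := if j ≤ 2 * l + 1 then 2 / ((2 * l + 1 - j).factorial : ℂ) else 0

/-- The Taylor expansion of `oddExp j` up to order `2 m`. -/
lemma oddExp_sub_isBigO {m j : ℕ} (hj : j < 2 * m) :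
    (fun y : ℂ => oddExp j y - ∑ l ∈ Finset.range m, y ^ (2 * l + 1) * oddExpCoeff l j)
      =O[𝓝 0] fun y => y ^ (2 * m) := by
  set n := 2 * m - j with hn
  have hE : (fun y : ℂ => Complex.exp y - ∑ k ∈ Finset.range n, y ^ k / k.factorial)
      =O[𝓝 0] fun y => y ^ n := by
    refine IsBigO.of_bound ((n.succ : ℝ) * ((n.factorial : ℝ) * n)⁻¹) ?_
    filter_upwards [Metric.ball_mem_nhds (0 : ℂ) one_pos] with y hy
    rw [mem_ball_zero_iff] at hy
    have := Complex.exp_bound hy.le (n := n) (by omega)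
    rw [norm_pow, mul_comm]
    exact_mod_cast this
  have hE' : (fun y : ℂ => Complex.exp (-y) - ∑ k ∈ Finset.range n, (-y) ^ k / k.factorial)
      =O[𝓝 0] fun y => y ^ n := by
    have h0 : Tendsto (fun y : ℂ => -y) (𝓝 0) (𝓝 0) := by
      have := (continuous_neg (G := ℂ)).tendsto 0
      rwa [neg_zero] at this
    have := hE.comp_tendsto h0
    refine this.trans (IsBigO.of_bound 1 (Eventually.of_forall fun y => ?_))
    simp [Function.comp]
  have hmain := (isBigO_refl (fun y : ℂ => y ^ j) (𝓝 0)).mul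
    (hE.sub (hE'.const_mul_left ((-1) ^ j)))
  refine (hmain.congr_left fun y => ?_).congr_right fun y => ?_
  · set g : ℕ → ℂ := fun p => if j ≤ p then y ^ p * (1 - (-1) ^ p) / ((p - j).factorial : ℂ) else 0
    have h1 : ∑ l ∈ Finset.range m, y ^ (2 * l + 1) * oddExpCoeff l j =
        ∑ p ∈ Finset.range (2 * m), g p := by
      rw [sum_range_two_mul_eq g (by intro l; simp [g])]
      refine Finset.sum_congr rfl fun l _ => ?_
      simp only [g, oddExpCoeff]
      split_ifs
      · rw [pow_succ (-1 : ℂ), pow_mul]; norm_num; ring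
      · simp
    have h2 : ∑ p ∈ Finset.range (2 * m), g p = ∑ k ∈ Finset.range n, g (j + k) := by
      rw [← Finset.sum_range_add_sum_Ico _ hj.le, Finset.sum_Ico_eq_sum_range,
        Finset.sum_eq_zero, zero_add]
      intro p hp
      simp only [Finset.mem_range] at hp
      simp [g, not_le.mpr hp]
    rw [h1, h2]
    simp only [oddExp, mul_sub, Finset.mul_sum]
    have h3 : ∀ k, g (j + k) = y ^ j * (y ^ k / k.factorial) -
        y ^ j * ((-1) ^ j * ((-y) ^ k / k.factorial)) := by
      intro k
      simp only [g, le_add_iff_nonneg_right, zero_le, if_true, Nat.add_sub_cancel_left]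
      rw [neg_pow y, pow_add, pow_add]
      ring
    simp only [h3, Finset.sum_sub_distrib]
    ring
  · rw [← pow_add]
    congr 1
    omega

/-- The matrix of the leading coefficients. -/
noncomputable def oddExpMatrix (m : ℕ) : Matrix (Fin m) (Fin m) ℂ := Matrix.of fun l j => oddExpCoeff l j

/-- The matrix of odd powers. -/
def oddVandermonde {m : ℕ} (a : Fin m → ℂ) : Matrix (Fin m) (Fin m) ℂ :=
  Matrix.of fun i l => a i ^ (2 * (l : ℕ) + 1)

lemma det_oddVandermonde {m : ℕ} (a : Fin m → ℂ) :
    (oddVandermonde a).det = (∏ i, a i) * ∏ i : Fin m, ∏ j ∈ Finset.Ioi i, (a j ^ 2 - a i ^ 2) := by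
  rw [← Matrix.det_vandermonde, ← Matrix.det_mul_column]
  congr 1
  ext i l
  simp only [oddVandermonde, of_apply, vandermonde_apply]
  rw [← pow_mul]
  ring

/-- Up to a factor in each row the entries are the descending factorials of the odd integers `2 l +
1`, so that the determinant is a Vandermonde determinant at these integers. -/
lemma det_oddExpMatrix (m : ℕ) :
    (oddExpMatrix m).det =
      2 ^ m * ∏ l ∈ Finset.range m, (2 : ℂ) ^ l * l.factorial / ((2 * l + 1).factorial : ℂ) := by
  have h1 : oddExpMatrix m = Matrix.of fun l j : Fin m =>
      (2 / ((2 * (l : ℕ) + 1).factorial : ℂ)) *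
        (Matrix.of fun (l j : Fin m) => (descPochhammer ℂ (j : ℕ)).eval (2 * (l : ℂ) + 1)) l j := by
    ext l j
    simp only [oddExpMatrix, oddExpCoeff, of_apply]
    have : (2 * (l : ℂ) + 1) = ((2 * (l : ℕ) + 1 : ℕ) : ℂ) := by push_cast; ring
    rw [this, descPochhammer_eval_eq_descFactorial]
    split_ifs with h
    · rw [← Nat.factorial_mul_descFactorial h]
      push_cast
      have h1 : ((2 * (l : ℕ) + 1 - j).factorial : ℂ) ≠ 0 := by
        exact_mod_cast Nat.factorial_ne_zero _
      have h2 : (((2 * (l : ℕ) + 1).descFactorial j : ℕ) : ℂ) ≠ 0 := by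
        exact_mod_cast (Nat.descFactorial_pos.mpr h).ne'
      field_simp
    · rw [Nat.descFactorial_of_lt (by omega)]
      simp
  rw [h1, Matrix.det_mul_column,
    ← Matrix.det_eval_matrixOfPolynomials_eq_det_vandermonde _ _
      (fun i => descPochhammer_natDegree ℂ i) (fun i => monic_descPochhammer ℂ i)]
  have h2 : (vandermonde fun l : Fin m => 2 * (l : ℂ) + 1).det =
      ∏ l ∈ Finset.range m, (2 : ℂ) ^ l * l.factorial := by
    clear h1
    have h3 : (vandermonde fun l : Fin m => 2 * (l : ℂ) + 1).det =
        (vandermonde fun l : Fin m => 2 * (l : ℂ)).det := by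
      simp [Matrix.det_vandermonde]
    have h4 : (vandermonde fun l : Fin m => 2 * (l : ℂ)) =
        Matrix.of fun l j : Fin m => (2 : ℂ) ^ (j : ℕ) * vandermonde (fun l : Fin m => (l : ℂ)) l j := by
      ext l j
      simp [vandermonde_apply, mul_pow]
    rw [h3, h4, Matrix.det_mul_row, Finset.prod_mul_distrib, Finset.prod_range]
    congr 1
    rcases m with _ | m
    · simp
    · rw [det_vandermonde_id_eq_superFactorial, ← Nat.prod_range_succ_factorial]
      push_cast
      rfl
  rw [h2, Finset.prod_range, Finset.prod_range, Finset.prod_div_distrib, Finset.prod_div_distrib]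
  simp only [Finset.prod_const, Finset.card_univ, Fintype.card_fin, Finset.prod_mul_distrib]
  ring

/-- By the Taylor expansions, the matrix of the `oddExp j (t a_i)` is to leading order the product
of `oddVandermonde a`, the diagonal matrix of the `t ^ (2 l + 1)`, and `oddExpMatrix m`. -/
lemma tendsto_det_oddExp {m : ℕ} (a : Fin m → ℂ) (ha : (oddVandermonde a).det ≠ 0) :
    Tendsto (fun t : ℂ => (Matrix.of fun i j : Fin m => oddExp j (t * a i)).det / t ^ (m ^ 2))
      (𝓝[≠] 0) (𝓝 ((oddVandermonde a).det * (oddExpMatrix m).det)) := by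
  set V := oddVandermonde a with hV
  set C := oddExpMatrix m with hC
  set P : ℂ → Matrix (Fin m) (Fin m) ℂ := fun t => Matrix.of fun i j => oddExp j (t * a i) with hP
  set D : ℂ → Matrix (Fin m) (Fin m) ℂ := fun t => diagonal fun l : Fin m => t ^ (2 * (l : ℕ) + 1)
  set D' : ℂ → Matrix (Fin m) (Fin m) ℂ := fun t =>
    diagonal fun l : Fin m => (t ^ (2 * (l : ℕ) + 1))⁻¹
  set R : ℂ → Matrix (Fin m) (Fin m) ℂ := fun t => P t - V * D t * C with hR
  have hVu : IsUnit V.det := isUnit_iff_ne_zero.mpr ha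
  have hR0 : ∀ i j : Fin m, ∀ l : Fin m,
      Tendsto (fun t => (t ^ (2 * (l : ℕ) + 1))⁻¹ * R t i j) (𝓝[≠] 0) (𝓝 0) := by
    intro i j l
    have hta : Tendsto (fun t : ℂ => t * a i) (𝓝 0) (𝓝 0) := by
      have : Continuous fun t : ℂ => t * a i := by fun_prop
      simpa using this.tendsto 0
    have hj2 : (j : ℕ) < 2 * m := by omega
    have h1 := (oddExp_sub_isBigO hj2).comp_tendsto hta
    have h2 : (fun t => R t i j) =O[𝓝 0] fun t : ℂ => t ^ (2 * m) := by
      refine (h1.congr_left fun t => ?_).trans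
        (IsBigO.of_bound (‖a i‖ ^ (2 * m)) (Eventually.of_forall fun t => ?_))
      · simp only [Function.comp_apply, hR, hP, hV, hC, Matrix.sub_apply, of_apply]
        rw [Matrix.mul_apply]
        simp only [D, mul_diagonal, of_apply, oddVandermonde, oddExpMatrix, Finset.sum_range, mul_pow]
        congr 1
        exact Finset.sum_congr rfl fun l _ => by ring
      · simp [mul_pow, mul_comm]
    have h3 : (fun t : ℂ => t ^ (2 * m)) =o[𝓝 0] fun t => t ^ (2 * (l : ℕ) + 1) :=
      isLittleO_pow_pow (by omega)
    have h4 := ((h2.trans_isLittleO h3).mono (nhdsWithin_le_nhds (s := {0}ᶜ))).tendsto_div_nhds_zero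
    refine h4.congr fun t => ?_
    rw [div_eq_inv_mul]
  have hfac : ∀ t : ℂ, t ≠ 0 → P t = V * (D t * (C + D' t * (V⁻¹ * R t))) := by
    intro t ht
    have hDD : D t * D' t = 1 := by
      simp only [D, D', diagonal_mul_diagonal]
      rw [← diagonal_one]
      congr 1
      funext l
      exact mul_inv_cancel₀ (pow_ne_zero _ ht)
    rw [mul_add, mul_add, ← mul_assoc (D t) (D' t), hDD, one_mul, ← mul_assoc V V⁻¹,
      mul_nonsing_inv _ hVu, one_mul, hR, ← mul_assoc]
    simp
  have hdetD : ∀ t : ℂ, (D t).det = t ^ (m ^ 2) := by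
    intro t
    simp only [D, det_diagonal]
    rw [Finset.prod_pow_eq_pow_sum, ← Finset.sum_range (fun l => 2 * l + 1)]
    congr 1
    clear * -
    induction m with
    | zero => rfl
    | succ m ih => rw [Finset.sum_range_succ, ih]; ring
  have hlim : Tendsto (fun t => V.det * (C + D' t * (V⁻¹ * R t)).det) (𝓝[≠] 0)
      (𝓝 (V.det * C.det)) := by
    refine Tendsto.const_mul _ ?_
    have h1 : Tendsto (fun t => C + D' t * (V⁻¹ * R t)) (𝓝[≠] 0) (𝓝 C) := by
      refine tendsto_pi_nhds.mpr fun l => tendsto_pi_nhds.mpr fun j => ?_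
      have h2 : ∀ t, (C + D' t * (V⁻¹ * R t)) l j =
          C l j + ∑ i, V⁻¹ l i * ((t ^ (2 * (l : ℕ) + 1))⁻¹ * R t i j) := by
        intro t
        rw [Matrix.add_apply]
        simp only [D', diagonal_mul]
        rw [Matrix.mul_apply, Finset.mul_sum]
        congr 1
        exact Finset.sum_congr rfl fun i _ => by ring
      simp only [h2]
      have h3 : Tendsto (fun t => C l j + ∑ i, V⁻¹ l i * ((t ^ (2 * (l : ℕ) + 1))⁻¹ * R t i j))
          (𝓝[≠] 0) (𝓝 (C l j + ∑ i, V⁻¹ l i * 0)) :=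
        tendsto_const_nhds.add (tendsto_finsetSum _ fun i _ => (hR0 i j l).const_mul _)
      simpa using h3
    exact ((Continuous.matrix_det continuous_id).tendsto C).comp h1
  refine hlim.congr' ?_
  filter_upwards [self_mem_nhdsWithin] with t ht
  have ht : t ≠ 0 := ht
  change _ = (P t).det / _
  rw [hfac t ht, det_mul, det_mul, hdetD]
  have : t ^ (m ^ 2) ≠ 0 := pow_ne_zero _ ht
  field_simp

/-- The alternating sum over signs is a determinant. -/
lemma det_oddExp_eq_sum {m : ℕ} (y : Fin m → ℂ) :
    (Matrix.of fun i j : Fin m => oddExp j (y i)).det =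
      ∑ ε : Fin m → Fin 2, (∏ i, fsgn (ε i)) *
        Complex.exp (∑ i, fsgn (ε i) * y i) *
        ∏ i : Fin m, ∏ j ∈ Finset.Ioi i, (fsgn (ε j) * y j - fsgn (ε i) * y i) := by
  set r : Fin m → Fin 2 → Fin m → ℂ := fun i e j =>
    (fsgn e * Complex.exp (fsgn e * y i)) * (fsgn e * y i) ^ (j : ℕ) with hr
  have h1 : (Matrix.of fun i j : Fin m => oddExp j (y i)) = fun i => ∑ e, r i e := by
    funext i j
    simp only [hr, Finset.sum_apply, Fin.sum_univ_two, of_apply, fsgn, oddExp]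
    simp
    rw [neg_pow (y i)]
    ring
  rw [h1]
  have h2 := (Matrix.detRowAlternating (R := ℂ) (n := Fin m)).toMultilinearMap.map_sum r
  change (Matrix.detRowAlternating (R := ℂ) (n := Fin m)).toMultilinearMap _ = _
  rw [h2]
  refine Finset.sum_congr rfl fun ε _ => ?_
  change Matrix.det (fun i => r i (ε i)) = _
  have h3 : (fun i => r i (ε i)) = Matrix.of fun i j : Fin m =>
      (fsgn (ε i) * Complex.exp (fsgn (ε i) * y i)) *
        vandermonde (fun i => fsgn (ε i) * y i) i j := by
    funext i j
    simp [hr, vandermonde_apply]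
  rw [h3, Matrix.det_mul_column, det_vandermonde, Finset.prod_mul_distrib, Complex.exp_sum]

lemma prod_Ici_eq_mul_prod_Ioi {m : ℕ} (g : Fin m → Fin m → ℂ) :
    ∏ i : Fin m, ∏ j ∈ Finset.Ici i, g i j =
      (∏ i, g i i) * ∏ i : Fin m, ∏ j ∈ Finset.Ioi i, g i j := by
  rw [← Finset.prod_mul_distrib]
  refine Finset.prod_congr rfl fun i _ => ?_
  rw [← Finset.Ioi_insert, Finset.prod_insert (by simp)]

lemma prod_Ioi_const (m : ℕ) (x : ℂ) :
    ∏ i : Fin m, ∏ _j ∈ Finset.Ioi i, x = x ^ (m * (m - 1) / 2) := by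
  simp only [Finset.prod_const, Fin.card_Ioi]
  rw [Finset.prod_pow_eq_pow_sum]
  congr 1
  rw [← Finset.sum_range_id, Finset.sum_range,
    ← Equiv.sum_comp Fin.revPerm (fun i : Fin m => (i : ℕ))]
  refine Finset.sum_congr rfl fun i _ => ?_
  simp only [Fin.revPerm_apply, Fin.val_rev]
  omega

lemma triangle_succ (m : ℕ) : (m + 1) * (m + 1 + 1) / 2 = (m + 1) + m * (m + 1) / 2 := by
  rw [show (m + 1) * (m + 1 + 1) = m * (m + 1) + 2 * (m + 1) by ring,
    Nat.add_mul_div_left _ _ (by norm_num)]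
  ring

lemma triangle_add_triangle (m : ℕ) : m * (m + 1) / 2 + m * (m - 1) / 2 = m ^ 2 := by
  induction m with
  | zero => rfl
  | succ m ih => rw [triangle_succ, Nat.triangle_succ]; linarith

/-- The leading Laurent coefficient of the sum over the polar hyperplanes. As the squares of `± a_i`
do not depend on the sign, `∏_{i ≤ j} (± a_i ± a_j)` is up to a constant the reciprocal of a
Vandermonde determinant in the `± a_i`. Hence the exponential generating function in `x` of the sums
with exponents `0, 1, 2, …` in place of `m (m + 1) / 2` is a multiple of the determinant
`det_oddExp_eq_sum`, and the assertion is read off from its behaviour as `x → 0`. -/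
theorem sum_signs_eq {m : ℕ} (a : Fin m → ℂ) (ha0 : ∀ i, a i ≠ 0)
    (ha : ∀ i j, i ≠ j → a i ^ 2 ≠ a j ^ 2) :
    ∑ ε : Fin m → Fin 2, (∏ i : Fin m, ∏ j ∈ Finset.Ici i,
        (fsgn (ε i) * a i + fsgn (ε j) * a j))⁻¹ *
        (-∑ i, ((ε i : ℕ) : ℂ) * a i) ^ (m * (m + 1) / 2) =
      (m * (m + 1) / 2).factorial *
        ∏ ℓ ∈ Finset.Icc 1 m, (ℓ.factorial : ℂ) / ((2 * ℓ).factorial : ℂ) := by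
  have hq : ∀ ε : Fin m → Fin 2, ∀ i, (fsgn (ε i) * a i) ^ 2 = a i ^ 2 := by
    intro ε i
    rw [mul_pow, sq (fsgn _), fsgn_mul_self, one_mul]
  have hVne : (oddVandermonde a).det ≠ 0 := by
    rw [det_oddVandermonde]
    refine mul_ne_zero (Finset.prod_ne_zero_iff.mpr fun i _ => ha0 i) ?_
    refine Finset.prod_ne_zero_iff.mpr fun i _ => Finset.prod_ne_zero_iff.mpr fun j hj => ?_
    exact sub_ne_zero.mpr (ha j i (Finset.mem_Ioi.mp hj).ne')
  set V := (oddVandermonde a).det with hV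
  -- `(b_i + b_j) (b_j - b_i) = b_j ^ 2 - b_i ^ 2`, where `b_i = ± a_i`, has no signs
  have hprod : ∀ ε : Fin m → Fin 2, (∏ i : Fin m, ∏ j ∈ Finset.Ici i,
      (fsgn (ε i) * a i + fsgn (ε j) * a j))⁻¹ = (∏ i, fsgn (ε i)) *
        (∏ i : Fin m, ∏ j ∈ Finset.Ioi i, (fsgn (ε j) * a j - fsgn (ε i) * a i)) /
          (2 ^ m * V) := by
    intro ε
    have h1 : (∏ i : Fin m, ∏ j ∈ Finset.Ici i, (fsgn (ε i) * a i + fsgn (ε j) * a j)) *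
        ((∏ i, fsgn (ε i)) *
          ∏ i : Fin m, ∏ j ∈ Finset.Ioi i, (fsgn (ε j) * a j - fsgn (ε i) * a i)) = 2 ^ m * V := by
      rw [prod_Ici_eq_mul_prod_Ioi, mul_mul_mul_comm, ← Finset.prod_mul_distrib,
        ← Finset.prod_mul_distrib, hV, det_oddVandermonde, ← mul_assoc]
      have h2 : ∏ i, (fsgn (ε i) * a i + fsgn (ε i) * a i) * fsgn (ε i) = 2 ^ m * ∏ i, a i := by
        have h3 : (2 : ℂ) ^ m = ∏ _i : Fin m, (2 : ℂ) := by simp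
        rw [h3, ← Finset.prod_mul_distrib]
        refine Finset.prod_congr rfl fun i _ => ?_
        linear_combination 2 * a i * fsgn_mul_self (ε i)
      rw [h2]
      congr 1
      refine Finset.prod_congr rfl fun i _ => ?_
      rw [← Finset.prod_mul_distrib]
      refine Finset.prod_congr rfl fun j _ => ?_
      linear_combination hq ε j - hq ε i
    have h3 : (2 : ℂ) ^ m * V ≠ 0 := mul_ne_zero (by norm_num) hVne
    have h4 := h3
    rw [← h1] at h4
    rw [← h1, eq_div_iff h4, inv_mul_cancel_left₀ (left_ne_zero_of_mul h4)]
  refine (sum_mul_pow_eq_of_tendsto _ (fun ε : Fin m → Fin 2 => -∑ i, ((ε i : ℕ) : ℂ) * a i)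
    (m * (m + 1) / 2) _ ?_)
  have hmain : ∀ x : ℂ, x ≠ 0 →
      Complex.exp (-(x / 2 * ∑ i, a i)) / (2 ^ m * V) *
        ((Matrix.of fun i j : Fin m => oddExp j (x / 2 * a i)).det / (x / 2) ^ (m ^ 2)) *
          (1 / 2) ^ (m * (m + 1) / 2) =
      (∑ ε : Fin m → Fin 2, (∏ i : Fin m, ∏ j ∈ Finset.Ici i,
        (fsgn (ε i) * a i + fsgn (ε j) * a j))⁻¹ *
        Complex.exp (x * -∑ i, ((ε i : ℕ) : ℂ) * a i)) / x ^ (m * (m + 1) / 2) := by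
    intro x hx
    rw [det_oddExp_eq_sum]
    have h1 : ∀ ε : Fin m → Fin 2, ∏ i : Fin m, ∏ j ∈ Finset.Ioi i,
        (fsgn (ε j) * (x / 2 * a j) - fsgn (ε i) * (x / 2 * a i)) =
        (x / 2) ^ (m * (m - 1) / 2) * ∏ i : Fin m, ∏ j ∈ Finset.Ioi i,
          (fsgn (ε j) * a j - fsgn (ε i) * a i) := by
      intro ε
      rw [← prod_Ioi_const, ← Finset.prod_mul_distrib]
      refine Finset.prod_congr rfl fun i _ => ?_
      rw [← Finset.prod_mul_distrib]
      refine Finset.prod_congr rfl fun j _ => ?_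
      ring
    have h2 : ∀ ε : Fin m → Fin 2, Complex.exp (x * -∑ i, ((ε i : ℕ) : ℂ) * a i) =
        Complex.exp (-(x / 2 * ∑ i, a i)) * Complex.exp (∑ i, fsgn (ε i) * (x / 2 * a i)) := by
      intro ε
      rw [← Complex.exp_add]
      congr 1
      simp only [fsgn_eq, Finset.mul_sum, ← Finset.sum_neg_distrib, ← Finset.sum_add_distrib]
      exact Finset.sum_congr rfl fun i _ => by ring
    simp only [h1, h2, hprod, Finset.sum_div, Finset.mul_sum, Finset.sum_mul]
    refine Finset.sum_congr rfl fun ε _ => ?_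
    rw [← triangle_add_triangle, pow_add (x / 2)]
    have h3 : (x / 2) ^ (m * (m - 1) / 2) ≠ 0 := pow_ne_zero _ (by simpa using hx)
    have h4 : (x / 2) ^ (m * (m + 1) / 2) = x ^ (m * (m + 1) / 2) * (1 / 2) ^ (m * (m + 1) / 2) := by
      rw [← mul_pow]; congr 1; ring
    have h5 : x ^ (m * (m + 1) / 2) ≠ 0 := pow_ne_zero _ hx
    have h6 : ((1 : ℂ) / 2) ^ (m * (m + 1) / 2) ≠ 0 := pow_ne_zero _ (by norm_num)
    rw [h4]
    field_simp
  have hlim0 : Tendsto (fun x : ℂ => x / 2) (𝓝[≠] 0) (𝓝[≠] 0) := by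
    refine tendsto_nhdsWithin_iff.mpr ⟨?_, ?_⟩
    · have : Continuous fun x : ℂ => x / 2 := by fun_prop
      simpa using (this.tendsto 0).mono_left nhdsWithin_le_nhds
    · filter_upwards [self_mem_nhdsWithin] with x hx
      simpa using hx
  have hexp : Tendsto (fun x : ℂ => Complex.exp (-(x / 2 * ∑ i, a i)) / (2 ^ m * V)) (𝓝[≠] 0)
      (𝓝 (1 / (2 ^ m * V))) := by
    have : Continuous fun x : ℂ => Complex.exp (-(x / 2 * ∑ i, a i)) / (2 ^ m * V) := by fun_prop
    simpa using (this.tendsto 0).mono_left nhdsWithin_le_nhds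
  have hlim := (hexp.mul ((tendsto_det_oddExp a hVne).comp hlim0)).mul_const
    ((1 / 2 : ℂ) ^ (m * (m + 1) / 2))
  have hval : 1 / (2 ^ m * V) * ((oddVandermonde a).det * (oddExpMatrix m).det) *
      (1 / 2 : ℂ) ^ (m * (m + 1) / 2) =
      ∏ ℓ ∈ Finset.Icc 1 m, (ℓ.factorial : ℂ) / ((2 * ℓ).factorial : ℂ) := by
    rw [← hV, det_oddExpMatrix]
    have h1 : ((1 : ℂ) / 2) ^ (m * (m + 1) / 2) = ∏ l ∈ Finset.range m, (1 / 2 : ℂ) ^ (l + 1) := by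
      rw [Finset.prod_pow_eq_pow_sum]
      congr 1
      have h5 := Finset.sum_range_id (m + 1)
      rw [Finset.sum_range_succ', Nat.add_sub_cancel, add_zero, mul_comm] at h5
      exact h5.symm
    have h2 : ∏ ℓ ∈ Finset.Icc 1 m, (ℓ.factorial : ℂ) / ((2 * ℓ).factorial : ℂ) =
        ∏ l ∈ Finset.range m, ((l + 1).factorial : ℂ) / ((2 * (l + 1)).factorial : ℂ) := by
      rw [Finset.range_eq_Ico, Finset.prod_Ico_add' (fun l => (l.factorial : ℂ) /
        ((2 * l).factorial : ℂ)) 0 m 1]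
      rfl
    have h3 : (2 : ℂ) ^ m ≠ 0 := by norm_num
    rw [h1, h2]
    have h4 : ∀ P Q : ℂ, 1 / (2 ^ m * V) * (V * (2 ^ m * P)) * Q = P * Q := by
      intro P Q
      field_simp
    rw [h4, ← Finset.prod_mul_distrib]
    refine Finset.prod_congr rfl fun l _ => ?_
    rw [show 2 * (l + 1) = 2 * l + 1 + 1 by ring, Nat.factorial_succ (2 * l + 1),
      Nat.factorial_succ l]
    push_cast
    have h5 : ((2 * l + 1).factorial : ℂ) ≠ 0 := by exact_mod_cast Nat.factorial_ne_zero _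
    have h6 : (2 * (l : ℂ) + 1 + 1) ≠ 0 := by
      have : ((2 * l + 1 + 1 : ℕ) : ℂ) ≠ 0 := Nat.cast_ne_zero.mpr (by omega)
      push_cast at this
      exact this
    have h7 : (1 / 2 : ℂ) ^ (l + 1) * 2 ^ l = 1 / 2 := by
      rw [pow_succ, mul_right_comm, ← mul_pow]; norm_num
    rw [div_mul_eq_mul_div, div_eq_div_iff h5 (mul_ne_zero h6 h5)]
    linear_combination (2 * (l : ℂ) + 1 + 1) * ((2 * l + 1).factorial : ℂ) * l.factorial * h7
  rw [hval] at hlim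
  refine hlim.congr' ?_
  filter_upwards [self_mem_nhdsWithin] with x hx
  exact hmain x hx

end LeadingConstant

/-! ### Quadratic Gauss sums -/

section GaussSum

open Complex

lemma summable_exp_neg_mul_int_sq {b : ℂ} (hb : 0 < b.re) (d : ℂ) :
    Summable fun n : ℤ => cexp (-Real.pi * b * n ^ 2 + 2 * Real.pi * d * n) := by
  have h := (summable_jacobiTheta₂_term_iff (-I * d) (I * b)).mpr (by simpa using hb)
  refine h.congr fun n => ?_
  rw [jacobiTheta₂_term]
  congr 1
  linear_combination (-(2 * Real.pi * n * d) + Real.pi * n ^ 2 * b) * I_sq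

lemma ofReal_mul_cpow {r : ℝ} (hr : 0 < r) {z : ℂ} (hz : z ≠ 0) (w : ℂ) :
    ((r : ℂ) * z) ^ w = (r : ℂ) ^ w * z ^ w := by
  have hr' : (r : ℂ) ≠ 0 := by exact_mod_cast hr.ne'
  rw [cpow_def_of_ne_zero (mul_ne_zero hr' hz), cpow_def_of_ne_zero hr', cpow_def_of_ne_zero hz,
    log_ofReal_mul hr hz, ← exp_add, ofReal_log hr.le, add_mul]

lemma ofReal_sq_cpow_half {r : ℝ} (hr : 0 < r) : (((r ^ 2 : ℝ) : ℂ)) ^ (1 / 2 : ℂ) = r := by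
  have : ((1 / 2 : ℂ)) = ((1 / 2 : ℝ) : ℂ) := by push_cast; rfl
  rw [this, ← ofReal_cpow (by positivity), ← Real.sqrt_eq_rpow, Real.sqrt_sq hr.le]

/-- Poisson summation along a residue class. -/
lemma cpow_half_mul_tsum_residue {N : ℕ} (hN : 0 < N) (r : ℤ) {z : ℂ} (hz : 0 < z.re) :
    z ^ (1 / 2 : ℂ) * ∑' k : ℤ, cexp (-Real.pi * z * ((k * N + r : ℤ) : ℂ) ^ 2) =
      1 / N * ∑' k : ℤ, cexp (-Real.pi / ((N : ℂ) ^ 2 * z) * k ^ 2) *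
        cexp (2 * Real.pi * I * k * r / N) := by
  have hz0 : z ≠ 0 := by rintro rfl; simp at hz
  have hN' : (0 : ℝ) < N := by exact_mod_cast hN
  have hNc : (N : ℂ) ≠ 0 := by exact_mod_cast hN.ne'
  have ha : 0 < ((N : ℂ) ^ 2 * z).re := by
    have : ((N : ℂ) ^ 2 * z) = ((N ^ 2 : ℝ) : ℂ) * z := by push_cast; ring
    rw [this, re_ofReal_mul]
    positivity
  have h1 := tsum_exp_neg_quadratic ha (-(N * r * z))
  have h2 : ∀ k : ℤ, cexp (-Real.pi * z * ((k * N + r : ℤ) : ℂ) ^ 2) = cexp (-Real.pi * z * r ^ 2) *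
      cexp (-Real.pi * ((N : ℂ) ^ 2 * z) * k ^ 2 + 2 * Real.pi * (-(N * r * z)) * k) := by
    intro k
    rw [← exp_add]
    congr 1
    push_cast
    ring
  have h3 : ∀ k : ℤ, cexp (-Real.pi / ((N : ℂ) ^ 2 * z) * k ^ 2) *
      cexp (2 * Real.pi * I * k * r / N) = cexp (-Real.pi * z * r ^ 2) *
        cexp (-Real.pi / ((N : ℂ) ^ 2 * z) * (k + I * (-(N * r * z))) ^ 2) := by
    intro k
    rw [← exp_add, ← exp_add]
    congr 1
    field_simp
    linear_combination ((N : ℂ) ^ 2 * r ^ 2 * z ^ 2) * I_sq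
  simp only [h2, h3, tsum_mul_left]
  rw [h1]
  have h4 : ((N : ℂ) ^ 2 * z) ^ (1 / 2 : ℂ) = N * z ^ (1 / 2 : ℂ) := by
    have : ((N : ℂ) ^ 2 * z) = (((N : ℝ) ^ 2 : ℝ) : ℂ) * z := by push_cast; ring
    rw [this, ofReal_mul_cpow (by positivity) hz0, ofReal_sq_cpow_half hN']
    simp
  have h5 : z ^ (1 / 2 : ℂ) ≠ 0 := by simp [cpow_eq_zero_iff, hz0]
  rw [h4]
  field_simp

/-- Gaussian sums weighted by a periodic function see only its mean value. -/
theorem tendsto_cpow_half_mul_tsum_periodic {ι : Type*} {l : Filter ι} [l.IsCountablyGenerated]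
    {N : ℕ} (hN : 0 < N)
    {c : ℤ → ℂ} (hc : ∀ n, c (n + N) = c n) {z : ι → ℂ} (hz : ∀ᶠ x in l, 0 < (z x).re)
    (hz' : Tendsto (fun x => (1 / z x).re) l atTop) :
    Tendsto (fun x => z x ^ (1 / 2 : ℂ) * ∑' n : ℤ, c n * cexp (-Real.pi * z x * n ^ 2)) l
      (𝓝 ((∑ r ∈ Finset.range N, c r) / N)) := by
  have hN' : (0 : ℝ) < N := by exact_mod_cast hN
  have : NeZero N := ⟨hN.ne'⟩
  have hc' : ∀ (k : ℤ) (r : ℤ), c (k * N + r) = c r := by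
    intro k r
    have h0 : Function.Periodic c (N : ℤ) := hc
    rw [add_comm]
    exact_mod_cast h0.int_mul k r
  have hcl : ∀ r : ℤ, Tendsto (fun x => z x ^ (1 / 2 : ℂ) *
      ∑' k : ℤ, cexp (-Real.pi * z x * ((k * N + r : ℤ) : ℂ) ^ 2)) l (𝓝 (1 / N)) := by
    intro r
    have h1 : Tendsto (fun x => ∑' k : ℤ, cexp (-Real.pi / ((N : ℂ) ^ 2 * z x) * k ^ 2) *
        cexp (2 * Real.pi * I * k * r / N)) l (𝓝 (∑' k : ℤ, if k = 0 then 1 else 0)) := by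
      have hn : ∀ x, ∀ k : ℤ, ‖cexp (-Real.pi / ((N : ℂ) ^ 2 * z x) * k ^ 2) *
        cexp (2 * Real.pi * I * k * r / N)‖ =
          Real.exp (-(Real.pi / N ^ 2 * k ^ 2 * (1 / z x).re)) := by
        intro x k
        rw [norm_mul]
        have e1 : cexp (2 * Real.pi * I * k * r / N) =
          cexp (((2 * Real.pi * k * r / N : ℝ) : ℂ) * I) := by
          congr 1; push_cast; ring
        have e2 : (-Real.pi / ((N : ℂ) ^ 2 * z x) * k ^ 2) =
          ((-(Real.pi / N ^ 2 * k ^ 2) : ℝ) : ℂ) * (1 / z x) := by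
          push_cast
          simp only [div_eq_mul_inv, mul_inv]
          ring
        rw [e1, norm_exp_ofReal_mul_I, mul_one, norm_exp, e2, re_ofReal_mul, neg_mul]
      refine tendsto_tsum_of_dominated_convergence
        (bound := fun k : ℤ => ‖cexp (-Real.pi * 1 * k ^ 2 + 2 * Real.pi * 0 * k)‖)
        (summable_exp_neg_mul_int_sq (by simp) 0).norm ?_ ?_
      · intro k
        by_cases hk : k = 0
        · subst hk
          simpa using tendsto_const_nhds
        · rw [if_neg hk, tendsto_zero_iff_norm_tendsto_zero]
          simp only [hn]
          refine Real.tendsto_exp_neg_atTop_nhds_zero.comp (hz'.const_mul_atTop ?_)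
          have : (0 : ℝ) < (k : ℝ) ^ 2 := by positivity
          have := Real.pi_pos
          positivity
      · filter_upwards [hz'.eventually_ge_atTop ((N : ℝ) ^ 2)] with x hx k
        rw [hn, norm_exp]
        refine Real.exp_le_exp.mpr ?_
        have e2 : (-Real.pi * 1 * k ^ 2 + 2 * Real.pi * 0 * k : ℂ) =
          ((-(Real.pi * k ^ 2) : ℝ) : ℂ) := by push_cast; ring
        rw [e2, ofReal_re, neg_le_neg_iff]
        have : Real.pi / N ^ 2 * k ^ 2 * (1 / z x).re ≥ Real.pi / N ^ 2 * k ^ 2 * (N : ℝ) ^ 2 := by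
          have := Real.pi_pos
          gcongr
        refine le_trans (le_of_eq ?_) this
        field_simp
    rw [tsum_ite_eq] at h1
    have h2 := h1.const_mul (1 / (N : ℂ))
    rw [mul_one] at h2
    refine h2.congr' ?_
    filter_upwards [hz] with x hx
    exact (cpow_half_mul_tsum_residue hN r hx).symm
  have hsum : ∀ x, 0 < (z x).re → z x ^ (1 / 2 : ℂ) * ∑' n : ℤ, c n * cexp (-Real.pi * z x * n ^ 2) =
      ∑ r : Fin N, c r * (z x ^ (1 / 2 : ℂ) *
        ∑' k : ℤ, cexp (-Real.pi * z x * ((k * N + (r : ℕ) : ℤ) : ℂ) ^ 2)) := by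
    intro x hx
    have hs : Summable fun n : ℤ => cexp (-Real.pi * z x * n ^ 2) := by
      refine (summable_exp_neg_mul_int_sq hx 0).congr fun n => ?_
      simp
    have hcb : ∀ n, ‖c n‖ ≤ ∑ r ∈ Finset.range N, ‖c r‖ := by
      intro n
      have h1 : c n = c ((n % N).toNat : ℕ) := by
        rw [Int.toNat_of_nonneg (Int.emod_nonneg _ (by exact_mod_cast hN.ne')),
          ← hc' (n / N) (n % N), Int.ediv_mul_add_emod]
      rw [h1]
      refine Finset.single_le_sum (f := fun r : ℕ => ‖c r‖) (fun _ _ => norm_nonneg _) ?_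
      have := Int.emod_lt_of_pos n (by exact_mod_cast hN : (0 : ℤ) < N)
      have := Int.emod_nonneg n (by exact_mod_cast hN.ne' : (N : ℤ) ≠ 0)
      simp only [Finset.mem_range]
      omega
    have hs' : Summable fun n : ℤ => c n * cexp (-Real.pi * z x * n ^ 2) := by
      refine Summable.of_norm_bounded (hs.norm.mul_left (∑ r ∈ Finset.range N, ‖c r‖)) fun n => ?_
      rw [norm_mul]
      exact mul_le_mul_of_nonneg_right (hcb n) (norm_nonneg _)
    set e : Fin N × ℤ ≃ ℤ := (Equiv.prodComm _ _).trans (Int.divModEquiv N).symm with he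
    have he' : ∀ (r : Fin N) (k : ℤ), e (r, k) = k * N + (r : ℕ) := fun r k => rfl
    have h2 := e.summable_iff.mpr hs'
    have h3 : ∑' n : ℤ, c n * cexp (-Real.pi * z x * n ^ 2) =
        ∑ r : Fin N, c r * ∑' k : ℤ, cexp (-Real.pi * z x * ((k * N + (r : ℕ) : ℤ) : ℂ) ^ 2) := by
      rw [← e.tsum_eq]
      change ∑' q, ((fun n : ℤ => c n * cexp (-Real.pi * z x * n ^ 2)) ∘ e) q = _
      rw [Summable.tsum_prod h2, tsum_fintype]
      refine Finset.sum_congr rfl fun r _ => ?_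
      rw [← tsum_mul_left]
      refine tsum_congr fun k => ?_
      simp only [Function.comp_apply]
      rw [he', hc']
    rw [h3, Finset.mul_sum]
    exact Finset.sum_congr rfl fun r _ => by ring
  have hfin := tendsto_finsetSum Finset.univ fun (r : Fin N) _ => (hcl (r : ℕ)).const_mul (c (r : ℕ))
  have heq : (∑ r ∈ Finset.range N, c r) / N = ∑ r : Fin N, c (r : ℕ) * (1 / N) := by
    rw [Finset.sum_range, Finset.sum_div]
    exact Finset.sum_congr rfl fun r _ => by ring
  rw [heq]
  refine hfin.congr' ?_
  filter_upwards [hz] with x hx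
  rw [hsum x hx]

/-- The quadratic Gauss sum of an odd modulus, including its sign, as a case of the
Landsberg–Schaar reciprocity: the transformation `a ↦ 1 / a` of the Gaussian sum
`∑ exp (-π a n²)`, with `a` tending to the boundary point `-2i / p`. -/
theorem sum_exp_sq_eq {p : ℕ} (hp : p % 2 = 1) :
    ∑ r ∈ Finset.range p, cexp (2 * Real.pi * I * (r : ℂ) ^ 2 / p) =
      Real.sqrt p * if p % 4 = 1 then 1 else I := by
  have hp0 : 0 < p := by omega
  have hpr : (0 : ℝ) < p := by exact_mod_cast hp0
  have hpc : (p : ℂ) ≠ 0 := by exact_mod_cast hp0.ne'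
  set b : ℝ → ℂ := fun w => w + I * (p / 2) with hb
  have hbre : ∀ w, (b w).re = w := by
    intro w
    have : b w = w + ((p / 2 : ℝ) : ℂ) * I := by simp only [hb]; push_cast; ring
    rw [this]; simp
  have hb0 : ∀ w, 0 < w → b w ≠ 0 := by
    intro w hw h
    have := hbre w
    rw [h] at this
    simp at this
    exact hw.ne this
  set z : ℝ → ℂ := fun w => w * (2 * I / p / b w) with hz
  set c : ℤ → ℂ := fun n => cexp (2 * Real.pi * I * (n : ℂ) ^ 2 / p) with hc
  set c' : ℤ → ℂ := fun n => cexp (-(Real.pi * I * (n : ℂ) ^ 2 * p / 2)) with hc'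
  have hcp : ∀ n, c (n + p) = c n := by
    intro n
    simp only [hc]
    refine exp_eq_exp_iff_exists_int.mpr ⟨2 * n + p, ?_⟩
    push_cast
    field_simp
    ring
  have hcp' : ∀ n, c' (n + (2 : ℕ)) = c' n := by
    intro n
    simp only [hc']
    refine exp_eq_exp_iff_exists_int.mpr ⟨-((n + 1) * p), ?_⟩
    push_cast
    ring
  have hzinv : ∀ w : ℝ, 0 < w → (1 / z w) = ((p ^ 2 / 4 / w : ℝ) : ℂ) - I * (p / 2) := by
    intro w hw
    have hwc : (w : ℂ) ≠ 0 := by exact_mod_cast hw.ne'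
    have h1 := hb0 w hw
    simp only [hz]
    push_cast
    field_simp
    simp only [hb]
    linear_combination (4 * (w : ℂ)) * I_sq
  have hzinvre : ∀ w : ℝ, 0 < w → (1 / z w).re = p ^ 2 / 4 / w := by
    intro w hw
    rw [hzinv w hw]
    have : I * ((p : ℂ) / 2) = ((p / 2 : ℝ) : ℂ) * I := by push_cast; ring
    rw [this, sub_re, ofReal_re, re_ofReal_mul, I_re, mul_zero, sub_zero]
  have hzre : ∀ w : ℝ, 0 < w → 0 < (z w).re := by
    intro w hw
    have h1 := hzinvre w hw
    have h2 : 0 < (1 / z w).re := by rw [h1]; positivity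
    rw [one_div, inv_re] at h2
    by_contra hcon
    push Not at hcon
    exact absurd h2 (not_lt.mpr (div_nonpos_of_nonpos_of_nonneg hcon (normSq_nonneg _)))
  have hT1 := tendsto_cpow_half_mul_tsum_periodic (l := 𝓝[>] (0 : ℝ)) hp0 hcp (z := z)
    (by filter_upwards [self_mem_nhdsWithin] with w hw; exact hzre w hw)
    (by
      have : Tendsto (fun w : ℝ => (p ^ 2 / 4 : ℝ) * w⁻¹) (𝓝[>] 0) atTop :=
        tendsto_inv_nhdsGT_zero.const_mul_atTop (by positivity)
      refine this.congr' ?_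
      filter_upwards [self_mem_nhdsWithin] with w hw
      rw [hzinvre w hw, div_eq_mul_inv _ w])
  have hT2 := tendsto_cpow_half_mul_tsum_periodic (l := 𝓝[>] (0 : ℝ)) (by norm_num : 0 < 2) hcp'
    (z := fun w => (w : ℂ))
    (by filter_upwards [self_mem_nhdsWithin] with w hw; simpa using hw)
    (by
      refine tendsto_inv_nhdsGT_zero.congr fun w => ?_
      rw [one_div, ← ofReal_inv, ofReal_re])
  -- The theta transformation relates `∑ c n e ^ (-π z n ^ 2)`, with `c` of period `p`, to a sum of
  -- the same kind with `c'` of period `2`. Both sides have limits as `w → 0`, the mean values of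
  -- `c` and `c'` up to factors, and their equality evaluates the Gauss sum.
  have hFE : ∀ w : ℝ, 0 < w → z w ^ (1 / 2 : ℂ) * ∑' n : ℤ, c n * cexp (-Real.pi * z w * n ^ 2) =
      (2 * I / p / b w) ^ (1 / 2 : ℂ) / (1 / b w) ^ (1 / 2 : ℂ) *
        ((w : ℂ) ^ (1 / 2 : ℂ) * ∑' n : ℤ, c' n * cexp (-Real.pi * w * n ^ 2)) := by
    intro w hw
    have hbw := hb0 w hw
    have hare : 0 < (1 / b w).re := by
      rw [one_div, inv_re, hbre]
      exact div_pos hw (normSq_pos.mpr hbw)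
    have h1 := tsum_exp_neg_mul_int_sq hare
    have h2 : ∀ n : ℤ, c n * cexp (-Real.pi * z w * n ^ 2) =
        cexp (-Real.pi * (1 / b w) * n ^ 2) := by
      intro n
      simp only [hc]
      rw [← exp_add]
      congr 1
      simp only [hz]
      field_simp
      simp only [hb]
      linear_combination ((n : ℂ) ^ 2 * p) * I_sq
    have h3 : ∀ n : ℤ, c' n * cexp (-Real.pi * w * n ^ 2) =
        cexp (-Real.pi / (1 / b w) * n ^ 2) := by
      intro n
      simp only [hc']
      rw [← exp_add]
      congr 1
      rw [div_div_eq_mul_div, div_one]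
      simp only [hb]
      ring
    simp only [h2, h3]
    rw [h1]
    have h4 : (2 * I / p / b w) ≠ 0 := by
      refine div_ne_zero (div_ne_zero (by simp) hpc) hbw
    simp only [hz]
    rw [ofReal_mul_cpow hw h4]
    ring
  have hblim : Tendsto b (𝓝[>] 0) (𝓝 (I * (p / 2))) := by
    have h1 : Continuous b := by fun_prop
    simpa [hb] using (h1.tendsto 0).mono_left nhdsWithin_le_nhds
  have hbl0 : I * ((p : ℂ) / 2) ≠ 0 := mul_ne_zero I_ne_zero (div_ne_zero hpc two_ne_zero)
  have hs1 : Tendsto (fun w => (2 * I / p / b w) ^ (1 / 2 : ℂ)) (𝓝[>] 0) (𝓝 (2 / p)) := by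
    have h1 : Tendsto (fun w => 2 * I / p / b w) (𝓝[>] 0) (𝓝 ((((2 / p : ℝ) ^ 2 : ℝ)) : ℂ)) := by
      have := (tendsto_const_nhds (x := 2 * I / (p : ℂ))).div hblim hbl0
      have e1 : (((2 / p : ℝ) ^ 2 : ℝ) : ℂ) = 2 * I / p / (I * (p / 2)) := by
        have := I_ne_zero
        push_cast
        field_simp
      rw [e1]
      exact this
    have h2 := h1.cpow (tendsto_const_nhds (x := (1 / 2 : ℂ))) (by
      rw [ofReal_mem_slitPlane]; positivity)
    rw [ofReal_sq_cpow_half (by positivity)] at h2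
    push_cast at h2
    exact h2
  have hsp : (0 : ℝ) < Real.sqrt p := Real.sqrt_pos.mpr hpr
  have hspc : ((Real.sqrt p : ℝ) : ℂ) ≠ 0 := by exact_mod_cast hsp.ne'
  have hspsq : ((Real.sqrt p : ℝ) : ℂ) ^ 2 = p := by
    rw [← ofReal_pow, Real.sq_sqrt hpr.le]; simp
  have hs2 : Tendsto (fun w => (1 / b w) ^ (1 / 2 : ℂ)) (𝓝[>] 0) (𝓝 ((1 - I) / Real.sqrt p)) := by
    set q : ℂ := (1 - I) / Real.sqrt p with hq
    have hqre : 0 < q.re := by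
      rw [hq, div_ofReal_re]
      simp [hsp]
    have hq2 : q ^ 2 = -(2 * I / p) := by
      rw [hq, div_pow, hspsq]
      field_simp
      linear_combination I_sq
    have h1 : Tendsto (fun w => 1 / b w) (𝓝[>] 0) (𝓝 (q ^ 2)) := by
      have := (tendsto_const_nhds (x := (1 : ℂ))).div hblim hbl0
      have e1 : q ^ 2 = 1 / (I * (p / 2)) := by
        have := I_ne_zero
        rw [hq2]
        field_simp
        linear_combination (-1 : ℂ) * I_sq
      rw [e1]
      exact this
    have h2 := h1.cpow (tendsto_const_nhds (x := (1 / 2 : ℂ))) (by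
      rw [hq2, mem_slitPlane_iff]
      right
      have : -(2 * I / p) = ((-(2 / p) : ℝ) : ℂ) * I := by push_cast; ring
      rw [this]
      simp [hp0.ne'])
    have h3 : (q ^ 2) ^ (1 / 2 : ℂ) = q := by
      rw [one_div]
      exact sq_cpow_two_inv hqre
    rwa [h3] at h2
  have h1I : (1 - I) ≠ 0 := by
    intro h
    have := congrArg re h
    simp at this
  have hq0 : (1 - I) / (Real.sqrt p : ℂ) ≠ 0 := div_ne_zero h1I hspc
  have hlim := ((hs1.div hs2 hq0).mul hT2)
  have hlim' := hlim.congr' (f₂ := fun w => z w ^ (1 / 2 : ℂ) *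
      ∑' n : ℤ, c n * cexp (-Real.pi * z w * n ^ 2)) (by
    filter_upwards [self_mem_nhdsWithin] with w hw
    exact (hFE w hw).symm)
  have heq := tendsto_nhds_unique hT1 hlim'
  have hG : ∑ r ∈ Finset.range p, cexp (2 * Real.pi * I * (r : ℂ) ^ 2 / p) =
      ∑ r ∈ Finset.range p, c r := by simp [hc]
  have hc0 : c' 0 = 1 := by simp [hc']
  have hc1 : c' 1 = if p % 4 = 1 then -I else I := by
    simp only [hc']
    obtain ⟨k, hk⟩ : ∃ k, p = 4 * k + p % 4 := ⟨p / 4, by omega⟩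
    have h4 : p % 4 = 1 ∨ p % 4 = 3 := by omega
    rcases h4 with h4 | h4
    · rw [if_pos h4, hk, h4]
      have : -(Real.pi * I * ((1 : ℤ) : ℂ) ^ 2 * ((4 * k + 1 : ℕ) : ℂ) / 2) =
          -(Real.pi / 2 * I) - k * (2 * Real.pi * I) := by push_cast; ring
      rw [this, exp_sub, exp_nat_mul_two_pi_mul_I, exp_neg, exp_pi_div_two_mul_I]
      simp
    · rw [if_neg (by omega), hk, h4]
      have : -(Real.pi * I * ((1 : ℤ) : ℂ) ^ 2 * ((4 * k + 3 : ℕ) : ℂ) / 2) =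
          (Real.pi / 2 * I) - (k + 1 : ℕ) * (2 * Real.pi * I) := by push_cast; ring
      rw [this, exp_sub, exp_nat_mul_two_pi_mul_I, exp_pi_div_two_mul_I]
      simp
  rw [hG]
  simp only [Finset.sum_range_succ, Finset.sum_range_zero, zero_add, Nat.cast_zero, Nat.cast_one,
    hc0, hc1] at heq
  rw [div_eq_iff hpc] at heq
  rw [heq]
  rw [← hspsq]
  split_ifs
  · field_simp
    push_cast
    ring
  · field_simp
    push_cast
    linear_combination (2 : ℂ) * I_sq

end GaussSum

/-! ### Gauss sums of Kronecker symbols -/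

section SelfDual

open Complex

/-- A completely multiplicative function `f` on `ℤ` of period `N` whose finite Fourier transform is
`c` times `f`. Primitive quadratic characters are the examples of interest. -/
structure IsSelfDual (N : ℕ) (f : ℤ → ℂ) (c : ℂ) : Prop where
  pos : 0 < N
  mul : ∀ a b, f (a * b) = f a * f b
  periodic : ∀ n, f (n + N) = f n
  fourier : ∀ k : ℤ, ∑ r ∈ Finset.range N, f r * cexp (2 * Real.pi * I * r * k / N) = c * f k

lemma apply_mul_add {N : ℕ} {f : ℤ → ℂ} (hf : ∀ n, f (n + N) = f n) (r k : ℤ) :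
    f (r + k * N) = f r := by
  have h0 : Function.Periodic f (N : ℤ) := hf
  exact_mod_cast h0.int_mul k r

lemma apply_eq_of_modEq {N : ℕ} {f : ℤ → ℂ} (hf : ∀ n, f (n + N) = f n) {a b : ℤ}
    (h : (N : ℤ) ∣ a - b) : f a = f b := by
  obtain ⟨k, hk⟩ := h
  rw [show a = b + k * N by linarith, apply_mul_add hf]

lemma sum_zmod_val_eq {N : ℕ} [NeZero N] (g : ℕ → ℂ) :
    ∑ a : ZMod N, g a.val = ∑ r ∈ Finset.range N, g r := by
  refine Finset.sum_bij (fun a _ => a.val) (fun a _ => Finset.mem_range.mpr a.val_lt)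
    (fun a _ b _ h => ZMod.val_injective N h) (fun r hr => ⟨(r : ZMod N), Finset.mem_univ _, ?_⟩)
    (fun a _ => rfl)
  exact ZMod.val_cast_of_lt (Finset.mem_range.mp hr)

/-- Summing a periodic function with the Chinese remainder theorem. -/
lemma sum_range_mul_eq {N₁ N₂ : ℕ} (h₁ : 0 < N₁) (h₂ : 0 < N₂) (hco : N₁.Coprime N₂) {F : ℤ → ℂ}
    (hF : ∀ n, F (n + (N₁ * N₂ : ℕ)) = F n) :
    ∑ r ∈ Finset.range (N₁ * N₂), F r =
      ∑ a ∈ Finset.range N₁, ∑ b ∈ Finset.range N₂, F (a * N₂ + b * N₁) := by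
  have : NeZero (N₁ * N₂) := ⟨(Nat.mul_pos h₁ h₂).ne'⟩
  simp only [Finset.sum_range]
  rw [← Fintype.sum_prod_type' (f := fun (a : Fin N₁) (b : Fin N₂) =>
    F (((a : ℕ) : ℤ) * N₂ + ((b : ℕ) : ℤ) * N₁))]
  set e : Fin N₁ × Fin N₂ → Fin (N₁ * N₂) := fun p =>
    ⟨((p.1 : ℕ) * N₂ + (p.2 : ℕ) * N₁) % (N₁ * N₂), Nat.mod_lt _ (Nat.mul_pos h₁ h₂)⟩ with he
  have hinj : Function.Injective e := by
    rintro ⟨a, b⟩ ⟨a', b'⟩ h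
    simp only [he, Fin.mk.injEq] at h
    have h3 : (a : ℕ) * N₂ + b * N₁ ≡ a' * N₂ + b' * N₁ [MOD N₁ * N₂] := h
    have h4 : (a : ℕ) ≡ a' [MOD N₁] := by
      have h5 := h3.of_mul_right N₂
      have h6 : (a : ℕ) * N₂ ≡ a' * N₂ [MOD N₁] := by
        have e1 : (a : ℕ) * N₂ + b * N₁ ≡ a * N₂ [MOD N₁] := by simp [Nat.ModEq]
        have e2 : (a' : ℕ) * N₂ + b' * N₁ ≡ a' * N₂ [MOD N₁] := by simp [Nat.ModEq]
        exact e1.symm.trans (h5.trans e2)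
      exact Nat.ModEq.cancel_right_of_coprime hco h6
    have h4' : (b : ℕ) ≡ b' [MOD N₂] := by
      have h5 := h3.of_mul_left N₁
      have h6 : (b : ℕ) * N₁ ≡ b' * N₁ [MOD N₂] := by
        have e1 : (a : ℕ) * N₂ + b * N₁ ≡ b * N₁ [MOD N₂] := by simp [Nat.ModEq]
        have e2 : (a' : ℕ) * N₂ + b' * N₁ ≡ b' * N₁ [MOD N₂] := by simp [Nat.ModEq]
        exact e1.symm.trans (h5.trans e2)
      exact Nat.ModEq.cancel_right_of_coprime hco.symm h6
    rw [Nat.ModEq, Nat.mod_eq_of_lt a.2, Nat.mod_eq_of_lt a'.2] at h4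
    rw [Nat.ModEq, Nat.mod_eq_of_lt b.2, Nat.mod_eq_of_lt b'.2] at h4'
    exact Prod.ext (Fin.ext h4) (Fin.ext h4')
  have hbij : Function.Bijective e :=
    (Fintype.bijective_iff_injective_and_card e).mpr ⟨hinj, by simp⟩
  refine (Fintype.sum_bijective e hbij _ _ fun p => ?_).symm
  refine apply_eq_of_modEq hF ?_
  simp only [he]
  rw [Int.natCast_mod]
  push_cast
  exact Int.dvd_self_sub_emod

/-- The product of two self-dual functions of coprime periods. -/
theorem IsSelfDual.prod {N₁ N₂ : ℕ} {f₁ f₂ : ℤ → ℂ} {c₁ c₂ : ℂ} (h₁ : IsSelfDual N₁ f₁ c₁)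
    (h₂ : IsSelfDual N₂ f₂ c₂) (hco : N₁.Coprime N₂) :
    IsSelfDual (N₁ * N₂) (fun n => f₁ n * f₂ n) (c₁ * c₂ * (f₁ N₂ * f₂ N₁)) where
  pos := Nat.mul_pos h₁.pos h₂.pos
  mul a b := by rw [h₁.mul, h₂.mul]; ring
  periodic n := by
    congr 1
    · refine apply_eq_of_modEq h₁.periodic ⟨N₂, by push_cast; ring⟩
    · refine apply_eq_of_modEq h₂.periodic ⟨N₁, by push_cast; ring⟩
  fourier k := by
    have hN₁ : (N₁ : ℂ) ≠ 0 := by exact_mod_cast h₁.pos.ne'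
    have hN₂ : (N₂ : ℂ) ≠ 0 := by exact_mod_cast h₂.pos.ne'
    set F : ℤ → ℂ := fun n => f₁ n * f₂ n *
      cexp (2 * Real.pi * I * n * k / ((N₁ * N₂ : ℕ) : ℂ)) with hF
    have hper : ∀ n, F (n + (N₁ * N₂ : ℕ)) = F n := by
      intro n
      have e1 : f₁ (n + (N₁ * N₂ : ℕ)) = f₁ n :=
        apply_eq_of_modEq h₁.periodic ⟨N₂, by push_cast; ring⟩
      have e2 : f₂ (n + (N₁ * N₂ : ℕ)) = f₂ n :=
        apply_eq_of_modEq h₂.periodic ⟨N₁, by push_cast; ring⟩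
      simp only [hF]
      rw [e1, e2]
      congr 1
      refine exp_eq_exp_iff_exists_int.mpr ⟨k, ?_⟩
      push_cast
      field_simp
    have hs := sum_range_mul_eq h₁.pos h₂.pos hco hper
    have hterm : ∀ a b : ℕ, F (a * N₂ + b * N₁) = (f₁ N₂ * f₂ N₁) *
        (f₁ a * cexp (2 * Real.pi * I * a * k / N₁)) *
          (f₂ b * cexp (2 * Real.pi * I * b * k / N₂)) := by
      intro a b
      have e1 : f₁ (a * N₂ + b * N₁) = f₁ a * f₁ N₂ := by rw [apply_mul_add h₁.periodic, h₁.mul]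
      have e2 : f₂ (a * N₂ + b * N₁) = f₂ b * f₂ N₁ := by
        rw [add_comm, apply_mul_add h₂.periodic, h₂.mul]
      have e3 : cexp (2 * Real.pi * I * ((a * N₂ + b * N₁ : ℤ) : ℂ) * k / ((N₁ * N₂ : ℕ) : ℂ)) =
          cexp (2 * Real.pi * I * a * k / N₁) * cexp (2 * Real.pi * I * b * k / N₂) := by
        rw [← exp_add]
        congr 1
        push_cast
        field_simp
      simp only [hF]
      rw [e1, e2, e3]
      ring
    simp only [hterm] at hs
    simp only [← Finset.mul_sum, ← Finset.sum_mul] at hs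
    rw [h₁.fourier, h₂.fourier] at hs
    rw [show c₁ * c₂ * (f₁ N₂ * f₂ N₁) * (f₁ k * f₂ k) =
      f₁ N₂ * f₂ N₁ * (c₁ * f₁ k) * (c₂ * f₂ k) by ring, ← hs]
    exact Finset.sum_congr rfl fun r _ => by simp only [hF]; push_cast; rfl

lemma isSelfDual_one : IsSelfDual 1 (fun _ => 1) 1 where
  pos := one_pos
  mul _ _ := by simp
  periodic _ := rfl
  fourier k := by simp

/-- The Legendre symbol. -/
theorem isSelfDual_legendre {p : ℕ} (hp : p.Prime) (hp2 : p % 2 = 1) :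
    IsSelfDual p (fun n => (jacobiSym n p : ℂ)) (Real.sqrt p * if p % 4 = 1 then 1 else I) := by
  have : Fact p.Prime := ⟨hp⟩
  have hchar : ringChar (ZMod p) ≠ 2 := by
    rw [ZMod.ringChar_zmod_n]; rintro rfl; omega
  have hJ : ∀ n : ℤ, jacobiSym n p = quadraticChar (ZMod p) (n : ZMod p) := fun n => by
    rw [← jacobiSym.legendreSym.to_jacobiSym]; rfl
  refine ⟨hp.pos, fun a b => by simp [jacobiSym.mul_left], fun n => ?_, fun k => ?_⟩
  · rw [jacobiSym.mod_left' (b := p) (a₁ := n + p) (a₂ := n) (by simp)]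
  · set ψ : AddChar (ZMod p) ℂ := ZMod.stdAddChar with hψ
    set χ : ZMod p → ℂ := fun a => (quadraticChar (ZMod p) a : ℂ) with hχ
    have h1 : ∑ r ∈ Finset.range p, ((jacobiSym r p : ℤ) : ℂ) *
        cexp (2 * Real.pi * I * r * k / p) = ∑ a : ZMod p, χ a * ψ (a * k) := by
      rw [← sum_zmod_val_eq (N := p)
        (fun r => ((jacobiSym r p : ℤ) : ℂ) * cexp (2 * Real.pi * I * r * k / p))]
      refine Finset.sum_congr rfl fun a _ => ?_
      have e1 : ((a.val : ℤ) : ZMod p) = a := by simp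
      have e2 : a * (k : ZMod p) = ((a.val * k : ℤ) : ZMod p) := by push_cast; simp
      rw [hJ, e1, e2, hψ, ZMod.stdAddChar_coe]
      push_cast
      simp only [hχ, mul_assoc]
    have hG : ∑ a : ZMod p, χ a * ψ a = Real.sqrt p * if p % 4 = 1 then 1 else I := by
      rw [← sum_exp_sq_eq hp2, ← sum_zmod_val_eq (N := p)
        (fun r => cexp (2 * Real.pi * I * (r : ℂ) ^ 2 / p))]
      have e0 : ∀ x : ZMod p, cexp (2 * Real.pi * I * (x.val : ℂ) ^ 2 / p) = ψ (x ^ 2) := by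
        intro x
        have e2 : x ^ 2 = ((x.val ^ 2 : ℤ) : ZMod p) := by push_cast; simp
        rw [e2, hψ, ZMod.stdAddChar_coe]
        push_cast
        rfl
      simp only [e0]
      have e3 : ∑ x : ZMod p, ψ (x ^ 2) = ∑ b : ZMod p, (χ b + 1) * ψ b := by
        rw [← Finset.sum_fiberwise (s := Finset.univ) (g := fun x : ZMod p => x ^ 2)]
        refine Finset.sum_congr rfl fun b _ => ?_
        have e4 := quadraticChar_card_sqrts hchar b
        have e5 : ({x : ZMod p | x ^ 2 = b} : Set (ZMod p)).toFinset =
            Finset.univ.filter fun x : ZMod p => x ^ 2 = b := by ext x; simp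
        rw [e5] at e4
        rw [Finset.sum_congr rfl (g := fun _ => ψ b)
          (fun x hx => by rw [(Finset.mem_filter.mp hx).2]), Finset.sum_const, nsmul_eq_mul]
        congr 1
        simp only [hχ]
        exact_mod_cast e4
      rw [e3]
      simp only [add_mul, one_mul, Finset.sum_add_distrib]
      have e6 : ∑ b : ZMod p, ψ b = 0 := by
        refine AddChar.sum_eq_zero_of_ne_one ?_
        have := ZMod.isPrimitive_stdAddChar p one_ne_zero
        rwa [AddChar.mulShift_one] at this
      rw [e6, add_zero]
    rw [h1]
    have hk : ((jacobiSym k p : ℤ) : ℂ) = χ k := by rw [hJ]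
    rw [hk]
    by_cases hk0 : (k : ZMod p) = 0
    · rw [hk0]
      have e7 := quadraticChar_sum_zero hchar
      simp only [mul_zero, AddChar.map_zero_eq_one, mul_one, hχ]
      rw [← Int.cast_sum, e7]
      simp
    · rw [← hG, Finset.sum_mul]
      refine Fintype.sum_bijective (fun a => a * (k : ZMod p))
        (mulRight_bijective₀ _ hk0) _ _ fun a => ?_
      have e8 : χ (a * k) * χ k = χ a := by
        simp only [hχ]
        have := quadraticChar_sq_one hk0
        rw [map_mul]
        push_cast
        rw [mul_assoc, ← sq]
        have e9 : ((quadraticChar (ZMod p) (k : ZMod p) : ℤ) : ℂ) ^ 2 = 1 := by exact_mod_cast this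
        rw [e9, mul_one]
      rw [mul_right_comm, e8]

/-- The Jacobi symbol of a square-free odd modulus. -/
theorem isSelfDual_jacobi {q : ℕ} (hq : Squarefree q) (hq2 : q % 2 = 1) :
    IsSelfDual q (fun n => (jacobiSym n q : ℂ)) (Real.sqrt q * if q % 4 = 1 then 1 else I) := by
  induction q using induction_on_primes with
  | zero => simp at hq2
  | one => simpa using isSelfDual_one
  | prime_mul p a hp ih =>
    have hp2 : p % 2 = 1 := by
      rcases Nat.mod_two_eq_zero_or_one p with h | h
      · rw [Nat.mul_mod, h] at hq2; simp at hq2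
      · exact h
    have ha2 : a % 2 = 1 := by
      rcases Nat.mod_two_eq_zero_or_one a with h | h
      · rw [Nat.mul_mod, h] at hq2; simp at hq2
      · exact h
    have hco : p.Coprime a := Nat.coprime_of_squarefree_mul hq
    have ih' := ih (hq.squarefree_of_dvd (Dvd.intro_left p rfl)) ha2
    have hprod := (isSelfDual_legendre hp hp2).prod ih' hco
    have ha0 : a ≠ 0 := by omega
    have h1 : (fun n : ℤ => ((jacobiSym n p : ℤ) : ℂ) * ((jacobiSym n a : ℤ) : ℂ)) =
        fun n => ((jacobiSym n (p * a) : ℤ) : ℂ) := by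
      funext n
      rw [jacobiSym.mul_right' n hp.ne_zero ha0]
      push_cast
      rfl
    rw [h1] at hprod
    convert hprod using 1
    have h2 : jacobiSym a p * jacobiSym p a = (-1) ^ (a / 2 * (p / 2)) := by
      rw [jacobiSym.quadratic_reciprocity (Nat.odd_iff.mpr ha2) (Nat.odd_iff.mpr hp2), mul_assoc,
        ← sq, jacobiSym.sq_one (by simpa using hco), mul_one]
    have h3 : ((jacobiSym (a : ℤ) p : ℤ) : ℂ) * ((jacobiSym (p : ℤ) a : ℤ) : ℂ) =
        (-1) ^ (a / 2 * (p / 2)) := by exact_mod_cast congrArg (Int.cast : ℤ → ℂ) h2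
    have h4 : Real.sqrt ((p * a : ℕ) : ℝ) = Real.sqrt p * Real.sqrt a := by
      push_cast
      exact Real.sqrt_mul (by positivity) _
    have hpa : ∀ n : ℕ, n % 4 = 1 → Even (n / 2) := fun n hn => Nat.even_iff.mpr (by omega)
    have hpo : ∀ n : ℕ, n % 4 = 3 → Odd (n / 2) := fun n hn => Nat.odd_iff.mpr (by omega)
    rw [h3, h4]
    push_cast
    have h5 : p % 4 = 1 ∨ p % 4 = 3 := by omega
    have h6 : a % 4 = 1 ∨ a % 4 = 3 := by omega
    rcases h5 with h5 | h5 <;> rcases h6 with h6 | h6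
    · have h7 : p * a % 4 = 1 := by rw [Nat.mul_mod, h5, h6]
      rw [if_pos h7, if_pos h5, if_pos h6, ((hpa a h6).mul_right _).neg_one_pow]
      ring
    · have h7 : p * a % 4 = 3 := by rw [Nat.mul_mod, h5, h6]
      rw [if_neg (by omega), if_pos h5, if_neg (by omega), ((hpa p h5).mul_left _).neg_one_pow]
      ring
    · have h7 : p * a % 4 = 3 := by rw [Nat.mul_mod, h5, h6]
      rw [if_neg (by omega), if_neg (by omega), if_pos h6, ((hpa a h6).mul_right _).neg_one_pow]
      ring
    · have h7 : p * a % 4 = 1 := by rw [Nat.mul_mod, h5, h6]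
      rw [if_pos h7, if_neg (by omega), if_neg (by omega), ((hpo a h6).mul (hpo p h5)).neg_one_pow]
      linear_combination ((Real.sqrt p : ℂ) * Real.sqrt a) * I_sq

/-- It suffices to check self-duality on a period. -/
lemma isSelfDual_of_lt {N : ℕ} (hN : 0 < N) {f : ℤ → ℂ} {c : ℂ}
    (hmul : ∀ a b, f (a * b) = f a * f b) (hper : ∀ n, f (n + N) = f n)
    (h : ∀ k < N, ∑ r ∈ Finset.range N, f r * cexp (2 * Real.pi * I / N) ^ (r * k) = c * f k) :
    IsSelfDual N f c where
  pos := hN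
  mul := hmul
  periodic := hper
  fourier k := by
    have hNc : (N : ℂ) ≠ 0 := by exact_mod_cast hN.ne'
    obtain ⟨j, hj, t, ht⟩ : ∃ j < N, ∃ t : ℤ, k = j + t * N := by
      refine ⟨(k % N).toNat, ?_, k / N, ?_⟩
      · have := Int.emod_lt_of_pos k (by exact_mod_cast hN : (0 : ℤ) < N)
        omega
      · rw [Int.toNat_of_nonneg (Int.emod_nonneg _ (by exact_mod_cast hN.ne'))]
        exact (Int.emod_add_ediv_mul k N).symm
    rw [ht, apply_mul_add hper, ← h j hj]
    refine Finset.sum_congr rfl fun r _ => ?_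
    congr 1
    rw [← exp_nat_mul]
    refine exp_eq_exp_iff_exists_int.mpr ⟨r * t, ?_⟩
    push_cast
    field_simp

lemma isSelfDual_χ₄ : IsSelfDual 4 (fun n => (ZMod.χ₄ n : ℂ)) (2 * I) := by
  refine isSelfDual_of_lt (by norm_num) (fun a b => by push_cast; rw [map_mul]; push_cast; rfl)
    (fun n => ?_) ?_
  · have : (((n + (4 : ℕ) : ℤ)) : ZMod 4) = n := by
      push_cast
      rw [show (4 : ZMod 4) = 0 from rfl, add_zero]
    rw [this]
  · have hI : cexp (2 * Real.pi * I / (4 : ℕ)) = I := by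
      have : (2 * Real.pi * I / (4 : ℕ) : ℂ) = Real.pi / 2 * I := by push_cast; ring
      rw [this, exp_pi_div_two_mul_I]
    have h0 : ZMod.χ₄ ((0 : ℤ) : ZMod 4) = 0 := rfl
    have h1 : ZMod.χ₄ ((1 : ℤ) : ZMod 4) = 1 := rfl
    have h2 : ZMod.χ₄ ((2 : ℤ) : ZMod 4) = 0 := rfl
    have h3 : ZMod.χ₄ ((3 : ℤ) : ZMod 4) = -1 := rfl
    intro k hk
    rw [hI]
    simp only [Finset.sum_range_succ, Finset.sum_range_zero, zero_add, Nat.cast_zero, Nat.cast_one,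
      Nat.cast_ofNat, h0, h1, h2, h3]
    interval_cases k <;>
    simp only [Nat.cast_zero, Nat.cast_one, Nat.cast_ofNat, h0, h1, h2, h3] <;> push_cast
    · ring
    · linear_combination (-I) * I_sq
    · ring
    · linear_combination I * I_sq

lemma exp_two_pi_div_eight_pow (n : ℕ) : cexp (2 * Real.pi * I / (8 : ℕ)) ^ n =
    I ^ (n / 2) * if n % 2 = 0 then 1 else (1 + I) / 2 * Real.sqrt 2 := by
  have h1 : cexp (2 * Real.pi * I / (8 : ℕ)) = (1 + I) / 2 * Real.sqrt 2 := by
    have : (2 * Real.pi * I / (8 : ℕ) : ℂ) = ((Real.pi / 4 : ℝ) : ℂ) * I := by push_cast; ring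
    rw [this, exp_mul_I, ← ofReal_cos, ← ofReal_sin, Real.cos_pi_div_four, Real.sin_pi_div_four]
    push_cast
    ring
  have h2 : cexp (2 * Real.pi * I / (8 : ℕ)) ^ 2 = I := by
    have : ((2 : ℕ) : ℂ) * (2 * Real.pi * I / (8 : ℕ)) = Real.pi / 2 * I := by push_cast; ring
    rw [← exp_nat_mul, this, exp_pi_div_two_mul_I]
  conv_lhs => rw [← Nat.div_add_mod n 2, pow_add, pow_mul, h2]
  rcases Nat.mod_two_eq_zero_or_one n with h | h
  · simp [h]
  · simp [h, ← h1]

lemma isSelfDual_χ₈ : IsSelfDual 8 (fun n => (ZMod.χ₈ n : ℂ)) (2 * Real.sqrt 2) := by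
  refine isSelfDual_of_lt (by norm_num) (fun a b => by push_cast; rw [map_mul]; push_cast; rfl)
    (fun n => ?_) ?_
  · have : (((n + (8 : ℕ) : ℤ)) : ZMod 8) = n := by
      push_cast
      rw [show (8 : ZMod 8) = 0 from rfl, add_zero]
    rw [this]
  · have h0 : ZMod.χ₈ ((0 : ℤ) : ZMod 8) = 0 := rfl
    have h1 : ZMod.χ₈ ((1 : ℤ) : ZMod 8) = 1 := rfl
    have h2 : ZMod.χ₈ ((2 : ℤ) : ZMod 8) = 0 := rfl
    have h3 : ZMod.χ₈ ((3 : ℤ) : ZMod 8) = -1 := rfl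
    have h4 : ZMod.χ₈ ((4 : ℤ) : ZMod 8) = 0 := rfl
    have h5 : ZMod.χ₈ ((5 : ℤ) : ZMod 8) = -1 := rfl
    have h6 : ZMod.χ₈ ((6 : ℤ) : ZMod 8) = 0 := rfl
    have h7 : ZMod.χ₈ ((7 : ℤ) : ZMod 8) = 1 := rfl
    intro k hk
    simp only [exp_two_pi_div_eight_pow]
    simp only [Finset.sum_range_succ, Finset.sum_range_zero, zero_add,
      Nat.cast_zero, Nat.cast_one, Nat.cast_ofNat, h0, h1, h2, h3, h4, h5, h6, h7]
    interval_cases k <;>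
    simp only [Nat.cast_zero, Nat.cast_one, Nat.cast_ofNat, h0, h1, h2, h3, h4, h5, h6, h7] <;>
    norm_num <;> apply Complex.ext <;> simp <;> ring

lemma isSelfDual_χ₈' : IsSelfDual 8 (fun n => (ZMod.χ₈' n : ℂ)) (2 * Real.sqrt 2 * I) := by
  refine isSelfDual_of_lt (by norm_num) (fun a b => by push_cast; rw [map_mul]; push_cast; rfl)
    (fun n => ?_) ?_
  · have : (((n + (8 : ℕ) : ℤ)) : ZMod 8) = n := by
      push_cast
      rw [show (8 : ZMod 8) = 0 from rfl, add_zero]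
    rw [this]
  · have h0 : ZMod.χ₈' ((0 : ℤ) : ZMod 8) = 0 := rfl
    have h1 : ZMod.χ₈' ((1 : ℤ) : ZMod 8) = 1 := rfl
    have h2 : ZMod.χ₈' ((2 : ℤ) : ZMod 8) = 0 := rfl
    have h3 : ZMod.χ₈' ((3 : ℤ) : ZMod 8) = 1 := rfl
    have h4 : ZMod.χ₈' ((4 : ℤ) : ZMod 8) = 0 := rfl
    have h5 : ZMod.χ₈' ((5 : ℤ) : ZMod 8) = -1 := rfl
    have h6 : ZMod.χ₈' ((6 : ℤ) : ZMod 8) = 0 := rfl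
    have h7 : ZMod.χ₈' ((7 : ℤ) : ZMod 8) = -1 := rfl
    intro k hk
    simp only [exp_two_pi_div_eight_pow]
    simp only [Finset.sum_range_succ, Finset.sum_range_zero, zero_add,
      Nat.cast_zero, Nat.cast_one, Nat.cast_ofNat, h0, h1, h2, h3, h4, h5, h6, h7]
    interval_cases k <;>
    simp only [Nat.cast_zero, Nat.cast_one, Nat.cast_ofNat, h0, h1, h2, h3, h4, h5, h6, h7] <;>
    norm_num <;> apply Complex.ext <;> simp <;> ring

/-! ### The Kronecker symbol -/

lemma kronecker_of_ne_zero (D : ℤ) {n : ℕ} (hn : n ≠ 0) : kronecker D n =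
    ZMod.χ₈ (D : ZMod 8) ^ (n.factorization 2) * jacobiSym D (n / 2 ^ n.factorization 2) := by
  rw [kronecker, if_neg hn]

lemma kronecker_mul_left (a b : ℤ) {n : ℕ} (hn : n ≠ 0) :
    kronecker (a * b) n = kronecker a n * kronecker b n := by
  simp only [kronecker_of_ne_zero _ hn, Int.cast_mul, map_mul, mul_pow, jacobiSym.mul_left]
  ring

lemma odd_ordCompl_two {n : ℕ} (hn : n ≠ 0) : Odd (n / 2 ^ n.factorization 2) := by
  rw [← Nat.not_even_iff_odd, even_iff_two_dvd]
  exact Nat.not_dvd_ordCompl Nat.prime_two hn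

/-- The Kronecker symbol of an even discriminant supported at `2`. -/
lemma kronecker_eq_of_even {D : ℤ} (hD : ZMod.χ₈ (D : ZMod 8) = 0) (χ : ℤ → ℤ)
    (hχe : ∀ n : ℕ, n % 2 = 0 → χ n = 0) (hχo : ∀ n : ℕ, n % 2 = 1 → χ n = jacobiSym D n)
    {n : ℕ} (hn : n ≠ 0) : kronecker D n = χ n := by
  rw [kronecker_of_ne_zero _ hn, hD]
  rcases Nat.mod_two_eq_zero_or_one n with h | h
  · have : n.factorization 2 ≠ 0 := by
      have := (Nat.prime_two.dvd_iff_one_le_factorization hn).mp (Nat.dvd_of_mod_eq_zero h)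
      omega
    rw [zero_pow this, zero_mul, hχe n h]
  · have : n.factorization 2 = 0 := Nat.factorization_eq_zero_of_not_dvd (by omega)
    rw [this, pow_zero, pow_zero, one_mul, Nat.div_one, hχo n h]

lemma χ₈_neg (a : ZMod 8) : ZMod.χ₈ (-a) = ZMod.χ₈ a := by
  revert a; decide

/-- The discriminant `±q ≡ 1 (mod 4)` attached to an odd `q`. -/
def primaryDisc (q : ℕ) : ℤ := if q % 4 = 1 then q else -q

/-- Quadratic reciprocity. -/
lemma kronecker_primaryDisc {q : ℕ} (hq : q % 2 = 1) {n : ℕ} (hn : n ≠ 0) :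
    kronecker (primaryDisc q) n = jacobiSym n q := by
  rw [kronecker_of_ne_zero _ hn]
  set e := n.factorization 2
  set n' := n / 2 ^ e with hn'
  have hodd : Odd n' := odd_ordCompl_two hn
  have hfac : n = 2 ^ e * n' := (Nat.ordProj_mul_ordCompl_eq_self n 2).symm
  have hqodd : Odd q := Nat.odd_iff.mpr hq
  have h1 : ZMod.χ₈ ((primaryDisc q : ℤ) : ZMod 8) = jacobiSym 2 q := by
    rw [jacobiSym.at_two hqodd, primaryDisc]
    split_ifs
    · simp
    · push_cast
      rw [χ₈_neg]
  have h2 : jacobiSym (primaryDisc q) n' = jacobiSym n' q := by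
    rw [primaryDisc]
    split_ifs with h
    · exact jacobiSym.quadratic_reciprocity_one_mod_four h hodd
    · have h3 : q % 4 = 3 := by omega
      rw [show (-(q : ℤ)) = -1 * q by ring, jacobiSym.mul_left, jacobiSym.at_neg_one hodd,
        jacobiSym.quadratic_reciprocity hqodd hodd, ZMod.χ₄_eq_neg_one_pow (Nat.odd_iff.mp hodd),
        ← mul_assoc, pow_mul]
      have h4 : Odd (q / 2) := Nat.odd_iff.mpr (by omega)
      rw [h4.neg_one_pow, ← mul_pow]
      norm_num
  rw [h1, h2]
  conv_rhs => rw [hfac]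
  push_cast
  rw [jacobiSym.mul_left, jacobiSym.pow_left]

end SelfDual

/-! ### L-functions of quadratic characters -/

section QuadraticLFunction

open Complex

lemma primaryDisc_natAbs (q : ℕ) : (primaryDisc q).natAbs = q := by
  unfold primaryDisc; split_ifs <;> omega

lemma primaryDisc_pos_iff {q : ℕ} (hq : q % 2 = 1) : 0 < primaryDisc q ↔ q % 4 = 1 := by
  unfold primaryDisc; split_ifs <;> omega

lemma quadDisc_ne_zero {d : ℤ} (hd : Squarefree d) : quadDisc d ≠ 0 := by
  have := hd.ne_zero
  unfold quadDisc; split_ifs <;> omega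

lemma quadDisc_pos_iff {d : ℤ} : 0 < quadDisc d ↔ 0 < d := by
  unfold quadDisc; split_ifs <;> omega

lemma squarefree_emod_four {d : ℤ} (hd : Squarefree d) : d % 4 = 1 ∨ d % 4 = 2 ∨ d % 4 = 3 := by
  have h4 : ¬ (4 : ℤ) ∣ d := by
    intro h
    have := hd 2 (by norm_num; exact h)
    rw [Int.isUnit_iff] at this
    omega
  omega

/-- The discriminant is a product of `1`, `-4`, `8` or `-8` and of a primary discriminant. -/
lemma exists_quadDisc_eq {d : ℤ} (hd : Squarefree d) : ∃ q : ℕ, Squarefree q ∧ q % 2 = 1 ∧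
    ∃ D₀ ∈ ({1, -4, 8, -8} : Finset ℤ), quadDisc d = D₀ * primaryDisc q := by
  rcases (squarefree_emod_four hd).imp_right Or.symm with h | h | h
  · refine ⟨d.natAbs, Int.squarefree_natAbs.mpr hd, by omega, 1, by simp, ?_⟩
    rw [quadDisc, if_pos h, primaryDisc]
    split_ifs <;> omega
  · refine ⟨d.natAbs, Int.squarefree_natAbs.mpr hd, by omega, -4, by simp, ?_⟩
    rw [quadDisc, if_neg (by omega), primaryDisc]
    split_ifs <;> omega
  · obtain ⟨e, rfl⟩ : ∃ e, d = 2 * e := ⟨d / 2, by omega⟩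
    have he : Squarefree e := hd.squarefree_of_dvd (Dvd.intro_left 2 rfl)
    have he2 : e % 2 = 1 := by omega
    by_cases h1 : e % 4 = 1
    · refine ⟨e.natAbs, Int.squarefree_natAbs.mpr he, by omega, 8, by simp, ?_⟩
      rw [quadDisc, if_neg (by omega), primaryDisc]
      split_ifs <;> omega
    · refine ⟨e.natAbs, Int.squarefree_natAbs.mpr he, by omega, -8, by simp, ?_⟩
      rw [quadDisc, if_neg (by omega), primaryDisc]
      split_ifs <;> omega

/-- The Kronecker symbol of `D₀ * primaryDisc q` as a product, including the value at `n = 0`. -/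
lemma isSelfDual_mul_jacobi {N : ℕ} {D₀ : ℤ} {χ : ℤ → ℤ} {c : ℂ}
    (h : IsSelfDual N (fun n => (χ n : ℂ)) c) (hN : N = 1 ∨ χ 0 = 0) {q : ℕ} (hq : Squarefree q)
    (hq2 : q % 2 = 1) (hco : N.Coprime q) (hDN : D₀.natAbs = N)
    (hk : ∀ n : ℕ, n ≠ 0 → kronecker D₀ n = χ n) (n : ℕ) :
    (χ n : ℂ) * (jacobiSym n q : ℂ) = (kronecker (D₀ * primaryDisc q) n : ℂ) := by
  rcases eq_or_ne n 0 with rfl | hn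
  · rw [kronecker, if_pos rfl, Int.natAbs_mul, hDN, primaryDisc_natAbs]
    split_ifs with h1
    · obtain ⟨rfl, rfl⟩ := mul_eq_one.mp h1
      have h2 : (χ 1 : ℂ) = 1 := by
        have := hk 1 one_ne_zero
        rw [← Nat.cast_one (R := ℤ), ← this, kronecker_of_ne_zero _ one_ne_zero]
        simp
      have h3 : (χ 0 : ℂ) = χ 1 := by
        have := h.periodic 0
        simpa using this.symm
      simp [h3, h2]
    · by_cases hq1 : q = 1
      · have hN1 : N ≠ 1 := by rintro rfl; simp [hq1] at h1
        have := hN.resolve_left hN1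
        simp [this]
      · have : 1 < q := by omega
        have := jacobiSym.zero_left this
        simp [this]
  · rw [kronecker_mul_left _ _ hn, hk n hn, kronecker_primaryDisc hq2 hn]
    push_cast
    rfl

/-- The Gauss sum of the Kronecker symbol of a discriminant. -/
theorem exists_isSelfDual_kronecker {d : ℤ} (hd : Squarefree d) : ∃ f : ℤ → ℂ,
    IsSelfDual (quadDisc d).natAbs f
      (Real.sqrt (quadDisc d).natAbs * if 0 < d then 1 else I) ∧
    (∀ n : ℕ, f n = kronecker (quadDisc d) n) ∧ f (-1) = if 0 < d then 1 else -1 := by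
  obtain ⟨q, hq, hq2, D₀, hD₀, hD⟩ := exists_quadDisc_eq hd
  have hJ := isSelfDual_jacobi hq hq2
  have hodd : Odd q := Nat.odd_iff.mpr hq2
  have hco2 : Nat.Coprime 2 q := (Nat.coprime_two_left).mpr hodd
  have hco4 : Nat.Coprime 4 q := hco2.pow_left 2
  have hco8 : Nat.Coprime 8 q := hco2.pow_left 3
  have hJneg : jacobiSym (-1) q = if q % 4 = 1 then 1 else -1 := by
    rw [jacobiSym.at_neg_one hodd, ZMod.χ₄_nat_eq_if_mod_four, if_neg (by omega)]
  have hpos := quadDisc_pos_iff (d := d)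
  have hppos := primaryDisc_pos_iff hq2
  have hq0 : primaryDisc q ≠ 0 := by
    have := primaryDisc_natAbs q
    intro h
    rw [h] at this
    simp at this
    omega
  have hq4 : q % 4 = 1 ∨ q % 4 = 3 := by omega
  have hs4 : Real.sqrt ((4 * q : ℕ) : ℝ) = 2 * Real.sqrt q := by
    push_cast
    rw [Real.sqrt_mul (by norm_num), show (4 : ℝ) = 2 ^ 2 by norm_num, Real.sqrt_sq (by norm_num)]
  have hs8 : Real.sqrt ((8 * q : ℕ) : ℝ) = 2 * Real.sqrt 2 * Real.sqrt q := by
    push_cast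
    rw [Real.sqrt_mul (by norm_num), show (8 : ℝ) = 2 ^ 2 * 2 by norm_num,
      Real.sqrt_mul (by norm_num), Real.sqrt_sq (by norm_num)]
  have hχ4q : (ZMod.χ₄ ((q : ℤ) : ZMod 4)) = if q % 4 = 1 then 1 else -1 := by
    have := ZMod.χ₄_nat_eq_if_mod_four q
    rw [if_neg (by omega)] at this
    exact_mod_cast this
  have h88 : ∀ n : ℕ, n % 2 = 1 → ZMod.χ₈ (n : ZMod 8) ^ 2 = 1 := by
    intro n hn
    rw [ZMod.χ₈_nat_eq_if_mod_eight, if_neg (by omega)]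
    split_ifs <;> norm_num
  have h88' : ∀ n : ℕ, n % 2 = 1 → ZMod.χ₈' (n : ZMod 8) * ZMod.χ₈ (n : ZMod 8) =
      if n % 4 = 1 then 1 else -1 := by
    intro n hn
    rw [ZMod.χ₈_nat_eq_if_mod_eight, ZMod.χ₈'_nat_eq_if_mod_eight]
    have : n % 8 = 1 ∨ n % 8 = 3 ∨ n % 8 = 5 ∨ n % 8 = 7 := by omega
    rcases this with h | h | h | h
    · simp [hn, h, show n % 4 = 1 by omega]
    · simp [hn, h, show n % 4 = 3 by omega]
    · simp [hn, h, show n % 4 = 1 by omega]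
    · simp [hn, h, show n % 4 = 3 by omega]
  have hJ8 : jacobiSym ((8 : ℕ) : ℤ) q = ZMod.χ₈ (q : ZMod 8) := by
    rw [show (((8 : ℕ) : ℤ)) = 2 ^ 2 * 2 by norm_num, jacobiSym.mul_left,
      jacobiSym.sq_one' (by exact_mod_cast hco2), one_mul, jacobiSym.at_two hodd]
  simp only [Finset.mem_insert, Finset.mem_singleton] at hD₀
  rcases hD₀ with rfl | rfl | rfl | rfl
  · refine ⟨fun n => (jacobiSym n q : ℂ), ?_, fun n => ?_, ?_⟩
    · rw [hD, one_mul, primaryDisc_natAbs]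
      convert hJ using 3
      rw [one_mul] at hD
      rw [← hpos, hD, hppos]
    · rw [hD]
      have := isSelfDual_mul_jacobi (χ := fun _ => 1) (D₀ := 1) (by simpa using isSelfDual_one)
        (Or.inl rfl) hq hq2 (Nat.coprime_one_left q) rfl (fun n hn => by
          rw [kronecker_of_ne_zero _ hn]; simp) n
      simpa using this
    · rw [one_mul] at hD
      change ((jacobiSym (-1) q : ℤ) : ℂ) = _
      simp only [hJneg, ← hppos, ← hD, hpos]
      split_ifs <;> simp
  · have hN : (quadDisc d).natAbs = 4 * q := by
      rw [hD, Int.natAbs_mul, primaryDisc_natAbs]; rfl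
    have hsign : 0 < d ↔ ¬ q % 4 = 1 := by
      rw [← hpos, hD, ← hppos]; omega
    refine ⟨fun n => (ZMod.χ₄ n : ℂ) * (jacobiSym n q : ℂ), ?_, fun n => ?_, ?_⟩
    · rw [hN, hs4]
      convert isSelfDual_χ₄.prod hJ hco4 using 1
      have h1 : jacobiSym ((4 : ℕ) : ℤ) q = 1 := jacobiSym.at_four hodd
      rw [h1, hχ4q]
      simp only [hsign]
      rcases hq4 with h | h
      · simp [h]
        ring
      · simp [h]
        linear_combination (2 * (Real.sqrt q : ℂ)) * I_sq
    · rw [hD]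
      exact isSelfDual_mul_jacobi (χ := fun n => ZMod.χ₄ n) isSelfDual_χ₄ (Or.inr (by simp)) hq hq2
        hco4 rfl (fun n hn => kronecker_eq_of_even (by decide) (fun n : ℤ => ZMod.χ₄ n)
          (fun n hn => by
            have := ZMod.χ₄_nat_eq_if_mod_four n
            rw [if_pos hn] at this
            exact_mod_cast this)
          (fun n hn => by
            rw [show (-4 : ℤ) = -1 * 4 by norm_num, jacobiSym.mul_left,
              jacobiSym.at_four (Nat.odd_iff.mpr hn), jacobiSym.at_neg_one (Nat.odd_iff.mpr hn)]
            simp) hn) n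
    · have h1 : ZMod.χ₄ (((-1 : ℤ)) : ZMod 4) = -1 := by decide
      simp only [h1, hJneg, hsign]
      rcases hq4 with h | h <;> simp [h]
  · have hN : (quadDisc d).natAbs = 8 * q := by
      rw [hD, Int.natAbs_mul, primaryDisc_natAbs]; rfl
    have hsign : 0 < d ↔ q % 4 = 1 := by
      rw [← hpos, hD, ← hppos]; omega
    refine ⟨fun n => (ZMod.χ₈ n : ℂ) * (jacobiSym n q : ℂ), ?_, fun n => ?_, ?_⟩
    · rw [hN, hs8]
      convert isSelfDual_χ₈.prod hJ hco8 using 1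
      have h1 : ((ZMod.χ₈ ((q : ℤ) : ZMod 8) : ℤ) : ℂ) * ((jacobiSym ((8 : ℕ) : ℤ) q : ℤ) : ℂ) = 1 := by
        rw [hJ8]
        have := h88 q hq2
        rw [sq] at this
        exact_mod_cast this
      rw [h1]
      simp only [hsign]
      push_cast
      ring
    · rw [hD]
      exact isSelfDual_mul_jacobi (χ := fun n => ZMod.χ₈ n) isSelfDual_χ₈ (Or.inr (by simp)) hq hq2
        hco8 rfl (fun n hn => kronecker_eq_of_even (by decide) (fun n : ℤ => ZMod.χ₈ n)
          (fun n hn => by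
            have := ZMod.χ₈_nat_eq_if_mod_eight n
            rw [if_pos hn] at this
            exact_mod_cast this)
          (fun n hn => by
            have h2 : Nat.Coprime 2 n := (Nat.coprime_two_left).mpr (Nat.odd_iff.mpr hn)
            rw [show (8 : ℤ) = 2 ^ 2 * 2 by norm_num, jacobiSym.mul_left,
              jacobiSym.sq_one' (by exact_mod_cast h2), one_mul,
              jacobiSym.at_two (Nat.odd_iff.mpr hn)]
            simp) hn) n
    · have h1 : ZMod.χ₈ (((-1 : ℤ)) : ZMod 8) = 1 := by decide
      simp only [h1, hJneg, hsign]
      rcases hq4 with h | h <;> simp [h]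
  · have hN : (quadDisc d).natAbs = 8 * q := by
      rw [hD, Int.natAbs_mul, primaryDisc_natAbs]; rfl
    have hsign : 0 < d ↔ ¬ q % 4 = 1 := by
      rw [← hpos, hD, ← hppos]; omega
    refine ⟨fun n => (ZMod.χ₈' n : ℂ) * (jacobiSym n q : ℂ), ?_, fun n => ?_, ?_⟩
    · rw [hN, hs8]
      convert isSelfDual_χ₈'.prod hJ hco8 using 1
      have h1 : ((ZMod.χ₈' ((q : ℤ) : ZMod 8) : ℤ) : ℂ) * ((jacobiSym ((8 : ℕ) : ℤ) q : ℤ) : ℂ) =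
          if q % 4 = 1 then 1 else -1 := by
        rw [hJ8]
        have := h88' q hq2
        exact_mod_cast congrArg (Int.cast : ℤ → ℂ) this
      rw [h1]
      simp only [hsign]
      push_cast
      rcases hq4 with h | h
      · simp [h]; ring
      · simp [h]
        linear_combination (2 * (Real.sqrt 2 : ℂ) * (Real.sqrt q : ℂ)) * I_sq
    · rw [hD]
      exact isSelfDual_mul_jacobi (χ := fun n => ZMod.χ₈' n) isSelfDual_χ₈' (Or.inr (by simp)) hq hq2
        hco8 rfl (fun n hn => kronecker_eq_of_even (by decide) (fun n : ℤ => ZMod.χ₈' n)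
          (fun n hn => by
            have := ZMod.χ₈'_nat_eq_if_mod_eight n
            rw [if_pos hn] at this
            exact_mod_cast this)
          (fun n hn => by
            have h2 : Nat.Coprime 2 n := (Nat.coprime_two_left).mpr (Nat.odd_iff.mpr hn)
            rw [show (-8 : ℤ) = 2 ^ 2 * (-2) by norm_num, jacobiSym.mul_left,
              jacobiSym.sq_one' (by exact_mod_cast h2), one_mul,
              jacobiSym.at_neg_two (Nat.odd_iff.mpr hn)]
            simp) hn) n
    · have h1 : ZMod.χ₈' (((-1 : ℤ)) : ZMod 8) = -1 := by decide
      simp only [h1, hJneg, hsign]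
      rcases hq4 with h | h <;> simp [h]

end QuadraticLFunction

/-! ### Analytic continuation, functional equation and growth of quadratic L-functions -/

section QuadraticLFunctionAnalytic

open Complex

lemma jacobiSym_natAbs_le_one (a : ℤ) (b : ℕ) : |jacobiSym a b| ≤ 1 := by
  rcases jacobiSym.trichotomy a b with h | h | h <;> simp [h]

lemma kronecker_abs_le_one (D : ℤ) (n : ℕ) : |kronecker D n| ≤ 1 := by
  unfold kronecker
  split_ifs
  · simp
  · simp
  · have h1 : |ZMod.χ₈ (D : ZMod 8)| ≤ 1 := by
      rcases ZMod.isQuadratic_χ₈ (D : ZMod 8) with h | h | h <;> simp [h]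
    rw [abs_mul, abs_pow]
    exact mul_le_one₀ (pow_le_one₀ (abs_nonneg _) h1) (abs_nonneg _) (jacobiSym_natAbs_le_one _ _)

lemma norm_kronecker_le_one (D : ℤ) (n : ℕ) : ‖(kronecker D n : ℂ)‖ ≤ 1 := by
  rw [Complex.norm_intCast]
  exact_mod_cast kronecker_abs_le_one D n

lemma quadL_def {D : ℤ} [hN : NeZero D.natAbs] (s : ℂ) :
    quadL D s = ZMod.LFunction (fun a : ZMod D.natAbs => (kronecker D a.val : ℂ)) s := by
  have h : D ≠ 0 := fun h => hN.out (by simp [h])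
  rw [quadL, dif_neg h]

lemma kronecker_val_natCast {d : ℤ} (hd : Squarefree d) (n : ℕ) :
    kronecker (quadDisc d) ((n : ZMod (quadDisc d).natAbs)).val = kronecker (quadDisc d) n := by
  obtain ⟨f, hf, hfk, -⟩ := exists_isSelfDual_kronecker hd
  have : NeZero (quadDisc d).natAbs := ⟨Int.natAbs_ne_zero.mpr (quadDisc_ne_zero hd)⟩
  have h : f (((n : ZMod (quadDisc d).natAbs)).val : ℕ) = f n := by
    refine apply_eq_of_modEq hf.periodic ?_
    rw [ZMod.val_natCast, Int.natCast_mod]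
    rw [← dvd_neg, neg_sub]
    exact Int.dvd_self_sub_emod
  rw [hfk, hfk] at h
  exact_mod_cast h

/-- For `Re s > 1` the `L`-function is given by its Dirichlet series. -/
theorem quadL_eq_LSeries {d : ℤ} (hd : Squarefree d) {s : ℂ} (hs : 1 < s.re) :
    quadL (quadDisc d) s = LSeries (fun n => (kronecker (quadDisc d) n : ℂ)) s := by
  have : NeZero (quadDisc d).natAbs := ⟨Int.natAbs_ne_zero.mpr (quadDisc_ne_zero hd)⟩
  rw [quadL_def, ZMod.LFunction_eq_LSeries _ hs]
  simp only [kronecker_val_natCast hd]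

/-- The value at a point of `ZMod N` of the function attached to the Kronecker symbol, in terms of
its multiplicative extension to `ℤ`. -/
lemma kronecker_val_eq {d : ℤ} [NeZero (quadDisc d).natAbs]
    {f : ℤ → ℂ} (hf : ∀ n, f (n + (quadDisc d).natAbs) = f n)
    (hfk : ∀ n : ℕ, f n = kronecker (quadDisc d) n) (n : ℤ) :
    (kronecker (quadDisc d) ((n : ZMod (quadDisc d).natAbs)).val : ℂ) = f n := by
  rw [← hfk]
  refine apply_eq_of_modEq hf ?_
  rw [ZMod.val_intCast, ← dvd_neg, neg_sub]
  exact Int.dvd_self_sub_emod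

/-- The functional equation, in the symmetric form that has no sign. -/
theorem quadL_one_sub {d : ℤ} (hd : Squarefree d) {s : ℂ} (hs0 : 0 < s.re) (hs1 : s.re < 1) :
    Gammaℝ (1 - s + if 0 < d then 0 else 1) * quadL (quadDisc d) (1 - s) =
      ((quadDisc d).natAbs : ℂ) ^ (s - 1 / 2) *
        (Gammaℝ (s + if 0 < d then 0 else 1) * quadL (quadDisc d) s) := by
  obtain ⟨f, hf, hfk, hf1⟩ := exists_isSelfDual_kronecker hd
  set N := (quadDisc d).natAbs with hN
  have hNZ : NeZero N := ⟨Int.natAbs_ne_zero.mpr (quadDisc_ne_zero hd)⟩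
  have hNc : (N : ℂ) ≠ 0 := by exact_mod_cast hNZ.out
  set Φ : ZMod N → ℂ := fun a => (kronecker (quadDisc d) a.val : ℂ) with hΦ
  have hval : ∀ n : ℤ, Φ (n : ZMod N) = f n := fun n => kronecker_val_eq hf.periodic hfk n
  have hL : ∀ z, quadL (quadDisc d) z = ZMod.LFunction Φ z := fun z => quadL_def z
  have hsurj : ∀ a : ZMod N, ∃ n : ℤ, (n : ZMod N) = a := ZMod.intCast_surjective
  have hneg : ∀ a, Φ (-a) = f (-1) * Φ a := by
    intro a
    obtain ⟨n, rfl⟩ := hsurj a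
    rw [← Int.cast_neg, hval, hval, ← hf.mul]
    congr 1
    ring
  have hdft : ZMod.dft Φ = fun k => (Real.sqrt N * (if 0 < d then 1 else I) * f (-1)) * Φ k := by
    funext k
    obtain ⟨n, rfl⟩ := hsurj k
    have h1 := hf.fourier (-n)
    rw [ZMod.dft_apply, hval, mul_assoc _ (f (-1)), ← hf.mul, neg_one_mul, ← h1,
      ← sum_zmod_val_eq (N := N) (fun r => f r * cexp (2 * Real.pi * I * (r : ℂ) * ((-n : ℤ) : ℂ) / N))]
    refine Finset.sum_congr rfl fun a _ => ?_
    have e1 : -(a * (n : ZMod N)) = ((a.val * -n : ℤ) : ZMod N) := by push_cast; simp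
    rw [e1, ZMod.stdAddChar_coe, smul_eq_mul, mul_comm]
    have e2 : Φ a = f a.val := by rw [← hval]; simp
    rw [e2]
    congr 2
    push_cast
    ring
  have hs0' : s ≠ 0 := by rintro rfl; simp at hs0
  have hs1' : s ≠ 1 := by rintro rfl; simp at hs1
  have hpow : (N : ℂ) ^ (s - 1) * (Real.sqrt N : ℂ) = (N : ℂ) ^ (s - 1 / 2) := by
    have : ((Real.sqrt N : ℝ) : ℂ) = (N : ℂ) ^ (1 / 2 : ℂ) := by
      rw [Real.sqrt_eq_rpow, ofReal_cpow (by positivity)]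
      push_cast
      rfl
    rw [this, ← cpow_add _ _ hNc]
    congr 1
    ring
  have h1s : 0 < (1 - s).re := by simp; linarith
  by_cases hd0 : 0 < d
  · simp only [if_pos hd0, add_zero] at *
    have heven : Φ.Even := fun a => by rw [hneg, hf1, one_mul]
    have h1 := ZMod.completedLFunction_one_sub_even heven s (Or.inl hs0') (Or.inl hs1')
    rw [hdft, ZMod.completedLFunction_const_mul] at h1
    have h2 := ZMod.LFunction_eq_completed_div_gammaFactor_even heven s (Or.inl hs0')
    have h3 := ZMod.LFunction_eq_completed_div_gammaFactor_even heven (1 - s)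
      (Or.inl (sub_ne_zero.mpr hs1'.symm))
    rw [hL, hL, h2, h3, mul_div_cancel₀ _ (Gammaℝ_ne_zero_of_re_pos h1s),
      mul_div_cancel₀ _ (Gammaℝ_ne_zero_of_re_pos hs0), h1, ← hpow, hf1]
    ring
  · simp only [if_neg hd0] at *
    have hodd : Φ.Odd := fun a => by rw [hneg, hf1, neg_one_mul]
    have h1 := ZMod.completedLFunction_one_sub_odd hodd s
    rw [hdft, ZMod.completedLFunction_const_mul] at h1
    have h2 := ZMod.LFunction_eq_completed_div_gammaFactor_odd hodd s
    have h3 := ZMod.LFunction_eq_completed_div_gammaFactor_odd hodd (1 - s)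
    have h4 : 0 < (s + 1).re := by simp; linarith
    have h5 : 0 < (1 - s + 1).re := by simp; linarith
    rw [hL, hL, h2, h3, mul_div_cancel₀ _ (Gammaℝ_ne_zero_of_re_pos h5),
      mul_div_cancel₀ _ (Gammaℝ_ne_zero_of_re_pos h4), h1, ← hpow, hf1]
    linear_combination (-(N : ℂ) ^ (s - 1) * (Real.sqrt N : ℂ) * ZMod.completedLFunction Φ s) * I_sq

lemma quadL_one (s : ℂ) : quadL (quadDisc 1) s = riemannZeta s := by
  have h1 : quadDisc 1 = 1 := rfl
  rw [h1]
  have : NeZero (1 : ℤ).natAbs := ⟨one_ne_zero⟩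
  rw [quadL_def]
  change ZMod.LFunction (N := 1) (fun a : ZMod 1 => (kronecker 1 a.val : ℂ)) s = _
  rw [ZMod.LFunction_modOne_eq]
  simp [kronecker]

lemma sum_range_mod_eq {N : ℕ} {g : ℕ → ℂ} (hg : ∀ n, g (n + N) = g n)
    (h0 : ∑ r ∈ Finset.range N, g r = 0) (n : ℕ) :
    ∑ r ∈ Finset.range n, g r = ∑ r ∈ Finset.range (n % N), g r := by
  have hq : ∀ q r, ∑ k ∈ Finset.range (N * q + r), g k = ∑ k ∈ Finset.range r, g k := by
    intro q r
    induction q with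
    | zero => simp
    | succ q ih =>
      have e1 : N * (q + 1) + r = N + (N * q + r) := by ring
      rw [e1, Finset.sum_range_add, h0, zero_add]
      rw [← ih]
      exact Finset.sum_congr rfl fun k _ => by rw [add_comm, hg]
  conv_lhs => rw [← Nat.div_add_mod n N]
  exact hq _ _

lemma natAbs_quadDisc_ne_one {d : ℤ} (hd1 : d ≠ 1) : (quadDisc d).natAbs ≠ 1 := by
  unfold quadDisc; split_ifs <;> omega

lemma sum_kronecker_eq_zero {d : ℤ} (hd : Squarefree d) (hd1 : d ≠ 1) :
    ∑ r ∈ Finset.range (quadDisc d).natAbs, (kronecker (quadDisc d) r : ℂ) = 0 := by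
  obtain ⟨f, hf, hfk, -⟩ := exists_isSelfDual_kronecker hd
  have h0 : f 0 = 0 := by
    have := hfk 0
    rw [kronecker, if_pos rfl, if_neg (natAbs_quadDisc_ne_one hd1)] at this
    simpa using this
  have h1 := hf.fourier 0
  simp only [Int.cast_zero, mul_zero, zero_div, Complex.exp_zero, mul_one, h0, hfk] at h1
  exact h1

/-- Partial sums of the Kronecker symbol are bounded by the period. -/
lemma norm_sum_kronecker_le {d : ℤ} (hd : Squarefree d) (hd1 : d ≠ 1) (n : ℕ) :
    ‖∑ k ∈ Finset.Icc 1 n, (kronecker (quadDisc d) k : ℂ)‖ ≤ (quadDisc d).natAbs := by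
  obtain ⟨f, hf, hfk, -⟩ := exists_isSelfDual_kronecker hd
  have hper : ∀ k : ℕ, (kronecker (quadDisc d) (k + (quadDisc d).natAbs) : ℂ) =
      kronecker (quadDisc d) k := by
    intro k
    rw [← hfk, ← hfk]
    rw [Nat.cast_add]
    exact hf.periodic k
  have h0 : (kronecker (quadDisc d) 0 : ℂ) = 0 := by
    rw [kronecker, if_pos rfl, if_neg (natAbs_quadDisc_ne_one hd1)]
    simp
  have h1 : ∑ k ∈ Finset.Icc 1 n, (kronecker (quadDisc d) k : ℂ) =
      ∑ k ∈ Finset.range (n + 1), (kronecker (quadDisc d) k : ℂ) := by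
    rw [Finset.range_eq_Ico, Finset.sum_eq_sum_Ico_succ_bot (Nat.succ_pos n), h0, zero_add]
    rfl
  rw [h1, sum_range_mod_eq hper (sum_kronecker_eq_zero hd hd1)]
  refine (norm_sum_le _ _).trans ?_
  refine (Finset.sum_le_sum fun k _ => norm_kronecker_le_one _ k).trans ?_
  simp only [Finset.sum_const, Finset.card_range, nsmul_eq_mul, mul_one]
  have hpos : 0 < (quadDisc d).natAbs := hf.pos
  exact_mod_cast (Nat.mod_lt _ hpos).le

/-- For `d ≠ 1` the sum of the Kronecker symbol over a period vanishes, so that there is no pole. -/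
theorem differentiable_quadL {d : ℤ} (hd : Squarefree d) (hd1 : d ≠ 1) :
    Differentiable ℂ (quadL (quadDisc d)) := by
  have : NeZero (quadDisc d).natAbs := ⟨Int.natAbs_ne_zero.mpr (quadDisc_ne_zero hd)⟩
  have h : quadL (quadDisc d) =
      ZMod.LFunction (fun a : ZMod (quadDisc d).natAbs => (kronecker (quadDisc d) a.val : ℂ)) := by
    funext s; rw [quadL_def]
  rw [h]
  refine ZMod.differentiable_LFunction_of_sum_zero ?_
  rw [sum_zmod_val_eq (N := (quadDisc d).natAbs) (fun r => (kronecker (quadDisc d) r : ℂ)),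
    sum_kronecker_eq_zero hd hd1]

lemma differentiableAt_quadL {d : ℤ} (hd : Squarefree d) {s : ℂ} (hs : s ≠ 1) :
    DifferentiableAt ℂ (quadL (quadDisc d)) s := by
  by_cases hd1 : d = 1
  · subst hd1
    have : quadL (quadDisc 1) = riemannZeta := funext quadL_one
    rw [this]
    exact differentiableAt_riemannZeta hs
  · exact differentiable_quadL hd hd1 s

/-- The integral representation of the `L`-function in `Re s > 0`. -/
theorem quadL_eq_mul_integral {d : ℤ} (hd : Squarefree d) (hd1 : d ≠ 1) {s : ℂ} (hs : 0 < s.re) :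
    quadL (quadDisc d) s = s * ∫ t in Set.Ioi (1 : ℝ),
      (∑ k ∈ Finset.Icc 1 ⌊t⌋₊, (kronecker (quadDisc d) k : ℂ)) * (t : ℂ) ^ (-(s + 1)) := by
  set S : ℝ → ℂ := fun t => ∑ k ∈ Finset.Icc 1 ⌊t⌋₊, (kronecker (quadDisc d) k : ℂ) with hS
  set N : ℝ := ((quadDisc d).natAbs : ℝ) with hN
  have hSb : ∀ t, ‖S t‖ ≤ N := fun t => norm_sum_kronecker_le hd hd1 _
  have hS0 : ∀ t < 1, S t = 0 := by
    intro t ht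
    simp only [hS]
    rw [Nat.floor_eq_zero.mpr ht]
    simp
  have hSm : Measurable S := by
    have : S = (fun n : ℕ => ∑ k ∈ Finset.Icc 1 n, (kronecker (quadDisc d) k : ℂ)) ∘ Nat.floor := rfl
    rw [this]
    exact (measurable_from_nat).comp Nat.measurable_floor
  have hmel : ∀ z : ℂ, mellin S (-z) = ∫ t in Set.Ioi (1 : ℝ), S t * (t : ℂ) ^ (-(z + 1)) := by
    intro z
    rw [mellin]
    have h1 : ∀ t : ℝ, (t : ℂ) ^ (-z - 1) • S t = S t * (t : ℂ) ^ (-(z + 1)) := by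
      intro t
      rw [smul_eq_mul, mul_comm]
      congr 2
      ring
    simp only [h1]
    symm
    rw [← MeasureTheory.integral_Ici_eq_integral_Ioi]
    symm
    refine MeasureTheory.setIntegral_eq_of_subset_of_forall_sdiff_eq_zero measurableSet_Ioi
      (fun t ht => lt_of_lt_of_le (one_pos : (0 : ℝ) < 1) ht) ?_
    intro t ht
    have : t < 1 := by
      have := ht.2
      simpa using this
    rw [hS0 t this, zero_mul]
  have hloc : MeasureTheory.LocallyIntegrableOn S (Set.Ioi 0) := by
    have hloc0 : MeasureTheory.LocallyIntegrable S := by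
      refine (MeasureTheory.locallyIntegrable_const (N : ℝ)).mono hSm.aestronglyMeasurable ?_
      refine Eventually.of_forall fun t => ?_
      rw [Real.norm_eq_abs]
      exact (hSb t).trans (le_abs_self _)
    exact hloc0.locallyIntegrableOn _
  have hdiff : DifferentiableOn ℂ (fun z => z * mellin S (-z)) {z | 0 < z.re} := by
    intro z hz
    have h1 : DifferentiableAt ℂ (mellin S) (-z) := by
      refine mellin_differentiableAt_of_isBigO_rpow (a := 0) (b := (-z).re - 1) hloc ?_ ?_ ?_ (by linarith)
      · refine IsBigO.of_bound N (Eventually.of_forall fun t => ?_)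
        simpa using hSb t
      · simpa using hz
      · refine IsBigO.of_bound 0 ?_
        filter_upwards [Ioo_mem_nhdsGT (one_pos : (0 : ℝ) < 1)] with t ht
        rw [hS0 t ht.2]
        simp
    have h2 : DifferentiableAt ℂ (mellin S ∘ Neg.neg) z :=
      DifferentiableAt.comp (g := mellin S) z h1 differentiableAt_id.neg
    exact (differentiableAt_id.mul h2).differentiableWithinAt
  have hopen : IsOpen {z : ℂ | 0 < z.re} := isOpen_lt continuous_const continuous_re
  have hconv : Convex ℝ {z : ℂ | 0 < z.re} := convex_halfSpace_re_gt 0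
  have hA1 : AnalyticOnNhd ℂ (quadL (quadDisc d)) {z | 0 < z.re} :=
    (differentiable_quadL hd hd1).differentiableOn.analyticOnNhd hopen
  have hA2 := hdiff.analyticOnNhd hopen
  have hev : quadL (quadDisc d) =ᶠ[𝓝 2] fun z => z * mellin S (-z) := by
    have : {z : ℂ | 1 < z.re} ∈ 𝓝 (2 : ℂ) :=
      (isOpen_lt continuous_const continuous_re).mem_nhds (by simp)
    filter_upwards [this] with z hz
    have hz : 1 < z.re := hz
    rw [quadL_eq_LSeries hd hz, hmel, LSeries_eq_mul_integral _ le_rfl (by linarith)]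
    · exact LSeriesSummable_of_bounded_of_one_lt_re (fun n _ => norm_kronecker_le_one _ n) hz
    · refine IsBigO.of_bound N (Eventually.of_forall fun n => ?_)
      simpa [hN] using norm_sum_kronecker_le hd hd1 n
  have := hA1.eqOn_of_preconnected_of_eventuallyEq hA2 hconv.isPreconnected
    (by simp : (2 : ℂ) ∈ {z : ℂ | 0 < z.re}) hev hs
  rw [this]
  simp only [hmel]
  rfl

/-- Convexity-type bound: the `L`-function grows at most linearly in the conductor. -/
theorem norm_quadL_le {d : ℤ} (hd : Squarefree d) (hd1 : d ≠ 1) {s : ℂ} (hs : 0 < s.re) :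
    ‖quadL (quadDisc d) s‖ ≤ ‖s‖ / s.re * (quadDisc d).natAbs := by
  rw [quadL_eq_mul_integral hd hd1 hs, norm_mul, div_mul_eq_mul_div, mul_div_assoc]
  refine mul_le_mul_of_nonneg_left ?_ (norm_nonneg _)
  have h1 : ∫ t in Set.Ioi (1 : ℝ), ((quadDisc d).natAbs : ℝ) * t ^ (-(s.re + 1)) =
      (quadDisc d).natAbs / s.re := by
    rw [MeasureTheory.integral_const_mul, integral_Ioi_rpow_of_lt (by linarith) one_pos,
      Real.one_rpow, show -(s.re + 1) + 1 = -s.re by ring, neg_div_neg_eq, mul_one_div]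
  rw [← h1]
  refine MeasureTheory.norm_integral_le_of_norm_le ?_ ?_
  · exact (integrableOn_Ioi_rpow_of_lt (by linarith) one_pos).const_mul _
  · filter_upwards [MeasureTheory.ae_restrict_mem measurableSet_Ioi] with t ht
    have ht : 1 < t := ht
    rw [norm_mul, norm_cpow_eq_rpow_re_of_pos (by linarith)]
    simp only [neg_re, add_re, one_re]
    have := norm_sum_kronecker_le hd hd1 ⌊t⌋₊
    gcongr

/-- The central value is real. -/
theorem quadL_half_real {d : ℤ} (hd : Squarefree d) (hd1 : d ≠ 1) :
    ∃ r : ℝ, quadL (quadDisc d) (1 / 2) = r := by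
  rw [quadL_eq_mul_integral hd hd1 (by norm_num)]
  refine ⟨1 / 2 * ∫ t in Set.Ioi (1 : ℝ),
    (∑ k ∈ Finset.Icc 1 ⌊t⌋₊, (kronecker (quadDisc d) k : ℝ)) * t ^ (-((1 / 2 : ℝ) + 1)), ?_⟩
  push_cast
  congr 1
  refine Eq.trans ?_ integral_ofReal
  refine MeasureTheory.setIntegral_congr_fun measurableSet_Ioi fun t ht => ?_
  have ht : 1 < t := ht
  have e : ((t ^ (-((1 / 2 : ℝ) + 1)) : ℝ) : ℂ) = (t : ℂ) ^ (-(1 / 2 + 1) : ℂ) := by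
    rw [ofReal_cpow (by linarith)]
    push_cast
    rfl
  rw [← e]
  simp

end QuadraticLFunctionAnalytic

/-! ### The completed multiple Dirichlet series and its functional equations -/

section MomentSeries

open Complex

theorem LineHol.of_tendstoLocallyUniformlyOn {E ι : Type*} [NormedAddCommGroup E] [NormedSpace ℂ E]
    {l : Filter ι} [l.NeBot] {F : ι → E → ℂ} {f : E → ℂ} {U : Set E} (hU : IsOpen U)
    (hF : ∀ n, LineHol (F n) U) (h : TendstoLocallyUniformlyOn F f l U) : LineHol f U where
  cont := h.continuousOn (Frequently.of_forall fun n => (hF n).cont)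
  hol a b := by
    have hUo : IsOpen {z : ℂ | a + z • b ∈ U} := isOpen_line_preimage hU a b
    have h1 : TendstoLocallyUniformlyOn (fun n (z : ℂ) => F n (a + z • b)) (fun z => f (a + z • b)) l
        {z : ℂ | a + z • b ∈ U} :=
      h.comp (fun z : ℂ => a + z • b) (fun z hz => hz) (by fun_prop)
    exact h1.differentiableOn (Eventually.of_forall fun n => (hF n).hol a b) hUo

lemma LineHol.finset_sum {E ι : Type*} [NormedAddCommGroup E] [NormedSpace ℂ E]
    {F : ι → E → ℂ} {U : Set E} (t : Finset ι) (hF : ∀ n, LineHol (F n) U) :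
    LineHol (fun z => ∑ n ∈ t, F n z) U where
  cont := continuousOn_finsetSum _ fun n _ => (hF n).cont
  hol a b := DifferentiableOn.fun_sum fun n _ => (hF n).hol a b

/-- A locally dominated series of holomorphic functions is holomorphic. -/
theorem LineHol.tsum {E ι : Type*} [NormedAddCommGroup E] [NormedSpace ℂ E]
    {F : ι → E → ℂ} {U : Set E} (hU : IsOpen U) (hF : ∀ n, LineHol (F n) U)
    (h : ∀ z ∈ U, ∃ V ∈ 𝓝 z, ∃ u : ι → ℝ, Summable u ∧ ∀ n, ∀ y ∈ V, ‖F n y‖ ≤ u n) :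
    LineHol (fun z => ∑' n, F n z) U := by
  refine LineHol.of_tendstoLocallyUniformlyOn (l := atTop) hU (fun t => LineHol.finset_sum t hF) ?_
  intro v hv z hz
  obtain ⟨V, hV, u, hu, hFu⟩ := h z hz
  refine ⟨V, mem_nhdsWithin_of_mem_nhds hV, ?_⟩
  exact tendstoUniformlyOn_tsum hu (fun n y hy => hFu n y hy) v hv

lemma differentiableAt_finsetProd {E ι : Type*} [NormedAddCommGroup E] [NormedSpace ℂ E]
    (t : Finset ι) {f : ι → E → ℂ} {x : E} (h : ∀ i ∈ t, DifferentiableAt ℂ (f i) x) :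
    DifferentiableAt ℂ (fun y => ∏ i ∈ t, f i y) x := by
  classical
  induction t using Finset.induction_on with
  | empty => simp
  | insert a t ha ih =>
    simp only [Finset.prod_insert ha]
    exact (h a (by simp)).fun_mul (ih fun i hi => h i (by simp [hi]))

/-- The term of the moment series attached to `d`. -/
noncomputable def momentTerm {m : ℕ} (s : Fin m → ℂ) (w : ℂ) (d : ℤ) : ℂ :=
  (∏ i, quadL (quadDisc d) (s i)) / ((quadDisc d).natAbs : ℂ) ^ w

/-- Square-free integers of a given sign. -/
abbrev SqfreeSigned (σ : ℤˣ) : Type := {d : ℤ // Squarefree d ∧ 0 < (σ : ℤ) * d}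

/-- The three residue classes combine to one sum over all square-free `d`: the factor `4 ^ (-w)`
turns `|d| ^ (-w)` into `|D| ^ (-w)` in the classes where `D = 4 d`. -/
theorem momentSeries_eq_tsum {m : ℕ} (σ : ℤˣ) (s : Fin m → ℂ) (w : ℂ)
    (h : Summable fun d : SqfreeSigned σ => momentTerm s w d) :
    momentSeries σ s w = ∑' d : SqfreeSigned σ, momentTerm s w d := by
  set S : Set ℤ := {d | Squarefree d ∧ 0 < (σ : ℤ) * d} with hS
  set P : ℤ → Set ℤ := fun ν => {d | Squarefree d ∧ d % 4 = ν ∧ 0 < (σ : ℤ) * d} with hP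
  have hind : Summable (S.indicator (momentTerm s w)) := summable_subtype_iff_indicator.mp h
  have hPind : ∀ ν, Summable ((P ν).indicator (momentTerm s w)) := by
    intro ν
    have : (P ν).indicator (momentTerm s w) =
        (P ν).indicator (S.indicator (momentTerm s w)) := by
      rw [Set.indicator_indicator]
      congr 1
      ext d
      simp [hS, hP]
      tauto
    rw [this]
    exact hind.indicator _
  have h1 : momentSeriesPart σ 1 s w = ∑' d, (P 1).indicator (momentTerm s w) d := by
    rw [← tsum_subtype (P 1)]
    refine tsum_congr fun d => ?_
    have h4 : (d : ℤ) % 4 = 1 := d.2.2.1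
    simp only [momentTerm, quadDisc, if_pos h4]
  have h23 : ∀ ν, ν = 2 ∨ ν = 3 → (4 : ℂ) ^ (-w) * momentSeriesPart σ ν s w =
      ∑' d, (P ν).indicator (momentTerm s w) d := by
    intro ν hν
    rw [← tsum_subtype (P ν), momentSeriesPart, ← tsum_mul_left]
    refine tsum_congr fun d => ?_
    have h4 : (d : ℤ) % 4 ≠ 1 := by have := d.2.2.1; omega
    simp only [momentTerm, quadDisc, if_neg h4, Int.natAbs_mul]
    push_cast
    rw [show ((4 : ℂ)) = ((4 : ℕ) : ℂ) by norm_num, natCast_mul_natCast_cpow, cpow_neg]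
    rw [div_eq_mul_inv, div_eq_mul_inv, mul_inv]
    ring
  rw [momentSeries, mul_add, h1, h23 2 (Or.inl rfl), h23 3 (Or.inr rfl),
    ← (hPind 2).tsum_add (hPind 3), ← (hPind 1).tsum_add ((hPind 2).add (hPind 3))]
  have hS' : ∑' d : SqfreeSigned σ, momentTerm s w d = ∑' d, S.indicator (momentTerm s w) d :=
    tsum_subtype S (momentTerm s w)
  rw [hS']
  refine tsum_congr fun d => ?_
  by_cases hd : d ∈ S
  · have h4 := squarefree_emod_four hd.1
    rw [Set.indicator_of_mem hd]
    simp only [Set.indicator, hP, Set.mem_ofPred_eq, hd.1, hd.2, true_and, and_true]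
    rcases h4 with h4 | h4 | h4 <;> simp [h4]
  · have : ∀ ν, d ∉ P ν := fun ν hν => hd ⟨hν.1, hν.2.2⟩
    rw [Set.indicator_of_notMem hd]
    simp [Set.indicator_of_notMem (this _)]

lemma natAbs_le_natAbs_quadDisc (d : ℤ) : d.natAbs ≤ (quadDisc d).natAbs := by
  unfold quadDisc; split_ifs <;> omega

lemma summable_sqfreeSigned_inv_rpow (σ : ℤˣ) {x : ℝ} (hx : 1 < x) :
    Summable fun d : SqfreeSigned σ => ((quadDisc d).natAbs : ℝ) ^ (-x) := by
  have h1 : Summable fun d : ℤ => |(d : ℝ)| ^ (-x) := Real.summable_abs_int_rpow hx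
  have h2 : Summable fun d : SqfreeSigned σ => |((d : ℤ) : ℝ)| ^ (-x) :=
    h1.comp_injective Subtype.val_injective
  refine Summable.of_nonneg_of_le (fun d => by positivity) (fun d => ?_) h2
  have hd0 : (0 : ℝ) < |((d : ℤ) : ℝ)| := abs_pos.mpr (by exact_mod_cast d.2.1.ne_zero)
  refine Real.rpow_le_rpow_of_nonpos hd0 ?_ (by linarith)
  have h3 : |((d : ℤ) : ℝ)| = (((d : ℤ).natAbs : ℕ) : ℝ) := by
    rw [← Int.cast_abs, Int.abs_eq_natAbs, Int.cast_natCast]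
  rw [h3]
  exact Nat.cast_le.mpr (natAbs_le_natAbs_quadDisc d)

lemma natAbs_quadDisc_pos (d : ℤ) (hd : Squarefree d) : 0 < (quadDisc d).natAbs :=
  Int.natAbs_pos.mpr (quadDisc_ne_zero hd)

lemma norm_momentTerm {m : ℕ} (s : Fin m → ℂ) (w : ℂ) {d : ℤ} (hd : Squarefree d) :
    ‖momentTerm s w d‖ =
      (∏ i, ‖quadL (quadDisc d) (s i)‖) * ((quadDisc d).natAbs : ℝ) ^ (-w.re) := by
  rw [momentTerm, norm_div, norm_prod, norm_natCast_cpow_of_pos (natAbs_quadDisc_pos d hd),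
    Real.rpow_neg (by positivity), div_eq_mul_inv]

/-- The region where the moment series is treated through the polynomial bound in the
conductor. -/
def polyRegion (m : ℕ) : Set ((Fin m → ℂ) × ℂ) :=
  {z | (∀ i, 1 / 4 < (z.1 i).re ∧ z.1 i ≠ 1) ∧ (m : ℝ) + 2 < z.2.re}

lemma isOpen_polyRegion (m : ℕ) : IsOpen (polyRegion m) := by
  have : polyRegion m = (⋂ i, ({z | 1 / 4 < (z.1 i).re} ∩ {z | z.1 i ≠ 1})) ∩
      {z : (Fin m → ℂ) × ℂ | (m : ℝ) + 2 < z.2.re} := by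
    ext z; simp [polyRegion]
  rw [this]
  refine IsOpen.inter (isOpen_iInter_of_finite fun i => IsOpen.inter ?_ ?_) ?_
  · exact isOpen_lt continuous_const (by fun_prop)
  · exact isOpen_ne_fun (by fun_prop) continuous_const
  · exact isOpen_lt continuous_const (by fun_prop)

lemma lineHol_momentTerm {m : ℕ} {d : ℤ} (hd : Squarefree d) :
    LineHol (fun z : (Fin m → ℂ) × ℂ => momentTerm z.1 z.2 d) (polyRegion m) := by
  refine DifferentiableOn.lineHol (fun z hz => ?_)
  have hN : ((quadDisc d).natAbs : ℂ) ≠ 0 := by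
    exact_mod_cast (natAbs_quadDisc_pos d hd).ne'
  refine DifferentiableAt.differentiableWithinAt ?_
  unfold momentTerm
  have hN' : ((quadDisc d).natAbs : ℂ) ^ z.2 ≠ 0 := fun h => hN ((cpow_eq_zero_iff _ _).mp h).1
  have h1 : DifferentiableAt ℂ (fun z : (Fin m → ℂ) × ℂ => ∏ i, quadL (quadDisc d) (z.1 i)) z := by
    refine differentiableAt_finsetProd _ fun i _ => ?_
    have h1 : DifferentiableAt ℂ (fun z : (Fin m → ℂ) × ℂ => z.1 i) z := by fun_prop
    exact DifferentiableAt.comp (g := quadL (quadDisc d)) z (differentiableAt_quadL hd (hz.1 i).2) h1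
  have h2 : DifferentiableAt ℂ (fun z : (Fin m → ℂ) × ℂ => ((quadDisc d).natAbs : ℂ) ^ z.2) z := by
    have h1 : DifferentiableAt ℂ (fun z : (Fin m → ℂ) × ℂ => z.2) z := by fun_prop
    exact h1.const_cpow (Or.inl hN)
  simp only [div_eq_mul_inv]
  exact h1.fun_mul (h2.inv hN')

lemma norm_momentTerm_le {m : ℕ} {s : Fin m → ℂ} {w : ℂ} {R : ℝ}
    (hs : ∀ i, 1 / 4 < (s i).re) (hR : ∀ i, ‖s i‖ ≤ R) (hw : (m : ℝ) + 2 < w.re) {d : ℤ}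
    (hd : Squarefree d) (hd1 : d ≠ 1) :
    ‖momentTerm s w d‖ ≤ (4 * R) ^ m * ((quadDisc d).natAbs : ℝ) ^ (-(2 : ℝ)) := by
  have hN : (1 : ℝ) ≤ ((quadDisc d).natAbs : ℝ) := by exact_mod_cast natAbs_quadDisc_pos d hd
  set N : ℝ := ((quadDisc d).natAbs : ℝ) with hNdef
  rw [norm_momentTerm s w hd]
  have h1 : ∏ i, ‖quadL (quadDisc d) (s i)‖ ≤ ∏ _i : Fin m, (4 * R * N) := by
    refine Finset.prod_le_prod (fun i _ => norm_nonneg _) fun i _ => ?_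
    have h2 := norm_quadL_le hd hd1 (by linarith [hs i] : 0 < (s i).re)
    refine h2.trans ?_
    have h3 : ‖s i‖ / (s i).re ≤ 4 * R := by
      rw [div_le_iff₀ (by linarith [hs i])]
      have := hR i
      have := norm_nonneg (s i)
      nlinarith [hs i]
    exact mul_le_mul_of_nonneg_right h3 (by positivity)
  rw [Finset.prod_const, Finset.card_univ, Fintype.card_fin] at h1
  have hR0 : 0 ≤ (4 * R * N) ^ m := le_trans (Finset.prod_nonneg fun i _ => norm_nonneg _) h1
  refine (mul_le_mul_of_nonneg_right h1 (by positivity)).trans ?_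
  rw [mul_pow, mul_assoc]
  have hR1 : 0 ≤ (4 * R) ^ m := by
    rw [mul_pow] at hR0
    exact nonneg_of_mul_nonneg_left hR0 (by positivity)
  refine mul_le_mul_of_nonneg_left ?_ hR1
  rw [← Real.rpow_natCast, ← Real.rpow_add (by linarith)]
  exact Real.rpow_le_rpow_of_exponent_le hN (by linarith)

/-- Locally uniform domination of the moment series; the term `d = 1` is bounded separately, because
the bound in the conductor excludes the zeta function. -/
lemma exists_summable_bound_momentTerm {m : ℕ} (σ : ℤˣ) {z : (Fin m → ℂ) × ℂ}
    (hz : z ∈ polyRegion m) : ∃ V ∈ 𝓝 z, ∃ u : SqfreeSigned σ → ℝ, Summable u ∧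
      ∀ d : SqfreeSigned σ, ∀ y ∈ V, ‖momentTerm y.1 y.2 d‖ ≤ u d := by
  classical
  have hopen := isOpen_polyRegion m
  have hc1 : ContinuousAt (fun y : (Fin m → ℂ) × ℂ => ‖momentTerm y.1 y.2 1‖) z :=
    ((lineHol_momentTerm squarefree_one).cont.continuousAt (hopen.mem_nhds hz)).norm
  have h1 : ∀ᶠ y in 𝓝 z, ‖momentTerm y.1 y.2 1‖ < ‖momentTerm z.1 z.2 1‖ + 1 :=
    hc1.eventually_lt_const (by linarith)
  have h2 : ∀ᶠ y in 𝓝 z, ‖y.1‖ < ‖z.1‖ + 1 :=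
    (by fun_prop : ContinuousAt (fun y : (Fin m → ℂ) × ℂ => ‖y.1‖) z).eventually_lt_const
      (by linarith)
  set B : ℝ := ‖momentTerm z.1 z.2 1‖ + 1
  set R : ℝ := ‖z.1‖ + 1
  have hR0 : 0 ≤ R := by positivity
  refine ⟨_, (h1.and h2).and (hopen.mem_nhds hz),
    fun d => (4 * R) ^ m * ((quadDisc d).natAbs : ℝ) ^ (-(2 : ℝ)) + if (d : ℤ) = 1 then B else 0,
    ?_, ?_⟩
  · refine Summable.add ((summable_sqfreeSigned_inv_rpow σ (by norm_num)).mul_left _) ?_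
    refine summable_of_hasFiniteSupport ?_
    refine Set.Finite.subset (Set.Finite.preimage Subtype.val_injective.injOn
      (Set.finite_singleton (1 : ℤ))) ?_
    intro d hd
    by_contra hcon
    simp only [Set.mem_preimage, Set.mem_singleton_iff] at hcon
    simp [hcon] at hd
  · rintro d y ⟨⟨hy1, hy2⟩, hy3⟩
    simp only []
    by_cases hd1 : (d : ℤ) = 1
    · rw [if_pos hd1, hd1]
      have : 0 ≤ (4 * R) ^ m * ((quadDisc 1).natAbs : ℝ) ^ (-(2 : ℝ)) := by positivity
      linarith
    · rw [if_neg hd1, add_zero]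
      exact norm_momentTerm_le (fun i => (hy3.1 i).1)
        (fun i => (norm_le_pi_norm y.1 i).trans hy2.le) hy3.2 d.2.1 hd1

lemma summable_momentTerm {m : ℕ} (σ : ℤˣ) {s : Fin m → ℂ} {w : ℂ}
    (hz : (s, w) ∈ polyRegion m) : Summable fun d : SqfreeSigned σ => momentTerm s w d := by
  obtain ⟨V, hV, u, hu, h⟩ := exists_summable_bound_momentTerm σ hz
  exact Summable.of_norm_bounded hu fun d => h d (s, w) (mem_of_mem_nhds hV)

lemma lineHol_momentSeries {m : ℕ} (σ : ℤˣ) :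
    LineHol (fun z : (Fin m → ℂ) × ℂ => momentSeries σ z.1 z.2) (polyRegion m) := by
  have h := LineHol.tsum (isOpen_polyRegion m)
    (F := fun (d : SqfreeSigned σ) (z : (Fin m → ℂ) × ℂ) => momentTerm z.1 z.2 d)
    (fun d => lineHol_momentTerm d.2.1) (fun z hz => exists_summable_bound_momentTerm σ hz)
  have heq : ∀ z ∈ polyRegion m, momentSeries σ z.1 z.2 =
      ∑' d : SqfreeSigned σ, momentTerm z.1 z.2 d :=
    fun z hz => momentSeries_eq_tsum σ z.1 z.2 (summable_momentTerm σ hz)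
  exact ⟨h.cont.congr heq, fun a b => (h.hol a b).congr fun z hz => heq _ hz⟩

/-- The product of the gamma factors. -/
noncomputable def gammaProd {m : ℕ} (σ : ℤˣ) (s : Fin m → ℂ) : ℂ :=
  ∏ i, Gammaℝ (s i + if σ = 1 then 0 else 1)

lemma differentiableAt_Gammaℝ {s : ℂ} (hs : 0 < s.re) : DifferentiableAt ℂ Gammaℝ s := by
  have h1 : DifferentiableAt ℂ (fun s => (Gammaℝ s)⁻¹) s := differentiable_Gammaℝ_inv s
  have h2 := h1.inv (inv_ne_zero (Gammaℝ_ne_zero_of_re_pos hs))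
  exact h2.congr_of_eventuallyEq (Eventually.of_forall fun z => by simp)

lemma re_add_sign_pos {σ : ℤˣ} {s : ℂ} (hs : 0 < s.re) :
    0 < (s + if σ = 1 then 0 else 1).re := by
  split_ifs <;> simp <;> linarith

lemma differentiableOn_gammaProd {m : ℕ} (σ : ℤˣ) :
    DifferentiableOn ℂ (gammaProd (m := m) σ) {s | ∀ i, 0 < (s i).re} := by
  intro s hs
  refine DifferentiableAt.differentiableWithinAt ?_
  change DifferentiableAt ℂ (fun s : Fin m → ℂ => ∏ i, Gammaℝ (s i + if σ = 1 then 0 else 1)) s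
  have h2 : ∀ i ∈ (Finset.univ : Finset (Fin m)), DifferentiableAt ℂ
      (fun s : Fin m → ℂ => Gammaℝ (s i + if σ = 1 then 0 else 1)) s := ?_
  · exact differentiableAt_finsetProd Finset.univ
      (f := fun i (s : Fin m → ℂ) => Gammaℝ (s i + if σ = 1 then 0 else 1)) h2
  intro i _
  have h1 : DifferentiableAt ℂ (fun s : Fin m → ℂ => s i + if σ = 1 then 0 else 1) s :=
    DifferentiableAt.add_const _ (by fun_prop)
  exact DifferentiableAt.comp (g := Gammaℝ) s (differentiableAt_Gammaℝ (re_add_sign_pos (hs i))) h1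

lemma gammaProd_ne_zero {m : ℕ} (σ : ℤˣ) {s : Fin m → ℂ} (hs : ∀ i, 0 < (s i).re) :
    gammaProd σ s ≠ 0 :=
  Finset.prod_ne_zero_iff.mpr fun i _ => Gammaℝ_ne_zero_of_re_pos (re_add_sign_pos (hs i))

theorem lineHol_completedSeries {m : ℕ} (σ : ℤˣ) :
    LineHol (fun z : (Fin m → ℂ) × ℂ => completedSeries σ z.1 z.2) (polyRegion m) := by
  have h1 : LineHol (fun z : (Fin m → ℂ) × ℂ => gammaProd σ z.1) (polyRegion m) := by
    refine DifferentiableOn.lineHol ?_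
    refine (differentiableOn_gammaProd σ).comp (by fun_prop) fun z hz i => ?_
    linarith [(hz.1 i).1]
  exact h1.mul (lineHol_momentSeries σ)

/-- The reflection `sᵢ ↦ 1 - sᵢ` for the indices with `εᵢ = 1`, together with the corresponding
shift of `w`. -/
noncomputable def reflection {m : ℕ} (ε : Fin m → Fin 2) (z : (Fin m → ℂ) × ℂ) :
    (Fin m → ℂ) × ℂ :=
  (fun i => if ε i = 1 then 1 - z.1 i else z.1 i, z.2 + ∑ i, ((ε i : ℕ) : ℂ) * (z.1 i - 1 / 2))

lemma sign_pos_iff {σ : ℤˣ} {d : ℤ} (hd : 0 < (σ : ℤ) * d) : 0 < d ↔ σ = 1 := by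
  rcases Int.units_eq_one_or σ with rfl | rfl
  · simpa using hd
  · simp at hd ⊢
    exact hd.le

lemma gammaProd_mul_momentTerm_reflection {m : ℕ} {σ : ℤˣ} (ε : Fin m → Fin 2) {s : Fin m → ℂ}
    {w : ℂ} (hs : ∀ i, 0 < (s i).re ∧ (s i).re < 1) {d : ℤ} (hd : Squarefree d)
    (hσ : 0 < (σ : ℤ) * d) :
    gammaProd σ (reflection ε (s, w)).1 *
      momentTerm (reflection ε (s, w)).1 (reflection ε (s, w)).2 d =
      gammaProd σ s * momentTerm s w d := by
  have hN : ((quadDisc d).natAbs : ℂ) ≠ 0 := by exact_mod_cast (natAbs_quadDisc_pos d hd).ne'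
  set N : ℂ := ((quadDisc d).natAbs : ℂ) with hNdef
  have hfac : ∀ i, Gammaℝ ((reflection ε (s, w)).1 i + if σ = 1 then 0 else 1) *
      quadL (quadDisc d) ((reflection ε (s, w)).1 i) =
      N ^ (((ε i : ℕ) : ℂ) * (s i - 1 / 2)) *
        (Gammaℝ (s i + if σ = 1 then 0 else 1) * quadL (quadDisc d) (s i)) := by
    intro i
    have hsg := sign_pos_iff hσ
    have hFE := quadL_one_sub hd (hs i).1 (hs i).2
    simp only [hsg] at hFE
    simp only [reflection]
    by_cases hε : ε i = 1
    · rw [if_pos hε, hFE, hε]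
      simp [hNdef]
    · have hε0 : ε i = 0 := by omega
      rw [if_neg hε, hε0]
      simp
  have hprod : (∏ i, Gammaℝ ((reflection ε (s, w)).1 i + if σ = 1 then 0 else 1)) *
      (∏ i, quadL (quadDisc d) ((reflection ε (s, w)).1 i)) =
      N ^ (∑ i, ((ε i : ℕ) : ℂ) * (s i - 1 / 2)) *
        ((∏ i, Gammaℝ (s i + if σ = 1 then 0 else 1)) * ∏ i, quadL (quadDisc d) (s i)) := by
    rw [← Finset.prod_mul_distrib, ← Finset.prod_mul_distrib, Finset.prod_congr rfl fun i _ => hfac i,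
      Finset.prod_mul_distrib]
    congr 1
    rw [cpow_def_of_ne_zero hN, Finset.mul_sum, exp_sum]
    exact Finset.prod_congr rfl fun i _ => by rw [cpow_def_of_ne_zero hN]
  rw [momentTerm, momentTerm, gammaProd, gammaProd, ← mul_div_assoc, hprod, ← mul_div_assoc]
  have hw2 : (reflection ε (s, w)).2 = w + ∑ i, ((ε i : ℕ) : ℂ) * (s i - 1 / 2) := rfl
  rw [hw2, ← hNdef, cpow_add _ _ hN, mul_comm (N ^ w)]
  have h1 : N ^ (∑ i, ((ε i : ℕ) : ℂ) * (s i - 1 / 2)) ≠ 0 := by simp [cpow_eq_zero_iff, hN]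
  rw [mul_div_mul_left _ _ h1]

/-- The functional equations of the completed series, in the region of convergence. -/
theorem completedSeries_reflection {m : ℕ} (σ : ℤˣ) (ε : Fin m → Fin 2) {z : (Fin m → ℂ) × ℂ}
    (hz : z ∈ polyRegion m) (hz1 : ∀ i, (z.1 i).re < 1) (hρ : reflection ε z ∈ polyRegion m) :
    completedSeries σ (reflection ε z).1 (reflection ε z).2 = completedSeries σ z.1 z.2 := by
  change gammaProd σ (reflection ε z).1 * momentSeries σ (reflection ε z).1 (reflection ε z).2 =
    gammaProd σ z.1 * momentSeries σ z.1 z.2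
  rw [momentSeries_eq_tsum σ (reflection ε z).1 (reflection ε z).2 (summable_momentTerm σ hρ),
    momentSeries_eq_tsum σ z.1 z.2 (summable_momentTerm σ (s := z.1) (w := z.2) hz), ← tsum_mul_left,
    ← tsum_mul_left]
  refine tsum_congr fun d => ?_
  exact gammaProd_mul_momentTerm_reflection ε (fun i => ⟨by linarith [(hz.1 i).1], hz1 i⟩) d.2.1 d.2.2

end MomentSeries

/-! ### Mean values of Jacobi symbols -/

section JacobiMean

lemma exists_jacobiSym_prime_eq_neg_one {p : ℕ} (hp : p.Prime) (hp2 : p ≠ 2) :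
    ∃ x : ℤ, jacobiSym x p = -1 := by
  have : Fact p.Prime := ⟨hp⟩
  obtain ⟨a, ha⟩ := quadraticChar_exists_neg_one (F := ZMod p) (by rwa [ZMod.ringChar_zmod_n])
  refine ⟨(a.val : ℤ), ?_⟩
  rw [← jacobiSym.legendreSym.to_jacobiSym, legendreSym]
  simpa using ha

/-- The Jacobi symbol modulo an odd non-square is not the trivial character. -/
theorem isSquare_or_exists_jacobiSym_eq_neg_one {n : ℕ} (hn : Odd n) :
    IsSquare n ∨ ∃ x : ℤ, jacobiSym x n = -1 := by
  induction n using Nat.recOnPosPrimePosCoprime with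
  | zero => simp at hn
  | one => exact Or.inl ⟨1, rfl⟩
  | prime_pow p k hp hk =>
    have hp2 : p ≠ 2 := by
      rintro rfl
      rw [Nat.odd_pow_iff hk.ne'] at hn
      exact absurd hn (by decide)
    rcases Nat.even_or_odd k with hk2 | hk2
    · exact Or.inl (hk2.isSquare_pow p)
    · obtain ⟨x, hx⟩ := exists_jacobiSym_prime_eq_neg_one hp hp2
      exact Or.inr ⟨x, by rw [jacobiSym.pow_right, hx, hk2.neg_one_pow]⟩
  | coprime a b ha hb hab iha ihb =>
    rw [Nat.odd_mul] at hn
    have ha0 : NeZero a := ⟨by omega⟩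
    have hb0 : NeZero b := ⟨by omega⟩
    have key : ∀ {a b : ℕ}, a ≠ 0 → b ≠ 0 → a.Coprime b → (∃ x : ℤ, jacobiSym x a = -1) →
        ∃ x : ℤ, jacobiSym x (a * b) = -1 := by
      rintro a b ha hb hab ⟨x, hx⟩
      have ha0 : NeZero a := ⟨ha⟩
      have hb0 : NeZero b := ⟨hb⟩
      have hxa : ((x % a).toNat : ℤ) = x % a :=
        Int.toNat_of_nonneg (Int.emod_nonneg _ (by exact_mod_cast ha))
      obtain ⟨y, hya, hyb⟩ := Nat.chineseRemainder hab (x % a).toNat 1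
      refine ⟨y, ?_⟩
      rw [jacobiSym.mul_right]
      have h1 : jacobiSym y a = jacobiSym x a := by
        rw [jacobiSym.mod_left (y : ℤ) a, jacobiSym.mod_left x a]
        congr 1
        have := (Int.natCast_modEq_iff.mpr hya)
        rw [Int.ModEq, hxa, Int.emod_emod] at this
        exact this
      have h2 : jacobiSym y b = 1 := by
        rw [jacobiSym.mod_left (y : ℤ) b, Int.natCast_modEq_iff.mpr hyb, ← jacobiSym.mod_left]
        simp
      rw [h1, h2, hx, mul_one]
    rcases iha hn.1 with h1 | h1
    · rcases ihb hn.2 with h2 | h2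
      · exact Or.inl (h1.mul h2)
      · right
        rw [mul_comm]
        exact key (by omega) (by omega) hab.symm h2
    · exact Or.inr (key (by omega) (by omega) hab h1)

/-- The Jacobi symbol `(· / n)` as a function on `ℤ / n`. -/
def jacobiZMod (n : ℕ) (a : ZMod n) : ℂ := (jacobiSym a.val n : ℂ)

lemma jacobiZMod_intCast (n : ℕ) [NeZero n] (a : ℤ) :
    jacobiZMod n (a : ZMod n) = jacobiSym a n := by
  rw [jacobiZMod, ZMod.val_intCast, ← jacobiSym.mod_left]

lemma jacobiZMod_mul (n : ℕ) [NeZero n] (a : ℤ) (b : ZMod n) :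
    jacobiZMod n ((a : ZMod n) * b) = jacobiSym a n * jacobiZMod n b := by
  have hb : b = ((b.val : ℤ) : ZMod n) := by simp
  rw [hb, ← Int.cast_mul, jacobiZMod_intCast, jacobiZMod_intCast, jacobiSym.mul_left]
  push_cast
  rfl

open Classical in
/-- The Jacobi symbol sums to `0` over a period, unless `n` is a square, when it is the indicator
function of the residues prime to `n`. -/
theorem sum_jacobiZMod {n : ℕ} [NeZero n] (hn : Odd n) :
    ∑ a, jacobiZMod n a = if IsSquare n then (n.totient : ℂ) else 0 := by
  split_ifs with hsq
  · obtain ⟨m, rfl⟩ := hsq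
    have h1 : ∀ a : ℕ, (jacobiSym a (m * m) : ℂ) = if (m * m).Coprime a then 1 else 0 := by
      intro a
      have hm : NeZero m := ⟨by rintro rfl; simp at hn⟩
      rw [jacobiSym.mul_right]
      split_ifs with h
      · have h2 : (a : ℤ).gcd m = 1 := by
          rw [Int.gcd_natCast_natCast]
          exact (Nat.Coprime.coprime_mul_right h).symm
        have := jacobiSym.sq_one h2
        rw [sq] at this
        exact_mod_cast this
      · have h2 : (a : ℤ).gcd m ≠ 1 := by
          rw [Int.gcd_natCast_natCast]
          exact fun h2 => h (Nat.Coprime.mul_left (Nat.coprime_comm.mp h2) (Nat.coprime_comm.mp h2))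
        rw [jacobiSym.eq_zero_iff_not_coprime.mpr h2]
        simp
    unfold jacobiZMod
    rw [sum_zmod_val_eq fun r => (jacobiSym r (m * m) : ℂ), Finset.sum_congr rfl fun r _ => h1 r,
      Finset.sum_boole, Nat.totient_eq_card_coprime]
  · obtain ⟨x, hx⟩ := (isSquare_or_exists_jacobiSym_eq_neg_one hn).resolve_left hsq
    have hgcd : x.gcd n = 1 := by
      by_contra h
      rw [jacobiSym.eq_zero_iff_not_coprime.mpr h] at hx
      norm_num at hx
    have hu : IsUnit (x : ZMod n) := by
      rw [ZMod.coe_int_isUnit_iff_isCoprime]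
      exact (Int.isCoprime_iff_gcd_eq_one.mpr hgcd).symm
    obtain ⟨u, hu⟩ := hu
    have h1 : ∑ a, jacobiZMod n a = ∑ a, jacobiZMod n ((x : ZMod n) * a) := by
      rw [← hu]
      exact (Equiv.sum_comp u.mulLeft (jacobiZMod n)).symm
    simp only [jacobiZMod_mul, hx, ← Finset.mul_sum] at h1
    push_cast at h1
    linear_combination h1 / 2

end JacobiMean

/-! ### Mean values of Kronecker symbols over fundamental discriminants -/

section KroneckerMean

open Complex

lemma ordCompl_two_pos {N : ℕ} (hN : N ≠ 0) : 0 < N / 2 ^ N.factorization 2 :=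
  Nat.ordCompl_pos 2 hN

lemma χ₈_pow_two_of_odd {a : ℕ} (ha : Odd a) : ZMod.χ₈ ((a : ℤ) : ZMod 8) ^ 2 = 1 := by
  obtain ⟨b, rfl⟩ := ha
  have key : ∀ c : ZMod 8, ZMod.χ₈ (2 * c + 1) ^ 2 = 1 := by decide
  have := key (b : ZMod 8)
  push_cast
  exact this

lemma kronecker_natCast_pow_two {a N : ℕ} (ha : Odd a) (hN : N ≠ 0) :
    kronecker (a : ℤ) N ^ 2 = if a.Coprime N then 1 else 0 := by
  rw [kronecker_of_ne_zero _ hN, mul_pow, ← pow_mul, mul_comm (N.factorization 2), pow_mul,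
    χ₈_pow_two_of_odd ha, one_pow, one_mul]
  set k := N.factorization 2
  set N' := N / 2 ^ k
  have hNN : 2 ^ k * N' = N := Nat.ordProj_mul_ordCompl_eq_self N 2
  have hN'0 : NeZero N' := ⟨(ordCompl_two_pos hN).ne'⟩
  have hco : a.Coprime N ↔ a.Coprime N' := by
    rw [← hNN, Nat.coprime_mul_iff_right]
    exact and_iff_right (Nat.Coprime.pow_right _ (Nat.coprime_two_right.mpr ha))
  split_ifs with h
  · exact jacobiSym.sq_one (by rw [Int.gcd_natCast_natCast]; exact hco.mp h)
  · rw [jacobiSym.eq_zero_iff_not_coprime.mpr]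
    · norm_num
    · rw [Int.gcd_natCast_natCast]; exact fun h' => h (hco.mpr h')

/-- The term `(D / N) |D| ^ (-w)` with `D` the discriminant attached to `σ n`. -/
noncomputable def kroneckerTerm (σ : ℤˣ) (N : ℕ) (w : ℂ) (n : ℕ) : ℂ :=
  (kronecker (quadDisc (σ * n)) N : ℂ) * ((quadDisc (σ * n)).natAbs : ℂ) ^ (-w)

lemma natAbs_units_mul (σ : ℤˣ) (n : ℕ) : ((σ : ℤ) * n).natAbs = n := by
  rw [Int.natAbs_mul, Int.units_natAbs, one_mul, Int.natAbs_natCast]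

lemma quadDisc_sq_mul {a : ℕ} (ha : Odd a) (d : ℤ) : quadDisc (a ^ 2 * d) = a ^ 2 * quadDisc d := by
  have h4 : (a : ℤ) ^ 2 * d % 4 = d % 4 := by
    obtain ⟨b, rfl⟩ := ha
    push_cast
    rw [show ((2 : ℤ) * b + 1) ^ 2 * d = d + 4 * ((b ^ 2 + b) * d) by ring]
    simp
  unfold quadDisc
  rw [h4]
  split_ifs <;> ring

lemma kroneckerTerm_sq_mul (σ : ℤˣ) {N : ℕ} (hN : N ≠ 0) (w : ℂ) {a : ℕ} (ha : Odd a) (q : ℕ) :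
    kroneckerTerm σ N w (a ^ 2 * q) =
      (if a.Coprime N then (a : ℂ) ^ (-(2 * w)) else 0) * kroneckerTerm σ N w q := by
  have h1 : quadDisc (σ * (a ^ 2 * q : ℕ)) = a ^ 2 * quadDisc (σ * q) := by
    rw [← quadDisc_sq_mul ha]
    congr 1
    push_cast; ring
  have h2 : ((quadDisc (σ * (a ^ 2 * q : ℕ))).natAbs : ℂ) ^ (-w) =
      (a : ℂ) ^ (-(2 * w)) * ((quadDisc (σ * q)).natAbs : ℂ) ^ (-w) := by
    have h3 : (quadDisc (σ * (a ^ 2 * q : ℕ))).natAbs = a * (a * (quadDisc (σ * q)).natAbs) := by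
      rw [h1, Int.natAbs_mul, Int.natAbs_pow, Int.natAbs_natCast]; ring
    have ha0 : (a : ℂ) ≠ 0 := by
      have : a ≠ 0 := by rintro rfl; simp at ha
      exact_mod_cast this
    rw [h3]
    push_cast
    rw [show ((a : ℂ) * (a * ((quadDisc (σ * q)).natAbs : ℂ))) =
      ((a : ℕ) : ℂ) * ((a * (quadDisc (σ * q)).natAbs : ℕ) : ℂ) by push_cast; ring,
      natCast_mul_natCast_cpow, Nat.cast_mul, natCast_mul_natCast_cpow, ← mul_assoc,
      ← cpow_add _ _ ha0]
    congr 2; ring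
  rw [kroneckerTerm, kroneckerTerm, h2, h1, kronecker_mul_left _ _ hN, sq,
    kronecker_mul_left _ _ hN, ← sq, kronecker_natCast_pow_two ha hN]
  split_ifs <;> push_cast <;> ring

/-- Every `n` not divisible by `4` is in a unique way `a ^ 2 * q` with `a` odd, `q` square-free. -/
lemma bijective_sq_mul : Function.Bijective
    (fun z : {a : ℕ // Odd a} × {q : ℕ // Squarefree q} =>
      (⟨(z.1 : ℕ) ^ 2 * z.2, by
        obtain ⟨⟨a, ha⟩, ⟨q, hq⟩⟩ := z
        intro h
        have h4 : Nat.Coprime 4 (a ^ 2) :=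
          Nat.Coprime.pow_right 2 (Nat.Coprime.pow_left 2 (Nat.coprime_two_left.mpr ha))
        have h5 : 2 * 2 ∣ q := h4.dvd_of_dvd_mul_left h
        have := hq 2 h5
        norm_num at this⟩ : {n : ℕ // ¬ 4 ∣ n})) := by
  constructor
  · rintro ⟨⟨a, ha⟩, ⟨q, hq⟩⟩ ⟨⟨b, hb⟩, ⟨r, hr⟩⟩ h
    simp only [Subtype.mk.injEq] at h
    have ha0 : a ≠ 0 := by rintro rfl; simp at ha
    have hb0 : b ≠ 0 := by rintro rfl; simp at hb
    have key : ∀ {a b q r : ℕ}, a ≠ 0 → b ≠ 0 → Squarefree q → Squarefree r →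
        a ^ 2 * q = b ^ 2 * r → a ∣ b := by
      intro a b q r ha hb hq hr h
      rw [← Nat.factorization_le_iff_dvd ha hb]
      intro p
      have h1 := congrArg (fun n => n.factorization p) h
      simp only [Nat.factorization_mul (pow_ne_zero 2 ha) hq.ne_zero,
        Nat.factorization_mul (pow_ne_zero 2 hb) hr.ne_zero, Nat.factorization_pow,
        Finsupp.add_apply, Finsupp.smul_apply, smul_eq_mul] at h1
      have h2 := hr.natFactorization_le_one p
      omega
    have hab : a = b := Nat.dvd_antisymm (key ha0 hb0 hq hr h) (key hb0 ha0 hr hq h.symm)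
    subst hab
    have : q = r := Nat.eq_of_mul_eq_mul_left (by positivity) h
    subst this
    rfl
  · rintro ⟨n, hn⟩
    obtain ⟨q, a, hqa, hq⟩ := Nat.sq_mul_squarefree n
    have ha : Odd a := by
      by_contra h
      rw [Nat.not_odd_iff_even] at h
      obtain ⟨c, rfl⟩ := h
      exact hn ⟨c ^ 2 * q, by rw [← hqa]; ring⟩
    exact ⟨(⟨a, ha⟩, ⟨q, hq⟩), Subtype.ext hqa⟩

lemma norm_kroneckerTerm_le (σ : ℤˣ) (N : ℕ) {w : ℂ} (hw : 0 < w.re) (n : ℕ) (hn : n ≠ 0) :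
    ‖kroneckerTerm σ N w n‖ ≤ (n : ℝ) ^ (-w.re) := by
  have h1 := natAbs_le_natAbs_quadDisc (σ * n)
  rw [natAbs_units_mul] at h1
  rw [kroneckerTerm, norm_mul, norm_natCast_cpow_of_pos (by omega), neg_re]
  refine (mul_le_mul_of_nonneg_right (norm_kronecker_le_one _ _) (by positivity)).trans ?_
  rw [one_mul]
  exact Real.rpow_le_rpow_of_nonpos (by positivity) (by exact_mod_cast h1) (by linarith)

lemma summable_norm_kroneckerTerm (σ : ℤˣ) (N : ℕ) {w : ℂ} (hw : 1 < w.re) :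
    Summable fun q : {q : ℕ // Squarefree q} => ‖kroneckerTerm σ N w q‖ := by
  have h1 : Summable fun n : ℕ => (n : ℝ) ^ (-w.re) := Real.summable_nat_rpow.mpr (by linarith)
  have h2 : Summable fun q : {q : ℕ // Squarefree q} => ((q : ℕ) : ℝ) ^ (-w.re) :=
    h1.comp_injective Subtype.val_injective
  exact Summable.of_nonneg_of_le (fun q => norm_nonneg _)
    (fun q => norm_kroneckerTerm_le σ N (by linarith) q q.2.ne_zero) h2

/-- The Dirichlet series of the odd integers prime to `N`. -/
lemma tsum_odd_coprime {N : ℕ} (hN : N ≠ 0) {z : ℂ} (hz : 1 < z.re) :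
    haveI : NeZero (2 * N) := ⟨by omega⟩
    ∑' a : {a : ℕ // Odd a}, (if (a : ℕ).Coprime N then ((a : ℕ) : ℂ) ^ (-z) else 0) =
      DirichletCharacter.LFunctionTrivChar (2 * N) z := by
  have : NeZero (2 * N) := ⟨by omega⟩
  rw [DirichletCharacter.LFunctionTrivChar, DirichletCharacter.LFunction_eq_LSeries _ hz, LSeries]
  rw [show (∑' a : {a : ℕ // Odd a}, (if (a : ℕ).Coprime N then ((a : ℕ) : ℂ) ^ (-z) else 0)) =
    ∑' a : ℕ, {a | Odd a}.indicator
      (fun a => if (a : ℕ).Coprime N then ((a : ℕ) : ℂ) ^ (-z) else 0) a from tsum_subtype {a | Odd a}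
      (fun a : ℕ => if (a : ℕ).Coprime N then ((a : ℕ) : ℂ) ^ (-z) else 0)]
  refine tsum_congr fun a => ?_
  have hco : a.Coprime (2 * N) ↔ Odd a ∧ a.Coprime N := by
    rw [Nat.coprime_mul_iff_right, Nat.coprime_two_right]
  by_cases ha : a.Coprime (2 * N)
  · have ha' := hco.mp ha
    have ha0 : a ≠ 0 := by rintro rfl; simp at ha'
    rw [Set.indicator_of_mem (by exact ha'.1), if_pos ha'.2, LSeries.term_of_ne_zero ha0,
      MulChar.one_apply ((ZMod.isUnit_iff_coprime a (2 * N)).mpr ha), cpow_neg, one_div]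
  · have : LSeries.term (fun n : ℕ => (1 : DirichletCharacter ℂ (2 * N)) (n : ZMod (2 * N))) z a
        = 0 := by
      rcases eq_or_ne a 0 with rfl | ha0
      · simp
      rw [LSeries.term_of_ne_zero ha0, MulChar.map_nonunit _
        (by rwa [ZMod.isUnit_iff_coprime]), zero_div]
    rw [this]
    by_cases h1 : Odd a
    · rw [Set.indicator_of_mem (by exact h1), if_neg fun h => ha (hco.mpr ⟨h1, h⟩)]
    · rw [Set.indicator_of_notMem (by exact h1)]

/-- Sieving for square-free numbers: with `n = a ^ 2 q` the sum over all `n` not divisible by `4`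
factors into a sum over `a` and the sum over square-free `q`. -/
theorem tsum_kroneckerTerm_eq (σ : ℤˣ) {N : ℕ} (hN : N ≠ 0) {w : ℂ} (hw : 1 < w.re) :
    haveI : NeZero (2 * N) := ⟨by omega⟩
    ∑' n : {n : ℕ // ¬ 4 ∣ n}, kroneckerTerm σ N w n =
      DirichletCharacter.LFunctionTrivChar (2 * N) (2 * w) *
        ∑' q : {q : ℕ // Squarefree q}, kroneckerTerm σ N w q := by
  have : NeZero (2 * N) := ⟨by omega⟩
  have hz : 1 < (2 * w).re := by simp; linarith
  rw [← tsum_odd_coprime hN hz, tsum_mul_tsum_of_summable_norm ?_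
    (summable_norm_kroneckerTerm σ N hw)]
  · rw [← (Equiv.ofBijective _ bijective_sq_mul).tsum_eq]
    refine tsum_congr fun z => ?_
    exact kroneckerTerm_sq_mul σ hN w z.1.2 z.2
  · have h1 : Summable fun n : ℕ => (n : ℝ) ^ (-(2 * w).re) :=
      Real.summable_nat_rpow.mpr (by linarith)
    have h2 : Summable fun a : {a : ℕ // Odd a} => ((a : ℕ) : ℝ) ^ (-(2 * w).re) :=
      h1.comp_injective Subtype.val_injective
    refine Summable.of_nonneg_of_le (fun q => norm_nonneg _) (fun a => ?_) h2
    have ha0 : 0 < (a : ℕ) := a.2.pos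
    split_ifs
    · rw [norm_natCast_cpow_of_pos ha0, neg_re]
    · rw [norm_zero]; positivity

/-- The contribution of the prime `2` to the periodic function `e ↦ (e / N)`, `e ≡ 1 (mod 4)`. -/
def twoFactorOne (k : ℕ) (a : ZMod 8) : ℂ := if a = 1 ∨ a = 5 then (ZMod.χ₈ a : ℂ) ^ k else 0

/-- The contribution of the prime `2` to the periodic function `e ↦ (4 e / N)`,
`e ≡ 2, 3 (mod 4)`. -/
def twoFactorFour (k : ℕ) (a : ZMod 8) : ℂ :=
  if a = 2 ∨ a = 3 ∨ a = 6 ∨ a = 7 then (0 : ℂ) ^ k else 0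

lemma sum_zmod_eight (f : ZMod 8 → ℂ) :
    ∑ a, f a = f 0 + f 1 + f 2 + f 3 + f 4 + f 5 + f 6 + f 7 :=
  Fin.sum_univ_eight f

lemma sum_twoFactorOne (k : ℕ) : ∑ a, twoFactorOne k a = 1 + (-1) ^ k := by
  have h5 : ZMod.χ₈ 5 = -1 := by decide
  rw [sum_zmod_eight]
  unfold twoFactorOne
  rw [if_neg (by decide), if_pos (by decide), if_neg (by decide), if_neg (by decide),
    if_neg (by decide), if_pos (by decide), if_neg (by decide), if_neg (by decide), map_one, h5]
  simp

lemma sum_twoFactorFour (k : ℕ) : ∑ a, twoFactorFour k a = 4 * 0 ^ k := by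
  rw [sum_zmod_eight]
  unfold twoFactorFour
  rw [if_neg (by decide), if_neg (by decide), if_pos (by decide), if_pos (by decide),
    if_neg (by decide), if_neg (by decide), if_pos (by decide), if_pos (by decide)]
  ring

/-- The function on `ℤ / 8 n` with values `u (σ a) (σ b / n)`, where `a` and `b` are the components
modulo `8` and modulo `n`. -/
def crtFun (σ : ℤˣ) {n : ℕ} (h : Nat.Coprime 8 n) (u : ZMod 8 → ℂ) (x : ZMod (8 * n)) : ℂ :=
  u (((σ : ℤ) : ZMod 8) * (ZMod.chineseRemainder h x).1) *
    jacobiZMod n (((σ : ℤ) : ZMod n) * (ZMod.chineseRemainder h x).2)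

lemma crtFun_natCast (σ : ℤˣ) {n : ℕ} [NeZero n] (h : Nat.Coprime 8 n) (u : ZMod 8 → ℂ) (e : ℕ) :
    crtFun σ h u (e : ZMod (8 * n)) = u ((σ * e : ℤ) : ZMod 8) * jacobiSym (σ * e) n := by
  rw [crtFun, map_natCast, ← jacobiZMod_intCast]
  simp

lemma sum_units_mul (σ : ℤˣ) {n : ℕ} [NeZero n] (f : ZMod n → ℂ) :
    ∑ a, f (((σ : ℤ) : ZMod n) * a) = ∑ a, f a := by
  rcases Int.units_eq_one_or σ with rfl | rfl
  · simp
  · simpa using Equiv.sum_comp (Equiv.neg (ZMod n)) f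

lemma sum_crtFun (σ : ℤˣ) {n : ℕ} [NeZero n] (h : Nat.Coprime 8 n) (u : ZMod 8 → ℂ) :
    haveI : NeZero (8 * n) := ⟨mul_ne_zero (by norm_num) (NeZero.ne n)⟩
    ∑ x, crtFun σ h u x = (∑ a, u a) * ∑ b, jacobiZMod n b := by
  have : NeZero (8 * n) := ⟨mul_ne_zero (by norm_num) (NeZero.ne n)⟩
  unfold crtFun
  have h1 := (ZMod.chineseRemainder h).toEquiv.sum_comp (fun y : ZMod 8 × ZMod n =>
    u (((σ : ℤ) : ZMod 8) * y.1) * jacobiZMod n (((σ : ℤ) : ZMod n) * y.2))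
  refine h1.trans ?_
  rw [Fintype.sum_prod_type, ← sum_units_mul σ u, ← sum_units_mul σ (jacobiZMod n),
    Finset.sum_mul_sum]

lemma intCast_zmod_eight_eq (e : ℤ) : (e : ZMod 8) = ((e % 8 : ℤ) : ZMod 8) := by
  rw [ZMod.intCast_eq_intCast_iff]
  exact (Int.mod_modEq e 8).symm

lemma emod_eight_cases (e : ℤ) : e % 8 = 0 ∨ e % 8 = 1 ∨ e % 8 = 2 ∨ e % 8 = 3 ∨ e % 8 = 4 ∨
    e % 8 = 5 ∨ e % 8 = 6 ∨ e % 8 = 7 := by omega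

lemma twoFactorOne_intCast (k : ℕ) (e : ℤ) : twoFactorOne k (e : ZMod 8) =
    if e % 4 = 1 then (ZMod.χ₈ (e : ZMod 8) : ℂ) ^ k else 0 := by
  unfold twoFactorOne
  congr 1
  have h4 : e % 4 = e % 8 % 4 := by omega
  rw [intCast_zmod_eight_eq e, eq_iff_iff, h4]
  rcases emod_eight_cases e with h | h | h | h | h | h | h | h <;> rw [h] <;> decide

lemma twoFactorFour_intCast (k : ℕ) (e : ℤ) : twoFactorFour k (e : ZMod 8) =
    if e % 4 = 2 ∨ e % 4 = 3 then (0 : ℂ) ^ k else 0 := by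
  unfold twoFactorFour
  congr 1
  have h4 : e % 4 = e % 8 % 4 := by omega
  rw [intCast_zmod_eight_eq e, eq_iff_iff, h4]
  rcases emod_eight_cases e with h | h | h | h | h | h | h | h <;> rw [h] <;> decide

lemma χ₈_four_mul (a : ZMod 8) : ZMod.χ₈ (4 * a) = 0 := by
  revert a; decide

lemma jacobiSym_four_mul (a : ℤ) {n : ℕ} (hn : Odd n) : jacobiSym (4 * a) n = jacobiSym a n := by
  rw [jacobiSym.mul_left, show (4 : ℤ) = 2 ^ 2 by norm_num, jacobiSym.pow_left, jacobiSym.sq_one,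
    one_mul]
  have : Nat.Coprime 2 n := Nat.coprime_two_left.mpr hn
  exact_mod_cast this

/-- The sum over all `n` not divisible by `4` in terms of two Dirichlet series with periodic
coefficients. -/
theorem tsum_kroneckerTerm_eq_LSeries (σ : ℤˣ) {N k n' : ℕ} (hN : N ≠ 0)
    (hk : k = N.factorization 2) (hn' : n' = N / 2 ^ N.factorization 2) (h8 : Nat.Coprime 8 n')
    {w : ℂ} (hw : 1 < w.re) :
    ∑' n : {n : ℕ // ¬ 4 ∣ n}, kroneckerTerm σ N w n =
      LSeries (fun n => crtFun σ h8 (twoFactorOne k) n) w +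
        4 ^ (-w) * LSeries (fun n => crtFun σ h8 (twoFactorFour k) n) w := by
  have hodd : Odd n' := hn' ▸ odd_ordCompl_two hN
  have hn0 : NeZero n' := ⟨by rintro rfl; simp at hodd⟩
  have : NeZero (8 * n') := ⟨mul_ne_zero (by norm_num) (NeZero.ne n')⟩
  have hs1 : LSeriesSummable (fun n => crtFun σ h8 (twoFactorOne k) n) w :=
    ZMod.LSeriesSummable_of_one_lt_re _ hw
  have hs2 : LSeriesSummable (fun n => crtFun σ h8 (twoFactorFour k) n) w :=
    ZMod.LSeriesSummable_of_one_lt_re _ hw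
  rw [LSeries, LSeries, ← tsum_mul_left, ← hs1.tsum_add (hs2.mul_left _),
    show ∑' n : {n : ℕ // ¬ 4 ∣ n}, kroneckerTerm σ N w n =
      ∑' n, {n : ℕ | ¬ 4 ∣ n}.indicator (kroneckerTerm σ N w) n from tsum_subtype {n | ¬ 4 ∣ n} _]
  refine tsum_congr fun n => ?_
  rcases eq_or_ne n 0 with rfl | hn
  · rw [Set.indicator_of_notMem (by simp)]
    simp
  have hn0' : (n : ℂ) ≠ 0 := by exact_mod_cast hn
  rw [LSeries.term_of_ne_zero hn, LSeries.term_of_ne_zero hn, crtFun_natCast, crtFun_natCast,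
    twoFactorOne_intCast, twoFactorFour_intCast]
  set e : ℤ := σ * n with he
  have hen : e.natAbs = n := natAbs_units_mul σ n
  have h4 : 4 ∣ n ↔ e % 4 = 0 := by omega
  by_cases he0 : e % 4 = 0
  · rw [Set.indicator_of_notMem (by simpa using h4.mpr he0), he0]
    simp
  rw [Set.indicator_of_mem (by simpa using fun h => he0 (h4.mp h)), kroneckerTerm,
    kronecker_of_ne_zero _ hN, ← hn', ← hk, ← he]
  by_cases he1 : e % 4 = 1
  · have hq : quadDisc e = e := by rw [quadDisc, if_pos he1]
    rw [hq, hen, if_pos he1, if_neg (by omega), cpow_neg]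
    push_cast
    ring
  · have hq : quadDisc e = 4 * e := by rw [quadDisc, if_neg he1]
    rw [hq, Int.natAbs_mul, hen, if_neg he1, if_pos (by omega), jacobiSym_four_mul _ hodd]
    push_cast
    rw [χ₈_four_mul, show ((4 : ℂ) * (n : ℂ)) = ((4 : ℕ) : ℂ) * (n : ℂ) by norm_num,
      natCast_mul_natCast_cpow, cpow_neg (n : ℂ)]
    push_cast
    ring

open Classical in
/-- `∏ (1 + 1 / p)⁻¹` over the primes dividing `N`, if `N` is a square, and `0` otherwise. -/
noncomputable def squareWeight (N : ℕ) : ℂ :=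
  if IsSquare N then ∏ p ∈ N.primeFactors, (1 + 1 / (p : ℂ))⁻¹ else 0

lemma isSquare_iff_ordCompl {N : ℕ} (hN : N ≠ 0) :
    IsSquare N ↔ Even (N.factorization 2) ∧ IsSquare (N / 2 ^ N.factorization 2) := by
  constructor
  · rintro ⟨r, rfl⟩
    have hr : r ≠ 0 := by rintro rfl; simp at hN
    refine ⟨?_, ⟨r / 2 ^ r.factorization 2, ?_⟩⟩
    · rw [Nat.factorization_mul hr hr]; simp
    · exact Nat.ordCompl_mul r r 2
  · rintro ⟨h1, h2⟩
    rw [← Nat.ordProj_mul_ordCompl_eq_self N 2]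
    exact (h1.isSquare_pow 2).mul h2

lemma two_notMem_primeFactors_of_odd {n : ℕ} (hn : Odd n) : 2 ∉ n.primeFactors := by
  intro h
  exact (Nat.not_even_iff_odd.mpr hn) (even_iff_two_dvd.mpr (Nat.dvd_of_mem_primeFactors h))

lemma totient_div_eq {n : ℕ} (hn : n ≠ 0) :
    (n.totient : ℂ) / n = ∏ p ∈ n.primeFactors, (1 - 1 / (p : ℂ)) := by
  have h := Nat.totient_eq_mul_prod_factors n
  have h2 : ((n.totient : ℚ) : ℂ) = ((n * ∏ p ∈ n.primeFactors, (1 - (p : ℚ)⁻¹) : ℚ) : ℂ) := by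
    rw [h]
  have hn' : (n : ℂ) ≠ 0 := by exact_mod_cast hn
  push_cast at h2
  rw [h2, mul_div_cancel_left₀ _ hn']
  simp

lemma one_sub_sq_inv (p : ℕ) (hp : p.Prime) : (1 - (p : ℂ) ^ (-(2 : ℂ))) * (1 + 1 / (p : ℂ))⁻¹ =
    1 - 1 / (p : ℂ) := by
  have hp0 : (p : ℂ) ≠ 0 := by exact_mod_cast hp.ne_zero
  have hp1 : (p : ℂ) + 1 ≠ 0 := by exact_mod_cast p.succ_ne_zero
  rw [cpow_neg, show (2 : ℂ) = ((2 : ℕ) : ℂ) by norm_num, cpow_natCast]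
  field_simp
  ring

lemma one_sub_sq_ne_zero (p : ℕ) (hp : p.Prime) : 1 - (p : ℂ) ^ (-(2 : ℂ)) ≠ 0 := by
  intro h
  have h1 := one_sub_sq_inv p hp
  rw [h, zero_mul] at h1
  have hp0 : (p : ℂ) ≠ 0 := by exact_mod_cast hp.ne_zero
  have : (p : ℂ) = 1 := by
    field_simp at h1
    linear_combination -h1
  exact hp.ne_one (by exact_mod_cast this)

/-- The local factors at the primes dividing `2 N` combine to `squareWeight N`. -/
lemma squareWeight_identity {N k n' : ℕ} (hN : N ≠ 0) (hk : k = N.factorization 2)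
    (hn' : n' = N / 2 ^ N.factorization 2) [NeZero n'] :
    ((1 + (-1) ^ k) + 4 * 0 ^ k / 4) * (∑ b, jacobiZMod n' b) / (8 * n') =
      (∏ p ∈ (2 * N).primeFactors, (1 - (p : ℂ) ^ (-(2 : ℂ)))) *
        (1 / 2 * squareWeight N) := by
  classical
  have hodd : Odd n' := hn' ▸ odd_ordCompl_two hN
  have hn0 : n' ≠ 0 := NeZero.ne n'
  have h2n := two_notMem_primeFactors_of_odd hodd
  have hNeq : N = 2 ^ k * n' := by
    rw [hk, hn']; exact (Nat.ordProj_mul_ordCompl_eq_self N 2).symm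
  have h2N : (2 * N).primeFactors = insert 2 n'.primeFactors := by
    rw [hNeq, ← mul_assoc, ← pow_succ', Nat.primeFactors_mul (by positivity) hn0,
      Nat.primeFactors_prime_pow (by omega) Nat.prime_two]
    rfl
  rw [sum_jacobiZMod hodd, h2N, Finset.prod_insert h2n, squareWeight]
  have hsq := isSquare_iff_ordCompl hN
  rw [← hn', ← hk] at hsq
  have h4 : (2 : ℂ) ^ (-(2 : ℂ)) = 1 / 4 := by
    rw [cpow_neg, show ((2 : ℂ) ^ (2 : ℂ)) = (2 : ℂ) ^ ((2 : ℕ) : ℂ) by norm_num, cpow_natCast]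
    norm_num
  by_cases h1 : IsSquare n'
  · rw [if_pos h1]
    have htot := totient_div_eq hn0
    have hprod : (∏ p ∈ n'.primeFactors, (1 - (p : ℂ) ^ (-(2 : ℂ)))) *
        ∏ p ∈ n'.primeFactors, (1 + 1 / (p : ℂ))⁻¹ = (n'.totient : ℂ) / n' := by
      rw [htot, ← Finset.prod_mul_distrib]
      exact Finset.prod_congr rfl fun p hp => one_sub_sq_inv p (Nat.prime_of_mem_primeFactors hp)
    have hn0' : (n' : ℂ) ≠ 0 := by exact_mod_cast hn0
    rcases Nat.even_or_odd k with hk2 | hk2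
    · rw [if_pos (hsq.mpr ⟨hk2, h1⟩), hk2.neg_one_pow]
      rcases Nat.eq_zero_or_pos k with hk0 | hk0
      · have : N.primeFactors = n'.primeFactors := by rw [hNeq, hk0, pow_zero, one_mul]
        rw [this, hk0, pow_zero]
        push_cast
        rw [h4]
        linear_combination (3 / 8 : ℂ) * (- hprod)
      · have : N.primeFactors = insert 2 n'.primeFactors := by
          rw [hNeq, Nat.primeFactors_mul (by positivity) hn0,
            Nat.primeFactors_prime_pow hk0.ne' Nat.prime_two]
          rfl
        rw [this, Finset.prod_insert h2n, zero_pow hk0.ne']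
        push_cast
        rw [h4]
        linear_combination (1 / 4 : ℂ) * (- hprod)
    · rw [if_neg fun h => Nat.not_even_iff_odd.mpr hk2 (hsq.mp h).1, hk2.neg_one_pow,
        zero_pow hk2.pos.ne']
      simp
  · rw [if_neg h1, if_neg fun h => h1 (hsq.mp h).2]
    simp

lemma tendsto_ofReal_nhdsGT_one :
    Tendsto (fun x : ℝ => (x : ℂ)) (𝓝[>] 1) (𝓝[≠] 1) := by
  refine tendsto_nhdsWithin_iff.mpr ⟨?_, ?_⟩
  · exact (continuous_ofReal.tendsto' 1 1 (by simp)).mono_left nhdsWithin_le_nhds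
  · filter_upwards [self_mem_nhdsWithin] with x hx h
    have : x = 1 := by simpa using h
    exact absurd this (ne_of_gt hx)

/-- The mean value of `(D / N)` over the fundamental discriminants `D` of a given sign (and `D =
1`). Both series on the right of `tsum_kroneckerTerm_eq_LSeries` have periodic coefficients, hence
residue at `w = 1` their mean over a period; this vanishes unless `N` is a square. Dividing by the
zeta value at `2` from `tsum_kroneckerTerm_eq` leaves `3 / π ^ 2` and the local factors at the
primes dividing `N`. -/
theorem tendsto_kronecker_mean (σ : ℤˣ) {N : ℕ} (hN : N ≠ 0) :
    Tendsto (fun x : ℝ => ((x : ℂ) - 1) * ∑' q : {q : ℕ // Squarefree q}, kroneckerTerm σ N x q)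
      (𝓝[>] 1) (𝓝 (3 / (Real.pi : ℂ) ^ 2 * squareWeight N)) := by
  obtain ⟨k, hk⟩ : ∃ k, k = N.factorization 2 := ⟨_, rfl⟩
  obtain ⟨n', hn'⟩ : ∃ n', n' = N / 2 ^ N.factorization 2 := ⟨_, rfl⟩
  have hodd : Odd n' := hn' ▸ odd_ordCompl_two hN
  have h8 : Nat.Coprime 8 n' := by
    have : Nat.Coprime (2 ^ 3) n' := Nat.Coprime.pow_left 3 (Nat.coprime_two_left.mpr hodd)
    simpa using this
  have hn0 : NeZero n' := ⟨by rintro rfl; simp at hodd⟩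
  have : NeZero (8 * n') := ⟨mul_ne_zero (by norm_num) (NeZero.ne n')⟩
  have : NeZero (2 * N) := ⟨by omega⟩
  have hres : ∀ Φ : ZMod (8 * n') → ℂ, Tendsto (fun x : ℝ => ((x : ℂ) - 1) * LSeries (fun n => Φ n) x)
      (𝓝[>] 1) (𝓝 (∑ j, Φ j / ((8 * n' : ℕ) : ℂ))) := by
    intro Φ
    refine ((ZMod.LFunction_residue_one Φ).comp tendsto_ofReal_nhdsGT_one).congr' ?_
    filter_upwards [self_mem_nhdsWithin] with x hx
    have hx1 : 1 < (x : ℂ).re := by simpa using hx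
    rw [Function.comp_apply, ZMod.LFunction_eq_LSeries _ hx1]
  have h4 : Tendsto (fun x : ℝ => (4 : ℂ) ^ (-(x : ℂ))) (𝓝[>] 1) (𝓝 (1 / 4)) := by
    have hc : Continuous fun x : ℝ => (4 : ℂ) ^ (-(x : ℂ)) :=
      Continuous.const_cpow (by fun_prop) (Or.inl (by norm_num))
    refine (hc.tendsto' 1 _ ?_).mono_left nhdsWithin_le_nhds
    rw [ofReal_one, cpow_neg_one]; norm_num
  have hL : Tendsto (fun x : ℝ => DirichletCharacter.LFunctionTrivChar (2 * N) (2 * (x : ℂ)))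
      (𝓝[>] 1) (𝓝 (DirichletCharacter.LFunctionTrivChar (2 * N) 2)) := by
    have hc : ContinuousAt (DirichletCharacter.LFunctionTrivChar (2 * N)) 2 :=
      (DirichletCharacter.differentiableAt_LFunction _ 2 (Or.inl (by norm_num))).continuousAt
    have hc2 : Tendsto (fun x : ℝ => 2 * (x : ℂ)) (𝓝[>] 1) (𝓝 2) :=
      ((by fun_prop : Continuous fun x : ℝ => 2 * (x : ℂ)).tendsto' 1 2 (by simp)).mono_left
        nhdsWithin_le_nhds
    exact hc.tendsto.comp hc2
  have hLval : DirichletCharacter.LFunctionTrivChar (2 * N) 2 =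
      (∏ p ∈ (2 * N).primeFactors, (1 - (p : ℂ) ^ (-(2 : ℂ)))) * ((Real.pi : ℂ) ^ 2 / 6) := by
    rw [DirichletCharacter.LFunctionTrivChar_eq_mul_riemannZeta (by norm_num), riemannZeta_two]
  have hpi : (Real.pi : ℂ) ≠ 0 := by exact_mod_cast Real.pi_ne_zero
  have hL0 : DirichletCharacter.LFunctionTrivChar (2 * N) 2 ≠ 0 := by
    rw [hLval]
    refine mul_ne_zero (Finset.prod_ne_zero_iff.mpr fun p hp =>
      one_sub_sq_ne_zero p (Nat.prime_of_mem_primeFactors hp)) ?_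
    exact div_ne_zero (pow_ne_zero 2 hpi) (by norm_num)
  have hlim := (((hres (crtFun σ h8 (twoFactorOne k))).add
    (h4.mul (hres (crtFun σ h8 (twoFactorFour k))))).div hL hL0)
  have hval : (∑ j, crtFun σ h8 (twoFactorOne k) j / ((8 * n' : ℕ) : ℂ) +
      1 / 4 * ∑ j, crtFun σ h8 (twoFactorFour k) j / ((8 * n' : ℕ) : ℂ)) /
      DirichletCharacter.LFunctionTrivChar (2 * N) 2 = 3 / (Real.pi : ℂ) ^ 2 * squareWeight N := by
    rw [div_eq_iff hL0, ← Finset.sum_div, ← Finset.sum_div, sum_crtFun, sum_crtFun,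
      sum_twoFactorOne, sum_twoFactorFour, hLval]
    have := squareWeight_identity hN hk hn'
    have hpp : 3 / (Real.pi : ℂ) ^ 2 * ((Real.pi : ℂ) ^ 2 / 6) = 1 / 2 := by
      field_simp; norm_num
    push_cast
    linear_combination this - (∏ p ∈ (2 * N).primeFactors, (1 - (p : ℂ) ^ (-(2 : ℂ)))) *
      squareWeight N * hpp
  rw [hval] at hlim
  refine hlim.congr' ?_
  have hLne := hL.eventually_ne hL0
  filter_upwards [self_mem_nhdsWithin, hLne] with x hx hx0
  have hx1 : 1 < (x : ℂ).re := by simpa using hx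
  have heq := tsum_kroneckerTerm_eq σ hN hx1
  rw [tsum_kroneckerTerm_eq_LSeries σ hN hk hn' h8 hx1] at heq
  simp only [Pi.div_apply]
  rw [div_eq_iff hx0]
  linear_combination ((x : ℂ) - 1) * heq

end KroneckerMean

/-! ### The residue of the moment series at `w = 1` -/

section Residue

open Complex

/-- The arithmetic function `n ↦ n ^ (-s)`. -/
noncomputable def powFun (s : ℂ) : ArithmeticFunction ℂ :=
  ⟨fun n => if n = 0 then 0 else (n : ℂ) ^ (-s), by simp⟩

lemma powFun_apply (s : ℂ) {n : ℕ} (hn : n ≠ 0) : powFun s n = (n : ℂ) ^ (-s) := by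
  change (if n = 0 then 0 else (n : ℂ) ^ (-s)) = _
  rw [if_neg hn]

lemma powFun_isMultiplicative (s : ℂ) : (powFun s).IsMultiplicative := by
  refine ArithmeticFunction.IsMultiplicative.iff_ne_zero.mpr ⟨by simp [powFun_apply], ?_⟩
  intro a b ha hb _
  rw [powFun_apply _ ha, powFun_apply _ hb, powFun_apply _ (mul_ne_zero ha hb), Nat.cast_mul,
    natCast_mul_natCast_cpow]

/-- The coefficients of `∏ ζ (s_i)`: the Dirichlet convolution of the functions `n ↦ n ^ (-s_i)`. -/
noncomputable def tupleCoeff {ι : Type*} (t : Finset ι) (s : ι → ℂ) : ArithmeticFunction ℂ :=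
  ∏ i ∈ t, powFun (s i)

lemma tupleCoeff_isMultiplicative {ι : Type*} (t : Finset ι) (s : ι → ℂ) :
    (tupleCoeff t s).IsMultiplicative := by
  classical
  unfold tupleCoeff
  induction t using Finset.induction_on with
  | empty => simp
  | insert a t ha ih =>
    rw [Finset.prod_insert ha]
    exact (powFun_isMultiplicative _).mul ih

/-- Pointwise multiplication of an arithmetic function by `ψ`. -/
def twist (ψ : ℕ → ℂ) (f : ArithmeticFunction ℂ) : ArithmeticFunction ℂ :=
  ⟨fun n => ψ n * f n, by simp⟩

lemma twist_apply (ψ : ℕ → ℂ) (f : ArithmeticFunction ℂ) (n : ℕ) : twist ψ f n = ψ n * f n := rfl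

lemma twist_mul {ψ : ℕ → ℂ} (hψ : ∀ a b, ψ (a * b) = ψ a * ψ b) (f g : ArithmeticFunction ℂ) :
    twist ψ (f * g) = twist ψ f * twist ψ g := by
  ext n
  rw [twist_apply, ArithmeticFunction.mul_apply, ArithmeticFunction.mul_apply, Finset.mul_sum]
  refine Finset.sum_congr rfl fun x hx => ?_
  rw [← (Nat.mem_divisorsAntidiagonal.mp hx).1, hψ, twist_apply, twist_apply]
  ring

lemma term_zero_eq (f : ArithmeticFunction ℂ) : LSeries.term (fun n => f n) 0 = fun n => f n := by
  ext n
  rcases eq_or_ne n 0 with rfl | hn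
  · simp
  · simp [LSeries.term_of_ne_zero hn]

/-- A product of Dirichlet series twisted by a completely multiplicative function. -/
theorem hasSum_twist_tupleCoeff {ι : Type*} (t : Finset ι) {s : ι → ℂ} (hs : ∀ i, 1 < (s i).re)
    {ψ : ℕ → ℂ} (h1 : ψ 1 = 1) (hψ : ∀ a b, ψ (a * b) = ψ a * ψ b) (hb : ∀ n, ‖ψ n‖ ≤ 1) :
    Summable (fun n => ψ n * tupleCoeff t s n) ∧
      ∑' n, ψ n * tupleCoeff t s n = ∏ i ∈ t, ∑' n, ψ n * powFun (s i) n := by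
  classical
  have hpow : ∀ i, Summable (fun n => twist ψ (powFun (s i)) n) := by
    intro i
    refine Summable.of_norm_bounded (Real.summable_nat_rpow.mpr
      (by linarith [hs i] : -(s i).re < -1)) fun n => ?_
    rw [twist_apply, norm_mul]
    rcases eq_or_ne n 0 with rfl | hn
    · simp; positivity
    · rw [powFun_apply _ hn, norm_natCast_cpow_of_pos (Nat.pos_of_ne_zero hn), neg_re]
      exact mul_le_of_le_one_left (by positivity) (hb n)
  suffices h : Summable (fun n => twist ψ (tupleCoeff t s) n) ∧
      ∑' n, twist ψ (tupleCoeff t s) n = ∏ i ∈ t, ∑' n, twist ψ (powFun (s i)) n from h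
  induction t using Finset.induction_on with
  | empty =>
    have h0 : twist ψ (tupleCoeff (∅ : Finset ι) s) = 1 := by
      ext n
      rw [twist_apply, tupleCoeff, Finset.prod_empty, ArithmeticFunction.one_apply]
      split_ifs with hn
      · rw [hn, h1, one_mul]
      · rw [mul_zero]
    rw [h0, Finset.prod_empty]
    have h2 : ∀ n, n ≠ 1 → (1 : ArithmeticFunction ℂ) n = 0 :=
      fun n hn => ArithmeticFunction.one_apply_ne hn
    exact ⟨(hasSum_single 1 h2).summable, by rw [tsum_eq_single 1 h2]; simp⟩
  | insert a t ha ih =>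
    have e : twist ψ (tupleCoeff (insert a t) s) =
        twist ψ (powFun (s a)) * twist ψ (tupleCoeff t s) := by
      rw [tupleCoeff, Finset.prod_insert ha, twist_mul hψ]; rfl
    have hf : LSeriesSummable (fun n => twist ψ (powFun (s a)) n) 0 := by
      rw [LSeriesSummable, term_zero_eq]; exact hpow a
    have hg : LSeriesSummable (fun n => twist ψ (tupleCoeff t s) n) 0 := by
      rw [LSeriesSummable, term_zero_eq]; exact ih.1
    have hfg := ArithmeticFunction.LSeries_mul' hf hg
    have hsum := ArithmeticFunction.LSeriesSummable_mul hf hg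
    rw [LSeriesSummable, term_zero_eq] at hsum
    rw [LSeries, LSeries, LSeries, term_zero_eq, term_zero_eq, term_zero_eq] at hfg
    rw [e, Finset.prod_insert ha, hfg, ih.2]
    exact ⟨hsum, rfl⟩

lemma summable_norm_tupleCoeff {m : ℕ} {s : Fin m → ℂ} (hs : ∀ i, 1 < (s i).re) :
    Summable fun n => ‖tupleCoeff Finset.univ s n‖ := by
  have := (hasSum_twist_tupleCoeff Finset.univ hs (ψ := fun _ => 1) rfl (by simp) (by simp)).1
  simpa using this.norm

lemma kronecker_quadDisc_mul {d : ℤ} (hd : Squarefree d) (a b : ℕ) :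
    (kronecker (quadDisc d) (a * b) : ℂ) = kronecker (quadDisc d) a * kronecker (quadDisc d) b := by
  obtain ⟨f, hf, hfk, -⟩ := exists_isSelfDual_kronecker hd
  rw [← hfk, ← hfk, ← hfk]
  push_cast
  exact hf.mul a b

lemma kronecker_one_right (D : ℤ) : kronecker D 1 = 1 := by
  rw [kronecker_of_ne_zero _ one_ne_zero]; simp

lemma prod_quadL_eq {m : ℕ} {s : Fin m → ℂ} (hs : ∀ i, 1 < (s i).re) {d : ℤ} (hd : Squarefree d) :
    ∏ i, quadL (quadDisc d) (s i) =
      ∑' N, (kronecker (quadDisc d) N : ℂ) * tupleCoeff Finset.univ s N := by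
  rw [(hasSum_twist_tupleCoeff Finset.univ hs (ψ := fun N => (kronecker (quadDisc d) N : ℂ))
    (by simp [kronecker_one_right]) (kronecker_quadDisc_mul hd)
    (fun n => norm_kronecker_le_one _ n)).2]
  refine Finset.prod_congr rfl fun i _ => ?_
  rw [quadL_eq_LSeries hd (hs i), LSeries]
  refine tsum_congr fun n => ?_
  rcases eq_or_ne n 0 with rfl | hn
  · simp
  · rw [LSeries.term_of_ne_zero hn, powFun_apply _ hn, cpow_neg, div_eq_mul_inv]

lemma squarefree_units_mul (σ : ℤˣ) {q : ℕ} (hq : Squarefree q) : Squarefree ((σ : ℤ) * q) := by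
  rw [← Int.squarefree_natAbs, natAbs_units_mul]; exact hq

/-- Square-free integers of sign `σ` are `σ q` with `q` a square-free natural number. -/
def sqfreeSignedEquiv (σ : ℤˣ) : {q : ℕ // Squarefree q} ≃ SqfreeSigned σ where
  toFun q := ⟨σ * q, squarefree_units_mul σ q.2, by
    rw [← mul_assoc, Int.units_coe_mul_self, one_mul]
    exact_mod_cast Nat.pos_of_ne_zero q.2.ne_zero⟩
  invFun d := ⟨(d : ℤ).natAbs, Int.squarefree_natAbs.mpr d.2.1⟩
  left_inv q := Subtype.ext (natAbs_units_mul σ q)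
  right_inv := by
    rintro ⟨d, hd, h⟩
    refine Subtype.ext ?_
    change (σ : ℤ) * (d.natAbs : ℤ) = d
    rcases Int.units_eq_one_or σ with rfl | rfl
    · simp at h ⊢; omega
    · rw [Units.val_neg, Units.val_one] at h ⊢; omega

/-- The moment series, summed over the discriminants first. -/
theorem momentSeries_eq_tsum_tupleCoeff {m : ℕ} (σ : ℤˣ) {s : Fin m → ℂ} (hs : ∀ i, 1 < (s i).re)
    {w : ℂ} (hw : 1 < w.re) :
    momentSeries σ s w = ∑' N, tupleCoeff Finset.univ s N *
      ∑' q : {q : ℕ // Squarefree q}, kroneckerTerm σ N w q := by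
  set T : ℕ → {q : ℕ // Squarefree q} → ℂ :=
    fun N q => tupleCoeff Finset.univ s N * kroneckerTerm σ N w q with hT
  have hsumT : Summable (Function.uncurry T) := by
    have h1 : Summable fun q : {q : ℕ // Squarefree q} => ((q : ℕ) : ℝ) ^ (-w.re) :=
      (Real.summable_nat_rpow.mpr (by linarith)).comp_injective Subtype.val_injective
    have h2 := (summable_norm_tupleCoeff hs).mul_of_nonneg h1 (fun _ => norm_nonneg _)
      (fun _ => by positivity)
    refine Summable.of_norm_bounded h2 fun x => ?_
    obtain ⟨N, q⟩ := x
    simp only [Function.uncurry, hT, norm_mul]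
    exact mul_le_mul_of_nonneg_left (norm_kroneckerTerm_le σ N (by linarith) q q.2.ne_zero)
      (norm_nonneg _)
  have hterm : ∀ q : {q : ℕ // Squarefree q},
      momentTerm s w (sqfreeSignedEquiv σ q : ℤ) = ∑' N, T N q := by
    intro q
    change momentTerm s w (σ * (q : ℕ)) = _
    rw [momentTerm, prod_quadL_eq hs (squarefree_units_mul σ q.2), div_eq_mul_inv, ← tsum_mul_right]
    refine tsum_congr fun N => ?_
    simp only [hT, kroneckerTerm, cpow_neg]
    ring
  have hsum2 : Summable fun q => ∑' N, T N q := by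
    have := hsumT.prod_symm
    exact this.prod
  have hsum3 : Summable fun d : SqfreeSigned σ => momentTerm s w d := by
    rw [← (sqfreeSignedEquiv σ).summable_iff]
    exact hsum2.congr fun q => (hterm q).symm
  rw [momentSeries_eq_tsum σ s w hsum3, ← (sqfreeSignedEquiv σ).tsum_eq, tsum_congr hterm]
  have hcomm : ∑' q, ∑' N, T N q = ∑' N, ∑' q, T N q := Summable.tsum_comm hsumT
  rw [hcomm]
  exact tsum_congr fun N => tsum_mul_left

/-- This dominates the mean values of `(D / N)` uniformly in `N`. -/
lemma eventually_tsum_rpow_le :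
    ∀ᶠ x : ℝ in 𝓝[>] 1, (x - 1) * ∑' n : ℕ, (n : ℝ) ^ (-x) ≤ 2 := by
  have h := (riemannZeta_residue_one.comp tendsto_ofReal_nhdsGT_one).norm
  have h2 := h.eventually_le_const (u := 2) (by norm_num)
  filter_upwards [h2, self_mem_nhdsWithin] with x hx hx1
  have hx1' : 1 < x := hx1
  have hz : riemannZeta x = ((∑' n : ℕ, (n : ℝ) ^ (-x) : ℝ) : ℂ) := by
    rw [zeta_eq_tsum_one_div_nat_cpow (by simpa using hx1'), ofReal_tsum]
    refine tsum_congr fun n => ?_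
    rw [ofReal_cpow (by positivity), one_div, ← cpow_neg]
    push_cast; rfl
  rw [Function.comp_apply, hz, ← ofReal_one, ← ofReal_sub, ← ofReal_mul, norm_real] at hx
  exact (le_abs_self _).trans hx

/-- The residue of the moment series at `w = 1`, for `s_i` in the region of absolute
convergence. -/
theorem tendsto_momentSeries_residue {m : ℕ} (σ : ℤˣ) {s : Fin m → ℂ} (hs : ∀ i, 1 < (s i).re) :
    Tendsto (fun x : ℝ => ((x : ℂ) - 1) * momentSeries σ s x) (𝓝[>] 1)
      (𝓝 (3 / (Real.pi : ℂ) ^ 2 * ∑' N, tupleCoeff Finset.univ s N * squareWeight N)) := by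
  have h1 : Tendsto (fun x : ℝ => ∑' N, tupleCoeff Finset.univ s N *
      (((x : ℂ) - 1) * ∑' q : {q : ℕ // Squarefree q}, kroneckerTerm σ N x q)) (𝓝[>] 1)
      (𝓝 (∑' N, tupleCoeff Finset.univ s N * (3 / (Real.pi : ℂ) ^ 2 * squareWeight N))) := by
    refine tendsto_tsum_of_dominated_convergence
      (bound := fun N => ‖tupleCoeff Finset.univ s N‖ * 2) ((summable_norm_tupleCoeff hs).mul_right 2)
      (fun N => ?_) ?_
    · rcases eq_or_ne N 0 with rfl | hN
      · simp
      · exact (tendsto_kronecker_mean σ hN).const_mul _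
    · filter_upwards [eventually_tsum_rpow_le, self_mem_nhdsWithin] with x hx hx1 N
      have hx1' : 1 < x := hx1
      have hxr : 1 < (x : ℂ).re := by simpa using hx1'
      rw [norm_mul]
      refine mul_le_mul_of_nonneg_left ?_ (norm_nonneg _)
      rw [norm_mul, ← ofReal_one, ← ofReal_sub, norm_real, Real.norm_of_nonneg (by linarith)]
      refine le_trans (mul_le_mul_of_nonneg_left ?_ (by linarith)) hx
      have hs1 : Summable fun n : ℕ => (n : ℝ) ^ (-x) := Real.summable_nat_rpow.mpr (by linarith)
      have hs2 : Summable fun q : {q : ℕ // Squarefree q} => ((q : ℕ) : ℝ) ^ (-x) :=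
        hs1.comp_injective Subtype.val_injective
      refine (norm_tsum_le_tsum_norm (summable_norm_kroneckerTerm σ N hxr)).trans ?_
      refine ((summable_norm_kroneckerTerm σ N hxr).tsum_le_tsum (fun q => ?_) hs2).trans
        (hs1.tsum_subtype_le _ {q | Squarefree q} (fun n => by positivity))
      simpa using norm_kroneckerTerm_le σ N (by linarith : 0 < (x : ℂ).re) q q.2.ne_zero
  have h2 : ∑' N, tupleCoeff Finset.univ s N * (3 / (Real.pi : ℂ) ^ 2 * squareWeight N) =
      3 / (Real.pi : ℂ) ^ 2 * ∑' N, tupleCoeff Finset.univ s N * squareWeight N := by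
    rw [← tsum_mul_left]
    exact tsum_congr fun N => by ring
  rw [h2] at h1
  refine h1.congr' ?_
  filter_upwards [self_mem_nhdsWithin] with x hx1
  have hxr : 1 < (x : ℂ).re := by simpa using hx1
  rw [momentSeries_eq_tsum_tupleCoeff σ hs hxr, ← tsum_mul_left]
  exact tsum_congr fun N => by ring

end Residue

/-! ### The Euler product of the residue -/

section LocalFactor

/-- The local factor of the arithmetic part of the residue, for the Satake-type parameters `x i`
and `t = 1 / p`, after removal of the local factors of the zeta functions. -/
noncomputable def eulerLocal {m : ℕ} (t : ℂ) (x : Fin m → ℂ) : ℂ :=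
  (1 + t)⁻¹ * ((∏ i, (1 + x i) + ∏ i, (1 - x i)) / 2 * (∏ i, ∏ j ∈ Finset.Ioi i, (1 - x i * x j)) +
    t * ∏ i, ∏ j ∈ Finset.Ici i, (1 - x i * x j))

variable {α : Type*} {l : Filter α} {r : α → ℝ}

lemma isBigO_pow_of_le (hr : r =O[l] fun _ => (1 : ℝ)) {a b : ℕ} (h : b ≤ a) :
    (fun z => r z ^ a) =O[l] fun z => r z ^ b := by
  obtain ⟨c, rfl⟩ := Nat.exists_eq_add_of_le h
  have h1 : (fun z => r z ^ c) =O[l] fun _ => (1 : ℝ) := by simpa using hr.pow c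
  have h2 := (isBigO_refl (fun z => r z ^ b) l).mul h1
  simpa [pow_add] using h2

lemma isBigO_mul_pow {f g : α → ℂ} {a b : ℕ} (hf : f =O[l] fun z => r z ^ a)
    (hg : g =O[l] fun z => r z ^ b) : (fun z => f z * g z) =O[l] fun z => r z ^ (a + b) := by
  simpa only [pow_add] using hf.mul hg

lemma isBigO_const_pow_zero (c : ℂ) : (fun _ : α => c) =O[l] fun z => r z ^ 0 := by
  simpa using isBigO_const_const c (one_ne_zero (α := ℝ)) l

lemma isBigO_sum {m : ℕ} {y : Fin m → α → ℂ} {a : ℕ} (hy : ∀ i, y i =O[l] fun z => r z ^ a) :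
    (fun z => ∑ i, y i z) =O[l] fun z => r z ^ a :=
  IsBigO.fun_sum fun i _ => hy i

/-- `∏ (1 - y i) = 1 - ∑ y i + O(ρ ^ 2)`. -/
lemma isBigO_prod_one_sub (hr : r =O[l] fun _ => (1 : ℝ)) {m a : ℕ} {y : Fin m → α → ℂ}
    (hy : ∀ i, y i =O[l] fun z => r z ^ a) :
    (fun z => ∏ i, (1 - y i z) - 1 + ∑ i, y i z) =O[l] fun z => r z ^ (a + a) := by
  induction m with
  | zero => simpa using isBigO_zero _ _
  | succ m ih =>
    have h1 := ih (y := fun i => y i.succ) (fun i => hy i.succ)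
    have h2 : (fun z => ∑ i : Fin m, y i.succ z) =O[l] fun z => r z ^ a :=
      isBigO_sum fun i => hy i.succ
    have h3 : (fun z => 1 - y 0 z) =O[l] fun z => r z ^ 0 :=
      (isBigO_const_pow_zero 1).sub ((hy 0).trans (isBigO_pow_of_le hr (Nat.zero_le a)))
    have h4 := (isBigO_mul_pow h3 h1).add ((isBigO_mul_pow (hy 0) h2).trans
      (by simpa using isBigO_refl _ l : (fun z => r z ^ (a + a)) =O[l] fun z => r z ^ (0 + (a + a))))
    simp only [zero_add] at h4
    refine h4.congr_left fun z => ?_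
    rw [Fin.prod_univ_succ, Fin.sum_univ_succ]
    ring

/-- Expansion to fourth order of the symmetric functions in the local factor; `e` is the second
elementary symmetric function. -/
lemma exists_isBigO_symmetric (hr : r =O[l] fun _ => (1 : ℝ)) {m : ℕ} {x : Fin m → α → ℂ}
    (hx : ∀ i, x i =O[l] fun z => r z ^ 1) :
    ∃ e : α → ℂ, e =O[l] (fun z => r z ^ 2) ∧
      (fun z => (∏ i, (1 + x i z) + ∏ i, (1 - x i z)) / 2 - 1 - e z) =O[l] (fun z => r z ^ 4) ∧
      (fun z => (∏ i, (1 + x i z) - ∏ i, (1 - x i z)) / 2 - ∑ i, x i z) =O[l] (fun z => r z ^ 3) ∧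
      (fun z => (∏ i, ∏ j ∈ Finset.Ioi i, (1 - x i z * x j z)) - 1 + e z) =O[l]
        fun z => r z ^ 4 := by
  induction m with
  | zero => exact ⟨fun _ => 0, isBigO_zero _ _, by simpa using isBigO_zero _ _,
      by simpa using isBigO_zero _ _, by simpa using isBigO_zero _ _⟩
  | succ m ih =>
    obtain ⟨e, he, hS, hT, hP⟩ := ih (x := fun i => x i.succ) (fun i => hx i.succ)
    have he1 : (fun z => ∑ i : Fin m, x i.succ z) =O[l] fun z => r z ^ 1 :=
      isBigO_sum fun i => hx i.succ
    have h42 := isBigO_pow_of_le hr (show 2 ≤ 4 by norm_num)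
    have h20 := isBigO_pow_of_le hr (show 0 ≤ 2 by norm_num)
    have h40 := isBigO_pow_of_le hr (show 0 ≤ 4 by norm_num)
    refine ⟨fun z => e z + x 0 z * ∑ i : Fin m, x i.succ z, he.add (isBigO_mul_pow (hx 0) he1),
      ?_, ?_, ?_⟩
    · refine (hS.add (isBigO_mul_pow (hx 0) hT)).congr_left fun z => ?_
      rw [Fin.prod_univ_succ, Fin.prod_univ_succ]
      ring
    · have hS2 := (hS.trans h42).add he
      refine (hT.add (isBigO_mul_pow (hx 0) hS2)).congr_left fun z => ?_
      rw [Fin.prod_univ_succ, Fin.prod_univ_succ, Fin.sum_univ_succ]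
      ring
    · have hy : ∀ i : Fin m, (fun z => x 0 z * x i.succ z) =O[l] fun z => r z ^ 2 :=
        fun i => isBigO_mul_pow (hx 0) (hx i.succ)
      have hB := isBigO_prod_one_sub hr hy
      have hsum := isBigO_sum hy
      have h1 : (fun z => 1 - e z) =O[l] fun z => r z ^ 0 :=
        (isBigO_const_pow_zero 1).sub (he.trans h20)
      have hP0 : (fun z => ∏ i : Fin m, (1 - x 0 z * x i.succ z)) =O[l] fun z => r z ^ 0 := by
        refine (((hB.trans h40).add (isBigO_const_pow_zero 1)).sub
          (hsum.trans h20)).congr_left fun z => ?_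
        ring
      have h5 := ((isBigO_mul_pow (a := 4) (b := 0) hP hP0).add (isBigO_mul_pow (a := 0) (b := 4) h1 hB)).add
        (isBigO_mul_pow (a := 2) (b := 2) he hsum)
      refine h5.congr_left fun z => ?_
      rw [Fin.prod_univ_succ, Fin.prod_Ioi_zero]
      simp only [Fin.prod_Ioi_succ]
      rw [← Finset.mul_sum]
      ring

/-- The local factors are `1 + O(r ^ 4 + t r ^ 2)` where `r` bounds the parameters. -/
theorem isBigO_eulerLocal (hr : r =O[l] fun _ => (1 : ℝ)) {m : ℕ} {x : Fin m → α → ℂ}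
    (hx : ∀ i, x i =O[l] fun z => r z ^ 1) {t : α → ℂ} (ht : t =O[l] fun z => r z ^ 2)
    (ht1 : (fun z => (1 + t z)⁻¹) =O[l] fun _ => (1 : ℝ)) (ht2 : ∀ z, 1 + t z ≠ 0) :
    (fun z => eulerLocal (t z) (fun i => x i z) - 1) =O[l] fun z => r z ^ 4 := by
  obtain ⟨e, he, hS, -, hP⟩ := exists_isBigO_symmetric hr hx
  have h20 := isBigO_pow_of_le hr (show 0 ≤ 2 by norm_num)
  have h40 := isBigO_pow_of_le hr (show 0 ≤ 4 by norm_num)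
  have h42 := isBigO_pow_of_le hr (show 2 ≤ 4 by norm_num)
  have h1e : (fun z => 1 + e z) =O[l] fun z => r z ^ 0 :=
    (isBigO_const_pow_zero 1).add (he.trans h20)
  have hP0 : (fun z => ∏ i, ∏ j ∈ Finset.Ioi i, (1 - x i z * x j z)) =O[l] fun z => r z ^ 0 := by
    refine (((hP.trans h40).add (isBigO_const_pow_zero 1)).sub (he.trans h20)).congr_left
      fun z => ?_
    ring
  have hQ := ((isBigO_mul_pow (a := 0) (b := 4) h1e hP).add (isBigO_mul_pow (a := 4) (b := 0) hS hP0)).sub (isBigO_mul_pow (a := 2) (b := 2) he he)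
  have hy : ∀ i, (fun z => x i z * x i z) =O[l] fun z => r z ^ 2 :=
    fun i => isBigO_mul_pow (hx i) (hx i)
  have hD : (fun z => ∏ i, (1 - x i z * x i z) - 1) =O[l] fun z => r z ^ 2 := by
    refine (((isBigO_prod_one_sub hr hy).trans (isBigO_pow_of_le hr (by norm_num))).sub
      (isBigO_sum hy)).congr_left fun z => ?_
    ring
  have hP2 : (fun z => (∏ i, ∏ j ∈ Finset.Ioi i, (1 - x i z * x j z)) - 1) =O[l]
      fun z => r z ^ 2 := by
    refine ((hP.trans h42).sub he).congr_left fun z => ?_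
    ring
  have hPi := (isBigO_mul_pow (a := 2) (b := 0) hD hP0).add hP2
  have htPi := isBigO_mul_pow (a := 2) (b := 2) ht hPi
  have hinv : (fun z => (1 + t z)⁻¹) =O[l] fun z => r z ^ 0 := by simpa using ht1
  have h5 := isBigO_mul_pow (a := 0) (b := 4) hinv (hQ.add htPi)
  refine h5.congr_left fun z => ?_
  have h6 : ∏ i, ∏ j ∈ Finset.Ici i, (1 - x i z * x j z) =
      (∏ i, (1 - x i z * x i z)) * ∏ i, ∏ j ∈ Finset.Ioi i, (1 - x i z * x j z) := by
    rw [← Finset.prod_mul_distrib]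
    exact Finset.prod_congr rfl fun i _ => (Finset.mul_prod_Ioi_eq_prod_Ici _).symm
  rw [eulerLocal, h6]
  have h7 := ht2 z
  field_simp
  ring

end LocalFactor

section EulerProduct

open Complex

/-- The parameters `p ^ (-s_i)`. -/
noncomputable def primeParam {m : ℕ} (s : Fin m → ℂ) (p : ℕ) (i : Fin m) : ℂ := (p : ℂ) ^ (-(s i))

/-- The arithmetic part of the residue, an Euler product converging for `Re s_i > 3 / 8`. -/
noncomputable def eulerProd {m : ℕ} (s : Fin m → ℂ) : ℂ :=
  ∏' p : Nat.Primes, eulerLocal (1 / (p : ℂ)) (primeParam s p)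

lemma norm_primeParam {m : ℕ} (s : Fin m → ℂ) {p : ℕ} (hp : 0 < p) (i : Fin m) :
    ‖primeParam s p i‖ = (p : ℝ) ^ (-(s i).re) := by
  rw [primeParam, norm_natCast_cpow_of_pos hp, neg_re]

lemma one_add_one_div_ne_zero (p : ℕ) : 1 + 1 / (p : ℂ) ≠ 0 := by
  rcases eq_or_ne p 0 with rfl | hp
  · simp
  have hp0 : (p : ℂ) ≠ 0 := by exact_mod_cast hp
  have hp1 : (p : ℂ) + 1 ≠ 0 := by exact_mod_cast p.succ_ne_zero
  have h : 1 + 1 / (p : ℂ) = (p + 1) / p := by field_simp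
  rw [h]
  exact div_ne_zero hp1 hp0

lemma norm_one_add_one_div_inv_le (p : ℕ) : ‖(1 + 1 / (p : ℂ))⁻¹‖ ≤ 1 := by
  have h : (1 + 1 / (p : ℂ)) = ((1 + 1 / (p : ℝ) : ℝ) : ℂ) := by push_cast; rfl
  have h0 : (0 : ℝ) ≤ 1 / (p : ℝ) := by positivity
  rw [h, norm_inv, norm_real, Real.norm_of_nonneg (by linarith)]
  exact inv_le_one_of_one_le₀ (by linarith)

/-- For `Re s_i ≥ 3 / 8` the parameters are at most `r = p ^ (-3 / 8)` and `1 / p ≤ r ^ 2`, so that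
the local factor is `1 + O(r ^ 4)`, and `r ^ 4 = p ^ (-3 / 2)` is summable over the primes. -/
theorem exists_norm_eulerLocal_sub_one_le (m : ℕ) : ∃ C : ℝ, ∀ (p : Nat.Primes) (s : Fin m → ℂ),
    (∀ i, 3 / 8 ≤ (s i).re) →
      ‖eulerLocal (1 / (p : ℂ)) (primeParam s p) - 1‖ ≤ C * (p : ℝ) ^ (-(3 / 2 : ℝ)) := by
  set α := Nat.Primes × {s : Fin m → ℂ // ∀ i, 3 / 8 ≤ (s i).re}
  set r : α → ℝ := fun z => (z.1 : ℝ) ^ (-(3 / 8 : ℝ)) with hrdef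
  have hp1 : ∀ z : α, (1 : ℝ) ≤ (z.1 : ℝ) := fun z => by exact_mod_cast z.1.2.one_lt.le
  have hr0 : ∀ z, 0 ≤ r z := fun z => by positivity
  have hr : r =O[⊤] fun _ => (1 : ℝ) := by
    refine IsBigO.of_bound 1 (Eventually.of_forall fun z => ?_)
    rw [Real.norm_of_nonneg (hr0 z), norm_one, mul_one]
    exact Real.rpow_le_one_of_one_le_of_nonpos (hp1 z) (by norm_num)
  have hx : ∀ i : Fin m, (fun z : α => primeParam z.2.1 z.1 i) =O[⊤] fun z => r z ^ 1 := by
    intro i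
    refine IsBigO.of_bound 1 (Eventually.of_forall fun z => ?_)
    rw [norm_primeParam _ z.1.2.pos, one_mul, pow_one, Real.norm_of_nonneg (hr0 z)]
    exact Real.rpow_le_rpow_of_exponent_le (hp1 z) (by linarith [z.2.2 i])
  have ht : (fun z : α => 1 / ((z.1 : ℕ) : ℂ)) =O[⊤] fun z => r z ^ 2 := by
    refine IsBigO.of_bound 1 (Eventually.of_forall fun z => ?_)
    rw [norm_div, norm_one, norm_natCast, one_mul, Real.norm_of_nonneg (by positivity), hrdef]
    simp only []
    rw [← Real.rpow_natCast, ← Real.rpow_mul (by positivity), one_div, ← Real.rpow_neg_one]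
    exact Real.rpow_le_rpow_of_exponent_le (hp1 z) (by norm_num)
  have ht1 : (fun z : α => (1 + 1 / ((z.1 : ℕ) : ℂ))⁻¹) =O[⊤] fun _ => (1 : ℝ) := by
    refine IsBigO.of_bound 1 (Eventually.of_forall fun z => ?_)
    rw [norm_one, mul_one]
    exact norm_one_add_one_div_inv_le _
  obtain ⟨C, hC⟩ := isBigO_top.mp
    (isBigO_eulerLocal hr hx ht ht1 fun z => one_add_one_div_ne_zero _)
  refine ⟨C, fun p s hs => ?_⟩
  have h := hC (p, ⟨s, hs⟩)
  rw [Real.norm_of_nonneg (pow_nonneg (hr0 _) 4), hrdef] at h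
  simp only [] at h
  rw [← Real.rpow_natCast, ← Real.rpow_mul (by positivity)] at h
  norm_num at h ⊢
  exact h

lemma summable_norm_eulerLocal_sub_one {m : ℕ} {s : Fin m → ℂ} (hs : ∀ i, 3 / 8 ≤ (s i).re) :
    Summable fun p : Nat.Primes => ‖eulerLocal (1 / (p : ℂ)) (primeParam s p) - 1‖ := by
  obtain ⟨C, hC⟩ := exists_norm_eulerLocal_sub_one_le m
  exact Summable.of_nonneg_of_le (fun _ => norm_nonneg _) (fun p => hC p s hs)
    ((Nat.Primes.summable_rpow.mpr (by norm_num)).mul_left C)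

lemma multipliable_eulerLocal {m : ℕ} {s : Fin m → ℂ} (hs : ∀ i, 3 / 8 ≤ (s i).re) :
    Multipliable fun p : Nat.Primes => eulerLocal (1 / (p : ℂ)) (primeParam s p) := by
  simpa using multipliable_one_add_of_summable (summable_norm_eulerLocal_sub_one hs)

lemma isOpen_re_gt {m : ℕ} (c : ℝ) : IsOpen {s : Fin m → ℂ | ∀ i, c < (s i).re} := by
  rw [Set.ofPred_forall]
  exact isOpen_iInter_of_finite fun i => isOpen_lt continuous_const (by fun_prop)

lemma differentiable_eulerLocal {m : ℕ} (p : Nat.Primes) :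
    Differentiable ℂ fun s : Fin m → ℂ => eulerLocal (1 / (p : ℂ)) (primeParam s p) := by
  intro s
  have hp0 : ((p : ℕ) : ℂ) ≠ 0 := by exact_mod_cast p.2.ne_zero
  have hx : ∀ i, DifferentiableAt ℂ (fun s : Fin m → ℂ => primeParam s p i) s := by
    intro i
    have h1 : DifferentiableAt ℂ (fun s : Fin m → ℂ => -(s i)) s := by fun_prop
    exact h1.const_cpow (Or.inl hp0)
  have h1 := differentiableAt_finsetProd Finset.univ fun i _ => (hx i).const_add 1
  have h2 := differentiableAt_finsetProd Finset.univ fun i _ => (hx i).const_sub 1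
  have h3 : ∀ T : Fin m → Finset (Fin m), DifferentiableAt ℂ (fun s : Fin m → ℂ =>
      ∏ i, ∏ j ∈ T i, (1 - primeParam s p i * primeParam s p j)) s := fun T =>
    differentiableAt_finsetProd Finset.univ fun i _ => differentiableAt_finsetProd (T i)
      fun j _ => ((hx i).fun_mul (hx j)).const_sub 1
  simp only [eulerLocal, div_eq_mul_inv _ (2 : ℂ)]
  have h4 := ((h1.fun_add h2).mul_const (2 : ℂ)⁻¹).fun_mul (h3 fun i => Finset.Ioi i)
  exact (h4.fun_add ((h3 fun i => Finset.Ici i).const_mul _)).const_mul _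

theorem lineHol_eulerProd (m : ℕ) :
    LineHol (eulerProd (m := m)) {s | ∀ i, 3 / 8 < (s i).re} := by
  obtain ⟨C, hC⟩ := exists_norm_eulerLocal_sub_one_le m
  have hu : Summable fun p : Nat.Primes => C * (p : ℝ) ^ (-(3 / 2 : ℝ)) :=
    (Nat.Primes.summable_rpow.mpr (by norm_num)).mul_left C
  have hprod : HasProdLocallyUniformlyOn
      (fun (p : Nat.Primes) (s : Fin m → ℂ) => eulerLocal (1 / (p : ℂ)) (primeParam s p))
      eulerProd {s | ∀ i, 3 / 8 < (s i).re} := by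
    refine hasProdLocallyUniformlyOn_of_forall_compact (isOpen_re_gt _) fun K hK hKc => ?_
    have := hu.hasProdUniformlyOn_one_add (f := fun (p : Nat.Primes) (s : Fin m → ℂ) =>
      eulerLocal (1 / (p : ℂ)) (primeParam s p) - 1) hKc
      (Eventually.of_forall fun p s hs => hC p s fun i => (hK hs i).le)
      (fun p => ((differentiable_eulerLocal p).continuous.sub continuous_const).continuousOn)
    simp only [add_sub_cancel] at this
    exact this
  exact LineHol.of_tendstoLocallyUniformlyOn (isOpen_re_gt _) (fun t => LineHol.prod fun p _ =>
    ((differentiable_eulerLocal p).differentiableOn).lineHol) hprod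

lemma isSquare_mul_of_coprime {a b : ℕ} (h : a.Coprime b) :
    IsSquare (a * b) ↔ IsSquare a ∧ IsSquare b := by
  refine ⟨?_, fun ⟨h1, h2⟩ => h1.mul h2⟩
  have key : ∀ {a b : ℕ}, a.Coprime b → IsSquare (a * b) → IsSquare a := by
    rintro a b h ⟨c, hc⟩
    obtain ⟨d, hd⟩ := exists_associated_pow_of_mul_eq_pow (k := 2)
      (by rw [Nat.isUnit_iff]; exact h) (hc.trans (sq c).symm)
    exact ⟨d, by rw [← sq]; exact (associated_iff_eq.mp hd).symm⟩
  intro hab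
  exact ⟨key h hab, key h.symm (by rwa [mul_comm])⟩

lemma squareWeight_mul {a b : ℕ} (h : a.Coprime b) :
    squareWeight (a * b) = squareWeight a * squareWeight b := by
  unfold squareWeight
  have h1 := isSquare_mul_of_coprime h
  by_cases ha : IsSquare a
  · by_cases hb : IsSquare b
    · rw [if_pos ha, if_pos hb, if_pos (h1.mpr ⟨ha, hb⟩), h.primeFactors_mul,
        Finset.prod_union h.disjoint_primeFactors]
    · rw [if_neg hb, if_neg fun h => hb (h1.mp h).2, mul_zero]
  · rw [if_neg ha, if_neg fun h => ha (h1.mp h).1, zero_mul]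

lemma norm_squareWeight_le_one (N : ℕ) : ‖squareWeight N‖ ≤ 1 := by
  unfold squareWeight
  split_ifs
  · rw [norm_prod]
    exact Finset.prod_le_one (fun _ _ => norm_nonneg _) fun p _ => norm_one_add_one_div_inv_le p
  · simp

lemma squareWeight_prime_pow {p : ℕ} (hp : p.Prime) (e : ℕ) :
    squareWeight (p ^ e) =
      (1 + 1 / (p : ℂ))⁻¹ * ((1 + (-1) ^ e) / 2 + if e = 0 then 1 / (p : ℂ) else 0) := by
  have hsq : IsSquare (p ^ e) ↔ Even e := by
    constructor
    · rintro ⟨r, hr⟩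
      have h1 := congrArg (fun n => n.factorization p) hr
      have hr0 : r ≠ 0 := by
        rintro rfl
        exact pow_ne_zero e hp.ne_zero hr
      simp only [Nat.factorization_pow, hp.factorization, Nat.factorization_mul hr0 hr0,
        Finsupp.add_apply, Finsupp.smul_apply, Finsupp.single_eq_same, smul_eq_mul, mul_one] at h1
      exact ⟨_, h1⟩
    · exact fun h => h.isSquare_pow p
  have h0 := one_add_one_div_ne_zero p
  unfold squareWeight
  rcases eq_or_ne e 0 with rfl | he
  · simp only [pow_zero, if_pos IsSquare.one, Nat.primeFactors_one, Finset.prod_empty, if_true]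
    rw [← two_mul, mul_one, div_self two_ne_zero, inv_mul_cancel₀ h0]
  · rw [if_neg he, Nat.primeFactors_prime_pow he hp, Finset.prod_singleton]
    rcases Nat.even_or_odd e with h | h
    · rw [if_pos (hsq.mpr h), h.neg_one_pow]; ring
    · rw [if_neg fun h' => Nat.not_even_iff_odd.mpr h (hsq.mp h'), h.neg_one_pow]; ring

/-- The completely multiplicative function with value `η ^ e` at `p ^ e`, supported at the
powers of `p`. -/
noncomputable def primePowFun (p : ℕ) (η : ℂ) (n : ℕ) : ℂ :=
  if n / p ^ n.factorization p = 1 then η ^ n.factorization p else 0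

lemma primePowFun_pow {p : ℕ} (hp : p.Prime) (η : ℂ) (e : ℕ) :
    primePowFun p η (p ^ e) = η ^ e := by
  have h : (p ^ e).factorization p = e := by
    rw [Nat.factorization_pow, hp.factorization]; simp
  rw [primePowFun, h, Nat.div_self (pow_pos hp.pos e), if_pos rfl]

lemma primePowFun_eq_zero {p : ℕ} (η : ℂ) {n : ℕ}
    (hn : n ∉ Set.range fun e : ℕ => p ^ e) : primePowFun p η n = 0 := by
  rw [primePowFun, if_neg]
  intro h
  exact hn ⟨n.factorization p, by
    simpa [h] using Nat.ordProj_mul_ordCompl_eq_self n p⟩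

lemma primePowFun_mul (p : ℕ) (η : ℂ) (a b : ℕ) :
    primePowFun p η (a * b) = primePowFun p η a * primePowFun p η b := by
  rcases eq_or_ne a 0 with rfl | ha
  · simp [primePowFun]
  rcases eq_or_ne b 0 with rfl | hb
  · simp [primePowFun]
  have h3 : (a * b).factorization p = a.factorization p + b.factorization p := by
    rw [Nat.factorization_mul ha hb, Finsupp.add_apply]
  rw [primePowFun, Nat.ordCompl_mul, h3, primePowFun, primePowFun]
  by_cases h1 : a / p ^ a.factorization p = 1 <;> by_cases h2 : b / p ^ b.factorization p = 1 <;>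
    simp [h1, h2, pow_add]

/-- The generating series of the coefficients at the powers of `p`. -/
theorem hasSum_tupleCoeff_prime_pow {m : ℕ} {s : Fin m → ℂ} (hs : ∀ i, 1 < (s i).re) {p : ℕ}
    (hp : p.Prime) {η : ℂ} (hη : ‖η‖ ≤ 1) :
    HasSum (fun e : ℕ => η ^ e * tupleCoeff Finset.univ s (p ^ e))
      (∏ i, (1 - η * primeParam s p i)⁻¹) := by
  have hinj : Function.Injective fun e : ℕ => p ^ e := Nat.pow_right_injective hp.two_le
  have hone : primePowFun p η 1 = 1 := by simpa using primePowFun_pow hp η 0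
  have hbd : ∀ n, ‖primePowFun p η n‖ ≤ 1 := by
    intro n
    unfold primePowFun
    split_ifs
    · rw [norm_pow]; exact pow_le_one₀ (norm_nonneg _) hη
    · simp
  obtain ⟨h1, h2⟩ := hasSum_twist_tupleCoeff Finset.univ hs hone (primePowFun_mul p η) hbd
  have hcomp : ∀ f : ℕ → ℂ, ∑' e : ℕ, η ^ e * f (p ^ e) = ∑' n, primePowFun p η n * f n := by
    intro f
    have := hinj.tsum_eq (f := fun n => primePowFun p η n * f n) (by
      intro n hn
      by_contra hcon
      exact hn (by simp [primePowFun_eq_zero η hcon]))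
    rw [← this]
    exact tsum_congr fun e => by simp only [primePowFun_pow hp]
  have hsum : Summable fun e : ℕ => η ^ e * tupleCoeff Finset.univ s (p ^ e) :=
    (h1.comp_injective hinj).congr fun e => by simp only [Function.comp, primePowFun_pow hp]
  have hval : ∑' e : ℕ, η ^ e * tupleCoeff Finset.univ s (p ^ e) =
      ∏ i, (1 - η * primeParam s p i)⁻¹ := by
    rw [hcomp, h2]
    refine Finset.prod_congr rfl fun i _ => ?_
    rw [← hcomp, ← tsum_geometric_of_norm_lt_one]
    · refine tsum_congr fun e => ?_
      rw [powFun_apply _ (pow_ne_zero e hp.ne_zero), mul_pow, primeParam, Nat.cast_pow,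
        ← natCast_cpow_natCast_mul, ← cpow_nat_mul]
    · rw [norm_mul, norm_primeParam s hp.pos]
      have hp1 : (1 : ℝ) < p := by exact_mod_cast hp.one_lt
      have : (p : ℝ) ^ (-(s i).re) < 1 :=
        Real.rpow_lt_one_of_one_lt_of_neg hp1 (by linarith [hs i])
      exact (mul_le_of_le_one_left (by positivity) hη).trans_lt this
  rw [← hval]
  exact hsum.hasSum

/-- The local factor of the residue series. -/
theorem tsum_tupleCoeff_squareWeight_prime_pow {m : ℕ} {s : Fin m → ℂ} (hs : ∀ i, 1 < (s i).re)
    {p : ℕ} (hp : p.Prime) :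
    ∑' e : ℕ, tupleCoeff Finset.univ s (p ^ e) * squareWeight (p ^ e) =
      eulerLocal (1 / (p : ℂ)) (primeParam s p) *
        ∏ i, ∏ j ∈ Finset.Ici i, (1 - primeParam s p i * primeParam s p j)⁻¹ := by
  have hA := hasSum_tupleCoeff_prime_pow hs hp (η := 1) (by simp)
  have hB := hasSum_tupleCoeff_prime_pow hs hp (η := -1) (by simp)
  have hC : HasSum (fun e : ℕ => if e = 0 then 1 / (p : ℂ) else 0) (1 / (p : ℂ)) := by
    simpa using hasSum_ite_eq 0 (1 / (p : ℂ))
  have hD := (((hA.add hB).div_const 2).add hC).mul_left (1 + 1 / (p : ℂ))⁻¹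
  have hone : tupleCoeff (Finset.univ : Finset (Fin m)) s 1 = 1 :=
    (tupleCoeff_isMultiplicative _ s).map_one
  have heq : ∀ e : ℕ, tupleCoeff Finset.univ s (p ^ e) * squareWeight (p ^ e) =
      (1 + 1 / (p : ℂ))⁻¹ * ((1 ^ e * tupleCoeff Finset.univ s (p ^ e) +
        (-1) ^ e * tupleCoeff Finset.univ s (p ^ e)) / 2 + if e = 0 then 1 / (p : ℂ) else 0) := by
    intro e
    rw [squareWeight_prime_pow hp]
    rcases eq_or_ne e 0 with rfl | he
    · simp only [pow_zero, hone, if_true]; ring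
    · simp only [if_neg he, one_pow]; ring
  rw [tsum_congr heq, hD.tsum_eq]
  have hx : ∀ i, ‖primeParam s p i‖ < 1 := by
    intro i
    rw [norm_primeParam s hp.pos]
    exact Real.rpow_lt_one_of_one_lt_of_neg (by exact_mod_cast hp.one_lt) (by linarith [hs i])
  set x := primeParam s p with hxdef
  have hne : ∀ i j, 1 - x i * x j ≠ 0 := by
    intro i j h
    have h1 : x i * x j = 1 := by linear_combination -h
    have h2 : ‖x i * x j‖ < 1 := by
      rw [norm_mul]; exact mul_lt_one_of_nonneg_of_lt_one_left (norm_nonneg _) (hx i) (hx j).le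
    rw [h1, norm_one] at h2
    exact lt_irrefl _ h2
  have hP : ∏ i, ∏ j ∈ Finset.Ici i, (1 - x i * x j) ≠ 0 :=
    Finset.prod_ne_zero_iff.mpr fun i _ => Finset.prod_ne_zero_iff.mpr fun j _ => hne i j
  have hsplit : ∏ i, ∏ j ∈ Finset.Ici i, (1 - x i * x j) =
      ((∏ i, (1 - x i)) * ∏ i, (1 + x i)) * ∏ i, ∏ j ∈ Finset.Ioi i, (1 - x i * x j) := by
    rw [← Finset.prod_mul_distrib, ← Finset.prod_mul_distrib]
    refine Finset.prod_congr rfl fun i _ => ?_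
    rw [← Finset.mul_prod_Ioi_eq_prod_Ici]
    ring
  simp only [Finset.prod_inv_distrib, one_mul, neg_mul, sub_neg_eq_add]
  rw [eulerLocal]
  set P := ∏ i, ∏ j ∈ Finset.Ici i, (1 - x i * x j)
  set Q := ∏ i, ∏ j ∈ Finset.Ioi i, (1 - x i * x j)
  set A := ∏ i, (1 - x i)
  set B := ∏ i, (1 + x i)
  have hA0 : A ≠ 0 := fun h => hP (by rw [hsplit, h]; ring)
  have hB0 : B ≠ 0 := fun h => hP (by rw [hsplit, h]; ring)
  have hQ0 : Q ≠ 0 := fun h => hP (by rw [hsplit, h]; ring)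
  rw [mul_assoc]
  congr 1
  rw [hsplit]
  field_simp

/-- The residue series is `∏ ζ(s_i + s_j)` times an Euler product converging further to the
left. -/
theorem tsum_tupleCoeff_squareWeight {m : ℕ} {s : Fin m → ℂ} (hs : ∀ i, 1 < (s i).re) :
    ∑' N, tupleCoeff Finset.univ s N * squareWeight N =
      eulerProd s * ∏ i, ∏ j ∈ Finset.Ici i, riemannZeta (s i + s j) := by
  have hs38 : ∀ i, 3 / 8 ≤ (s i).re := fun i => by linarith [hs i]
  have h1 : HasProd (fun p : Nat.Primes => ∑' e : ℕ, tupleCoeff Finset.univ s ((p : ℕ) ^ e) *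
      squareWeight ((p : ℕ) ^ e)) (∑' N, tupleCoeff Finset.univ s N * squareWeight N) := by
    refine EulerProduct.eulerProduct_hasProd (f := fun N => tupleCoeff Finset.univ s N *
      squareWeight N) ?_ ?_ ?_ ?_
    · simp [(tupleCoeff_isMultiplicative Finset.univ s).map_one, squareWeight]
    · intro a b hab
      simp only [(tupleCoeff_isMultiplicative Finset.univ s).map_mul_of_coprime hab,
        squareWeight_mul hab]
      ring
    · refine Summable.of_nonneg_of_le (fun _ => norm_nonneg _) (fun N => ?_)
        (summable_norm_tupleCoeff hs)
      rw [norm_mul]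
      exact mul_le_of_le_one_right (norm_nonneg _) (norm_squareWeight_le_one N)
    · simp
  have h2 : HasProd (fun p : Nat.Primes => eulerLocal (1 / (p : ℂ)) (primeParam s p))
      (eulerProd s) := (multipliable_eulerLocal hs38).hasProd
  have h3 : ∀ i j, HasProd (fun p : Nat.Primes => (1 - primeParam s p i * primeParam s p j)⁻¹)
      (riemannZeta (s i + s j)) := by
    intro i j
    have hre : 1 < (s i + s j).re := by rw [add_re]; linarith [hs i, hs j]
    refine (riemannZeta_eulerProduct_hasProd hre).congr_fun fun p => ?_
    have hp0 : ((p : ℕ) : ℂ) ≠ 0 := by exact_mod_cast p.2.ne_zero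
    rw [primeParam, primeParam, neg_add, cpow_add _ _ hp0]
  have h4 : HasProd (fun p : Nat.Primes => ∏ i, ∏ j ∈ Finset.Ici i,
      (1 - primeParam s p i * primeParam s p j)⁻¹)
      (∏ i, ∏ j ∈ Finset.Ici i, riemannZeta (s i + s j)) :=
    hasProd_prod fun i _ => hasProd_prod fun j _ => h3 i j
  refine h1.unique ((h2.mul h4).congr_fun fun p => ?_)
  exact (tsum_tupleCoeff_squareWeight_prime_pow hs p.2)

end EulerProduct

section ArithmeticFactor

open Complex

lemma prod_Ici_const (m : ℕ) (c : ℂ) :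
    ∏ i : Fin m, ∏ _j ∈ Finset.Ici i, c = c ^ (m * (m + 1) / 2) := by
  induction m with
  | zero => simp
  | succ m ih =>
    rw [Fin.prod_univ_succ, triangle_succ, pow_add]
    congr 1
    · rw [Finset.prod_const, ← bot_eq_zero, Finset.Ici_bot, Finset.card_univ, Fintype.card_fin]
    · rw [← ih]
      exact Finset.prod_congr rfl fun i _ => Fin.prod_Ici_succ (fun _ => c) i

/-- The factor of `arithmeticFactor m` at `p`. -/
noncomputable def arithmeticLocal (m p : ℕ) : ℝ :=
  (1 - 1 / (p : ℝ)) ^ (m * (m + 1) / 2) / (1 + 1 / (p : ℝ)) *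
    ((((1 - 1 / √(p : ℝ)) ^ m)⁻¹ + ((1 + 1 / √(p : ℝ)) ^ m)⁻¹) / 2 + 1 / (p : ℝ))

lemma arithmeticLocal_pos (m : ℕ) {p : ℕ} (hp : p.Prime) : 0 < arithmeticLocal m p := by
  have hp1 : (1 : ℝ) < p := by exact_mod_cast hp.one_lt
  have h1 : 0 < 1 - 1 / (p : ℝ) := by
    rw [sub_pos, div_lt_one (by linarith)]; exact hp1
  have h2 : 0 < 1 - 1 / √(p : ℝ) := by
    rw [sub_pos, div_lt_one (by positivity)]
    exact Real.lt_sqrt_of_sq_lt (by simpa using hp1)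
  unfold arithmeticLocal
  positivity

lemma primeParam_half {m : ℕ} (p : ℕ) (i : Fin m) :
    primeParam (fun _ : Fin m => 1 / 2) p i = ((1 / √(p : ℝ) : ℝ) : ℂ) := by
  rw [primeParam, Real.sqrt_eq_rpow, cpow_neg, ofReal_div, ofReal_one, one_div (_ : ℂ),
    ofReal_cpow (by positivity)]
  push_cast
  rw [one_div ((p : ℂ) ^ _)]
  norm_num

/-- At the central point `x_i = 1 / √p`, and the removed zeta factors contribute `(1 - 1 / p) ^ (m
(m + 1) / 2)`. -/
lemma eulerLocal_half (m : ℕ) {p : ℕ} (hp : p.Prime) :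
    eulerLocal (1 / (p : ℂ)) (primeParam (fun _ : Fin m => 1 / 2) p) =
      (arithmeticLocal m p : ℂ) := by
  have hp1 : (1 : ℝ) < p := by exact_mod_cast hp.one_lt
  have hp0 : (0 : ℝ) < p := by linarith
  obtain ⟨y, hy⟩ : ∃ y : ℝ, y = 1 / √(p : ℝ) := ⟨_, rfl⟩
  have hyy : y * y = 1 / (p : ℝ) := by
    rw [hy, div_mul_div_comm, one_mul, Real.mul_self_sqrt hp0.le]
  have hy1 : y < 1 := by
    rw [hy, div_lt_one (by positivity)]
    exact Real.lt_sqrt_of_sq_lt (by simpa using hp1)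
  have hy0 : 0 < y := by rw [hy]; positivity
  have hx : primeParam (fun _ : Fin m => 1 / 2) p = fun _ => (y : ℂ) := by
    ext i; rw [primeParam_half, hy]
  have hyyc : (1 / (p : ℂ)) = (y : ℂ) * y := by
    rw [← ofReal_mul, hyy]; push_cast; rfl
  have ha : (1 - (y : ℂ)) ≠ 0 := by
    rw [← ofReal_one, ← ofReal_sub]; exact_mod_cast ne_of_gt (by linarith : 0 < 1 - y)
  have hb : (1 + (y : ℂ)) ≠ 0 := by
    rw [← ofReal_one, ← ofReal_add]; exact_mod_cast ne_of_gt (by linarith : 0 < 1 + y)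
  have hsplit : (1 - (y : ℂ) * y) ^ (m * (m + 1) / 2) =
      (1 - (y : ℂ)) ^ m * (1 + (y : ℂ)) ^ m *
        ∏ i : Fin m, ∏ _j ∈ Finset.Ioi i, (1 - (y : ℂ) * y) := by
    rw [← prod_Ici_const, ← mul_pow]
    have : ((1 - (y : ℂ)) * (1 + y)) ^ m = ∏ _i : Fin m, (1 - (y : ℂ) * y) := by
      rw [Finset.prod_const, Finset.card_univ, Fintype.card_fin]; ring
    rw [this, ← Finset.prod_mul_distrib]
    exact Finset.prod_congr rfl fun i _ => (Finset.mul_prod_Ioi_eq_prod_Ici _).symm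
  have hloc : (arithmeticLocal m p : ℂ) = (1 - (y : ℂ) * y) ^ (m * (m + 1) / 2) /
      (1 + (y : ℂ) * y) * ((((1 - (y : ℂ)) ^ m)⁻¹ + ((1 + (y : ℂ)) ^ m)⁻¹) / 2 + (y : ℂ) * y) := by
    rw [arithmeticLocal, ← hy, ← hyy]
    push_cast
    rfl
  rw [eulerLocal, hx, hloc, hyyc]
  simp only [Finset.prod_const, Finset.card_univ, Fintype.card_fin]
  have h3 := prod_Ici_const m (1 - (y : ℂ) * y)
  simp only [Finset.prod_const] at h3 hsplit
  rw [h3, hsplit]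
  have ha' := pow_ne_zero m ha
  have hb' := pow_ne_zero m hb
  field_simp

lemma arithmeticFactor_eq (m : ℕ) :
    arithmeticFactor m = ∏' p : Nat.Primes, arithmeticLocal m p := rfl

lemma summable_norm_arithmeticLocal_sub_one (m : ℕ) :
    Summable fun p : Nat.Primes => ‖arithmeticLocal m p - 1‖ := by
  refine (summable_norm_eulerLocal_sub_one (s := fun _ : Fin m => (1 / 2 : ℂ))
    (fun _ => by norm_num)).congr fun p => ?_
  rw [eulerLocal_half m p.2, ← ofReal_one, ← ofReal_sub, norm_real]

theorem arithmeticFactor_ne_zero (m : ℕ) : arithmeticFactor m ≠ 0 := by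
  rw [arithmeticFactor_eq]
  have := tprod_one_add_ne_zero_of_summable (f := fun p : Nat.Primes => arithmeticLocal m p - 1)
    (fun p => by rw [add_sub_cancel]; exact (arithmeticLocal_pos m p.2).ne')
    (summable_norm_arithmeticLocal_sub_one m)
  simpa only [add_sub_cancel] using this

theorem eulerProd_half (m : ℕ) :
    eulerProd (fun _ : Fin m => (1 / 2 : ℂ)) = (arithmeticFactor m : ℂ) := by
  have hm : Multipliable fun p : Nat.Primes => arithmeticLocal m p := by
    simpa only [add_sub_cancel] using
      multipliable_one_add_of_summable (summable_norm_arithmeticLocal_sub_one m)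
  have h1 := hm.hasProd.map ofRealHom continuous_ofReal
  rw [eulerProd, arithmeticFactor_eq]
  refine Eq.trans ?_ h1.tprod_eq
  exact tprod_congr fun p => eulerLocal_half m p.2

end ArithmeticFactor

/-! ### Continuation of the completed series -/

section Continuation

open Complex Set

variable {m : ℕ}

/-- The tube with all `Re s_i ∈ I` and `Re w ∈ J`. -/
def boxTube (m : ℕ) (I J : Set ℝ) : Set ((Fin m → ℂ) × ℂ) :=
  tube ((univ.pi fun _ => I) ×ˢ J)

lemma mem_boxTube {I J : Set ℝ} {z : (Fin m → ℂ) × ℂ} :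
    z ∈ boxTube m I J ↔ (∀ i, (z.1 i).re ∈ I) ∧ z.2.re ∈ J := by
  change _ ∈ (univ.pi fun _ => I) ×ˢ J ↔ _
  simp

lemma isOpen_boxTube {I J : Set ℝ} (hI : IsOpen I) (hJ : IsOpen J) : IsOpen (boxTube m I J) :=
  ((isOpen_set_pi finite_univ fun _ _ => hI).prod hJ).preimage
    (by fun_prop : Continuous fun z : (Fin m → ℂ) × ℂ =>
      ((fun i => (z.1 i).re, z.2.re) : (Fin m → ℝ) × ℝ))

lemma convex_boxTube {I J : Set ℝ} (hI : Convex ℝ I) (hJ : Convex ℝ J) :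
    Convex ℝ (boxTube m I J) := by
  intro x hx y hy a b ha hb hab
  rw [mem_boxTube] at *
  refine ⟨fun i => ?_, ?_⟩
  · simpa using hI (hx.1 i) (hy.1 i) ha hb hab
  · simpa using hJ hx.2 hy.2 ha hb hab

lemma boxTube_mono {I J I' J' : Set ℝ} (hI : I ⊆ I') (hJ : J ⊆ J') :
    boxTube m I J ⊆ boxTube m I' J' := fun z hz => by
  rw [mem_boxTube] at *
  exact ⟨fun i => hI (hz.1 i), hJ hz.2⟩

/-- The point `(1/2, …, 1/2, 1)`. -/
noncomputable def centerPoint (m : ℕ) : (Fin m → ℂ) × ℂ := (fun _ => 1 / 2, 1)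

/-- A convex open set containing the centre and the region `σ_i > 1`, `ω > 1` contains an orthant
with the centre in its interior. -/
lemma exists_orthant_subset {B : Set ((Fin m → ℝ) × ℝ)} (hB : IsOpen B) (hBc : Convex ℝ B)
    (hP : ((fun _ => 1 / 2, 1) : (Fin m → ℝ) × ℝ) ∈ B)
    (h1 : {x : (Fin m → ℝ) × ℝ | (∀ i, 1 < x.1 i) ∧ 1 < x.2} ⊆ B) :
    ∃ δ > 0, δ ≤ 1 / 8 ∧ ∀ x : (Fin m → ℝ) × ℝ, (∀ i, 1 / 2 - δ < x.1 i) → 1 - δ < x.2 → x ∈ B := by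
  obtain ⟨ρ, hρ, hball⟩ := Metric.isOpen_iff.mp hB _ hP
  refine ⟨min (ρ / 2) (1 / 8), by positivity, min_le_right _ _, fun x hx1 hx2 => ?_⟩
  set δ := min (ρ / 2) (1 / 8)
  have hδρ : δ < ρ := (min_le_left _ _).trans_lt (by linarith)
  have hδ : 0 < δ := by positivity
  set q : (Fin m → ℝ) × ℝ := (fun _ => 1 / 2 - δ, 1 - δ) with hq
  have hqB : q ∈ B := by
    refine hball ?_
    rw [Metric.mem_ball, Prod.dist_eq, max_lt_iff]
    refine ⟨(dist_pi_lt_iff hρ).mpr fun i => ?_, ?_⟩ <;>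
    · rw [hq, Real.dist_eq]
      simp only []
      rw [abs_lt]; constructor <;> linarith
  have hev : ∀ v : ℝ, 0 < v → ∀ᶠ t : ℝ in 𝓝[>] 0, 2 < v / t := fun v hv =>
    (tendsto_inv_nhdsGT_zero.const_mul_atTop hv).eventually_gt_atTop 2
  -- `x` lies on the segment from the corner `q` of the orthant to `q + t⁻¹ (x - q)`, which for
  -- small `t > 0` has all coordinates larger than `1`
  obtain ⟨t, ⟨ht1, ht2⟩, ht0, ht3⟩ := ((((eventually_all.mpr fun i =>
    hev (x.1 i - (1 / 2 - δ)) (by linarith [hx1 i])).and (hev (x.2 - (1 - δ)) (by linarith))).and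
    (Ioo_mem_nhdsGT one_pos)).exists)
  have ht : t ≠ 0 := ht0.ne'
  have hb : q + (1 / t : ℝ) • (x - q) ∈ B := by
    refine h1 ⟨fun i => ?_, ?_⟩
    · have := ht1 i
      have hδ8 : δ ≤ 1 / 8 := min_le_right _ _
      change 1 < (1 / 2 - δ) + 1 / t * (x.1 i - (1 / 2 - δ))
      rw [one_div_mul_eq_div]; linarith
    · have hδ8 : δ ≤ 1 / 8 := min_le_right _ _
      change 1 < (1 - δ) + 1 / t * (x.2 - (1 - δ))
      rw [one_div_mul_eq_div]; linarith
  have := hBc hqB hb (by linarith : 0 ≤ 1 - t) ht0.le (by ring)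
  convert this using 1
  rw [smul_add, ← add_assoc, ← add_smul, smul_smul, mul_one_div_cancel ht]
  simp

/-- A meromorphic continuation of the completed series, normalized so that it coincides with the
series itself also over a strip around `Re s_i = 1/2` with `Re w` large. -/
structure IsContinuation (σ : ℤˣ) (δ : ℝ) (k : (Fin m → Fin 2) → ℕ)
    (F : (Fin m → ℂ) × ℂ → ℂ) : Prop where
  mero : IsMeromorphicOn F (boxTube m (Ioi (1 / 2 - δ)) (Ioi (1 - δ)))
  eq_series : ∀ (s : Fin m → ℂ) (w : ℂ), (∀ i, 1 < (s i).re) → 1 < w.re →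
    F (s, w) = completedSeries σ s w
  eq_strip : ∀ z ∈ boxTube m (Ioo (1 / 2 - δ) (1 / 2 + δ)) (Ioi (m + 2)),
    F z = completedSeries σ z.1 z.2
  polar : HasPolarDivisorAt F polarForm k (centerPoint m)

lemma strip_subset_polyRegion {δ : ℝ} (hδ : δ ≤ 1 / 8) :
    boxTube m (Ioo (1 / 2 - δ) (1 / 2 + δ)) (Ioi (m + 2)) ⊆ polyRegion m := by
  intro z hz
  rw [mem_boxTube] at hz
  refine ⟨fun i => ⟨by linarith [(hz.1 i).1], fun h => ?_⟩, hz.2⟩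
  have := (hz.1 i).2
  rw [h, one_re] at this
  linarith

/-- On the strip, a continuation of the completed series agrees densely with its defining
series. -/
lemma strip_subset_closure {σ : ℤˣ} {δ : ℝ} (hδ0 : 0 < δ) (hδ : δ ≤ 1 / 8)
    {F : (Fin m → ℂ) × ℂ → ℂ} (hF : IsMeromorphicOn F (boxTube m (Ioi (1 / 2 - δ)) (Ioi (1 - δ))))
    (heq : ∀ (s : Fin m → ℂ) (w : ℂ), (∀ i, 1 < (s i).re) → 1 < w.re →
      F (s, w) = completedSeries σ s w) :
    boxTube m (Ioo (1 / 2 - δ) (1 / 2 + δ)) (Ioi (m + 2)) ⊆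
      closure (interior {z | F z = completedSeries σ z.1 z.2}) := by
  have hm : (0 : ℝ) ≤ m := Nat.cast_nonneg m
  -- the upper half-planes `Im s_i > 1` avoid the poles of `ζ (s_i)` at `s_i = 1`
  set A := boxTube m (Ioi (1 / 2 - δ)) (Ioi (m + 2)) ∩ {z | ∀ i, 1 < (z.1 i).im} with hA
  have hAo : IsOpen A := by
    refine (isOpen_boxTube isOpen_Ioi isOpen_Ioi).inter ?_
    rw [Set.ofPred_forall]
    exact isOpen_iInter_of_finite fun i => isOpen_lt continuous_const (by fun_prop)
  have hAc : Convex ℝ A := by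
    refine (convex_boxTube (convex_Ioi _) (convex_Ioi _)).inter ?_
    intro x hx y hy a b ha hb hab i
    have := convex_Ioi (1 : ℝ) (hx i) (hy i) ha hb hab
    simpa using this
  have hsub : ∀ {I : Set ℝ}, I ⊆ Ioi (1 / 2 - δ) →
      boxTube m I (Ioi (m + 2)) ⊆ boxTube m (Ioi (1 / 2 - δ)) (Ioi (1 - δ)) := fun hI =>
    boxTube_mono hI (Ioi_subset_Ioi (by linarith))
  have hAp : A ⊆ polyRegion m := by
    rintro z ⟨hz1, hz2⟩
    rw [mem_boxTube] at hz1
    refine ⟨fun i => ⟨?_, fun h => ?_⟩, hz1.2⟩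
    · have : 1 / 2 - δ < (z.1 i).re := hz1.1 i
      linarith
    · have := hz2 i
      rw [h, one_im] at this
      linarith
  have hH := lineHol_completedSeries (m := m) σ
  have hone : ∀ U : Set ((Fin m → ℂ) × ℂ), LineHol (fun _ => (1 : ℂ)) U :=
    fun U => (differentiableOn_const _).lineHol
  have h1 : A ⊆ closure (interior {z | F z = completedSeries σ z.1 z.2}) := by
    have := IsMeromorphicOn.subset_closure_eq (F := F) (r₁ := fun z => completedSeries σ z.1 z.2)
      (r₂ := fun _ => 1) (S := boxTube m (Ioi 1) (Ioi 1))
      (fun z hz => hF z (hsub subset_rfl hz.1)) hAo hAc (hH.mono hAp) (hone A)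
      (isOpen_boxTube isOpen_Ioi isOpen_Ioi) ?_ ?_
    · simpa only [one_mul] using this
    · refine ⟨(fun _ => 2 + 2 * I, ((m + 3 : ℝ) : ℂ)), ⟨?_, fun i => ?_⟩, ?_⟩
      · rw [mem_boxTube]
        refine ⟨fun i => ?_, ?_⟩ <;> simp <;> linarith
      · simp
      · rw [mem_boxTube]
        refine ⟨fun i => ?_, ?_⟩ <;> simp; linarith
    · intro z hz
      rw [mem_boxTube] at hz
      rw [one_mul]
      exact heq z.1 z.2 hz.1 hz.2
  have h2 := IsMeromorphicOn.subset_closure_eq (F := F) (r₁ := fun z => completedSeries σ z.1 z.2)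
      (r₂ := fun _ => 1) (S := interior {z | F z = completedSeries σ z.1 z.2})
      (fun z hz => hF z (hsub Ioo_subset_Ioi_self hz))
      (isOpen_boxTube isOpen_Ioo isOpen_Ioi) (convex_boxTube (convex_Ioo _ _) (convex_Ioi _))
      (hH.mono (strip_subset_polyRegion hδ)) (hone _) isOpen_interior ?_ ?_
  · simpa only [one_mul] using h2
  · have hz : ((fun _ => 1 / 2 + 2 * I, ((m + 3 : ℝ) : ℂ)) : (Fin m → ℂ) × ℂ) ∈ A := by
      refine ⟨?_, fun i => by simp⟩
      rw [mem_boxTube]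
      refine ⟨fun i => ?_, ?_⟩ <;> simp <;> linarith
    obtain ⟨y, hy1, hy2⟩ := mem_closure_iff.mp (h1 hz)
      (boxTube m (Ioo (1 / 2 - δ) (1 / 2 + δ)) (Ioi (m + 2)))
      (isOpen_boxTube isOpen_Ioo isOpen_Ioi) (by
        rw [mem_boxTube]
        refine ⟨fun i => ?_, ?_⟩ <;> simp <;> linarith)
    exact ⟨y, hy1, hy2⟩
  · intro z hz
    rw [one_mul]
    have hz' : z ∈ {z | F z = completedSeries σ z.1 z.2} := interior_subset hz
    exact hz'

/-- Changing the values of `F` on an open set to those of a continuous function which agrees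
with `F` densely. -/
lemma eq_of_subset_closure {X : Type*} [TopologicalSpace X] {F H q : X → ℂ} {S V : Set X}
    (hS : IsOpen S) (hV : IsOpen V) (hH : ContinuousOn H S) (hq : ContinuousOn q V)
    (hd : S ⊆ closure (interior {z | F z = H z})) (hFq : ∀ z ∈ V, F z = q z) :
    ∀ z ∈ S ∩ V, H z = q z := by
  rintro z ⟨hzS, hzV⟩
  have h1 : ∃ᶠ y in 𝓝 z, y ∈ interior {z | F z = H z} := mem_closure_iff_frequently.mp (hd hzS)
  have h2 : ContinuousAt (fun y => H y - q y) z :=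
    (hH.continuousAt (hS.mem_nhds hzS)).sub (hq.continuousAt (hV.mem_nhds hzV))
  by_contra hne
  have h3 : ∀ᶠ y in 𝓝 z, H y - q y ≠ 0 := h2.eventually_ne (sub_ne_zero.mpr hne)
  obtain ⟨y, hy, hy3, hyV⟩ := (h1.and_eventually (h3.and (hV.mem_nhds hzV))).exists
  have hFy : y ∈ {z | F z = H z} := interior_subset hy
  change F y = H y at hFy
  exact hy3 (by rw [← hFy, hFq y hyV, sub_self])

lemma analyticAt_fst_apply (i : Fin m) (z : (Fin m → ℂ) × ℂ) :
    AnalyticAt ℂ (fun z : (Fin m → ℂ) × ℂ => z.1 i) z :=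
  ((ContinuousLinearMap.proj (R := ℂ) (φ := fun _ : Fin m => ℂ) i).comp
    (ContinuousLinearMap.fst ℂ (Fin m → ℂ) ℂ)).analyticAt z

lemma analyticAt_polarForm (ε : Fin m → Fin 2) (z : (Fin m → ℂ) × ℂ) :
    AnalyticAt ℂ (polarForm ε) z :=
  ((Finset.analyticAt_fun_sum _ fun i _ => analyticAt_const.mul (analyticAt_fst_apply i z)).add
    analyticAt_snd).sub analyticAt_const

open Classical in
/-- The continuation given by the conjecture is meromorphic only in the sense of quotients, so its
values on the strip may be redefined there. -/
theorem exists_isContinuation {σ : ℤˣ} {δ : ℝ} {k : (Fin m → Fin 2) → ℕ} (hδ0 : 0 < δ)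
    (hδ : δ ≤ 1 / 8) {F : (Fin m → ℂ) × ℂ → ℂ}
    (hF : IsMeromorphicOn F (boxTube m (Ioi (1 / 2 - δ)) (Ioi (1 - δ))))
    (heq : ∀ (s : Fin m → ℂ) (w : ℂ), (∀ i, 1 < (s i).re) → 1 < w.re →
      F (s, w) = completedSeries σ s w)
    (hk : ∀ ε, 1 ≤ k ε) (hpol : HasPolarDivisorAt F polarForm k (centerPoint m)) :
    ∃ F', IsContinuation σ δ k F' := by
  set S := boxTube m (Ioo (1 / 2 - δ) (1 / 2 + δ)) (Ioi (m + 2)) with hS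
  set H : (Fin m → ℂ) × ℂ → ℂ := fun z => completedSeries σ z.1 z.2
  have hSo : IsOpen S := isOpen_boxTube isOpen_Ioo isOpen_Ioi
  have hd : S ⊆ closure (interior {z | F z = H z}) := strip_subset_closure hδ0 hδ hF heq
  have hH : ContinuousOn H S :=
    (lineHol_completedSeries σ).cont.mono (strip_subset_polyRegion hδ)
  -- every local expression for `F` is one for the modified function
  have key : ∀ {z₀ : (Fin m → ℂ) × ℂ} {f g : (Fin m → ℂ) × ℂ → ℂ}, AnalyticAt ℂ f z₀ →
      AnalyticAt ℂ g z₀ → (∀ᶠ z in 𝓝 z₀, g z ≠ 0 → F z = f z / g z) →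
      ∀ᶠ z in 𝓝 z₀, g z ≠ 0 → S.piecewise H F z = f z / g z := by
    intro z₀ f g hf hg h
    obtain ⟨ρ, hρ, hb⟩ := Metric.eventually_nhds_iff_ball.mp
      ((hf.eventually_analyticAt.and hg.eventually_analyticAt).and h)
    refine Metric.eventually_nhds_iff_ball.mpr ⟨ρ, hρ, fun z hz hgz => ?_⟩
    have hfc : ContinuousOn f (Metric.ball z₀ ρ) :=
      fun y hy => (hb y hy).1.1.continuousAt.continuousWithinAt
    have hgc : ContinuousOn g (Metric.ball z₀ ρ) :=
      fun y hy => (hb y hy).1.2.continuousAt.continuousWithinAt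
    by_cases hzS : z ∈ S
    · rw [Set.piecewise_eq_of_mem _ _ _ hzS]
      exact eq_of_subset_closure hSo (hgc.isOpen_inter_preimage Metric.isOpen_ball isOpen_ne) hH
        ((hfc.mono inter_subset_left).div (hgc.mono inter_subset_left) fun y hy => hy.2) hd
        (fun y hy => (hb y hy.1).2 hy.2) z ⟨hzS, hz, hgz⟩
    · rw [Set.piecewise_eq_of_notMem _ _ _ hzS]
      exact (hb z hz).2 hgz
  refine ⟨S.piecewise H F, ?_, ?_, ?_, ?_⟩
  · intro z₀ hz₀
    obtain ⟨f, g, hf, hg, hne, h⟩ := hF z₀ hz₀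
    exact ⟨f, g, hf, hg, hne, key hf hg h⟩
  · intro s w hs hw
    by_cases hzS : (s, w) ∈ S
    · rw [Set.piecewise_eq_of_mem _ _ _ hzS]
    · rw [Set.piecewise_eq_of_notMem _ _ _ hzS, heq s w hs hw]
  · intro z hz
    rw [Set.piecewise_eq_of_mem _ _ _ hz]
  · obtain ⟨f, hf, h, hne⟩ := hpol
    have hg : AnalyticAt ℂ (fun z => ∏ ε, polarForm ε z ^ k ε) (centerPoint m) := by
      exact Finset.analyticAt_fun_prod _ fun ε _ => (analyticAt_polarForm ε _).pow _
    refine ⟨f, hf, ?_, hne⟩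
    have h' : ∀ᶠ z in 𝓝 (centerPoint m), ∏ ε, polarForm ε z ^ k ε ≠ 0 →
        F z = f z / ∏ ε, polarForm ε z ^ k ε := by
      filter_upwards [h] with z hz hgz
      refine hz fun ε hε => hgz (Finset.prod_eq_zero (Finset.mem_univ ε) ?_)
      rw [hε, zero_pow (by have := hk ε; omega)]
    filter_upwards [key hf hg h'] with z hz hne
    exact hz (Finset.prod_ne_zero_iff.mpr fun ε _ => pow_ne_zero _ (hne ε))

end Continuation

/-! ### The reflections and the polar hyperplanes -/

section Continuation

open Complex Set

variable {m : ℕ}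

/-- Continuous functions that agree at points arbitrarily close to `x` agree at `x`. -/
lemma eq_of_frequently_eq {X : Type*} [TopologicalSpace X] {p q : X → ℂ} {x : X}
    (hp : ContinuousAt p x) (hq : ContinuousAt q x) (h : ∃ᶠ y in 𝓝 x, p y = q y) : p x = q x := by
  by_contra hne
  have h3 : ∀ᶠ y in 𝓝 x, p y - q y ≠ 0 := (hp.sub hq).eventually_ne (sub_ne_zero.mpr hne)
  obtain ⟨y, hy, hy3⟩ := (h.and_eventually h3).exists
  exact hy3 (by rw [hy, sub_self])

lemma polarForm_eq (ε : Fin m → Fin 2) (z : (Fin m → ℂ) × ℂ) :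
    polarForm ε z = z.2 - 1 + ∑ i, ((ε i : ℕ) : ℂ) * (z.1 i - 1 / 2) := by
  have : ∑ i, ((ε i : ℕ) : ℂ) * (z.1 i - 1 / 2) =
      ∑ i, ((ε i : ℕ) : ℂ) * z.1 i - (∑ i, ((ε i : ℕ) : ℂ)) / 2 := by
    rw [Finset.sum_div, ← Finset.sum_sub_distrib]
    exact Finset.sum_congr rfl fun i _ => by ring
  rw [this, polarForm]
  ring

lemma polarForm_zero (z : (Fin m → ℂ) × ℂ) : polarForm 0 z = z.2 - 1 := by
  rw [polarForm_eq]; simp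

lemma reflection_fst_sub_half (ε : Fin m → Fin 2) (z : (Fin m → ℂ) × ℂ) (i : Fin m) :
    (reflection ε z).1 i - 1 / 2 = fsgn (ε i) * (z.1 i - 1 / 2) := by
  simp only [reflection, fsgn]
  split_ifs <;> ring

/-- The reflections permute the polar hyperplanes. -/
lemma polarForm_reflection (ε ε' : Fin m → Fin 2) (z : (Fin m → ℂ) × ℂ) :
    polarForm ε' (reflection ε z) = polarForm (ε' + ε) z := by
  have hc : ∀ a b : Fin 2, ((a : ℕ) : ℂ) * fsgn b + ((b : ℕ) : ℂ) = (((a + b : Fin 2) : ℕ) : ℂ) := by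
    intro a b
    rw [fsgn_eq]
    fin_cases a <;> fin_cases b <;> norm_num
  rw [polarForm_eq, polarForm_eq]
  have h2 : (reflection ε z).2 = z.2 + ∑ i, ((ε i : ℕ) : ℂ) * (z.1 i - 1 / 2) := rfl
  rw [h2, add_sub_right_comm, add_assoc, ← Finset.sum_add_distrib]
  congr 1
  refine Finset.sum_congr rfl fun i _ => ?_
  rw [reflection_fst_sub_half, Pi.add_apply, ← hc]
  ring

lemma reflection_reflection (ε : Fin m → Fin 2) (z : (Fin m → ℂ) × ℂ) :
    reflection ε (reflection ε z) = z := by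
  refine Prod.ext (funext fun i => ?_) ?_
  · simp only [reflection]; split_ifs <;> ring
  · simp only [reflection]
    rw [add_assoc, ← Finset.sum_add_distrib, Finset.sum_eq_zero, add_zero]
    intro i _
    by_cases h : ε i = 1
    · rw [if_pos h]; ring
    · have : ε i = 0 := by omega
      simp [this]

lemma reflection_centerPoint (ε : Fin m → Fin 2) : reflection ε (centerPoint m) = centerPoint m := by
  refine Prod.ext (funext fun i => ?_) ?_
  · simp only [reflection, centerPoint]; split_ifs <;> norm_num
  · simp [reflection, centerPoint]

lemma analyticAt_reflection (ε : Fin m → Fin 2) (z : (Fin m → ℂ) × ℂ) :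
    AnalyticAt ℂ (reflection ε) z := by
  refine AnalyticAt.prod ?_ ?_
  · refine AnalyticAt.pi fun i => ?_
    by_cases h : ε i = 1
    · simp only [if_pos h]; exact analyticAt_const.sub (analyticAt_fst_apply i z)
    · simp only [if_neg h]; exact analyticAt_fst_apply i z
  · exact analyticAt_snd.add (Finset.analyticAt_fun_sum _ fun i _ =>
      analyticAt_const.mul ((analyticAt_fst_apply i z).sub analyticAt_const))

lemma IsMeromorphicOn.comp_reflection {F : (Fin m → ℂ) × ℂ → ℂ} {Ω Ω' : Set ((Fin m → ℂ) × ℂ)}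
    (hF : IsMeromorphicOn F Ω) (ε : Fin m → Fin 2) (h : ∀ z ∈ Ω', reflection ε z ∈ Ω) :
    IsMeromorphicOn (fun z => F (reflection ε z)) Ω' := by
  intro z hz
  obtain ⟨f, g, hf, hg, hne, heq⟩ := hF _ (h z hz)
  have ha := analyticAt_reflection ε z
  refine ⟨fun z => f (reflection ε z), fun z => g (reflection ε z), hf.comp ha, hg.comp ha, ?_,
    ha.continuousAt.tendsto.eventually heq⟩
  intro hcon
  have hb := (analyticAt_reflection ε (reflection ε z)).continuousAt.tendsto
  rw [reflection_reflection] at hb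
  refine hne ((hb.eventually hcon).mono fun y hy => ?_)
  have hy' : ¬ g (reflection ε (reflection ε y)) ≠ 0 := hy
  rw [reflection_reflection] at hy'
  exact hy'

lemma re_natCast_mul_le (e : Fin 2) {x η : ℝ} (hx : |x| < η) : |((e : ℕ) : ℝ) * x| < η := by
  have hη : 0 < η := (abs_nonneg _).trans_lt hx
  fin_cases e <;> simp [hx, hη]

lemma reflection_mem_boxTube (ε : Fin m → Fin 2) {η c : ℝ} {z : (Fin m → ℂ) × ℂ}
    (hz : z ∈ boxTube m (Ioo (1 / 2 - η) (1 / 2 + η)) (Ioi c)) :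
    reflection ε z ∈ boxTube m (Ioo (1 / 2 - η) (1 / 2 + η)) (Ioi (c - m * η)) := by
  rw [mem_boxTube] at *
  have habs : ∀ i, |(z.1 i).re - 1 / 2| < η := fun i => by
    have := hz.1 i
    rw [abs_lt]; constructor <;> linarith [this.1, this.2]
  refine ⟨fun i => ?_, ?_⟩
  · have h1 := hz.1 i
    simp only [reflection]
    split_ifs
    · rw [sub_re, one_re]; constructor <;> linarith [h1.1, h1.2]
    · exact h1
  · have h2 : (reflection ε z).2.re =
        z.2.re + ∑ i, ((ε i : ℕ) : ℝ) * ((z.1 i).re - 1 / 2) := by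
      simp [reflection]
    have h3 : ∑ i, -(η : ℝ) ≤ ∑ i, ((ε i : ℕ) : ℝ) * ((z.1 i).re - 1 / 2) :=
      Finset.sum_le_sum fun i _ => (abs_lt.mp (re_natCast_mul_le (ε i) (habs i))).1.le
    rw [Finset.sum_const, Finset.card_univ, Fintype.card_fin, nsmul_eq_mul] at h3
    have h4 : c < z.2.re := hz.2
    rw [h2, mem_Ioi]
    linarith

/-- The local form of a continuation near the centre, with numerator `φ` and multiplicities `κ`. -/
def HasLocalForm (F φ : (Fin m → ℂ) × ℂ → ℂ) (κ : (Fin m → Fin 2) → ℕ) : Prop :=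
  AnalyticAt ℂ φ (centerPoint m) ∧ ∀ᶠ z in 𝓝 (centerPoint m), (∀ ε, polarForm ε z ≠ 0) →
    F z = φ z / ∏ ε, polarForm ε z ^ κ ε

lemma add_self_fin_two (ε : Fin m → Fin 2) : ε + ε = 0 := by
  ext i
  have : ∀ a : Fin 2, a + a = 0 := by decide
  simp [this]

/-- The functional equations transform one local form into others. -/
theorem IsContinuation.hasLocalForm_reflection {σ : ℤˣ} {δ : ℝ} {k κ : (Fin m → Fin 2) → ℕ}
    {F φ : (Fin m → ℂ) × ℂ → ℂ} (hδ0 : 0 < δ) (hδ : δ ≤ 1 / 8) (hF : IsContinuation σ δ k F)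
    (hφ : HasLocalForm F φ κ) (ε : Fin m → Fin 2) :
    HasLocalForm F (fun z => φ (reflection ε z)) (fun ε' => κ (ε' + ε)) := by
  have hm : (0 : ℝ) ≤ m := Nat.cast_nonneg m
  -- a reflection changes `Re w` by at most `m η` where `|Re s_i - 1 / 2| < η`, and `m η + η ≤ δ`
  -- keeps the image in the domain of `F`
  set η := δ / (m + 1) with hη
  have hη0 : 0 < η := by positivity
  have hηm : (m + 1) * η = δ := by rw [hη]; field_simp
  have hηδ : η ≤ δ := by nlinarith
  set Ω := boxTube m (Ioo (1 / 2 - η) (1 / 2 + η)) (Ioi (1 - η)) with hΩ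
  have hI : Ioo (1 / 2 - η) (1 / 2 + η) ⊆ Ioo (1 / 2 - δ) (1 / 2 + δ) :=
    Ioo_subset_Ioo (by linarith) (by linarith)
  have hI' : Ioo (1 / 2 - η) (1 / 2 + η) ⊆ Ioi (1 / 2 - δ) :=
    hI.trans Ioo_subset_Ioi_self
  have hmero : IsMeromorphicOn F Ω := fun z hz =>
    hF.mero z (boxTube_mono hI' (Ioi_subset_Ioi (by linarith)) hz)
  have hmero' : IsMeromorphicOn (fun z => F (reflection ε z)) Ω :=
    hF.mero.comp_reflection ε fun z hz =>
      boxTube_mono hI' (Ioi_subset_Ioi (by linarith)) (reflection_mem_boxTube ε hz)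
  -- `F` and its reflection agree where `Re w > m + 3`, by the functional equation of the series,
  -- hence on a dense set
  have hdense := hmero.subset_closure_eq' hmero' (convex_boxTube (convex_Ioo _ _) (convex_Ioi _))
    (S := boxTube m (Ioo (1 / 2 - η) (1 / 2 + η)) (Ioi (m + 3)))
    (isOpen_boxTube isOpen_Ioo isOpen_Ioi) ⟨(fun _ => 1 / 2, ((m + 4 : ℝ) : ℂ)), by
      constructor <;>
      · rw [mem_boxTube]
        refine ⟨fun i => ?_, ?_⟩ <;> simp <;> linarith⟩ (by
      intro z hz
      have hz1 := boxTube_mono hI (Ioi_subset_Ioi (by linarith : (m : ℝ) + 2 ≤ m + 3)) hz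
      have hz2 : reflection ε z ∈ boxTube m (Ioo (1 / 2 - δ) (1 / 2 + δ)) (Ioi (m + 2)) :=
        boxTube_mono hI (Ioi_subset_Ioi (by linarith)) (reflection_mem_boxTube ε hz)
      rw [hF.eq_strip z hz1, hF.eq_strip _ hz2]
      refine (completedSeries_reflection σ ε (strip_subset_polyRegion hδ hz1) (fun i => ?_)
        (strip_subset_polyRegion hδ hz2)).symm
      have h2 : (z.1 i).re < 1 / 2 + δ := ((mem_boxTube.mp hz1).1 i).2
      linarith)
  obtain ⟨hφa, hform⟩ := hφ
  have hcen : centerPoint m ∈ Ω := by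
    rw [mem_boxTube]; refine ⟨fun i => ?_, ?_⟩ <;> simp [centerPoint, hη0]
  have hr := analyticAt_reflection ε (centerPoint m)
  have hφa' : AnalyticAt ℂ φ (reflection ε (centerPoint m)) := by
    rwa [reflection_centerPoint]
  have hcomp : AnalyticAt ℂ (fun z => φ (reflection ε z)) (centerPoint m) := hφa'.comp hr
  refine ⟨hcomp, ?_⟩
  have hrt : Tendsto (reflection ε) (𝓝 (centerPoint m)) (𝓝 (centerPoint m)) := by
    have := hr.continuousAt.tendsto
    rwa [reflection_centerPoint] at this
  have hΩn : Ω ∈ 𝓝 (centerPoint m) := (isOpen_boxTube isOpen_Ioo isOpen_Ioi).mem_nhds hcen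
  filter_upwards [hform.eventually_nhds, (hrt.eventually hform).eventually_nhds, hΩn,
    hφa.eventually_analyticAt, hcomp.eventually_analyticAt] with z h1 h2 hzΩ ha1 ha2 hne
  have hprod : ∀ κ' : (Fin m → Fin 2) → ℕ, ContinuousAt (fun z => ∏ ε, polarForm ε z ^ κ' ε) z ∧
      ∏ ε, polarForm ε z ^ κ' ε ≠ 0 := fun κ' =>
    ⟨(Finset.analyticAt_fun_prod _ fun ε _ => (analyticAt_polarForm ε z).pow _).continuousAt,
      Finset.prod_ne_zero_iff.mpr fun ε _ => pow_ne_zero _ (hne ε)⟩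
  rw [h1.self_of_nhds hne]
  refine eq_of_frequently_eq (p := fun z => φ z / ∏ ε, polarForm ε z ^ κ ε)
    (q := fun z => φ (reflection ε z) / ∏ ε', polarForm ε' z ^ κ (ε' + ε))
    (ha1.continuousAt.div (hprod κ).1 (hprod κ).2)
    (ha2.continuousAt.div (hprod _).1 (hprod _).2) ?_
  have hne' : ∀ᶠ y in 𝓝 z, ∀ ε, polarForm ε y ≠ 0 := eventually_all.mpr fun ε =>
    (analyticAt_polarForm ε z).continuousAt.eventually_ne (hne ε)
  refine ((mem_closure_iff_frequently.mp (hdense hzΩ)).and_eventually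
    (h1.and (h2.and hne'))).mono ?_
  rintro y ⟨hy, hy1, hy2, hyne⟩
  have hFy : y ∈ {z | F z = F (reflection ε z)} := interior_subset hy
  change F y = F (reflection ε y) at hFy
  rw [hy1 hyne, hy2 fun ε' => by rw [polarForm_reflection]; exact hyne _] at hFy
  rw [hFy]
  congr 1
  rw [← Equiv.prod_comp (Equiv.addRight ε)]
  refine Finset.prod_congr rfl fun ε' _ => ?_
  rw [Equiv.coe_addRight, polarForm_reflection, add_assoc, add_self_fin_two, add_zero]

end Continuation

/-! ### The residue along `w = 1` -/

section PolarResidue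

open Complex Set

variable {m : ℕ}

/-- The entire function `(s - 1) ζ(s)`. -/
noncomputable def zetaReg (s : ℂ) : ℂ := Function.update (fun s => (s - 1) * riemannZeta s) 1 1 s

lemma zetaReg_of_ne_one {s : ℂ} (hs : s ≠ 1) : zetaReg s = (s - 1) * riemannZeta s :=
  Function.update_of_ne hs _ _

lemma zetaReg_one : zetaReg 1 = 1 := Function.update_self _ _ _

lemma differentiable_zetaReg : Differentiable ℂ zetaReg := by
  unfold zetaReg
  rw [← differentiableOn_univ,
    ← differentiableOn_compl_singleton_and_continuousAt_iff (c := 1) Filter.univ_mem]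
  refine ⟨DifferentiableOn.congr (f := fun s => (s - 1) * riemannZeta s) (fun s hs => ?_)
    fun _ hs => Function.update_of_ne (Set.mem_sdiff_singleton.mp hs).2 _ _,
    continuousWithinAt_compl_self.mp ?_⟩
  · have hs1 : s ≠ 1 := (Set.mem_sdiff_singleton.mp hs).2
    exact (((differentiableAt_id.sub_const 1).mul
      (differentiableAt_riemannZeta hs1))).differentiableWithinAt
  · simpa using riemannZeta_residue_one

/-- `∏ (s_i + s_j - 1)` over `i ≤ j`. -/
noncomputable def residueDen (s : Fin m → ℂ) : ℂ := ∏ i, ∏ j ∈ Finset.Ici i, (s i + s j - 1)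

/-- `residueDen` times the residue at `w = 1` of the completed series. -/
noncomputable def residueNum (σ : ℤˣ) (s : Fin m → ℂ) : ℂ :=
  gammaProd σ s * (3 / (Real.pi : ℂ) ^ 2 * eulerProd s *
    ∏ i, ∏ j ∈ Finset.Ici i, zetaReg (s i + s j))

lemma lineHol_residueDen (U : Set (Fin m → ℂ)) : LineHol (residueDen (m := m)) U := by
  refine LineHol.prod fun i _ => LineHol.prod fun j _ => DifferentiableOn.lineHol ?_
  fun_prop

lemma lineHol_residueNum (σ : ℤˣ) {δ : ℝ} (hδ : δ ≤ 1 / 8) :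
    LineHol (residueNum (m := m) σ) {s | ∀ i, 1 / 2 - δ < (s i).re} := by
  have hsub : {s : Fin m → ℂ | ∀ i, 1 / 2 - δ < (s i).re} ⊆ {s | ∀ i, 3 / 8 < (s i).re} :=
    fun s hs i => by have := hs i; linarith
  refine LineHol.mul ((differentiableOn_gammaProd σ).lineHol.mono fun s hs i => ?_)
    (LineHol.mul (LineHol.mul (differentiableOn_const _).lineHol ((lineHol_eulerProd m).mono hsub))
      (LineHol.prod fun i _ => LineHol.prod fun j _ => DifferentiableOn.lineHol ?_))
  · have := hs i; linarith
  · exact differentiable_zetaReg.comp_differentiableOn (by fun_prop)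

/-- The residue at `w = 1` in the region of absolute convergence, multiplied by `residueDen s`,
which cancels the poles of the factors `ζ(s_i + s_j)`. -/
lemma tendsto_sub_one_mul_completedSeries (σ : ℤˣ) {s : Fin m → ℂ} (hs : ∀ i, 1 < (s i).re) :
    Tendsto (fun x : ℝ => residueDen s * (((x : ℂ) - 1) * completedSeries σ s x)) (𝓝[>] 1)
      (𝓝 (residueNum σ s)) := by
  have h := ((tendsto_momentSeries_residue σ hs).const_mul (gammaProd σ s)).const_mul (residueDen s)
  rw [tsum_tupleCoeff_squareWeight hs] at h
  have hz : ∏ i, ∏ j ∈ Finset.Ici i, zetaReg (s i + s j) =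
      residueDen s * ∏ i, ∏ j ∈ Finset.Ici i, riemannZeta (s i + s j) := by
    rw [residueDen, ← Finset.prod_mul_distrib]
    refine Finset.prod_congr rfl fun i _ => ?_
    rw [← Finset.prod_mul_distrib]
    refine Finset.prod_congr rfl fun j _ => zetaReg_of_ne_one fun h1 => ?_
    have h2 := congrArg re h1
    rw [add_re, one_re] at h2
    linarith [hs i, hs j]
  have e : residueNum σ s = residueDen s * (gammaProd σ s * (3 / (Real.pi : ℂ) ^ 2 *
      (eulerProd s * ∏ i, ∏ j ∈ Finset.Ici i, riemannZeta (s i + s j)))) := by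
    rw [residueNum, hz]; ring
  rw [e]
  refine h.congr fun x => ?_
  change _ = residueDen s * (((x : ℂ) - 1) * (gammaProd σ s * momentSeries σ s x))
  ring

/-- For generic `s` near the centre, the continuation has a simple pole at `w = 1`, with the
residue continued from the region of absolute convergence. -/
theorem IsContinuation.subset_closure_residue {σ : ℤˣ} {δ : ℝ} {k : (Fin m → Fin 2) → ℕ}
    {F : (Fin m → ℂ) × ℂ → ℂ} (hδ0 : 0 < δ) (hδ : δ ≤ 1 / 8) (hF : IsContinuation σ δ k F) :
    {s : Fin m → ℂ | ∀ i, 1 / 2 - δ < (s i).re} ⊆ closure (interior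
      {s | Tendsto (fun w => residueDen s * ((w - 1) * F (s, w))) (𝓝[≠] 1)
        (𝓝 (residueNum σ s))}) := by
  have hmero : IsMeromorphicOn (fun z : (Fin m → ℂ) × ℂ => (z.2 - 1) * F z)
      ({s : Fin m → ℂ | ∀ i, 1 / 2 - δ < (s i).re} ×ˢ {1}) := by
    rintro ⟨s, w⟩ ⟨hs, hw⟩
    obtain rfl : w = 1 := hw
    obtain ⟨f, g, hf, hg, hne, h⟩ := hF.mero (s, 1) (by
      rw [mem_boxTube]; exact ⟨hs, by simp [hδ0]⟩)
    refine ⟨fun z => (z.2 - 1) * f z, g, (analyticAt_snd.sub analyticAt_const).mul hf, hg, hne, ?_⟩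
    filter_upwards [h] with z hz hgz
    rw [hz hgz, mul_div_assoc]
  refine hmero.subset_closure_tendsto (isOpen_re_gt _) ?_ (lineHol_residueNum σ hδ)
    (lineHol_residueDen _) ⟨fun _ => 1, fun i => by simp; linarith, ?_⟩ (isOpen_re_gt 1)
    ⟨fun _ => 2, fun i => by simp; linarith, fun i => by simp⟩ ?_
  · intro x hx y hy a b ha hb hab i
    simpa using convex_Ioi (1 / 2 - δ) (hx i) (hy i) ha hb hab
  · exact Finset.prod_ne_zero_iff.mpr fun i _ => Finset.prod_ne_zero_iff.mpr fun j _ => by norm_num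
  · intro s hs
    refine ⟨map (fun x : ℝ => (x : ℂ)) (𝓝[>] 1), inferInstance, tendsto_ofReal_nhdsGT_one, ?_⟩
    rw [tendsto_map'_iff]
    refine (tendsto_sub_one_mul_completedSeries σ hs).congr' ?_
    filter_upwards [self_mem_nhdsWithin] with x hx
    have hx1 : 1 < (x : ℂ).re := by simpa using hx
    rw [Function.comp_apply, hF.eq_series s x hs hx1]

/-- `∏_{ε ≠ 0} polarForm ε ^ κ ε`. -/
noncomputable def otherForms (κ : (Fin m → Fin 2) → ℕ) (z : (Fin m → ℂ) × ℂ) : ℂ :=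
  ∏ ε ∈ Finset.univ.erase 0, polarForm ε z ^ κ ε

lemma analyticAt_otherForms (κ : (Fin m → Fin 2) → ℕ) (z : (Fin m → ℂ) × ℂ) :
    AnalyticAt ℂ (otherForms κ) z :=
  Finset.analyticAt_fun_prod _ fun ε _ => (analyticAt_polarForm ε z).pow _

lemma exists_pos_eq_one {ε : Fin m → Fin 2} (hε : ε ≠ 0) : ∃ i, ε i = 1 := by
  by_contra! h
  exact hε (funext fun i => by have := h i; simp only [Pi.zero_apply]; omega)

lemma polarForm_diag_ne_zero {ε : Fin m → Fin 2} (hε : ε ≠ 0) {t : ℝ} (ht : t ≠ 0) :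
    polarForm ε ((fun _ => 1 / 2 + (t : ℂ), 1) : (Fin m → ℂ) × ℂ) ≠ 0 := by
  have h1 : polarForm ε ((fun _ => 1 / 2 + (t : ℂ), 1) : (Fin m → ℂ) × ℂ) =
      ((∑ i, (ε i : ℕ) : ℕ) : ℂ) * t := by
    rw [polarForm_eq, sub_self, zero_add, Nat.cast_sum, Finset.sum_mul]
    exact Finset.sum_congr rfl fun i _ => by ring
  rw [h1]
  obtain ⟨i, hi⟩ := exists_pos_eq_one hε
  refine mul_ne_zero (Nat.cast_ne_zero.mpr fun h => ?_) (by exact_mod_cast ht)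
  have := (Finset.sum_eq_zero_iff.mp h) i (Finset.mem_univ i)
  rw [hi] at this
  simp at this

/-- The multiplicity of the hyperplane `w = 1` is one, and the residue along it is known. -/
theorem IsContinuation.residue_of_hasLocalForm {σ : ℤˣ} {δ : ℝ} {k κ : (Fin m → Fin 2) → ℕ}
    {F φ : (Fin m → ℂ) × ℂ → ℂ} (hδ0 : 0 < δ) (hδ : δ ≤ 1 / 8) (hF : IsContinuation σ δ k F)
    (hφ : HasLocalForm F φ κ) (hκ : 1 ≤ κ 0)
    (hne : ∃ᶠ z in 𝓝 (centerPoint m), polarForm 0 z = 0 ∧ φ z ≠ 0) :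
    κ 0 = 1 ∧ ∀ᶠ s in 𝓝 (fun _ : Fin m => (1 / 2 : ℂ)),
      residueDen s * φ (s, 1) = residueNum σ s * otherForms κ (s, 1) := by
  obtain ⟨ρ, hρ, hball⟩ := Metric.eventually_nhds_iff_ball.mp
    (hφ.1.eventually_analyticAt.and hφ.2)
  set c : Fin m → ℂ := fun _ => 1 / 2 with hc
  set r := min ρ δ with hr
  have hr0 : 0 < r := lt_min hρ hδ0
  set U := Metric.ball c r with hU
  have hUK : U ⊆ {s : Fin m → ℂ | ∀ i, 1 / 2 - δ < (s i).re} := by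
    intro s hs i
    have h1 : dist (s i) (c i) < r := (dist_pi_lt_iff hr0).mp hs i
    have h2 : |(s i - c i).re| < r := (abs_re_le_norm _).trans_lt (by rwa [dist_eq_norm] at h1)
    have h3 := (abs_lt.mp h2).1
    have h4 : r ≤ δ := min_le_right _ _
    have h5 : (c i).re = 1 / 2 := by simp [hc]
    rw [sub_re, h5] at h3
    linarith
  have hmem : ∀ {s : Fin m → ℂ} {w : ℂ}, s ∈ U → dist w 1 < ρ →
      (s, w) ∈ Metric.ball (centerPoint m) ρ := by
    intro s w hs hw
    rw [Metric.mem_ball, Prod.dist_eq, max_lt_iff]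
    exact ⟨lt_of_lt_of_le hs (min_le_left _ _), hw⟩
  have hline : ∀ s : Fin m → ℂ, AnalyticAt ℂ (fun s : Fin m → ℂ => (s, (1 : ℂ))) s :=
    fun s => analyticAt_id.prod analyticAt_const
  have hφU : ContinuousOn (fun s => φ (s, 1)) U := fun s hs => by
    have h1 := (hball (s, 1) (hmem hs (by simpa using hρ))).1.continuousAt
    exact (ContinuousAt.comp (g := φ) (f := fun s : Fin m → ℂ => (s, (1 : ℂ))) h1
      (hline s).continuousAt).continuousWithinAt
  -- a dense open set of `s`, where the residue exists and the other factors do not vanish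
  set D : (Fin m → ℂ) → ℂ := fun s => residueDen s * otherForms (fun _ => 1) (s, 1) with hD
  have hDhol : LineHol D U := by
    refine (lineHol_residueDen U).mul (AnalyticOnNhd.lineHol fun s _ => ?_)
    exact AnalyticAt.fun_comp (g := otherForms fun _ => 1) (analyticAt_otherForms _ _) (hline s)
  have hDne : ∃ s ∈ U, D s ≠ 0 := by
    refine ⟨fun _ => 1 / 2 + ((r / 2 : ℝ) : ℂ), (dist_pi_lt_iff hr0).mpr fun i => ?_, ?_⟩
    · rw [hc, dist_eq_norm, add_sub_cancel_left, norm_real, Real.norm_of_nonneg (by positivity)]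
      linarith
    · refine mul_ne_zero (Finset.prod_ne_zero_iff.mpr fun i _ => Finset.prod_ne_zero_iff.mpr
        fun j _ => ?_) (Finset.prod_ne_zero_iff.mpr fun ε hε => ?_)
      · have : (1 / 2 + ((r / 2 : ℝ) : ℂ) + (1 / 2 + ((r / 2 : ℝ) : ℂ)) - 1) = (r : ℂ) := by
          push_cast; ring
        rw [this]; exact_mod_cast hr0.ne'
      · rw [pow_one]
        exact polarForm_diag_ne_zero (Finset.ne_of_mem_erase hε) (by positivity)
  have hDd := hDhol.subset_closure_ne_zero Metric.isOpen_ball (convex_ball _ _) hDne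
  have hDo := hDhol.isOpen_ne_zero Metric.isOpen_ball
  set T := {s : Fin m → ℂ | Tendsto (fun w => residueDen s * ((w - 1) * F (s, w))) (𝓝[≠] 1)
    (𝓝 (residueNum σ s))} with hT
  have hdense : U ⊆ closure ((U ∩ {s | D s ≠ 0}) ∩ interior T) :=
    subset_closure_inter_of_isOpen Metric.isOpen_ball hDo hDd
      (hUK.trans (hF.subset_closure_residue hδ0 hδ))
  -- for generic `s` compare two expressions for the limit of `(w - 1) F (s, w)` as `w → 1`
  have hgen : ∀ s ∈ (U ∩ {s | D s ≠ 0}) ∩ interior T,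
      residueDen s * φ (s, 1) = residueNum σ s * (0 ^ (κ 0 - 1) * otherForms κ (s, 1)) := by
    rintro s ⟨⟨hs, hDs⟩, hsT⟩
    have hsT' : s ∈ T := interior_subset hsT
    have hlin : ∀ w : ℂ, AnalyticAt ℂ (fun w : ℂ => (s, w)) w :=
      fun w => analyticAt_const.prod analyticAt_id
    have hoth : ∀ ε ∈ Finset.univ.erase (0 : Fin m → Fin 2), polarForm ε (s, (1 : ℂ)) ≠ 0 := by
      intro ε hε h0
      exact hDs (mul_eq_zero_of_right _ (Finset.prod_eq_zero hε (by rw [h0, pow_one])))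
    have hev : ∀ᶠ w in 𝓝[≠] (1 : ℂ), ∀ ε, polarForm ε (s, w) ≠ 0 := by
      refine eventually_all.mpr fun ε => ?_
      by_cases hε : ε = 0
      · filter_upwards [self_mem_nhdsWithin] with w hw
        rw [hε, polarForm_zero]
        exact sub_ne_zero.mpr hw
      · exact ((AnalyticAt.fun_comp (g := polarForm ε) (analyticAt_polarForm _ _)
          (hlin 1)).continuousAt.eventually_ne
          (hoth ε (Finset.mem_erase.mpr ⟨hε, Finset.mem_univ _⟩))).filter_mono nhdsWithin_le_nhds
    have hc1 : Tendsto (fun w : ℂ => residueDen s * φ (s, w)) (𝓝[≠] 1)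
        (𝓝 (residueDen s * φ (s, 1))) := by
      refine Tendsto.const_mul _ (Tendsto.mono_left ?_ nhdsWithin_le_nhds)
      exact (AnalyticAt.fun_comp (g := φ) (hball (s, 1) (hmem hs (by simpa using hρ))).1
        (hlin 1)).continuousAt
    have hc2 : Tendsto (fun w : ℂ => (w - 1) ^ (κ 0 - 1) * otherForms κ (s, w)) (𝓝[≠] 1)
        (𝓝 (0 ^ (κ 0 - 1) * otherForms κ (s, 1))) := by
      refine Tendsto.mono_left ?_ nhdsWithin_le_nhds
      have h1 : Tendsto (fun w : ℂ => (w - 1) ^ (κ 0 - 1)) (𝓝 1) (𝓝 (0 ^ (κ 0 - 1))) :=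
        (by fun_prop : Continuous fun w : ℂ => (w - 1) ^ (κ 0 - 1)).tendsto' _ _ (by simp)
      exact h1.mul (AnalyticAt.fun_comp (g := otherForms κ) (analyticAt_otherForms _ _)
        (hlin 1)).continuousAt
    refine tendsto_nhds_unique (hc1.congr' ?_) (Tendsto.mul hsT' hc2)
    filter_upwards [hev, self_mem_nhdsWithin,
      mem_nhdsWithin_of_mem_nhds (Metric.ball_mem_nhds (1 : ℂ) hρ)] with w hw hw1 hwρ
    have hwsub : w - 1 ≠ 0 := sub_ne_zero.mpr hw1
    have hsplit : ∏ ε, polarForm ε (s, w) ^ κ ε = (w - 1) ^ κ 0 * otherForms κ (s, w) := by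
      rw [otherForms, ← Finset.mul_prod_erase _ _ (Finset.mem_univ (0 : Fin m → Fin 2)),
        polarForm_zero]
    have hne0 : otherForms κ (s, w) ≠ 0 :=
      Finset.prod_ne_zero_iff.mpr fun ε _ => pow_ne_zero _ (hw ε)
    rw [(hball (s, w) (hmem hs hwρ)).2 hw, hsplit]
    obtain ⟨n, hn⟩ := Nat.exists_eq_add_of_le' hκ
    rw [hn, Nat.add_sub_cancel, pow_succ]
    field_simp
  have hcont1 : ContinuousOn (fun s => residueDen s * φ (s, 1)) U :=
    (lineHol_residueDen U).cont.mul hφU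
  have hcont2 : ContinuousOn (fun s => residueNum σ s * (0 ^ (κ 0 - 1) * otherForms κ (s, 1))) U :=
    ((lineHol_residueNum σ hδ).mono hUK).cont.mul (continuousOn_const.mul fun s _ =>
      (AnalyticAt.fun_comp (g := otherForms κ) (analyticAt_otherForms _ _)
        (hline s)).continuousAt.continuousWithinAt)
  have hall : ∀ s ∈ U,
      residueDen s * φ (s, 1) = residueNum σ s * (0 ^ (κ 0 - 1) * otherForms κ (s, 1)) := by
    intro s hs
    refine eq_of_frequently_eq (hcont1.continuousAt (Metric.isOpen_ball.mem_nhds hs))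
      (hcont2.continuousAt (Metric.isOpen_ball.mem_nhds hs)) ?_
    exact (mem_closure_iff_frequently.mp (hdense hs)).mono hgen
  -- for `κ 0 > 1` the numerator would vanish on the hyperplane, contrary to the definition of the
  -- polar divisor
  have hκ1 : κ 0 = 1 := by
    by_contra hκ1
    have hz : ∀ s ∈ U, φ (s, 1) = 0 := by
      intro s hs
      refine eq_of_frequently_eq (p := fun s => φ (s, 1)) (q := fun _ => 0)
        (hφU.continuousAt (Metric.isOpen_ball.mem_nhds hs)) continuousAt_const ?_
      refine (mem_closure_iff_frequently.mp (hDd hs)).mono fun y hy => ?_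
      have h1 := hall y hy.1
      rw [zero_pow (by omega), zero_mul, mul_zero] at h1
      exact (mul_eq_zero.mp h1).resolve_left fun h => hy.2 (mul_eq_zero_of_left h _)
    obtain ⟨⟨s, w⟩, ⟨hz0, hz1⟩, hzU⟩ := (hne.and_eventually
      (Metric.ball_mem_nhds (centerPoint m) hr0)).exists
    rw [polarForm_zero, sub_eq_zero] at hz0
    obtain rfl : w = 1 := hz0
    have hsU : dist s c < r := lt_of_le_of_lt (le_max_left _ _) hzU
    exact hz1 (hz s hsU)
  refine ⟨hκ1, ?_⟩
  filter_upwards [Metric.ball_mem_nhds c hr0] with s hs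
  have := hall s hs
  rwa [hκ1, Nat.sub_self, pow_zero, one_mul] at this

end PolarResidue

/-! ### Divided differences of analytic functions -/

section DividedDifference

open Polynomial

variable {E : Type*} [NormedAddCommGroup E] [NormedSpace ℂ E]

/-- A homogeneous polynomial of degree `n` is on the line `A + v B` a polynomial in `v` with leading
coefficient its value at `B`. -/
lemma ContinuousMultilinearMap.exists_polynomial_eval {n : ℕ}
    (p : ContinuousMultilinearMap ℂ (fun _ : Fin n => E) ℂ) (A B : E) :
    ∃ q : ℂ[X], q.natDegree ≤ n ∧ q.coeff n = p (fun _ => B) ∧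
      ∀ v : ℂ, q.eval v = p (fun _ => A + v • B) := by
  refine ⟨∑ s : Finset (Fin n), C (p (s.piecewise (fun _ => B) fun _ => A)) * X ^ s.card, ?_, ?_,
    fun v => ?_⟩
  · exact natDegree_sum_le_of_forall_le _ _ fun s _ =>
      (natDegree_C_mul_X_pow_le _ _).trans (by simpa using s.card_le_univ)
  · rw [finsetSum_coeff, Finset.sum_eq_single Finset.univ]
    · simp
    · intro s _ hs
      rw [coeff_C_mul_X_pow, if_neg fun h => hs ?_]
      exact Finset.eq_univ_of_card s (by simp [← h])
    · simp
  · have h1 : (fun _ : Fin n => A + v • B) = (fun _ => v • B) + fun _ => A :=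
      funext fun _ => add_comm _ _
    rw [eval_finsetSum, h1, p.map_add_univ]
    refine Finset.sum_congr rfl fun s _ => ?_
    have h2 := p.map_piecewise_smul (fun _ => v) (s.piecewise (fun _ => B) fun _ => A) s
    rw [Finset.prod_const, smul_eq_mul] at h2
    rw [eval_C_mul, eval_X_pow, mul_comm, ← h2]
    congr 1
    ext i
    by_cases hi : i ∈ s <;> simp [hi]

/-- Taylor expansion along a complex line. -/
lemma HasFPowerSeriesAt.isBigO_line {f : E → ℂ} {x : E} {P : FormalMultilinearSeries ℂ E ℂ}
    (hf : HasFPowerSeriesAt f P x) (y : E) (k : ℕ) :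
    (fun t : ℂ => f (x + t • y) - P.partialSum k (t • y)) =O[𝓝 0] fun t => t ^ k := by
  have ht : Tendsto (fun t : ℂ => t • y) (𝓝 0) (𝓝 0) :=
    (by fun_prop : Continuous fun t : ℂ => t • y).tendsto' _ _ (zero_smul _ _)
  refine ((hf.isBigO_sub_partialSum_pow k).comp_tendsto ht).trans
    (IsBigO.of_bound (‖y‖ ^ k) (Eventually.of_forall fun t => ?_))
  simp [norm_smul, mul_pow, mul_comm]

lemma tendsto_div_pow_of_isBigO {g : ℂ → ℂ} {n : ℕ} {b : ℂ}
    (hO : (fun t : ℂ => g t - t ^ n * b) =O[𝓝 0] fun t => t ^ (n + 1)) :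
    Tendsto (fun t => g t / t ^ n) (𝓝[≠] 0) (𝓝 b) := by
  have hT : Tendsto (fun t : ℂ => t ^ (n + 1) / t ^ n) (𝓝[≠] 0) (𝓝 0) := by
    refine (tendsto_id.mono_left nhdsWithin_le_nhds).congr' ?_
    filter_upwards [self_mem_nhdsWithin] with t ht
    have : t ≠ 0 := ht
    rw [id, pow_succ]; field_simp
  have h3 := ((hO.mono nhdsWithin_le_nhds).mul (isBigO_refl (fun t : ℂ => (t ^ n)⁻¹)
    (𝓝[≠] 0))).trans_tendsto (by simpa only [div_eq_mul_inv] using hT)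
  have h4 := h3.add_const b
  rw [zero_add] at h4
  refine h4.congr' ?_
  filter_upwards [self_mem_nhdsWithin] with t ht
  have : t ≠ 0 := ht
  field_simp
  ring

/-- The divided differences of an analytic function, at nodes shrinking to a point, pick out one
of its Taylor coefficients: by homogeneity the terms of other orders are polynomials of the wrong
degree in the nodes, or negligible. -/
theorem HasFPowerSeriesAt.tendsto_dividedDifference {ι : Type*} [Fintype ι] [DecidableEq ι]
    {f : E → ℂ} {x : E} {P : FormalMultilinearSeries ℂ E ℂ} (hf : HasFPowerSeriesAt f P x)
    (A B : E) {c : ι → ℂ} (hc : Function.Injective c) {j n : ℕ}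
    (hcard : Fintype.card ι = j + n + 1) :
    Tendsto (fun t : ℂ => (∑ i, c i ^ j * f (x + t • (A + c i • B)) /
      ∏ i' ∈ Finset.univ.erase i, (c i - c i')) / t ^ n) (𝓝[≠] 0) (𝓝 (P n fun _ => B)) := by
  choose q hq1 hq2 hq3 using fun k => (P k).exists_polynomial_eval A B
  -- `v ^ j q_k(v)` has degree at most `j + k`, one less than the number of nodes if `k = n`, and
  -- smaller if `k < n`; the divided difference is its coefficient of order `j + n`
  have hlag : ∀ k ≤ n, ∑ i, c i ^ j * (q k).eval (c i) / ∏ i' ∈ Finset.univ.erase i, (c i - c i') =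
      if k = n then P n fun _ => B else 0 := by
    intro k hk
    have hdeg : (X ^ j * q k).degree < ((Finset.univ : Finset ι).card : WithBot ℕ) := by
      refine lt_of_le_of_lt degree_le_natDegree (Nat.cast_lt.mpr ?_)
      rw [Finset.card_univ, hcard]
      have := natDegree_mul_le (p := (X : ℂ[X]) ^ j) (q := q k)
      rw [natDegree_X_pow] at this
      have := hq1 k
      omega
    have h1 := Lagrange.coeff_eq_sum (hc.injOn (s := (Finset.univ : Finset ι))) hdeg
    rw [Finset.card_univ, hcard, Nat.add_sub_cancel, add_comm j n, coeff_X_pow_mul] at h1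
    simp only [eval_mul, eval_pow, eval_X] at h1
    rw [← h1]
    split_ifs with h
    · rw [h, hq2]
    · exact coeff_eq_zero_of_natDegree_lt (lt_of_le_of_lt (hq1 k) (by omega))
  have hpart : ∀ t : ℂ, ∑ i, c i ^ j * P.partialSum (n + 1) (t • (A + c i • B)) /
      ∏ i' ∈ Finset.univ.erase i, (c i - c i') = t ^ n * P n fun _ => B := by
    intro t
    have h1 : ∀ i, P.partialSum (n + 1) (t • (A + c i • B)) =
        ∑ k ∈ Finset.range (n + 1), t ^ k * (q k).eval (c i) := fun i =>
      Finset.sum_congr rfl fun k _ => by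
        rw [hq3, (P k).map_smul_univ (fun _ => t) fun _ => A + c i • B]; simp
    simp only [h1, Finset.mul_sum, Finset.sum_div]
    rw [Finset.sum_comm, Finset.sum_eq_single n]
    · rw [← if_pos (c := n = n) (t := P n fun _ => B) (e := 0) rfl, ← hlag n le_rfl,
        Finset.mul_sum]
      exact Finset.sum_congr rfl fun i _ => by ring
    · intro k hk hkn
      have := hlag k (by simpa [Nat.lt_succ_iff] using hk)
      rw [if_neg hkn] at this
      rw [← mul_zero (t ^ k), ← this, Finset.mul_sum]
      exact Finset.sum_congr rfl fun i _ => by ring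
    · simp
  refine tendsto_div_pow_of_isBigO ?_
  simp only [← hpart, ← Finset.sum_sub_distrib]
  refine IsBigO.fun_sum fun i _ => ?_
  have h2 := (hf.isBigO_line (A + c i • B) (n + 1)).const_mul_left
    (c i ^ j / ∏ i' ∈ Finset.univ.erase i, (c i - c i'))
  exact h2.congr_left fun t => by ring

/-- An analytic function of one variable whose Taylor coefficients of order below `n` vanish is
divisible by the `n`-th power of the variable. -/
lemma HasFPowerSeriesAt.exists_pow_mul {f : E → ℂ} {x : E} {P : FormalMultilinearSeries ℂ E ℂ}
    (hf : HasFPowerSeriesAt f P x) (B : E) (w₀ : ℂ) {n : ℕ}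
    (h0 : ∀ k < n, (P k fun _ => B) = 0) :
    ∃ φ : ℂ → ℂ, AnalyticAt ℂ φ w₀ ∧ φ w₀ = (P n fun _ => B) ∧
      ∀ᶠ w in 𝓝 w₀, f (x + (w - w₀) • B) = (w - w₀) ^ n * φ w := by
  have hg : AnalyticAt ℂ (fun w : ℂ => f (x + (w - w₀) • B)) w₀ := by
    refine AnalyticAt.fun_comp (g := f) (f := fun w => x + (w - w₀) • B) ?_ (by fun_prop)
    simpa using hf.analyticAt
  have hpt : ∀ t : ℂ, P.partialSum (n + 1) (t • B) = t ^ n * P n fun _ => B := by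
    intro t
    rw [FormalMultilinearSeries.partialSum, Finset.sum_eq_single n]
    · rw [(P n).map_smul_univ (fun _ => t) fun _ => B]; simp
    · intro k hk hkn
      rw [(P k).map_smul_univ (fun _ => t) fun _ => B, h0 k (by
        have := Finset.mem_range.mp hk; omega), smul_zero]
    · simp
  have hlim : Tendsto (fun w : ℂ => f (x + (w - w₀) • B) / (w - w₀) ^ n) (𝓝[≠] w₀)
      (𝓝 (P n fun _ => B)) := by
    have hsub : Tendsto (fun w : ℂ => w - w₀) (𝓝[≠] w₀) (𝓝[≠] 0) :=
      tendsto_nhdsWithin_iff.mpr ⟨((continuous_sub_right w₀).tendsto' _ _ (sub_self _)).mono_left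
        nhdsWithin_le_nhds, by filter_upwards [self_mem_nhdsWithin] with w hw using sub_ne_zero.mpr hw⟩
    refine (tendsto_div_pow_of_isBigO (g := fun t => f (x + t • B)) ?_).comp hsub
    simpa only [hpt] using hf.isBigO_line B (n + 1)
  obtain ⟨φ, hφ, heq⟩ := (natCast_le_analyticOrderAt hg).mp
    ((natCast_le_analyticOrderAt_iff_iteratedDeriv_eq_zero hg).mpr
      (hg.iteratedDeriv_eq_zero_of_tendsto le_rfl hlim))
  refine ⟨φ, hφ, tendsto_nhds_unique (hφ.continuousAt.tendsto.mono_left nhdsWithin_le_nhds)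
    (hlim.congr' ?_), heq⟩
  filter_upwards [self_mem_nhdsWithin, nhdsWithin_le_nhds heq] with w hw hw2
  have : w - w₀ ≠ 0 := sub_ne_zero.mpr hw
  rw [hw2, smul_eq_mul]
  field_simp

end DividedDifference

/-! ### The residues along all hyperplanes -/

section LocalForm

open Complex Set

variable {m : ℕ}

/-- The order `m (m + 1) / 2 + 1` of the pole does not exceed the number of hyperplanes. -/
lemma triangle_lt_two_pow (m : ℕ) : m * (m + 1) / 2 < 2 ^ m := by
  induction m with
  | zero => simp
  | succ m ih =>
    rw [triangle_succ, pow_succ]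
    have := Nat.lt_two_pow_self (n := m)
    omega

/-- All multiplicities of a continuation are one, and the functional equations give its residues
along all the polar hyperplanes. -/
theorem IsContinuation.exists_residues {σ : ℤˣ} {δ : ℝ} {k : (Fin m → Fin 2) → ℕ}
    {F : (Fin m → ℂ) × ℂ → ℂ} (hδ0 : 0 < δ) (hδ : δ ≤ 1 / 8) (hF : IsContinuation σ δ k F)
    (hk : ∀ ε, 1 ≤ k ε) : ∃ f, HasLocalForm F f (fun _ => 1) ∧
      ∀ ε, ∀ᶠ s in 𝓝 (fun _ : Fin m => (1 / 2 : ℂ)),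
        residueDen s * f (reflection ε (s, 1)) =
          residueNum σ s * otherForms (fun _ => 1) (s, 1) := by
  obtain ⟨f, hfa, hform, hne⟩ := hF.polar
  have hloc : HasLocalForm F f k := ⟨hfa, hform⟩
  -- the reflection of `ε` carries the hyperplane of `ε` to `w = 1`, where the residue is known
  have hres := fun ε => hF.residue_of_hasLocalForm hδ0 hδ
    (hF.hasLocalForm_reflection hδ0 hδ hloc ε) (hk _) (by
      have hr := (analyticAt_reflection ε (centerPoint m)).continuousAt.tendsto
      rw [reflection_centerPoint] at hr
      refine hr.frequently (p := fun z => polarForm 0 z = 0 ∧ f (reflection ε z) ≠ 0)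
        ((hne ε).mono fun z hz => ?_)
      rwa [polarForm_reflection, zero_add, reflection_reflection])
  have hk1 : k = fun _ => 1 := funext fun ε => by simpa using (hres ε).1
  subst hk1
  exact ⟨f, hloc, fun ε => (hres ε).2⟩

/-- Along the line through the centre in the direction `(a, -∑ ε_i a_i)` the residue formula of
the hyperplane of `ε` gives the values of the numerator of the local form. -/
lemma residue_formula_on_line {ε : Fin m → Fin 2} {a : Fin m → ℂ}
    {c : (Fin m → Fin 2) → ℂ} (hc : c = fun ε => -∑ i, ((ε i : ℕ) : ℂ) * a i) {f : (Fin m → ℂ) × ℂ → ℂ}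
    {t r : ℂ}
    (h : residueDen (fun i => 1 / 2 + t * (fsgn (ε i) * a i)) *
        f (reflection ε (fun i => 1 / 2 + t * (fsgn (ε i) * a i), 1)) =
      r * otherForms (fun _ => 1) (fun i => 1 / 2 + t * (fsgn (ε i) * a i), 1)) :
    t ^ (m * (m + 1) / 2) * (∏ i, ∏ j ∈ Finset.Ici i, (fsgn (ε i) * a i + fsgn (ε j) * a j)) *
        f (centerPoint m + t • (((a, 0) : (Fin m → ℂ) × ℂ) + c ε • ((0, 1) : (Fin m → ℂ) × ℂ))) =
      r * (t ^ (2 ^ m - 1) * ∏ ε' ∈ Finset.univ.erase ε, (c ε - c ε')) := by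
  set s : Fin m → ℂ := fun i => 1 / 2 + t * (fsgn (ε i) * a i) with hs
  set y := centerPoint m + t • (((a, 0) : (Fin m → ℂ) × ℂ) + c ε • ((0, 1) : (Fin m → ℂ) × ℂ))
    with hy
  have hy1 : ∀ i, y.1 i = 1 / 2 + t * a i := fun i => by simp [hy, centerPoint]
  have hy2 : y.2 = 1 + t * c ε := by simp [hy, centerPoint]
  have hρ : reflection ε (s, 1) = y := by
    refine Prod.ext (funext fun i => ?_) ?_
    · have h1 := reflection_fst_sub_half ε (s, 1) i
      rw [hy1, ← sub_eq_iff_eq_add', h1]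
      linear_combination (t * a i) * fsgn_mul_self (ε i)
    · rw [hy2, hc]
      simp only [reflection, hs, mul_neg, Finset.mul_sum, ← Finset.sum_neg_distrib]
      congr 1
      refine Finset.sum_congr rfl fun i _ => ?_
      rw [fsgn_eq]
      generalize ε i = e
      fin_cases e <;> simp; ring
  have hden : residueDen s = t ^ (m * (m + 1) / 2) *
      ∏ i, ∏ j ∈ Finset.Ici i, (fsgn (ε i) * a i + fsgn (ε j) * a j) := by
    rw [← prod_Ici_const, ← Finset.prod_mul_distrib, residueDen]
    refine Finset.prod_congr rfl fun i _ => ?_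
    rw [← Finset.prod_mul_distrib]
    exact Finset.prod_congr rfl fun j _ => by simp only [hs]; ring
  have hoth : otherForms (fun _ => 1) (s, 1) =
      t ^ (2 ^ m - 1) * ∏ ε' ∈ Finset.univ.erase ε, (c ε - c ε') := by
    have hcard : (Finset.univ.erase ε).card = 2 ^ m - 1 := by
      rw [Finset.card_erase_of_mem (Finset.mem_univ _)]; simp
    rw [← hcard, ← Finset.prod_const, ← Finset.prod_mul_distrib, otherForms]
    refine Finset.prod_nbij' (· + ε) (· + ε) (fun ε' h' => ?_) (fun ε' h' => ?_)
      (fun ε' _ => by simp only [add_assoc, add_self_fin_two, add_zero])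
      (fun ε' _ => by simp only [add_assoc, add_self_fin_two, add_zero]) fun ε' _ => ?_
    · simpa using h'
    · simp only [Finset.mem_erase, Finset.mem_univ, and_true] at h' ⊢
      intro h0
      refine h' ?_
      rw [← add_zero ε', ← add_self_fin_two ε, ← add_assoc, h0, zero_add]
    · rw [pow_one, ← reflection_reflection ε (s, 1), polarForm_reflection, hρ, polarForm_eq, hy2, hc]
      simp only [hy1, add_sub_cancel_left, sub_neg_eq_add, mul_left_comm _ t, ← Finset.mul_sum,
        mul_add, Pi.add_apply]
  rw [← hden, ← hoth, ← hρ, h]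

/-- The numerator of the local form on the line `s = (1/2, …, 1/2)`: its vanishing order at `w = 1`
reduces the order of the pole to `m (m + 1) / 2 + 1`, and its leading coefficient comes from the sum
of the residues along all hyperplanes. For a fixed direction `a` the line `s = 1/2 + t a` meets the
hyperplanes at the heights `w = 1 + t c_ε`. There the numerator is known from the residues, up to
functions that are continuous at `t = 0`, and divided differences over the `2 ^ m` nodes `c_ε` yield
its Taylor coefficients in `w`. -/
theorem IsContinuation.exists_numerator {σ : ℤˣ} {δ : ℝ} {k : (Fin m → Fin 2) → ℕ}
    {F : (Fin m → ℂ) × ℂ → ℂ} (hδ0 : 0 < δ) (hδ : δ ≤ 1 / 8) (hF : IsContinuation σ δ k F)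
    (hk : ∀ ε, 1 ≤ k ε) : ∃ f φ, HasLocalForm F f (fun _ => 1) ∧ AnalyticAt ℂ φ 1 ∧
      φ 1 = residueNum σ (fun _ : Fin m => 1 / 2) * ((m * (m + 1) / 2).factorial *
        ∏ ℓ ∈ Finset.Icc 1 m, (ℓ.factorial : ℂ) / ((2 * ℓ).factorial : ℂ)) ∧
      ∀ᶠ w in 𝓝 (1 : ℂ), f (fun _ => 1 / 2, w) =
        (w - 1) ^ (2 ^ m - 1 - m * (m + 1) / 2) * φ w := by
  obtain ⟨f, hloc, hres⟩ := hF.exists_residues hδ0 hδ hk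
  obtain ⟨P, hP⟩ := hloc.1
  set M := m * (m + 1) / 2 with hM
  have hMN : M < 2 ^ m := triangle_lt_two_pow m
  -- with `a_i = 2 ^ i` the nodes `c_ε` are the negatives of the integers with binary digits `ε`,
  -- hence distinct, and no `± a_i ± a_j` with `i ≤ j` and one sign for each index vanishes
  set a : Fin m → ℂ := fun i => 2 ^ (i : ℕ) with ha
  have ha0 : ∀ i, a i ≠ 0 := fun i => pow_ne_zero _ two_ne_zero
  have ha2 : ∀ i j, i ≠ j → a i ^ 2 ≠ a j ^ 2 := by
    intro i j hij h
    simp only [ha, ← pow_mul] at h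
    have h2 : 2 ^ ((i : ℕ) * 2) = 2 ^ ((j : ℕ) * 2) := by exact_mod_cast h
    have := Nat.pow_right_injective le_rfl h2
    exact hij (Fin.ext (by omega))
  set c : (Fin m → Fin 2) → ℂ := fun ε => -∑ i, ((ε i : ℕ) : ℂ) * a i with hc
  have hcinj : Function.Injective c := by
    intro ε ε' h
    have h1 := neg_injective h
    simp only [ha] at h1
    have h2 : ∑ i, (ε i : ℕ) * 2 ^ (i : ℕ) = ∑ i, (ε' i : ℕ) * 2 ^ (i : ℕ) := by exact_mod_cast h1
    rw [← finFunctionFinEquiv_apply, ← finFunctionFinEquiv_apply] at h2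
    exact finFunctionFinEquiv.injective (Fin.ext h2)
  set Q : (Fin m → Fin 2) → ℂ :=
    fun ε => ∏ i, ∏ j ∈ Finset.Ici i, (fsgn (ε i) * a i + fsgn (ε j) * a j) with hQ
  have hQ0 : ∀ ε, Q ε ≠ 0 := by
    refine fun ε => Finset.prod_ne_zero_iff.mpr fun i _ => Finset.prod_ne_zero_iff.mpr
      fun j _ h => ?_
    by_cases hij : i = j
    · subst hij
      have h1 := fsgn_mul_self (ε i)
      have : fsgn (ε i) * (fsgn (ε i) * a i + fsgn (ε i) * a i) = 0 := by rw [h, mul_zero]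
      refine ha0 i (by linear_combination this / 2 - a i * h1)
    · refine ha2 i j hij ?_
      linear_combination (fsgn (ε i) * a i - fsgn (ε j) * a j) * h - a i ^ 2 * fsgn_mul_self (ε i)
        + a j ^ 2 * fsgn_mul_self (ε j)
  -- `reflection ε (b ε t, 1)` is the point of the hyperplane of `ε` at height `1 + t c_ε`
  set b : (Fin m → Fin 2) → ℂ → Fin m → ℂ := fun ε t i => 1 / 2 + t * (fsgn (ε i) * a i) with hb
  have hbt : ∀ ε, Tendsto (b ε) (𝓝 0) (𝓝 fun _ => 1 / 2) := fun ε =>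
    (by fun_prop : Continuous (b ε)).tendsto' _ _ (by simp [hb])
  have hcont : ContinuousAt (residueNum (m := m) σ) fun _ => 1 / 2 :=
    (lineHol_residueNum σ hδ).cont.continuousAt ((_root_.isOpen_re_gt _).mem_nhds fun i => by simp [hδ0])
  -- the exponent `2 ^ m - 1 - n` of `c_ε` makes the number of nodes the one that isolates order
  -- `n`; for `n < 2 ^ m - 1 - M` a positive power of `t` remains, so the coefficient vanishes
  have hcoeff : ∀ n ≤ 2 ^ m - 1 - M, (P n fun _ => ((0, 1) : (Fin m → ℂ) × ℂ)) =
      0 ^ (2 ^ m - 1 - M - n) * ∑ ε, c ε ^ (2 ^ m - 1 - n) *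
        residueNum σ (fun _ : Fin m => 1 / 2) / Q ε := by
    intro n hn
    have h1 := hP.tendsto_dividedDifference ((a, 0) : (Fin m → ℂ) × ℂ) (0, 1) hcinj
      (j := 2 ^ m - 1 - n) (n := n) (by simp; omega)
    have h2 : Tendsto (fun t : ℂ => t ^ (2 ^ m - 1 - M - n) * ∑ ε, c ε ^ (2 ^ m - 1 - n) *
        residueNum σ (b ε t) / Q ε) (𝓝[≠] 0) (𝓝 (0 ^ (2 ^ m - 1 - M - n) *
          ∑ ε, c ε ^ (2 ^ m - 1 - n) * residueNum σ (fun _ : Fin m => 1 / 2) / Q ε)) := by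
      refine Tendsto.mono_left ?_ nhdsWithin_le_nhds
      refine ((continuous_id.pow _).tendsto' _ _ rfl).mul (tendsto_finsetSum _ fun ε _ => ?_)
      exact ((hcont.tendsto.comp (hbt ε)).const_mul _).div_const _
    refine tendsto_nhds_unique h1 (h2.congr' ?_)
    filter_upwards [self_mem_nhdsWithin, nhdsWithin_le_nhds (eventually_all.mpr fun ε =>
      (hbt ε).eventually (hres ε))] with t ht htε
    have ht0 : t ≠ 0 := ht
    rw [Finset.mul_sum, Finset.sum_div]
    refine Finset.sum_congr rfl fun ε _ => ?_
    have h3 := residue_formula_on_line hc (htε ε)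
    have h4 : ∏ ε' ∈ Finset.univ.erase ε, (c ε - c ε') ≠ 0 := Finset.prod_ne_zero_iff.mpr
      fun ε' hε' => sub_ne_zero.mpr fun h => Finset.ne_of_mem_erase hε' (hcinj h).symm
    have h5 : (2 : ℕ) ^ m - 1 = M + (2 ^ m - 1 - M - n) + n := by omega
    have h6 := hQ0 ε
    generalize f _ = y at h3 ⊢
    rw [← hM, h5, pow_add, pow_add] at h3
    have h7 : Q ε * y = residueNum σ (b ε t) * (t ^ (2 ^ m - 1 - M - n) * t ^ n *
        ∏ ε' ∈ Finset.univ.erase ε, (c ε - c ε')) :=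
      mul_left_cancel₀ (pow_ne_zero M ht0) (by rw [← mul_assoc, h3]; ring)
    field_simp
    linear_combination -(c ε ^ (2 ^ m - 1 - n)) * h7
  obtain ⟨φ, hφ, hφ1, heq⟩ := hP.exists_pow_mul ((0, 1) : (Fin m → ℂ) × ℂ) 1
    (n := 2 ^ m - 1 - M) fun k hk => by
      rw [hcoeff k hk.le, zero_pow (by omega), zero_mul]
  refine ⟨f, φ, hloc, hφ, ?_, heq.mono fun w hw => ?_⟩
  · rw [hφ1, hcoeff _ le_rfl, Nat.sub_self, pow_zero, one_mul, ← sum_signs_eq a ha0 ha2,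
      Finset.mul_sum, show 2 ^ m - 1 - (2 ^ m - 1 - M) = M by omega]
    exact Finset.sum_congr rfl fun ε _ => by rw [div_eq_mul_inv]; ring
  · rw [← hw]
    congr 1
    refine Prod.ext (funext fun i => ?_) ?_ <;> simp [centerPoint]

end LocalForm

/-! ### The pole of the series at the central point -/

section CentralPole

open Complex Set

variable {m : ℕ}

lemma analyticAt_centralLine (x : ((Fin m → ℂ) × ℂ) × ℂ) :
    AnalyticAt ℂ (fun x : ((Fin m → ℂ) × ℂ) × ℂ =>
      (((fun i => 1 / 2 + x.2 * x.1.1 i), x.1.2) : (Fin m → ℂ) × ℂ)) x := by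
  refine AnalyticAt.prod (AnalyticAt.pi fun i => ?_) (analyticAt_snd.fun_comp analyticAt_fst)
  exact analyticAt_const.add (analyticAt_snd.mul
    ((analyticAt_fst_apply i x.1).fun_comp (f := Prod.fst) analyticAt_fst))

/-- Restriction to lines `s = (1/2, …, 1/2) + t b` with variable direction `b` keeps a function
meromorphic: a denominator vanishing on all of them would vanish identically. -/
lemma IsMeromorphicOn.centralLine {F : (Fin m → ℂ) × ℂ → ℂ} {V : Set ℂ}
    (hF : ∀ w ∈ V, IsMeromorphicOn F {((fun _ => 1 / 2, w) : (Fin m → ℂ) × ℂ)}) :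
    IsMeromorphicOn (fun x : ((Fin m → ℂ) × ℂ) × ℂ => F (fun i => 1 / 2 + x.2 * x.1.1 i, x.1.2))
      ({y : (Fin m → ℂ) × ℂ | y.2 ∈ V} ×ˢ {0}) := by
  rintro ⟨⟨b, w⟩, t⟩ ⟨hw, ht⟩
  obtain rfl : t = 0 := ht
  obtain ⟨f, g, hf, hg, hne, h⟩ := hF w hw _ rfl
  set L : ((Fin m → ℂ) × ℂ) × ℂ → (Fin m → ℂ) × ℂ := fun x => (fun i => 1 / 2 + x.2 * x.1.1 i, x.1.2)
    with hL
  have hLa : ∀ x, AnalyticAt ℂ L x := analyticAt_centralLine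
  have hL0 : L ((b, w), 0) = (fun _ => 1 / 2, w) := by simp [hL]
  have hLt : Tendsto L (𝓝 ((b, w), 0)) (𝓝 (fun _ => 1 / 2, w)) := by
    rw [← hL0]; exact (hLa _).continuousAt.tendsto
  rw [← hL0] at hf hg
  refine ⟨fun x => f (L x), fun x => g (L x), hf.fun_comp (hLa _), hg.fun_comp (hLa _), ?_,
    hLt.eventually h⟩
  intro hcon
  rw [hL0] at hg
  obtain ⟨ρ, hρ, hball⟩ := Metric.eventually_nhds_iff_ball.mp hg.eventually_analyticAt
  have hcon' : ∀ᶠ x in 𝓝 (((b, w), 0) : ((Fin m → ℂ) × ℂ) × ℂ), g (L x) = 0 :=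
    hcon.mono fun x hx => not_not.mp hx
  have h2 : ∀ᶠ t : ℂ in 𝓝[≠] 0, (∀ᶠ y in 𝓝 (b, w), g (L (y, t)) = 0) ∧
      L ((b, w), t) ∈ Metric.ball ((fun _ => 1 / 2, w) : (Fin m → ℂ) × ℂ) ρ := by
    have h3 := hcon'.eventually_nhds.and (hLt.eventually (Metric.ball_mem_nhds _ hρ))
    have h4 : Tendsto (fun t : ℂ => (((b, w), t) : ((Fin m → ℂ) × ℂ) × ℂ)) (𝓝 0) (𝓝 ((b, w), 0)) :=
      (by fun_prop : Continuous fun t : ℂ => (((b, w), t) : ((Fin m → ℂ) × ℂ) × ℂ)).tendsto' _ _ rfl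
    refine ((h4.eventually h3).filter_mono nhdsWithin_le_nhds).mono fun t ht => ⟨?_, ht.2⟩
    exact (by fun_prop : Continuous fun y : (Fin m → ℂ) × ℂ => (y, t)).continuousAt.tendsto.eventually
      ht.1
  obtain ⟨t, ⟨h5, h6⟩, ht⟩ := (h2.and self_mem_nhdsWithin).exists
  have ht0 : t ≠ 0 := ht
  -- the map `(b, w) ↦ L ((b, w), t)` is a homeomorphism
  have h7 : ∀ᶠ z in 𝓝 (L ((b, w), t)), g z = 0 := by
    have hinv : Tendsto (fun z : (Fin m → ℂ) × ℂ => ((fun i => (z.1 i - 1 / 2) / t, z.2) :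
        (Fin m → ℂ) × ℂ)) (𝓝 (L ((b, w), t))) (𝓝 (b, w)) := by
      refine Continuous.tendsto' (by fun_prop) _ _ ?_
      simp [hL, ht0]
    refine (hinv.eventually h5).mono fun z hz => ?_
    rw [← hz]
    congr 1
    refine Prod.ext (funext fun i => ?_) rfl
    simp only [hL]
    field_simp
    ring
  have h8 := AnalyticOnNhd.eqOn_zero_of_preconnected_of_eventuallyEq_zero
    (fun z hz => hball z hz) (convex_ball _ _).isPreconnected h6 h7
  exact hne (eventually_of_mem (Metric.ball_mem_nhds _ hρ) fun z hz => not_not.mpr (h8 hz))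

/-- The continuation on the line `s = (1/2, …, 1/2)` is the continuation in one variable. A priori a
denominator of `F` may vanish on this line, so `F` is approached from nearby along `s = 1/2 + t b`,
`t → 0`, with generic `b`: the limit is `Z w` up to gamma factors for `Re w` large, hence for
generic `(b, w)` with `Re w > 1`. -/
theorem IsContinuation.numerator_eq {σ : ℤˣ} {δ : ℝ} {k : (Fin m → Fin 2) → ℕ}
    {F f : (Fin m → ℂ) × ℂ → ℂ} (hδ0 : 0 < δ) (hδ : δ ≤ 1 / 8) (hF : IsContinuation σ δ k F)
    (hloc : HasLocalForm F f fun _ => 1) {Z : ℂ → ℂ} (hZ : DifferentiableOn ℂ Z {w | 1 < w.re})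
    {c : ℝ} (hc : ∀ w : ℂ, c < w.re → Z w = momentSeries σ (fun _ : Fin m => 1 / 2) w) :
    ∀ᶠ w in 𝓝 (1 : ℂ), 1 < w.re →
      f (fun _ => 1 / 2, w) = (w - 1) ^ 2 ^ m * (gammaProd σ (fun _ : Fin m => 1 / 2) * Z w) := by
  set G := gammaProd σ (fun _ : Fin m => 1 / 2)
  have hV : IsOpen {w : ℂ | 1 < w.re} := isOpen_lt continuous_const continuous_re
  have hK : IsOpen {y : (Fin m → ℂ) × ℂ | y.2 ∈ {w : ℂ | 1 < w.re}} := hV.preimage continuous_snd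
  have hmero := IsMeromorphicOn.centralLine (F := F) (V := {w : ℂ | 1 < w.re}) fun w hw z hz => by
    refine hF.mero z (mem_boxTube.mpr ⟨fun i => ?_, ?_⟩) <;> rw [mem_singleton_iff.mp hz]
    · simp [hδ0]
    · have : 1 < w.re := hw
      simp only [mem_Ioi]; linarith
  have hdense := hmero.subset_closure_tendsto hK ?_ (r₁ := fun y => G * Z y.2) (r₂ := fun _ => 1)
    (S := {y : (Fin m → ℂ) × ℂ | max c (m + 2) < y.2.re}) ?_ (differentiableOn_const _).lineHol
    ⟨(0, 2), by simp, one_ne_zero⟩ (isOpen_lt continuous_const (by fun_prop)) ?_ ?_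
  · have hlt : Tendsto (fun w : ℂ => ((fun _ => 1 / 2, w) : (Fin m → ℂ) × ℂ)) (𝓝 1)
        (𝓝 (centerPoint m)) := Continuous.tendsto' (by fun_prop) _ _ rfl
    filter_upwards [(hlt.eventually
      (hloc.1.eventually_analyticAt.and hloc.2.eventually_nhds)).eventually_nhds] with w hw hw1
    have hZw : ContinuousAt Z w := hZ.continuousOn.continuousAt (hV.mem_nhds hw1)
    refine eq_of_frequently_eq (p := fun w => f (fun _ => 1 / 2, w))
      (hw.self_of_nhds.1.continuousAt.comp (f := fun w : ℂ => ((fun _ => 1 / 2, w) : (Fin m → ℂ) × ℂ))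
        (by fun_prop))
      (by fun_prop : ContinuousAt (fun w => (w - 1) ^ 2 ^ m * (G * Z w)) w) ?_
    have h1 := mem_closure_iff_frequently.mp (hdense (show (0, w) ∈ {y : (Fin m → ℂ) × ℂ |
      y.2 ∈ {w : ℂ | 1 < w.re}} from hw1))
    have h2 : ∀ᶠ w' in 𝓝 w, w' ≠ 1 := eventually_ne_nhds fun h => by simp [h] at hw1
    refine continuous_snd.continuousAt.tendsto.frequently (h1.and_eventually
      (continuous_snd.continuousAt.tendsto.eventually (hw.and h2)) |>.mono ?_)
    rintro ⟨b, v⟩ ⟨hb, ⟨hfv, hform⟩, hv1⟩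
    have hb' : (b, v) ∈ {y : (Fin m → ℂ) × ℂ | _} := interior_subset hb
    have hlim : Tendsto (fun t : ℂ => F (fun i => 1 / 2 + t * b i, v)) (𝓝[≠] 0) (𝓝 (G * Z v)) := by
      simpa only [mem_ofPred_eq, one_mul] using hb'
    have hL : Tendsto (fun t : ℂ => ((fun i => 1 / 2 + t * b i, v) : (Fin m → ℂ) × ℂ)) (𝓝 0)
        (𝓝 (fun _ => 1 / 2, v)) := Continuous.tendsto' (by fun_prop) _ _ (by simp)
    have hpf : ∀ ε : Fin m → Fin 2, polarForm ε (fun _ => 1 / 2, v) = v - 1 := fun ε => by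
      rw [polarForm_eq]; simp
    have hv : v - 1 ≠ 0 := sub_ne_zero.mpr hv1
    have hpt : ∀ ε : Fin m → Fin 2, Tendsto (fun t : ℂ => polarForm ε (fun i => 1 / 2 + t * b i, v))
        (𝓝 0) (𝓝 (v - 1)) := fun ε => by
      rw [← hpf ε]; exact (analyticAt_polarForm ε _).continuousAt.tendsto.comp hL
    have h3 : Tendsto (fun t : ℂ => f (fun i => 1 / 2 + t * b i, v) /
        ∏ ε : Fin m → Fin 2, polarForm ε (fun i => 1 / 2 + t * b i, v) ^ 1) (𝓝[≠] 0)
        (𝓝 (f (fun _ => 1 / 2, v) / ∏ _ε : Fin m → Fin 2, (v - 1) ^ 1)) :=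
      (((hfv.continuousAt.tendsto.comp hL).div (tendsto_finsetProd _ fun ε _ => (hpt ε).pow 1)
        (Finset.prod_ne_zero_iff.mpr fun _ _ => pow_ne_zero _ hv))).mono_left nhdsWithin_le_nhds
    have h4 := tendsto_nhds_unique hlim (h3.congr' (nhdsWithin_le_nhds (by
      filter_upwards [hL.eventually hform, eventually_all.mpr fun ε => (hpt ε).eventually_ne hv]
        with t ht1 ht2 using (ht1 ht2).symm)))
    simp only [Finset.prod_const, pow_one, Finset.card_univ, Fintype.card_fun, Fintype.card_fin]
      at h4
    change f _ = (v - 1) ^ 2 ^ m * (G * Z v)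
    rw [h4]
    field_simp
  · exact fun x hx y hy p q hp hq hpq => by
      simpa using convex_Ioi (1 : ℝ) hx hy hp hq hpq
  · exact (DifferentiableOn.const_mul (DifferentiableOn.comp (g := Z) (f := Prod.snd) hZ
      differentiableOn_snd fun y hy => hy) G).lineHol
  · refine ⟨(0, ((max c (m + 2) + 1 : ℝ) : ℂ)), ?_, ?_⟩
    · have : (m : ℝ) + 2 ≤ max c (m + 2) := le_max_right _ _
      have : (0 : ℝ) ≤ m := Nat.cast_nonneg m
      simp only [mem_ofPred_eq, ofReal_re]
      linarith
    · simp only [mem_ofPred_eq, ofReal_re]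
      linarith
  · rintro ⟨b, v⟩ hv
    rw [mem_ofPred_eq, max_lt_iff] at hv
    refine ⟨𝓝[≠] 0, inferInstance, le_rfl, ?_⟩
    simp only [one_mul]
    have hL : Tendsto (fun t : ℂ => ((fun i => 1 / 2 + t * b i, v) : (Fin m → ℂ) × ℂ)) (𝓝 0)
        (𝓝 (fun _ => 1 / 2, v)) := Continuous.tendsto' (by fun_prop) _ _ (by simp)
    have hT := isOpen_boxTube (m := m) (isOpen_Ioo (a := 1 / 2 - δ) (b := 1 / 2 + δ))
      (isOpen_Ioi (a := (m : ℝ) + 2))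
    have hmem : ((fun _ => 1 / 2, v) : (Fin m → ℂ) × ℂ) ∈
        boxTube m (Ioo (1 / 2 - δ) (1 / 2 + δ)) (Ioi (m + 2)) :=
      mem_boxTube.mpr ⟨fun i => by simp [hδ0], hv.2⟩
    have h1 := (((lineHol_completedSeries (m := m) σ).mono (strip_subset_polyRegion hδ)).cont.continuousAt
      (hT.mem_nhds hmem)).tendsto.comp hL
    rw [hc v hv.1]
    refine Tendsto.congr' (nhdsWithin_le_nhds ?_) (h1.mono_left nhdsWithin_le_nhds)
    filter_upwards [hL.eventually (hT.mem_nhds hmem)] with t ht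
    exact (hF.eq_strip _ ht).symm

/-- The pole at `w = 1` of the continued series `Z^±(1/2, …, 1/2, w)`. -/
theorem IsContinuation.exists_pole {σ : ℤˣ} {δ : ℝ} {k : (Fin m → Fin 2) → ℕ}
    {F : (Fin m → ℂ) × ℂ → ℂ} (hδ0 : 0 < δ) (hδ : δ ≤ 1 / 8) (hF : IsContinuation σ δ k F)
    (hk : ∀ ε, 1 ≤ k ε) {Z : ℂ → ℂ} (hZ : DifferentiableOn ℂ Z {w | 1 < w.re})
    {c : ℝ} (hc : ∀ w : ℂ, c < w.re → Z w = momentSeries σ (fun _ : Fin m => 1 / 2) w) :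
    ∃ φ, AnalyticAt ℂ φ 1 ∧ φ 1 = 3 / (Real.pi : ℂ) ^ 2 * arithmeticFactor m *
      (∏ ℓ ∈ Finset.Icc 1 m, (ℓ.factorial : ℂ) / ((2 * ℓ).factorial : ℂ)) *
        (m * (m + 1) / 2).factorial ∧
      ∀ᶠ w in 𝓝 (1 : ℂ), 1 < w.re → Z w = φ w / (w - 1) ^ (m * (m + 1) / 2 + 1) := by
  obtain ⟨f, φ, hloc, hφ, hφ1, hfφ⟩ := hF.exists_numerator hδ0 hδ hk
  have hG : gammaProd σ (fun _ : Fin m => 1 / 2) ≠ 0 := gammaProd_ne_zero σ fun i => by simp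
  refine ⟨fun w => φ w / gammaProd σ (fun _ : Fin m => 1 / 2), hφ.div analyticAt_const hG, ?_, ?_⟩
  · have h2 : (1 / 2 + 1 / 2 : ℂ) = 1 := by norm_num
    simp only [hφ1, residueNum, h2, zetaReg_one, Finset.prod_const_one, eulerProd_half]
    field_simp
  · filter_upwards [hF.numerator_eq hδ0 hδ hloc hZ hc, hfφ] with w h1 h2 hw
    have h3 := h1 hw
    have hw1 : w - 1 ≠ 0 := fun h => by rw [sub_eq_zero.mp h] at hw; simp at hw
    have hN := triangle_lt_two_pow m
    rw [h2, show 2 ^ m = (2 ^ m - 1 - m * (m + 1) / 2) + (m * (m + 1) / 2 + 1) by omega,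
      pow_add _ _ (_ + 1), mul_assoc] at h3
    have h4 := mul_left_cancel₀ (pow_ne_zero _ hw1) (a := (w - 1) ^ (2 ^ m - 1 - m * (m + 1) / 2))
      (by convert h3 using 3; omega)
    rw [h4]
    field_simp

end CentralPole

/-! ### The moment -/

section Moment

open Complex Set

variable {m : ℕ}

open Classical in
/-- `L(1/2, χ_D) ^ m` for `D` a fundamental discriminant or `D = 1`, and `0` for all other `D`. -/
noncomputable def centralPower (m : ℕ) (D : ℤ) : ℂ :=
  if ∃ d : ℤ, Squarefree d ∧ D = quadDisc d then quadL D (1 / 2) ^ m else 0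

open Classical in
/-- `L(1/2, χ_D) ^ m` as a real number for `D` a fundamental discriminant, and `0` for all other
`D`. -/
noncomputable def centralMoment (m : ℕ) (D : ℤ) : ℝ :=
  if IsFundamentalDiscriminant D then (quadL D (1 / 2)).re ^ m else 0

open Classical in
lemma ofReal_centralMoment (D : ℤ) :
    (centralMoment m D : ℂ) = if IsFundamentalDiscriminant D then quadL D (1 / 2) ^ m else 0 := by
  rw [centralMoment]
  split_ifs with h
  · obtain ⟨h1, d, hd, rfl⟩ := h
    obtain ⟨r, hr⟩ := quadL_half_real hd fun h => h1 (by rw [h]; rfl)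
    rw [hr]; simp
  · simp

open Classical in
lemma ofReal_centralMoment_eq_sub (D : ℤ) :
    (centralMoment m D : ℂ) = centralPower m D - if D = 1 then centralPower m 1 else 0 := by
  rw [ofReal_centralMoment, centralPower]
  by_cases h1 : D = 1
  · subst h1; simp [IsFundamentalDiscriminant, centralPower]
  · rw [if_neg h1, sub_zero]
    exact if_congr (by simp [IsFundamentalDiscriminant, h1]) rfl rfl

lemma quadDisc_injective : Function.Injective quadDisc := by
  intro d d' h
  unfold quadDisc at h
  split_ifs at h <;> omega

/-- The central series as a Dirichlet series in `n = |D|`. -/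
lemma LSeriesHasSum_centralPower (σ : ℤˣ) {w : ℂ} (hw : m + 2 < w.re) :
    LSeriesHasSum (fun n => centralPower m (σ * n)) w
      (momentSeries σ (fun _ : Fin m => 1 / 2) w) := by
  have hsum := summable_momentTerm σ (s := fun _ : Fin m => 1 / 2) (w := w)
    ⟨fun i => ⟨by norm_num, by norm_num⟩, hw⟩
  have hnat : ∀ d : SqfreeSigned σ, (σ : ℤ) * ((quadDisc d).natAbs : ℤ) = quadDisc d := by
    rintro ⟨d, hd, hσ⟩
    have h1 := quadDisc_pos_iff (d := d)
    have h2 := quadDisc_ne_zero hd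
    rcases Int.units_eq_one_or σ with rfl | rfl <;>
      simp only [Units.val_one, Units.val_neg, one_mul, neg_mul] at hσ ⊢ <;> omega
  have hinj : Function.Injective fun d : SqfreeSigned σ => (quadDisc d).natAbs := by
    intro d d' h
    simp only [] at h
    exact Subtype.ext (quadDisc_injective (by rw [← hnat d, ← hnat d', h]))
  rw [momentSeries_eq_tsum σ _ w hsum, LSeriesHasSum, ← hinj.hasSum_iff]
  · convert hsum.hasSum using 1
    funext d
    rw [Function.comp_apply, LSeries.term_of_ne_zero (natAbs_quadDisc_pos d d.2.1).ne', hnat,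
      centralPower, if_pos ⟨d, d.2.1, rfl⟩, momentTerm]
    simp
  · intro n hn
    by_cases hn0 : n = 0
    · rw [hn0, LSeries.term_zero]
    · rw [LSeries.term_of_ne_zero hn0, centralPower, if_neg, zero_div]
      rintro ⟨d, hd, hdn⟩
      refine hn ⟨⟨d, hd, ?_⟩, ?_⟩
      · have h1 := quadDisc_pos_iff (d := d)
        have h2 : d ≠ 0 := hd.ne_zero
        rcases Int.units_eq_one_or σ with rfl | rfl <;>
          simp only [Units.val_one, Units.val_neg, one_mul, neg_mul] at * <;> omega
      · change (quadDisc d).natAbs = n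
        rw [← hdn, natAbs_units_mul]

lemma sum_Icc_neg_eq {G : Type*} [AddCommMonoid G] (f : ℤ → G) (h0 : f 0 = 0) (N : ℕ) :
    ∑ D ∈ Finset.Icc (-N : ℤ) N, f D = ∑ k ∈ Finset.Icc 1 N, (f k + f (-k)) := by
  induction N with
  | zero => simp [h0]
  | succ N ih =>
    have h1 : Finset.Icc (-(N + 1 : ℕ) : ℤ) (N + 1 : ℕ) =
        insert ((N + 1 : ℕ) : ℤ) (insert (-(N + 1 : ℕ) : ℤ) (Finset.Icc (-N : ℤ) N)) := by
      ext; simp; omega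
    rw [Finset.sum_Icc_succ_top (by omega), h1, Finset.sum_insert (by simp; omega),
      Finset.sum_insert (by simp), ih, add_comm (∑ k ∈ _, _), add_assoc]

lemma quadMoment_eq {x : ℝ} (hx : 0 ≤ x) : quadMoment m x =
    ((∑ k ∈ Finset.Icc 1 ⌊x⌋₊, (centralMoment m k + centralMoment m (-k)) : ℝ) : ℂ) := by
  have h0 : centralMoment m 0 = 0 :=
    if_neg fun ⟨_, d, hd, h⟩ => quadDisc_ne_zero hd h.symm
  rw [← sum_Icc_neg_eq _ h0, ofReal_sum, quadMoment, Finset.sum_filter, Int.natCast_floor_eq_floor hx]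
  simp only [ofReal_centralMoment]

end Moment

theorem theorem3p7 (m : ℕ) (hm_pos : 0 < m) (hm_even : Even m)
    (hconj : PolarDivisorConjecture m) :
    (fun x : ℝ => quadMoment m x) ~[atTop] fun x : ℝ =>
      ((6 / Real.pi ^ 2 * arithmeticFactor m
        * (∏ ℓ ∈ Finset.Icc 1 m, (ℓ.factorial : ℝ) / ((2 * ℓ).factorial : ℝ))
        * (x * Real.log x ^ (m * (m + 1) / 2)) : ℝ) : ℂ) := by
  obtain ⟨B, k, F, hB, hBc, hP, h1, hk, hF⟩ := hconj
  obtain ⟨δ, hδ0, hδ, hsub⟩ := exists_orthant_subset hB hBc hP h1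
  choose hmero heq hpol Z hZ hZc c hc using hF
  choose F' hF' using fun σ => exists_isContinuation hδ0 hδ (fun z hz => hmero σ z (by
    rw [mem_boxTube] at hz
    exact hsub _ hz.1 hz.2)) (heq σ) hk (hpol σ)
  choose φ hφ hφ1 hφZ using fun σ => (hF' σ).exists_pole hδ0 hδ hk (hZ σ) (hc σ)
  set M := m * (m + 1) / 2 with hM
  set γ : ℝ := 6 / Real.pi ^ 2 * arithmeticFactor m *
    (∏ ℓ ∈ Finset.Icc 1 m, (ℓ.factorial : ℝ) / ((2 * ℓ).factorial : ℝ)) with hγ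
  set a : ℕ → ℝ := fun n => centralMoment m n + centralMoment m (-n) with ha
  have ha0 : ∀ n, 0 ≤ a n := fun n => by
    refine add_nonneg ?_ ?_ <;> unfold centralMoment <;> split_ifs <;>
      first | exact hm_even.pow_nonneg _ | exact le_rfl
  -- the term `d = 1` belongs to `Z⁺` but not to the moment
  set Y : ℂ → ℂ := fun w => Z 1 w + Z (-1) w - centralPower m 1 with hY
  have hseries : ∀ w : ℂ, max (max (c 1) (c (-1))) (m + 2) < w.re →
      LSeriesHasSum (fun n => (a n : ℂ)) w (Y w) := by
    intro w hw
    rw [max_lt_iff, max_lt_iff] at hw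
    have h2 := LSeriesHasSum_centralPower 1 hw.2
    have h3 := LSeriesHasSum_centralPower (-1) hw.2
    have h4 : LSeriesHasSum (fun n => if n = 1 then centralPower m 1 else 0) w
        (centralPower m 1) := by
      rw [LSeriesHasSum]
      convert hasSum_ite_eq 1 (centralPower m 1) using 1
      funext n
      by_cases hn : n = 1
      · simp [hn, LSeries.term]
      · simp [hn, LSeries.term]
    have h5 := (h2.add h3).sub h4
    rw [← hc 1 w hw.1.1, ← hc (-1) w hw.1.2] at h5
    convert h5 using 1
    funext n
    have h6 : ¬ (-(n : ℤ) = 1) := by omega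
    simp [ha, ofReal_centralMoment_eq_sub, h6]
    ring
  have hYd : DifferentiableOn ℂ Y {w | 1 < w.re} := ((hZ 1).add (hZ (-1))).sub_const _
  have hL := fun w hw => LSeriesSummable_of_differentiableOn ha0 hYd
    (fun w hw => (hseries w hw).LSeriesSummable) (fun w hw => (hseries w hw).LSeries_eq)
    (w := w) hw
  have hT := tendsto_sum_div_of_pole ha0 (fun w hw => (hL w hw).1) (fun w hw => (hL w hw).2)
    (((hZc 1).add (hZc (-1))).sub continuousOn_const)
    (φ := fun w => φ 1 w + φ (-1) w - (w - 1) ^ (M + 1) * centralPower m 1)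
    (((hφ 1).add (hφ (-1))).sub (by fun_prop)) (M := M) (by
      filter_upwards [hφZ 1, hφZ (-1)] with w h2 h3 hw
      have hw1 : w - 1 ≠ 0 := fun h => by rw [sub_eq_zero.mp h] at hw; simp at hw
      simp only [hY, h2 hw, h3 hw]
      field_simp) (γ := γ) (by
      simp only [hφ1, sub_self, zero_pow (Nat.succ_ne_zero M), zero_mul, sub_zero, hγ]
      push_cast
      ring)
  have hγ0 : γ ≠ 0 := by
    refine mul_ne_zero (mul_ne_zero (by positivity) (arithmeticFactor_ne_zero m)) ?_
    exact Finset.prod_ne_zero_iff.mpr fun ℓ _ => by positivity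
  have hreal : (fun x : ℝ => ∑ k ∈ Finset.Icc 1 ⌊x⌋₊, a k) ~[atTop]
      fun x => γ * (x * Real.log x ^ M) := by
    have hv : ∀ᶠ x : ℝ in atTop, γ * (x * Real.log x ^ M) ≠ 0 := by
      filter_upwards [eventually_gt_atTop 1] with x hx
      have := Real.log_pos hx
      positivity
    rw [isEquivalent_iff_tendsto_one hv]
    have h2 := hT.div_const γ
    rw [div_self hγ0] at h2
    refine h2.congr fun x => ?_
    rw [Pi.div_apply, div_div, mul_comm γ]
  have hcast : (fun x : ℝ => ((∑ k ∈ Finset.Icc 1 ⌊x⌋₊, a k : ℝ) : ℂ)) ~[atTop]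
      fun x => ((γ * (x * Real.log x ^ M) : ℝ) : ℂ) := by
    have h2 : (fun x : ℝ => ∑ k ∈ Finset.Icc 1 ⌊x⌋₊, a k - γ * (x * Real.log x ^ M)) =o[atTop]
      fun x => γ * (x * Real.log x ^ M) := hreal
    rw [← Complex.isLittleO_ofReal_left, ← Complex.isLittleO_ofReal_right] at h2
    simp only [Complex.ofReal_sub] at h2
    exact h2
  refine hcast.congr_left ?_
  filter_upwards [eventually_ge_atTop 0] with x hx
  rw [quadMoment_eq hx]
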